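/- **Theorem.** If one-way group actions exist, then two-tier quantum lightning with classical semi-verification exists. *Algorithms.* Let $n\in\mathbb{N}$ be the security parameter. A *QPT algorithm* is a polynomial-time uniform family of quantum circuits (gates $X$, CNOT, Toffoli, $H$, $T$; ancillas initialised to $|0\rangle$; measurement of the classical output wires; partial trace over unused wires). A *classical deterministic polynomial-time* algorithm is a polynomial-time uniform family of classical circuits; a *PPT* algorithm is such a family that additionally receives uniformly random coins. A *non-uniform QPT* algorithm is a family of quantum circuits of polynomial size. A function $\mathbb{N}\to\mathbb{R}$ is *negligible* if it tends to $0$ faster than every inverse polynomial; $\mathsf{negl}(n)$ stands for some negligible function. *One-way group actions.* A group action with efficient algorithms is a family $(G_n,S_n,\star_n)_{n\in\mathbb{N}}$ of (not necessarily abelian) finite groups $G_n$ acting on non-empty finite sets $S_n$, together with unique representations of the elements of $G_n$ and of $S_n$ as bit strings of length $\mathrm{poly}(n)$, such that: there are classical deterministic polynomial-time algorithms that compute $gh$ from $g,h\in G_n$, compute $g^{-1}$ from $g\in G_n$, compute $g\star s$ from $g\in G_n$ and $s\in S_n$, and decide whether a bit string represents an element of $G_n$, respectively of $S_n$; there are PPT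 algorithms whose output distributions have negligible statistical distance from the uniform distribution on $G_n$, respectively on $S_n$; and there is a QPT algorithm that generates a state whose trace distance from $|G_n\rangle=|G_n|^{-1/2}\sum_{g\in G_n}|g\rangle$ is negligible. It is *one-way* if for every non-uniform QPT adversary $\mathcal{A}$, with $s$ and $g$ uniform and independent in $S_n$ and $G_n$, $$\Pr\left[g'\star s=g\star s \;:\; s\gets S_n,\ g\gets G_n,\ g'\gets\mathcal{A}(s,g\star s)\right]=\mathsf{negl}(n).$$ *Two-tier quantum lightning with classical semi-verification.* It consists of QPT algorithms $\mathsf{Setup}(1^n)\to(\mathsf{sk},\mathsf{pk})$, $\mathsf{StateGen}(\mathsf{pk})\to(\psi,\mathsf{snum})$, $\mathsf{Del}(\psi)\to\mathsf{cert}$, $\mathsf{FullVer}(\mathsf{sk},\mathsf{snum},\psi)\to\top/\bot$ and a classical deterministic polynomial-time algorithm $\mathsf{SemiVer}(\mathsf{pk},\mathsf{snum},\mathsf{cert})\to\top/\bot$, where $\psi$ is a quantum state and $\mathsf{sk},\mathsf{pk},\mathsf{snum},\mathsf{cert}$ are classical, such that: 1. (Correctness of semi-verification) if $(\mathsf{sk},\mathsf{pk})\gets\mathsf{Setup}(1^n)$,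 $(\psi,\mathsf{snum})\gets\mathsf{StateGen}(\mathsf{pk})$ and $\mathsf{cert}\gets\mathsf{Del}(\psi)$, then $\mathsf{SemiVer}(\mathsf{pk},\mathsf{snum},\mathsf{cert})$ outputs $\top$ with probability at least $1-\mathsf{negl}(n)$. 2. (Correctness of full verification) if $(\mathsf{sk},\mathsf{pk})\gets\mathsf{Setup}(1^n)$ and $(\psi,\mathsf{snum})\gets\mathsf{StateGen}(\mathsf{pk})$, then $\mathsf{FullVer}(\mathsf{sk},\mathsf{snum},\psi)$ outputs $\top$ with probability at least $1-\mathsf{negl}(n)$. 3. (Security) for every non-uniform QPT adversary $\mathcal{A}$ (in particular for every QPT adversary), if $(\mathsf{sk},\mathsf{pk})\gets\mathsf{Setup}(1^n)$ and $(\mathsf{cert},\psi,\mathsf{snum})\gets\mathcal{A}(\mathsf{pk})$, then the probability that both $\mathsf{SemiVer}(\mathsf{pk},\mathsf{snum},\mathsf{cert})$ and $\mathsf{FullVer}(\mathsf{sk},\mathsf{snum},\psi)$ output $\top$ is at most $\mathsf{negl}(n)$. -/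

import Mathlib

/-! Two-tier quantum lightning with classical semi-verification, and one-way group actions.

Computational model: all algorithms are families of circuits indexed by the security parameter `n`.
* a quantum polynomial-time (QPT) algorithm is a polynomial-time uniform family of quantum circuits
  over the gates `X, CNOT, Toffoli, H, T`, with ancillas initialised to zero, a final measurement of
  the classical output wires and a partial trace over the unused wires;
* a classical deterministic polynomial-time algorithm is a polynomial-time uniform family of
  classical circuits (`X, CNOT, Toffoli` with zero ancillas and discarded garbage);
* a PPT algorithm is such a classical family that has uniformly random coins as (extra) input;
* a non-uniform QPT algorithm is a family of quantum circuits of polynomial size. -/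

noncomputable section

namespace QL

/-- Bit strings of length `n`. -/
abbrev Bits (n : ℕ) : Type := Fin n → Bool

/-- A function `ℕ → ℝ` is negligible if it decays faster than every inverse polynomial. -/
def Negligible (f : ℕ → ℝ) : Prop :=
  Asymptotics.SuperpolynomialDecay Filter.atTop (fun n : ℕ => (n : ℝ)) f

/-! ### Gates and circuits -/

/-- Classical reversible gates on wires labelled by `ι`. -/
inductive CGate (ι : Type) : Type
  /-- negate the wire `t` -/
  | not (t : ι)
  /-- add the control `c` to the target `t` -/
  | cnot (c t : ι)
  /-- add the conjunction of the controls `a`, `b` to the target `t` (Toffoli) -/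
  | ccnot (a b t : ι)

/-- Quantum gates: the classical reversible ones, the Hadamard gate and the `π/8` gate `T`. -/
inductive Gate (ι : Type) : Type
  | classical (g : CGate ι)
  | had (t : ι)
  | tgate (t : ι)

/-- Relabelling of wires. -/
def CGate.map {ι κ : Type} (f : ι → κ) : CGate ι → CGate κ
  | .not t => .not (f t)
  | .cnot c t => .cnot (f c) (f t)
  | .ccnot a b t => .ccnot (f a) (f b) (f t)

/-- Relabelling of wires. -/
def Gate.map {ι κ : Type} (f : ι → κ) : Gate ι → Gate κ
  | .classical g => .classical (g.map f)
  | .had t => .had (f t)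
  | .tgate t => .tgate (f t)

/-- Action of a classical gate on bit assignments. A gate whose target is one of its own controls
is degenerate and acts as the identity. -/
def CGate.apply {ι : Type} [DecidableEq ι] : CGate ι → (ι → Bool) → (ι → Bool)
  | .not t, z => Function.update z t (!(z t))
  | .cnot c t, z => if c = t then z else Function.update z t (xor (z t) (z c))
  | .ccnot a b t, z =>
      if a = t ∨ b = t then z else Function.update z t (xor (z t) (z a && z b))

/-- The unitary matrix of a gate, in the computational basis. -/
def Gate.matrix {ι : Type} [Fintype ι] [DecidableEq ι] :
    Gate ι → Matrix (ι → Bool) (ι → Bool) ℂ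
  | .classical g => Matrix.of fun y z => if y = g.apply z then 1 else 0
  | .had t => Matrix.of fun y z =>
      if ∀ i, i ≠ t → y i = z i then (if y t && z t then -1 else 1) / (Real.sqrt 2 : ℂ) else 0
  | .tgate t => Matrix.diagonal fun z =>
      if z t then Complex.exp (Complex.I * (Real.pi : ℂ) / 4) else 1

/-- The `l` bits of `z` that start at position `o`. -/
def slice {w : ℕ} (z : Bits w) (o l : ℕ) (h : o + l ≤ w) : Bits l :=
  fun i => z ⟨o + i, by omega⟩

/-- A quantum circuit on `width` wires, with `kin` classical input bits, `qin` input qubits, `kout`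
classical output bits and `qout` output qubits.

Input wires, in this order: classical input, quantum input, ancillas initialised to zero.
Output wires, in this order: classical output (measured in the computational basis),
quantum output, discarded wires. -/
structure Circ (kin qin kout qout : ℕ) : Type where
  width : ℕ
  le_in : kin + qin ≤ width
  le_out : kout + qout ≤ width
  gates : List (Gate (Fin width))

/-- The unitary of a list of gates; the head of the list is applied first. -/
def gatesMatrix {w : ℕ} (gates : List (Gate (Fin w))) : Matrix (Bits w) (Bits w) ℂ :=
  gates.foldl (fun U g => g.matrix * U) 1

namespace Circ

variable {kin qin kout qout : ℕ}

/-- The initial density matrix `|x⟩⟨x| ⊗ ρ ⊗ |0…0⟩⟨0…0|`. -/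
def initial (C : Circ kin qin kout qout) (x : Bits kin) (ρ : Matrix (Bits qin) (Bits qin) ℂ) :
    Matrix (Bits C.width) (Bits C.width) ℂ :=
  have h := C.le_in
  Matrix.of fun z z' =>
    if slice z 0 kin (by omega) = x ∧ slice z' 0 kin (by omega) = x ∧
       ∀ i : Fin C.width, kin + qin ≤ i → z i = false ∧ z' i = false
    then ρ (slice z kin qin h) (slice z' kin qin h)
    else 0

/-- The density matrix after the gates, before the measurement. -/
def final (C : Circ kin qin kout qout) (x : Bits kin) (ρ : Matrix (Bits qin) (Bits qin) ℂ) :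
    Matrix (Bits C.width) (Bits C.width) ℂ :=
  gatesMatrix C.gates * C.initial x ρ * (gatesMatrix C.gates).conjTranspose

/-- The quantum instrument implemented by the circuit. On classical input `x` and quantum input
`ρ`, `C.run x ρ y` is the subnormalised state of the output qubits when the classical output is `y`
(the classical output wires are projected on `y` and the discarded wires are traced out);
its trace is the probability of `y`. -/
def run (C : Circ kin qin kout qout) (x : Bits kin) (ρ : Matrix (Bits qin) (Bits qin) ℂ)
    (y : Bits kout) : Matrix (Bits qout) (Bits qout) ℂ :=
  have h := C.le_out
  Matrix.of fun a b =>
    ∑ z : Bits C.width, ∑ z' : Bits C.width,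
      if slice z 0 kout (by omega) = y ∧ slice z' 0 kout (by omega) = y ∧
         slice z kout qout h = a ∧ slice z' kout qout h = b ∧
         ∀ i : Fin C.width, kout + qout ≤ i → z i = z' i
      then C.final x ρ z z'
      else 0

/-- The probability of the classical output `y`, the output qubits being discarded. If `ρ` is
subnormalised, this is the joint probability with the event that `ρ` stands for. -/
def prob (C : Circ kin qin kout qout) (x : Bits kin) (ρ : Matrix (Bits qin) (Bits qin) ℂ)
    (y : Bits kout) : ℝ :=
  (C.run x ρ y).trace.re

/-- Number of wires plus number of gates. -/
def size (C : Circ kin qin kout qout) : ℕ := C.width + C.gates.length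

end Circ

/-- The state of zero qubits, used as quantum input of circuits that have none. -/
def noQubits : Matrix (Bits 0) (Bits 0) ℂ := 1

/-- The empty bit string. -/
def noBits : Bits 0 := fun _ => false

/-- A classical circuit on `width` wires, with `k` input bits and `k'` output bits: the input wires
come first, followed by zero ancillas; the output wires come first, followed by discarded wires. -/
structure DetCirc (k k' : ℕ) : Type where
  width : ℕ
  le_in : k ≤ width
  le_out : k' ≤ width
  gates : List (CGate (Fin width))

namespace DetCirc

variable {k k' : ℕ}

/-- The function computed by a classical circuit. -/
def eval (C : DetCirc k k') (x : Bits k) : Bits k' :=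
  have h := C.le_out
  slice (C.gates.foldl (fun z g => g.apply z)
    (fun i : Fin C.width => if hi : (i : ℕ) < k then x ⟨i, hi⟩ else false)) 0 k' (by omega)

/-- A classical circuit as a quantum circuit. -/
abbrev toCirc (C : DetCirc k k') : Circ k 0 k' 0 where
  width := C.width
  le_in := C.le_in
  le_out := C.le_out
  gates := C.gates.map Gate.classical

/-- The output distribution of a classical circuit all of whose input bits are random coins. -/
def coinDist (C : DetCirc k k') (y : Bits k') : ℝ :=
  ((Finset.univ.filter fun r : Bits k => C.eval r = y).card : ℝ) / 2 ^ k

end DetCirc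

/-! ### Uniformity

Circuits are generated by deterministic programs over finitely many registers that hold bit strings
(stacks), with a step count. The loops are bounded, which is no restriction on polynomial time: a
clock of polynomial length can be built by nested loops, so the programs with a polynomial step
count simulate all polynomial-time multi-tape Turing machines and conversely. -/

/-- Programs of the circuit generator. Registers are numbered. -/
inductive Prog : Type
  /-- do nothing -/
  | skip
  /-- push the bit `b` on register `r` -/
  | push (r : ℕ) (b : Bool)
  /-- remove the top of register `r`, if there is one -/
  | pop (r : ℕ)
  /-- run `P`, then `Q` -/
  | seq (P Q : Prog)
  /-- run `E` if register `r` is empty, `F` if its top is `false`, `T` if its top is `true` -/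
  | cases (r : ℕ) (E F T : Prog)
  /-- run `P` as many times as the length that register `r` has on entry -/
  | loop (r : ℕ) (P : Prog)
  /-- output a gate; its labels are registers, whose lengths are the numbers of the wires -/
  | emit (g : Gate ℕ)

/-- Configurations of the circuit generator: registers, gates output so far, steps made so far. -/
structure Config : Type where
  reg : ℕ → List Bool
  out : List (Gate ℕ)
  time : ℕ

/-- Count one step. -/
def Config.tick (s : Config) : Config := { s with time := s.time + 1 }

/-- Execution of a program. -/
def Prog.exec : Prog → Config → Config
  | .skip, s => s.tick
  | .push r b, s => { s.tick with reg := Function.update s.reg r (b :: s.reg r) }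
  | .pop r, s => { s.tick with reg := Function.update s.reg r (s.reg r).tail }
  | .seq P Q, s => Q.exec (P.exec s)
  | .cases r E F T, s =>
      match s.reg r with
      | [] => E.exec s.tick
      | false :: _ => F.exec s.tick
      | true :: _ => T.exec s.tick
  | .loop r P, s => (P.exec)^[(s.reg r).length] s.tick
  | .emit g, s => { s.tick with out := s.out ++ [g.map fun r => (s.reg r).length] }

/-- Execution on the input `1ⁿ`, which is held by register `0`. -/
def Prog.start (P : Prog) (n : ℕ) : Config :=
  P.exec { reg := fun r => if r = 0 then List.replicate n true else [], out := [], time := 0 }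

/-- Descriptions of circuits. -/
structure Desc : Type where
  kin : ℕ
  qin : ℕ
  kout : ℕ
  qout : ℕ
  width : ℕ
  gates : List (Gate ℕ)

/-- The description of a circuit. -/
def Circ.desc {kin qin kout qout : ℕ} (C : Circ kin qin kout qout) : Desc :=
  ⟨kin, qin, kout, qout, C.width, C.gates.map (Gate.map Fin.val)⟩

/-- The description held by a configuration: the numbers of wires are the lengths of the
registers `1, …, 5`, the gates are those that were output. -/
def Config.desc (s : Config) : Desc :=
  ⟨(s.reg 1).length, (s.reg 2).length, (s.reg 3).length, (s.reg 4).length, (s.reg 5).length, s.out⟩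

/-- A function `ℕ → ℕ` bounded by a polynomial. -/
def PolyBounded (f : ℕ → ℕ) : Prop := ∃ p : Polynomial ℕ, ∀ n, f n ≤ p.eval n

/-- Polynomial-time uniformity: one program produces, from `1ⁿ` and in time polynomial in `n`, the
description of the `n`-th circuit. Such a family is a QPT algorithm. -/
def Uniform {kin qin kout qout : ℕ → ℕ}
    (C : ∀ n, Circ (kin n) (qin n) (kout n) (qout n)) : Prop :=
  ∃ P : Prog, PolyBounded (fun n => (P.start n).time) ∧ ∀ n, (P.start n).desc = (C n).desc

/-- Polynomial-time uniformity of classical circuits. Such a family is a classical deterministic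
polynomial-time algorithm (a PPT algorithm, if its input bits are read as random coins). -/
def DetUniform {k k' : ℕ → ℕ} (C : ∀ n, DetCirc (k n) (k' n)) : Prop :=
  Uniform fun n => (C n).toCirc

/-- Polynomial size. Such a family is a non-uniform QPT algorithm. -/
def PolySize {kin qin kout qout : ℕ → ℕ}
    (C : ∀ n, Circ (kin n) (qin n) (kout n) (qout n)) : Prop :=
  PolyBounded fun n => (C n).size

/-! ### Distances -/

/-- Statistical distance of two distributions on a finite type. -/
def statDist {α : Type} [Fintype α] (p q : α → ℝ) : ℝ := (1 / 2) * ∑ a, |p a - q a|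

/-- Trace distance of density matrices: half the sum of the absolute values of the eigenvalues of
the difference, with multiplicity. -/
def traceDist {α : Type} [Fintype α] [DecidableEq α] (ρ σ : Matrix α α ℂ) : ℝ :=
  (1 / 2) * (((ρ - σ).charpoly.roots).map fun z : ℂ => ‖z‖).sum

/-! ### Group actions -/

/-- A family of group actions `Gₙ × Sₙ → Sₙ`, with unique representations of the elements of `Gₙ`
and `Sₙ` as bit strings of lengths `lenG n` and `lenS n`. -/
structure GroupActionFamily : Type 1 where
  G : ℕ → Type
  S : ℕ → Type
  group : ∀ n, Group (G n)
  action : ∀ n, MulAction (G n) (S n)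
  nonempty : ∀ n, Nonempty (S n)
  lenG : ℕ → ℕ
  lenS : ℕ → ℕ
  repG : ∀ n, G n → Bits (lenG n)
  repS : ∀ n, S n → Bits (lenS n)
  repG_injective : ∀ n, Function.Injective (repG n)
  repS_injective : ∀ n, Function.Injective (repS n)

namespace GroupActionFamily

variable (A : GroupActionFamily)

instance (n : ℕ) : Group (A.G n) := A.group n
instance (n : ℕ) : MulAction (A.G n) (A.S n) := A.action n
instance (n : ℕ) : Nonempty (A.S n) := A.nonempty n
instance (n : ℕ) : Fintype (A.G n) := Fintype.ofInjective (A.repG n) (A.repG_injective n)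
instance (n : ℕ) : Fintype (A.S n) := Fintype.ofInjective (A.repS n) (A.repS_injective n)

open Classical in
/-- The uniform distribution on (representations of elements of) `Gₙ`. -/
def unifG (n : ℕ) (y : Bits (A.lenG n)) : ℝ :=
  if y ∈ Set.range (A.repG n) then 1 / (Fintype.card (A.G n) : ℝ) else 0

open Classical in
/-- The uniform distribution on (representations of elements of) `Sₙ`. -/
def unifS (n : ℕ) (y : Bits (A.lenS n)) : ℝ :=
  if y ∈ Set.range (A.repS n) then 1 / (Fintype.card (A.S n) : ℝ) else 0

open Classical in
/-- The uniform superposition `|Gₙ⟩ = |Gₙ|^{-1/2} ∑_g |g⟩`. -/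
def ketG (n : ℕ) (y : Bits (A.lenG n)) : ℂ :=
  if y ∈ Set.range (A.repG n) then 1 / (Real.sqrt (Fintype.card (A.G n)) : ℂ) else 0

/-- The density matrix `|Gₙ⟩⟨Gₙ|`. -/
def densG (n : ℕ) : Matrix (Bits (A.lenG n)) (Bits (A.lenG n)) ℂ :=
  Matrix.vecMulVec (A.ketG n) (star (A.ketG n))

/-- Group actions with efficient algorithms. -/
structure HasEfficientAlgorithms : Prop where
  lenG_poly : PolyBounded A.lenG
  lenS_poly : PolyBounded A.lenS
  /-- group multiplication -/
  mul : ∃ C : ∀ n, DetCirc (A.lenG n + A.lenG n) (A.lenG n), DetUniform C ∧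
    ∀ n (g h : A.G n), (C n).eval (Fin.append (A.repG n g) (A.repG n h)) = A.repG n (g * h)
  /-- inversion in the group -/
  inv : ∃ C : ∀ n, DetCirc (A.lenG n) (A.lenG n), DetUniform C ∧
    ∀ n (g : A.G n), (C n).eval (A.repG n g) = A.repG n g⁻¹
  /-- group action -/
  act : ∃ C : ∀ n, DetCirc (A.lenG n + A.lenS n) (A.lenS n), DetUniform C ∧
    ∀ n (g : A.G n) (s : A.S n),
      (C n).eval (Fin.append (A.repG n g) (A.repS n s)) = A.repS n (g • s)
  /-- efficient recognizability of the group -/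
  recogG : ∃ C : ∀ n, DetCirc (A.lenG n) 1, DetUniform C ∧
    ∀ n (y : Bits (A.lenG n)), (C n).eval y 0 = true ↔ y ∈ Set.range (A.repG n)
  /-- efficient recognizability of the set -/
  recogS : ∃ C : ∀ n, DetCirc (A.lenS n) 1, DetUniform C ∧
    ∀ n (y : Bits (A.lenS n)), (C n).eval y 0 = true ↔ y ∈ Set.range (A.repS n)
  /-- almost uniform random sampling from the group -/
  sampleG : ∃ (k : ℕ → ℕ) (C : ∀ n, DetCirc (k n) (A.lenG n)), DetUniform C ∧
    Negligible fun n => statDist (C n).coinDist (A.unifG n)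
  /-- almost uniform random sampling from the set -/
  sampleS : ∃ (k : ℕ → ℕ) (C : ∀ n, DetCirc (k n) (A.lenS n)), DetUniform C ∧
    Negligible fun n => statDist (C n).coinDist (A.unifS n)
  /-- approximate generation of the uniform superposition over the group -/
  superposition : ∃ C : ∀ n, Circ 0 0 0 (A.lenG n), Uniform C ∧
    Negligible fun n => traceDist ((C n).run noBits noQubits noBits) (A.densG n)

open Classical in
/-- The probability that an adversary which is given a uniform `s` and `g • s`, for a uniform `g`,
outputs some `g'` with `g' • s = g • s`. -/
def invertProb (n : ℕ) (B : Circ (A.lenS n + A.lenS n) 0 (A.lenG n) 0) : ℝ :=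
  ∑ s : A.S n, ∑ g : A.G n,
    (1 / (Fintype.card (A.S n) : ℝ)) * (1 / (Fintype.card (A.G n) : ℝ)) *
      ∑ y : Bits (A.lenG n),
        if ∃ g' : A.G n, A.repG n g' = y ∧ g' • s = g • s then
          B.prob (Fin.append (A.repS n s) (A.repS n (g • s))) noQubits y
        else 0

/-- One-wayness against non-uniform QPT adversaries. -/
def OneWay : Prop :=
  ∀ B : ∀ n, Circ (A.lenS n + A.lenS n) 0 (A.lenG n) 0, PolySize B →
    Negligible fun n => A.invertProb n (B n)

end GroupActionFamily

/-! ### Two-tier quantum lightning with classical semi-verification -/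

/-- The algorithms of two-tier quantum lightning with classical semi-verification. Acceptance is
the output bit `true`. -/
structure LightningScheme : Type where
  skLen : ℕ → ℕ
  pkLen : ℕ → ℕ
  snumLen : ℕ → ℕ
  certLen : ℕ → ℕ
  qubits : ℕ → ℕ
  /-- `Setup(1ⁿ) → (sk, pk)` -/
  setup : ∀ n, Circ 0 0 (skLen n + pkLen n) 0
  /-- `StateGen(pk) → (snum, ψ)` -/
  stateGen : ∀ n, Circ (pkLen n) 0 (snumLen n) (qubits n)
  /-- `Del(ψ) → cert` -/
  del : ∀ n, Circ 0 (qubits n) (certLen n) 0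
  /-- `SemiVer(pk, snum, cert)` -/
  semiVer : ∀ n, DetCirc (pkLen n + snumLen n + certLen n) 1
  /-- `FullVer(sk, snum, ψ)` -/
  fullVer : ∀ n, Circ (skLen n + snumLen n) (qubits n) 1 0
  setup_uniform : Uniform setup
  stateGen_uniform : Uniform stateGen
  del_uniform : Uniform del
  semiVer_uniform : DetUniform semiVer
  fullVer_uniform : Uniform fullVer

namespace LightningScheme

variable (Q : LightningScheme)

/-- The probability that `Setup(1ⁿ)` outputs `(sk, pk)`. -/
def setupProb (n : ℕ) (sk : Bits (Q.skLen n)) (pk : Bits (Q.pkLen n)) : ℝ :=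
  (Q.setup n).prob noBits noQubits (Fin.append sk pk)

/-- `SemiVer` accepts. -/
def SemiAccepts (n : ℕ) (pk : Bits (Q.pkLen n)) (snum : Bits (Q.snumLen n))
    (cert : Bits (Q.certLen n)) : Prop :=
  (Q.semiVer n).eval (Fin.append (Fin.append pk snum) cert) 0 = true

/-- The probability that `FullVer` accepts the state `ρ`. -/
def fullProb (n : ℕ) (sk : Bits (Q.skLen n)) (snum : Bits (Q.snumLen n))
    (ρ : Matrix (Bits (Q.qubits n)) (Bits (Q.qubits n)) ℂ) : ℝ :=
  (Q.fullVer n).prob (Fin.append sk snum) ρ (fun _ => true)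

open Classical in
/-- The probability that `SemiVer` accepts the certificate that `Del` makes of an honest state. -/
def semiCorrectProb (n : ℕ) : ℝ :=
  ∑ sk : Bits (Q.skLen n), ∑ pk : Bits (Q.pkLen n),
    Q.setupProb n sk pk *
      ∑ snum : Bits (Q.snumLen n), ∑ cert : Bits (Q.certLen n),
        if Q.SemiAccepts n pk snum cert then
          (Q.del n).prob noBits ((Q.stateGen n).run pk noQubits snum) cert
        else 0

/-- The probability that `FullVer` accepts an honest state. -/
def fullCorrectProb (n : ℕ) : ℝ :=
  ∑ sk : Bits (Q.skLen n), ∑ pk : Bits (Q.pkLen n),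
    Q.setupProb n sk pk *
      ∑ snum : Bits (Q.snumLen n),
        Q.fullProb n sk snum ((Q.stateGen n).run pk noQubits snum)

open Classical in
/-- The probability that an adversary which is given `pk` outputs `(cert, snum, ψ)` such that
`SemiVer` accepts `(snum, cert)` and `FullVer` accepts `(snum, ψ)`. -/
def winProb (n : ℕ) (B : Circ (Q.pkLen n) 0 (Q.certLen n + Q.snumLen n) (Q.qubits n)) : ℝ :=
  ∑ sk : Bits (Q.skLen n), ∑ pk : Bits (Q.pkLen n),
    Q.setupProb n sk pk *
      ∑ cert : Bits (Q.certLen n), ∑ snum : Bits (Q.snumLen n),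
        if Q.SemiAccepts n pk snum cert then
          Q.fullProb n sk snum (B.run pk noQubits (Fin.append cert snum))
        else 0

/-- Correctness of both verifications, and security. -/
structure IsTwoTierQuantumLightning : Prop where
  semi_correct : ∃ ν : ℕ → ℝ, Negligible ν ∧ ∀ n, 1 - ν n ≤ Q.semiCorrectProb n
  full_correct : ∃ ν : ℕ → ℝ, Negligible ν ∧ ∀ n, 1 - ν n ≤ Q.fullCorrectProb n
  secure : ∀ B : ∀ n, Circ (Q.pkLen n) 0 (Q.certLen n + Q.snumLen n) (Q.qubits n), PolySize B →
    ∃ ν : ℕ → ℝ, Negligible ν ∧ ∀ n, Q.winProb n (B n) ≤ ν n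

end LightningScheme

end QL

end

namespace QL

/-! ### Polynomial-time generation of gate lists -/

/-! The scheme. The public key is a pair `s₀ = s`, `s₁ = g • s`, and the secret key contains `g` as
well. One copy of the quantum state is made from a bit `b` in equal superposition and a
superposition of all group elements `h`: the set element `h • s_b` is computed and measured, with
outcome `y`. What remains is a superposition of the pairs `(0, x)` and `(1, x g⁻¹)`, where `x` runs
over the group elements with `x • s = y`. The state consists of `n` such copies, and the serial
number is the public key together with the `n` outcomes. Deletion measures everything in the
computational basis, and semi-verification checks in every copy that the group element found sends
`s_b` to `y`. Full verification checks the same relation coherently, uses `g` to turn `(1, x g⁻¹)`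
into `(1, x)`, and then tests by Hadamard gates that each bit is in equal superposition.

The central formula is `Kit.prob_fullVer`: amplitudes `φ` are accepted with probability `2⁻ⁿ ∑_u
|∑_β φ(β, u twisted by β)|²`, where `u` runs over the tuples of blocks whose group elements send `s`
to the prescribed images, and twisting multiplies the blocks with `β j = 1` by `g⁻¹` from the right.

Correctness. For the honest state this probability is the `n`-th power of a quantity of a single
copy: the squared norm of the symmetrisation of the superposition under right multiplication by
`g⁻¹`, cut down to actual group elements (`Kit.sum_prob_fullVer`). Symmetrisation is a contraction
that fixes `|G_n⟩`, so the quantity is at least 1 minus twice the trace distance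
(`Kit.le_symmNorm`), and Bernoulli's inequality costs a factor `n`. Semi-verification is governed by
the same quantity for `g = 1`.

Security. A valid certificate contains a bit string `γ`. Separating the term `β = γ` from the inner
sum and using Cauchy–Schwarz on the others bounds the acceptance probability by `2 · 2⁻ⁿ` plus twice
the probability that measuring the state gives a valid tuple with some `β ≠ γ`
(`Kit.prob_fullVer_le`). At a copy where `β` and `γ` differ, the certificate and the measured state
contain two group elements of which one sends `s` and the other `g • s` to the same image, so their
quotient sends `s` to `g • s` (`Kit.breaks_of_maps`). The second term is therefore at most twice the
sum of the success probabilities of `2n` inverters, indexed by the copy and by the bit of the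
certificate there. A non-uniform adversary can use the best of them for every `n`, which one-wayness
makes negligible. It takes `n` copies to make the first term negligible.

Two further ingredients. Replacing sampled keys by uniform ones changes each of these averages by at
most twice the statistical distances of the samplers (`Kit.abs_sum_setup_sub_le`). Uniformity of the
circuits is proved with a small calculus of polynomial-time generated numbers and gate lists,
`GenNum` and `GenGates`, closed under arithmetic, concatenation, loops, shifts and reversal;
`Uniform.gen` and `uniform_of_gen` pass between it and uniform families. -/

theorem peval_mono (p : Polynomial ℕ) : Monotone fun x : ℕ => p.eval x := by
  intro a b h
  simp only [Polynomial.eval_eq_sum, Polynomial.sum]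
  exact Finset.sum_le_sum fun i _ => Nat.mul_le_mul_left _ (Nat.pow_le_pow_left h _)

theorem Gate.map_map {ι κ μ : Type} (f : ι → κ) (h : κ → μ) (g : Gate ι) :
    (g.map f).map h = g.map (fun i => h (f i)) := by
  rcases g with (_ | _ | _) | _ | _ <;> rfl

theorem Gate.map_id' {ι : Type} (g : Gate ι) : g.map (fun i => i) = g := by
  rcases g with (_ | _ | _) | _ | _ <;> rfl

/-! ### Executions of generator programs: renaming of registers, time and space bounds. -/

namespace Prog

/-- Renaming of registers. -/
def map (ρ : ℕ → ℕ) : Prog → Prog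
  | .skip => .skip
  | .push r b => .push (ρ r) b
  | .pop r => .pop (ρ r)
  | .seq P Q => .seq (P.map ρ) (Q.map ρ)
  | .cases r E F T => .cases (ρ r) (E.map ρ) (F.map ρ) (T.map ρ)
  | .loop r P => .loop (ρ r) (P.map ρ)
  | .emit g => .emit (g.map ρ)

theorem map_id' (P : Prog) : P.map (fun r => r) = P := by
  induction P <;> simp_all [map, Gate.map_id']

/-- The configuration `s'` simulates `s` through the renaming `ρ`. -/
structure Sim (ρ : ℕ → ℕ) (base : ℕ → List Bool) (pre : List (Gate ℕ)) (t : ℕ)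
    (s s' : Config) : Prop where
  reg : ∀ r, s'.reg (ρ r) = s.reg r
  off : ∀ r, (∀ q, ρ q ≠ r) → s'.reg r = base r
  out : s'.out = pre ++ s.out
  time : s'.time = t + s.time

theorem Sim.tick {ρ : ℕ → ℕ} {base : ℕ → List Bool} {pre : List (Gate ℕ)} {t : ℕ} {s s' : Config}
    (h : Sim ρ base pre t s s') : Sim ρ base pre t s.tick s'.tick :=
  ⟨h.reg, h.off, h.out, by simp only [Config.tick]; rw [h.time]; omega⟩

theorem Sim.update {ρ : ℕ → ℕ} (hρ : Function.Injective ρ) {base : ℕ → List Bool}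
    {pre : List (Gate ℕ)} {t : ℕ} {s s' : Config} (h : Sim ρ base pre t s s') (r : ℕ)
    (l : List Bool) :
    Sim ρ base pre t { s with reg := Function.update s.reg r l }
      { s' with reg := Function.update s'.reg (ρ r) l } where
  reg q := by
    by_cases hq : q = r
    · subst hq; simp
    · simp [Function.update_of_ne hq, Function.update_of_ne (hρ.ne hq), h.reg]
  off q hq := by simp [Function.update_of_ne (hq r).symm, h.off q hq]
  out := h.out
  time := h.time

/-- Programs refer to registers only by name, so an injective renaming commutes with execution.
Previous output, elapsed time and the registers outside the range of the renaming are carried along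
untouched. -/
theorem Sim.exec {ρ : ℕ → ℕ} (hρ : Function.Injective ρ) {base : ℕ → List Bool}
    {pre : List (Gate ℕ)} {t : ℕ} (P : Prog) :
    ∀ {s s' : Config}, Sim ρ base pre t s s' → Sim ρ base pre t (P.exec s) ((P.map ρ).exec s') := by
  induction P with
  | skip => intro s s' h; exact h.tick
  | push r b =>
    intro s s' h
    have := h.tick.update hρ r (b :: s.reg r)
    simp only [Prog.exec, Prog.map, Config.tick, h.reg] at this ⊢
    exact this
  | pop r =>
    intro s s' h
    have := h.tick.update hρ r (s.reg r).tail
    simp only [Prog.exec, Prog.map, Config.tick, h.reg] at this ⊢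
    exact this
  | seq P Q hP hQ => intro s s' h; exact hQ (hP h)
  | cases r E F T hE hF hT =>
    intro s s' h
    simp only [Prog.exec, Prog.map, h.reg]
    rcases s.reg r with _ | ⟨_ | _, _⟩
    · exact hE h.tick
    · exact hF h.tick
    · exact hT h.tick
  | loop r P hP =>
    intro s s' h
    simp only [Prog.exec, Prog.map, h.reg]
    generalize (s.reg r).length = m
    induction m with
    | zero => exact h.tick
    | succ m ih => rw [Function.iterate_succ_apply', Function.iterate_succ_apply']; exact hP ih
  | emit g =>
    intro s s' h
    refine ⟨h.reg, h.off, ?_, h.tick.time⟩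
    simp [Prog.exec, Prog.map, Gate.map_map, h.reg, h.out]

/-- `P` turns the registers `a` into `b`, outputs `L` and makes at most `T` steps. -/
def Runs (P : Prog) (a b : ℕ → List Bool) (L : List (Gate ℕ)) (T : ℕ) : Prop :=
  ∃ t ≤ T, P.exec ⟨a, [], 0⟩ = ⟨b, L, t⟩

/-- Execution never inspects the output or the clock, so both merely accumulate. This is the
simulation along the identity renaming, and it is what lets `Runs` start from empty output and time
zero. -/
theorem exec_eq (P : Prog) (a : ℕ → List Bool) (out : List (Gate ℕ)) (t : ℕ) :
    P.exec ⟨a, out, t⟩ = ⟨(P.exec ⟨a, [], 0⟩).reg, out ++ (P.exec ⟨a, [], 0⟩).out,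
      t + (P.exec ⟨a, [], 0⟩).time⟩ := by
  have h : Sim (fun r => r) a out t ⟨a, [], 0⟩ ⟨a, out, t⟩ :=
    ⟨fun _ => rfl, fun r hr => absurd rfl (hr r), by simp, rfl⟩
  have h' := h.exec (fun _ _ h => h) P
  rw [map_id'] at h'
  rw [← h'.out, ← h'.time, ← funext h'.reg]

theorem Runs.exec {P : Prog} {a b : ℕ → List Bool} {L : List (Gate ℕ)} {T : ℕ}
    (h : Runs P a b L T) (out : List (Gate ℕ)) (t : ℕ) :
    ∃ t' ≤ T, P.exec ⟨a, out, t⟩ = ⟨b, out ++ L, t + t'⟩ := by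
  obtain ⟨t', ht', h⟩ := h
  exact ⟨t', ht', by rw [exec_eq, h]⟩

theorem Runs.mono {P : Prog} {a b : ℕ → List Bool} {L : List (Gate ℕ)} {T T' : ℕ}
    (h : Runs P a b L T) (hT : T ≤ T') : Runs P a b L T' := by
  obtain ⟨t, ht, h⟩ := h
  exact ⟨t, ht.trans hT, h⟩

theorem Runs.congr {P : Prog} {a b b' : ℕ → List Bool} {L L' : List (Gate ℕ)} {T T' : ℕ}
    (h : Runs P a b L T) (hb : b = b') (hL : L = L') (hT : T ≤ T') : Runs P a b' L' T' := by
  subst hb hL; exact h.mono hT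

theorem Runs.seq {P Q : Prog} {a b c : ℕ → List Bool} {L L' : List (Gate ℕ)} {T T' : ℕ}
    (h : Runs P a b L T) (h' : Runs Q b c L' T') : Runs (.seq P Q) a c (L ++ L') (T + T') := by
  obtain ⟨t, ht, h⟩ := h
  obtain ⟨t', ht', h'⟩ := h'.exec L t
  exact ⟨t + t', by omega, by rw [Prog.exec, h, h']⟩

theorem runs_skip (a : ℕ → List Bool) : Runs .skip a a [] 1 := ⟨1, le_rfl, rfl⟩

theorem runs_push (a : ℕ → List Bool) (r : ℕ) (b : Bool) :
    Runs (.push r b) a (Function.update a r (b :: a r)) [] 1 := ⟨1, le_rfl, rfl⟩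

theorem runs_pop (a : ℕ → List Bool) (r : ℕ) :
    Runs (.pop r) a (Function.update a r (a r).tail) [] 1 := ⟨1, le_rfl, rfl⟩

theorem runs_emit (a : ℕ → List Bool) (g : Gate ℕ) :
    Runs (.emit g) a a [g.map fun r => (a r).length] 1 := ⟨1, le_rfl, rfl⟩

/-- The number of iterations is read off on entry, so the body may freely change the loop register;
the sequence `a` plays the role of a loop invariant. -/
theorem Runs.loop {P : Prog} {r : ℕ} (a : ℕ → ℕ → List Bool) (L : ℕ → List (Gate ℕ)) {T m : ℕ}
    (hm : (a 0 r).length = m) (h : ∀ i < m, Runs P (a i) (a (i + 1)) (L i) T) :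
    Runs (.loop r P) (a 0) (a m) ((List.range m).flatMap L) (1 + m * T) := by
  have key : ∀ k ≤ m, ∃ t ≤ 1 + k * T, P.exec^[k] ⟨a 0, [], 1⟩ =
      ⟨a k, (List.range k).flatMap L, t⟩ := by
    intro k
    induction k with
    | zero => intro _; exact ⟨1, by omega, rfl⟩
    | succ k ih =>
      intro hk
      obtain ⟨t, ht, e⟩ := ih (by omega)
      obtain ⟨t', ht', e'⟩ := (h k (by omega)).exec ((List.range k).flatMap L) t
      refine ⟨t + t', by rw [Nat.succ_mul]; omega, ?_⟩
      rw [Function.iterate_succ_apply', e, e', List.range_succ, List.flatMap_append]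
      simp
  obtain ⟨t, ht, e⟩ := key m le_rfl
  refine ⟨t, ht, ?_⟩
  simp only [Prog.exec, Config.tick, hm]
  exact e

theorem Runs.cases_nil {r : ℕ} {E F T : Prog} {a b : ℕ → List Bool} {L : List (Gate ℕ)} {t : ℕ}
    (hr : a r = []) (h : Runs E a b L t) : Runs (.cases r E F T) a b L (1 + t) := by
  obtain ⟨t', ht', e⟩ := h.exec [] 1
  refine ⟨1 + t', by omega, ?_⟩
  simp only [Prog.exec, Config.tick, hr]
  simpa using e

theorem Runs.cases_false {r : ℕ} {E F T : Prog} {a b : ℕ → List Bool} {L : List (Gate ℕ)} {t : ℕ}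
    {l : List Bool} (hr : a r = false :: l) (h : Runs F a b L t) :
    Runs (.cases r E F T) a b L (1 + t) := by
  obtain ⟨t', ht', e⟩ := h.exec [] 1
  refine ⟨1 + t', by omega, ?_⟩
  simp only [Prog.exec, Config.tick, hr]
  simpa using e

theorem Runs.cases_true {r : ℕ} {E F T : Prog} {a b : ℕ → List Bool} {L : List (Gate ℕ)} {t : ℕ}
    {l : List Bool} (hr : a r = true :: l) (h : Runs T a b L t) :
    Runs (.cases r E F T) a b L (1 + t) := by
  obtain ⟨t', ht', e⟩ := h.exec [] 1
  refine ⟨1 + t', by omega, ?_⟩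
  simp only [Prog.exec, Config.tick, hr]
  simpa using e

/-- A frame rule: registers outside the range of the renaming keep their contents, so a program can
be run next to data it does not know of. -/
theorem Runs.map {P : Prog} {a b : ℕ → List Bool} {L : List (Gate ℕ)} {T : ℕ} (h : Runs P a b L T)
    {ρ : ℕ → ℕ} (hρ : Function.Injective ρ) {a' b' : ℕ → List Bool} (ha : ∀ r, a' (ρ r) = a r)
    (hb : ∀ r, b' (ρ r) = b r) (hab : ∀ r, (∀ q, ρ q ≠ r) → b' r = a' r) :
    Runs (P.map ρ) a' b' L T := by
  obtain ⟨t, ht, e⟩ := h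
  have hs : Sim ρ a' [] 0 ⟨a, [], 0⟩ ⟨a', [], 0⟩ := ⟨ha, fun _ _ => rfl, rfl, rfl⟩
  have h' := hs.exec hρ P
  rw [e] at h'
  refine ⟨t, ht, ?_⟩
  have h1 : ((P.map ρ).exec ⟨a', [], 0⟩).reg = b' := by
    funext r
    by_cases hr : ∃ q, ρ q = r
    · obtain ⟨q, rfl⟩ := hr
      rw [h'.reg, hb]
    · push Not at hr
      rw [h'.off r hr, hab r hr]
  have h2 := h'.out
  have h3 := h'.time
  simp only [List.nil_append, Nat.zero_add] at h2 h3
  rw [← h1, ← h2, ← h3]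

/-- A step pushes at most one bit. Hence a time bound is also a bound on every number that is
computed in unary, and composing programs keeps their running times polynomial. -/
theorem length_exec_le (P : Prog) : ∀ (B : ℕ) (s : Config), (∀ r, (s.reg r).length ≤ B + s.time) →
    ∀ r, ((P.exec s).reg r).length ≤ B + (P.exec s).time := by
  intro B
  induction P with
  | skip => intro s h r; have := h r; simp only [Prog.exec, Config.tick]; omega
  | push q b =>
    intro s h r
    have := h r
    simp only [Prog.exec, Config.tick, Function.update_apply]
    split_ifs with hr
    · subst hr; simp; omega
    · omega
  | pop q =>
    intro s h r
    have := h r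
    simp only [Prog.exec, Config.tick, Function.update_apply]
    split_ifs with hr
    · subst hr; simp; omega
    · omega
  | seq P Q hP hQ => intro s h; exact hQ _ (hP _ h)
  | cases q E F T hE hF hT =>
    intro s h
    have h' : ∀ r, (s.tick.reg r).length ≤ B + s.tick.time := by
      intro r; have := h r; simp only [Config.tick]; omega
    simp only [Prog.exec]
    rcases s.reg q with _ | ⟨_ | _, _⟩
    · exact hE _ h'
    · exact hF _ h'
    · exact hT _ h'
  | loop q P hP =>
    intro s h
    simp only [Prog.exec]
    generalize (s.reg q).length = m
    induction m with
    | zero => intro r; have := h r; simp only [Config.tick, Function.iterate_zero, id]; omega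
    | succ m ih => rw [Function.iterate_succ_apply']; exact hP _ ih
  | emit g => intro s h r; have := h r; simp only [Prog.exec, Config.tick]; omega

theorem Runs.length_le {P : Prog} {a b : ℕ → List Bool} {L : List (Gate ℕ)} {T B : ℕ}
    (h : Runs P a b L T) (ha : ∀ r, (a r).length ≤ B) (r : ℕ) : (b r).length ≤ B + T := by
  obtain ⟨t, ht, e⟩ := h
  have := length_exec_le P B ⟨a, [], 0⟩ (by simpa using ha) r
  rw [e] at this
  simp only at this
  omega

/-- A bound for the registers that a program uses. -/
def bound : Prog → ℕ
  | .skip => 0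
  | .push r _ => r + 1
  | .pop r => r + 1
  | .seq P Q => max P.bound Q.bound
  | .cases _ E F T => max E.bound (max F.bound T.bound)
  | .loop _ P => P.bound
  | .emit _ => 0

/-- Only `push` and `pop` change registers, which is why `bound` ignores registers that are merely
read. Thus an arbitrary program leaves behind data in a known finite range, which can be cleared. -/
theorem exec_reg_of_bound_le (P : Prog) : ∀ (s : Config) (r : ℕ), P.bound ≤ r →
    (P.exec s).reg r = s.reg r := by
  induction P with
  | skip => intro s r h; rfl
  | push q b =>
    intro s r h
    simp only [bound] at h
    simp only [Prog.exec, Config.tick]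
    rw [Function.update_of_ne (by omega)]
  | pop q =>
    intro s r h
    simp only [bound] at h
    simp only [Prog.exec, Config.tick]
    rw [Function.update_of_ne (by omega)]
  | seq P Q hP hQ =>
    intro s r h
    simp only [bound, max_le_iff] at h
    rw [Prog.exec, hQ _ _ h.2, hP _ _ h.1]
  | cases q E F T hE hF hT =>
    intro s r h
    simp only [bound, max_le_iff] at h
    simp only [Prog.exec]
    rcases s.reg q with _ | ⟨_ | _, _⟩
    · exact hE _ _ h.1
    · exact hF _ _ h.2.1
    · exact hT _ _ h.2.2
  | loop q P hP =>
    intro s r h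
    simp only [bound] at h
    simp only [Prog.exec]
    generalize (s.reg q).length = m
    induction m with
    | zero => rfl
    | succ m ih => rw [Function.iterate_succ_apply', hP _ _ h, ih]
  | emit g => intro s r h; rfl

/-! #### Basic programs -/

/-- Empty the register `r`. -/
def clear (r : ℕ) : Prog := .loop r (.pop r)

theorem runs_clear (a : ℕ → List Bool) (r : ℕ) :
    Runs (clear r) a (Function.update a r []) [] (1 + (a r).length) := by
  have h := Runs.loop (P := .pop r) (r := r) (fun i => Function.update a r ((a r).drop i))
    (fun _ => []) (T := 1) (m := (a r).length) (by simp)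
    (fun i _ => (runs_pop _ r).congr (by simp) rfl le_rfl)
  simp only [List.drop_zero, Function.update_eq_self] at h
  exact h.congr (by simp) (by simp) (by simp)

/-- Add the length of register `r` to register `q`. -/
def add (r q : ℕ) : Prog := .loop r (.push q true)

theorem replicate_succ_append (i : ℕ) (l : List Bool) :
    true :: (List.replicate i true ++ l) = List.replicate (i + 1) true ++ l := rfl

theorem runs_add (a : ℕ → List Bool) (r q : ℕ) :
    Runs (add r q) a (Function.update a q (List.replicate (a r).length true ++ a q)) []
      (1 + (a r).length) := by
  have h := Runs.loop (P := .push q true) (r := r)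
    (fun i => Function.update a q (List.replicate i true ++ a q))
    (fun _ => []) (T := 1) (m := (a r).length) (by simp)
    (fun i _ => (runs_push _ q true).congr (by simp [replicate_succ_append]) rfl le_rfl)
  simp only [List.replicate_zero, List.nil_append, Function.update_eq_self] at h
  exact h.congr rfl (by simp) (by simp)

/-- Empty the registers from `r` to `r + m - 1`. -/
def clearFrom (r : ℕ) : ℕ → Prog
  | 0 => .skip
  | m + 1 => .seq (clearFrom r m) (clear (r + m))

theorem runs_clearFrom (a : ℕ → List Bool) (r m B : ℕ) (hB : ∀ i, (a i).length ≤ B) :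
    Runs (clearFrom r m) a (fun i => if r ≤ i ∧ i < r + m then [] else a i) []
      (1 + m * (1 + B)) := by
  induction m with
  | zero =>
    refine (runs_skip a).congr ?_ rfl (by omega)
    funext i; rw [if_neg (by omega)]
  | succ m ih =>
    refine (ih.seq (runs_clear _ (r + m))).congr ?_ rfl ?_
    · funext i
      simp only [Function.update_apply]
      split_ifs <;> first | rfl | omega
    · have := hB (r + m)
      rw [if_neg (by omega), Nat.succ_mul]; omega

end Prog

open Prog

/-! ### Numbers and gate lists that are generated in polynomial time from finitely many numbers. -/

/-- The registers below `k` hold the numbers `e`, in unary; the others are empty. -/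
def regs (k : ℕ) (e : ℕ → ℕ) : ℕ → List Bool :=
  fun r => if r < k then List.replicate (e r) true else []

/-- The sum of the first `k` numbers. -/
def envSize (k : ℕ) (e : ℕ → ℕ) : ℕ := ∑ i ∈ Finset.range k, e i

theorem le_envSize {k : ℕ} (e : ℕ → ℕ) {i : ℕ} (h : i < k) : e i ≤ envSize k e :=
  Finset.single_le_sum (f := e) (fun _ _ => Nat.zero_le _) (Finset.mem_range.2 h)

theorem envSize_succ_update (k : ℕ) (e : ℕ → ℕ) (x : ℕ) :
    envSize (k + 1) (Function.update e k x) = envSize k e + x := by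
  unfold envSize
  rw [Finset.sum_range_succ, Function.update_self]
  congr 1
  refine Finset.sum_congr rfl fun i hi => ?_
  rw [Function.update_of_ne (by have := Finset.mem_range.1 hi; omega)]

theorem envSize_le_add (k m : ℕ) (e : ℕ → ℕ) : envSize k e ≤ envSize (k + m) e :=
  Finset.sum_le_sum_of_subset (Finset.range_mono (by omega))

theorem length_regs_le (k : ℕ) (e : ℕ → ℕ) (r : ℕ) : (regs k e r).length ≤ envSize k e := by
  unfold regs
  split_ifs with h
  · simpa using le_envSize e h
  · simp

/-- A list of gates that depends on `k` numbers and is generated in polynomial time. -/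
def GenGates (k : ℕ) (L : (ℕ → ℕ) → List (Gate ℕ)) : Prop :=
  ∃ (P : Prog) (p : Polynomial ℕ), ∀ e, Runs P (regs k e) (regs k e) (L e) (p.eval (envSize k e))

/-- A number that depends on `k` numbers and is computed in polynomial time, in unary. -/
def GenNum (k : ℕ) (f : (ℕ → ℕ) → ℕ) : Prop :=
  ∃ (P : Prog) (p : Polynomial ℕ), ∀ e, Runs P (regs k e)
    (regs (k + 1) (Function.update e k (f e))) [] (p.eval (envSize k e))

theorem GenGates.congr {k : ℕ} {L L' : (ℕ → ℕ) → List (Gate ℕ)} (h : GenGates k L)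
    (hL : ∀ e, L e = L' e) : GenGates k L' := (funext hL : L = L') ▸ h

theorem GenNum.congr {k : ℕ} {f f' : (ℕ → ℕ) → ℕ} (h : GenNum k f)
    (hf : ∀ e, f e = f' e) : GenNum k f' := (funext hf : f = f') ▸ h

/-- This renaming keeps the first `k` variables in place and moves the work space up by `m`, making
room for `m` further variables. -/
theorem skip_injective (k m : ℕ) : Function.Injective fun r : ℕ => if r < k then r else r + m := by
  intro a b h
  simp only at h
  split_ifs at h <;> omega

theorem skip_ne {k m r : ℕ} (h : ∀ q : ℕ, (if q < k then q else q + m) ≠ r) : k ≤ r ∧ r < k + m := by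
  constructor
  · by_contra hr
    exact h r (if_pos (by omega))
  · by_contra hr
    refine h (r - m) ?_
    rw [if_neg (by omega)]; omega

theorem GenGates.weaken {k : ℕ} {L : (ℕ → ℕ) → List (Gate ℕ)} (h : GenGates k L) (m : ℕ) :
    GenGates (k + m) L := by
  obtain ⟨P, p, h⟩ := h
  refine ⟨P.map fun r => if r < k then r else r + m, p, fun e => ?_⟩
  refine ((h e).map (skip_injective k m) ?_ ?_ fun _ _ => rfl).mono
    (peval_mono p (envSize_le_add k m e)) <;>
  · intro r
    simp only [regs]
    split_ifs <;> first | rfl | omega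

theorem GenNum.weaken {k : ℕ} {f : (ℕ → ℕ) → ℕ} (h : GenNum k f) (m : ℕ) : GenNum (k + m) f := by
  obtain ⟨P, p, h⟩ := h
  refine ⟨P.map fun r => if r < k then r else r + m, p, fun e => ?_⟩
  refine ((h e).map (skip_injective k m) ?_ ?_ ?_).mono (peval_mono p (envSize_le_add k m e))
  · intro r
    simp only [regs]
    split_ifs <;> first | rfl | omega
  · intro r
    simp only [regs, Function.update_apply]
    split_ifs <;> first | rfl | omega
  · intro r hr
    have := skip_ne hr
    simp only [regs, Function.update_apply]
    split_ifs <;> first | rfl | omega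

theorem GenNum.exists_bound {k : ℕ} {f : (ℕ → ℕ) → ℕ} (h : GenNum k f) :
    ∃ p : Polynomial ℕ, ∀ e, f e ≤ p.eval (envSize k e) := by
  obtain ⟨P, p, h⟩ := h
  refine ⟨.X + p, fun e => ?_⟩
  have := (h e).length_le (length_regs_le k e) k
  simpa [regs] using this

theorem GenGates.nil (k : ℕ) : GenGates k fun _ => [] :=
  ⟨.skip, 1, fun e => by simpa using runs_skip _⟩

theorem GenGates.append {k : ℕ} {L M : (ℕ → ℕ) → List (Gate ℕ)} (hL : GenGates k L)
    (hM : GenGates k M) : GenGates k fun e => L e ++ M e := by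
  obtain ⟨P, p, hP⟩ := hL
  obtain ⟨Q, q, hQ⟩ := hM
  exact ⟨.seq P Q, p + q, fun e => by simpa using (hP e).seq (hQ e)⟩

/-- Substitution: the value of `f` is stored as a new variable, `L` is generated from it, and the
variable is erased. The polynomial bound on `f` is needed because the time for `L` is measured in
all its variables, including the new one. -/
theorem GenGates.bind {k : ℕ} {f : (ℕ → ℕ) → ℕ} {L : (ℕ → ℕ) → List (Gate ℕ)} (hf : GenNum k f)
    (hL : GenGates (k + 1) L) : GenGates k fun e => L (Function.update e k (f e)) := by
  obtain ⟨b, hb⟩ := hf.exists_bound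
  obtain ⟨P, p, hP⟩ := hf
  obtain ⟨Q, q, hQ⟩ := hL
  refine ⟨.seq P (.seq Q (clear k)), p + (q.comp (.X + b) + (1 + b)), fun e => ?_⟩
  refine ((hP e).seq ((hQ _).seq (runs_clear _ k))).congr ?_ (by simp) ?_
  · funext r
    simp only [regs, Function.update_apply]
    split_ifs <;> first | rfl | omega
  · have h1 : envSize (k + 1) (Function.update e k (f e)) ≤ envSize k e + b.eval (envSize k e) := by
      rw [envSize_succ_update]; exact Nat.add_le_add_left (hb e) _
    have h2 := peval_mono q h1
    have h3 := hb e
    simp only [regs, lt_add_iff_pos_right, zero_lt_one, if_true, Function.update_self,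
      List.length_replicate, Polynomial.eval_add, Polynomial.eval_comp, Polynomial.eval_X,
      Polynomial.eval_one] at h2 ⊢
    omega

/-- The result appears one register above the temporary value of `f`; it is moved down once that
value has been erased. -/
theorem GenNum.bind {k : ℕ} {f g : (ℕ → ℕ) → ℕ} (hf : GenNum k f) (hg : GenNum (k + 1) g) :
    GenNum k fun e => g (Function.update e k (f e)) := by
  obtain ⟨b, hb⟩ := hf.exists_bound
  obtain ⟨c, hc⟩ := hg.exists_bound
  obtain ⟨P, p, hP⟩ := hf
  obtain ⟨Q, q, hQ⟩ := hg
  refine ⟨.seq P (.seq Q (.seq (clear k) (.seq (add (k + 1) k) (clear (k + 1))))),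
    p + (q.comp (.X + b) + ((1 + b) + ((1 + c.comp (.X + b)) + (1 + c.comp (.X + b))))),
    fun e => ?_⟩
  refine ((hP e).seq ((hQ _).seq ((runs_clear _ k).seq ((runs_add _ _ _).seq
    (runs_clear _ (k + 1)))))).congr ?_ (by simp) ?_
  · funext r
    simp only [regs, Function.update_apply]
    split_ifs <;> first | rfl | omega | simp
  · have h1 : envSize (k + 1) (Function.update e k (f e)) ≤ envSize k e + b.eval (envSize k e) := by
      rw [envSize_succ_update]; exact Nat.add_le_add_left (hb e) _
    have h2 := peval_mono q h1
    have h4 := (hc (Function.update e k (f e))).trans (peval_mono c h1)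
    have h3 := hb e
    simp [regs] at h2 h4 ⊢
    omega

theorem GenNum.var {k i : ℕ} (h : i < k) : GenNum k fun e => e i := by
  refine ⟨add i k, 1 + .X, fun e => (runs_add _ _ _).congr ?_ rfl ?_⟩
  · funext r
    simp only [regs, Function.update_apply]
    split_ifs <;> first | rfl | omega | simp
  · have := le_envSize e h
    simp [regs, h]; omega

theorem GenNum.const (k c : ℕ) : GenNum k fun _ => c := by
  induction c with
  | zero =>
    refine ⟨.skip, 1, fun e => (runs_skip _).congr ?_ rfl (by simp)⟩
    funext r
    simp only [regs, Function.update_apply]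
    split_ifs <;> first | rfl | omega
  | succ c ih =>
    obtain ⟨P, p, h⟩ := ih
    refine ⟨.seq P (.push k true), p + 1, fun e => ((h e).seq (runs_push _ k true)).congr ?_ rfl
      (by simp)⟩
    funext r
    simp only [regs, Function.update_apply]
    split_ifs <;> first | rfl | omega

theorem GenNum.bind₂ {k : ℕ} {f g h : (ℕ → ℕ) → ℕ} (hf : GenNum k f) (hg : GenNum k g)
    (hh : GenNum (k + 2) h)
    (hg' : ∀ e x, g (Function.update e k x) = g e) :
    GenNum k fun e => h (Function.update (Function.update e k (f e)) (k + 1) (g e)) :=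
  (GenNum.bind hf (GenNum.bind (hg.weaken 1) hh)).congr fun e => by rw [hg']

/-- A generated number cannot depend on variables from `k` on: the initial registers do not contain
them, and execution is deterministic. -/
theorem GenNum.apply_update {k : ℕ} {f : (ℕ → ℕ) → ℕ} (h : GenNum k f) {i : ℕ} (hi : k ≤ i)
    (e : ℕ → ℕ) (x : ℕ) : f (Function.update e i x) = f e := by
  obtain ⟨P, p, h⟩ := h
  have he : regs k (Function.update e i x) = regs k e := by
    funext r
    simp only [regs, Function.update_apply]
    split_ifs <;> first | rfl | omega
  obtain ⟨t, _, h1⟩ := h e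
  obtain ⟨t', _, h2⟩ := h (Function.update e i x)
  rw [he, h1] at h2
  have := congrArg (fun c : Config => (c.reg k).length) h2
  simpa [regs] using this.symm

theorem GenNum.add {k : ℕ} {f g : (ℕ → ℕ) → ℕ} (hf : GenNum k f) (hg : GenNum k g) :
    GenNum k fun e => f e + g e := by
  have h : GenNum (k + 2) fun e => e k + e (k + 1) := by
    refine ⟨.seq (Prog.add k (k + 2)) (Prog.add (k + 1) (k + 2)), (1 + .X) + (1 + .X), fun e =>
      ((runs_add _ _ _).seq (runs_add _ _ _)).congr ?_ rfl ?_⟩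
    · funext r
      simp only [regs, Function.update_apply]
      split_ifs <;> first | rfl | omega | skip
      simp only [List.append_nil, List.length_replicate, List.replicate_append_replicate, Nat.add_comm]
    · have h1 := le_envSize e (show k < k + 2 by omega)
      have h2 := le_envSize e (show k + 1 < k + 2 by omega)
      simp [regs]; omega
  exact (GenNum.bind₂ hf hg h fun e x => hg.apply_update le_rfl e x).congr fun e => by simp

theorem GenNum.mul {k : ℕ} {f g : (ℕ → ℕ) → ℕ} (hf : GenNum k f) (hg : GenNum k g) :
    GenNum k fun e => f e * g e := by
  have h : GenNum (k + 2) fun e => e k * e (k + 1) := by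
    refine ⟨.loop k (Prog.add (k + 1) (k + 2)), 1 + .X * (1 + .X), fun e => ?_⟩
    have := Runs.loop (P := Prog.add (k + 1) (k + 2)) (r := k)
      (fun i => regs (k + 3) (Function.update e (k + 2) (i * e (k + 1)))) (fun _ => [])
      (m := e k) (T := 1 + e (k + 1)) (by simp [regs]) (fun i _ => by
        refine (runs_add _ _ _).congr ?_ rfl (by simp [regs])
        funext r
        simp only [regs, Function.update_apply]
        split_ifs <;> first | rfl | omega | skip
        simp [Nat.succ_mul, add_comm])
    have h0 : regs (k + 3) (Function.update e (k + 2) (0 * e (k + 1))) = regs (k + 2) e := by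
      funext r
      simp only [regs, Function.update_apply]
      split_ifs <;> first | rfl | omega | simp
    simp only [h0] at this
    refine this.congr rfl (by simp) ?_
    have h1 := le_envSize e (show k < k + 2 by omega)
    have h2 := le_envSize e (show k + 1 < k + 2 by omega)
    simp only [Polynomial.eval_add, Polynomial.eval_mul, Polynomial.eval_X, Polynomial.eval_one]
    gcongr
  exact (GenNum.bind₂ hf hg h fun e x => hg.apply_update le_rfl e x).congr fun e => by simp

theorem GenGates.gate (k : ℕ) (g : Gate ℕ) (L : (ℕ → ℕ) → List (Gate ℕ))
    (h : ∀ e, g.map (fun r => (regs k e r).length) = g.map e) (hL : ∀ e, [g.map e] = L e) :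
    GenGates k L :=
  ⟨.emit g, 1, fun e => (runs_emit _ g).congr rfl (by rw [← hL, h]) (by simp)⟩

theorem GenGates.had {k : ℕ} {f : (ℕ → ℕ) → ℕ} (hf : GenNum k f) :
    GenGates k fun e => [.had (f e)] := by
  have h : GenGates (k + 1) fun e => [.had (e k)] :=
    .gate _ (.had k) _ (fun e => by simp [Gate.map, regs]) fun e => rfl
  exact (GenGates.bind hf h).congr fun e => by simp

theorem GenGates.not {k : ℕ} {f : (ℕ → ℕ) → ℕ} (hf : GenNum k f) :
    GenGates k fun e => [.classical (.not (f e))] := by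
  have h : GenGates (k + 1) fun e => [.classical (.not (e k))] :=
    .gate _ (.classical (.not k)) _ (fun e => by simp [Gate.map, CGate.map, regs]) fun e => rfl
  exact (GenGates.bind hf h).congr fun e => by simp

theorem GenGates.cnot {k : ℕ} {f g : (ℕ → ℕ) → ℕ} (hf : GenNum k f) (hg : GenNum k g) :
    GenGates k fun e => [.classical (.cnot (f e) (g e))] := by
  have h : GenGates (k + 2) fun e => [.classical (.cnot (e k) (e (k + 1)))] :=
    .gate _ (.classical (.cnot k (k + 1))) _ (fun e => by simp [Gate.map, CGate.map, regs])
      fun e => rfl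
  exact (GenGates.bind hf (GenGates.bind (hg.weaken 1) h)).congr fun e => by
    simp [hg.apply_update]

theorem GenGates.ccnot {k : ℕ} {f g h : (ℕ → ℕ) → ℕ} (hf : GenNum k f) (hg : GenNum k g)
    (hh : GenNum k h) : GenGates k fun e => [.classical (.ccnot (f e) (g e) (h e))] := by
  have h : GenGates (k + 3) fun e => [.classical (.ccnot (e k) (e (k + 1)) (e (k + 2)))] :=
    .gate _ (.classical (.ccnot k (k + 1) (k + 2))) _
      (fun e => by simp [Gate.map, CGate.map, regs]) fun e => rfl
  exact (GenGates.bind hf (GenGates.bind (hg.weaken 1) (GenGates.bind (hh.weaken 2) h))).congr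
    fun e => by
      simp only [hg.apply_update, hh.apply_update, Function.update_apply, le_refl, Nat.le_succ]
      simp; omega

/-- Register `k` holds the number of iterations and register `k + 1` the counter. The body expects
the counter in register `k`, so its registers from `k` on are moved up by one. -/
theorem GenGates.flatMap {k : ℕ} {m : (ℕ → ℕ) → ℕ} {L : (ℕ → ℕ) → List (Gate ℕ)} (hm : GenNum k m)
    (hL : GenGates (k + 1) L) :
    GenGates k fun e => (List.range (m e)).flatMap fun j => L (Function.update e k j) := by
  obtain ⟨b, hb⟩ := hm.exists_bound
  obtain ⟨P, p, hP⟩ := hm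
  obtain ⟨Q, q, hQ⟩ := hL
  refine ⟨.seq P (.seq (.loop k (.seq (Q.map fun r => if r < k then r else r + 1)
    (.push (k + 1) true))) (.seq (clear k) (clear (k + 1)))),
    p + ((1 + b * (q.comp (.X + b) + 1)) + ((1 + b) + (1 + b))), fun e => ?_⟩
  set e' : ℕ → ℕ → ℕ := fun j => Function.update (Function.update e k (m e)) (k + 1) j with he'
  have hloop := Runs.loop (r := k) (P := .seq (Q.map fun r => if r < k then r else r + 1)
    (.push (k + 1) true)) (fun j => regs (k + 2) (e' j)) (fun j => L (Function.update e k j))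
    (m := m e) (T := q.eval (envSize k e + m e) + 1) (by simp [regs, he']) (fun j hj => by
      have h1 : Runs (Q.map fun r => if r < k then r else r + 1) (regs (k + 2) (e' j))
          (regs (k + 2) (e' j)) (L (Function.update e k j))
          (q.eval (envSize (k + 1) (Function.update e k j))) := by
        refine (hQ (Function.update e k j)).map (skip_injective k 1) ?_ ?_ (fun _ _ => rfl) <;>
        · intro r
          simp only [regs, he', Function.update_apply]
          split_ifs <;> first | rfl | omega
      refine (h1.seq (runs_push _ (k + 1) true)).congr ?_ (by simp) ?_
      · funext r
        simp only [regs, he', Function.update_apply]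
        split_ifs <;> first | rfl | omega
      · rw [envSize_succ_update]
        have := peval_mono q (show envSize k e + j ≤ envSize k e + m e by omega)
        simp only at this
        omega)
  have h0 : regs (k + 2) (e' 0) = regs (k + 1) (Function.update e k (m e)) := by
    funext r
    simp only [regs, he', Function.update_apply]
    split_ifs <;> first | rfl | omega
  rw [h0] at hloop
  refine ((hP e).seq (hloop.seq ((runs_clear _ k).seq (runs_clear _ (k + 1))))).congr ?_
    (by simp) ?_
  · funext r
    simp only [regs, he', Function.update_apply]
    split_ifs <;> first | rfl | omega
  · have h1 := hb e
    have h2 := peval_mono q (show envSize k e + m e ≤ envSize k e + b.eval (envSize k e) by omega)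
    simp only at h2
    have h3 : m e * (q.eval (envSize k e + m e) + 1) ≤ b.eval (envSize k e) *
        (q.eval (envSize k e + b.eval (envSize k e)) + 1) := Nat.mul_le_mul h1 (by omega)
    simp [regs, he'] at h3 ⊢
    omega

end QL

/-! ### Reversal and shift of generated gate lists, by way of a stack of gate codes. -/

namespace QL
open Prog

/-! #### Recording the gates of a program -/

/-- The code of four numbers. -/
def encNums (t a b c : ℕ) : List Bool :=
  List.replicate t true ++ false :: (List.replicate a true ++ false ::
    (List.replicate b true ++ false :: (List.replicate c true ++ [false])))

/-- The gate with type `t` and wires `a`, `b`, `c`. -/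
def mkGate (t a b c : ℕ) : Gate ℕ :=
  match t with
  | 0 => .classical (.not a)
  | 1 => .classical (.cnot a b)
  | 2 => .classical (.ccnot a b c)
  | 3 => .had a
  | _ => .tgate a

/-- The type of a gate, as a number. -/
def Gate.kind {ι : Type} : Gate ι → ℕ
  | .classical (.not _) => 0
  | .classical (.cnot _ _) => 1
  | .classical (.ccnot _ _ _) => 2
  | .had _ => 3
  | .tgate _ => 4

/-- The wires of a gate. -/
def Gate.labels {ι : Type} : Gate ι → List ι
  | .classical (.not t) => [t]
  | .classical (.cnot c t) => [c, t]
  | .classical (.ccnot a b t) => [a, b, t]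
  | .had t => [t]
  | .tgate t => [t]

/-- The code of a gate. -/
def Gate.enc (g : Gate ℕ) : List Bool :=
  encNums g.kind (g.labels.getD 0 0) (g.labels.getD 1 0) (g.labels.getD 2 0)

theorem Gate.mkGate_kind (g : Gate ℕ) :
    mkGate g.kind (g.labels.getD 0 0) (g.labels.getD 1 0) (g.labels.getD 2 0) = g := by
  rcases g with (_ | _ | _) | _ | _ <;> rfl

theorem map_mkGate (t a b c o : ℕ) :
    (mkGate t a b c).map (· + o) = mkGate t (a + o) (b + o) (c + o) := by
  rcases t with _ | _ | _ | _ | t <;> rfl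

theorem Gate.length_enc_pos (g : Gate ℕ) : 0 < g.enc.length := by
  simp [Gate.enc, encNums]

namespace Prog

/-- Push the code of the length of register `q.1`, or of the number `q.2`. -/
def pushNum (D : ℕ) : Option ℕ → Prog
  | none => .push D false
  | some r => .seq (.push D false) (add r D)

/-- Push a fixed number of marks. -/
def pushConst (D : ℕ) : ℕ → Prog
  | 0 => .skip
  | m + 1 => .seq (pushConst D m) (.push D true)

/-- Push the code of a gate on the register `D`. -/
def pushGate (D : ℕ) (g : Gate ℕ) : Prog :=
  .seq (pushNum D g.labels[2]?) (.seq (pushNum D g.labels[1]?) (.seq (pushNum D g.labels[0]?)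
    (.seq (.push D false) (pushConst D g.kind))))

theorem runs_pushNum (a : ℕ → List Bool) (D : ℕ) (q : Option ℕ) (B : ℕ)
    (hD : ∀ r ∈ q, r ≠ D) (hB : ∀ r ∈ q, (a r).length ≤ B) :
    Runs (pushNum D q) a
      (Function.update a D (List.replicate (q.elim 0 fun r => (a r).length) true ++ false :: a D))
      [] (B + 2) := by
  rcases q with _ | r
  · exact (runs_push a D false).congr (by simp) rfl (by omega)
  · have hr := hD r rfl
    have := hB r rfl
    refine ((runs_push a D false).seq (runs_add _ r D)).congr ?_ rfl ?_
    · simp [Function.update_of_ne hr]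
    · rw [Function.update_of_ne hr]; omega

theorem runs_pushConst (a : ℕ → List Bool) (D m : ℕ) :
    Runs (pushConst D m) a (Function.update a D (List.replicate m true ++ a D)) [] (m + 1) := by
  induction m with
  | zero => exact (runs_skip a).congr (by simp) rfl le_rfl
  | succ m ih => exact (ih.seq (runs_push _ D true)).congr (by simp [List.replicate_succ]) rfl le_rfl

/-- The fields are pushed in the opposite order, the type last, so that a reader pops the type first
and then the wires in order. -/
theorem runs_pushGate (a : ℕ → List Bool) (D : ℕ) (g : Gate ℕ) (B : ℕ)
    (hD : ∀ r ∈ g.labels, r ≠ D) (hB : ∀ r ∈ g.labels, (a r).length ≤ B) :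
    Runs (pushGate D g) a
      (Function.update a D ((g.map fun r => (a r).length).enc ++ a D)) [] (3 * B + 12) := by
  have hk : g.kind ≤ 4 := by rcases g with (_ | _ | _) | _ | _ <;> simp [Gate.kind]
  have h2 := runs_pushNum a D g.labels[2]? B
    (fun r hr => hD r (List.mem_of_getElem? hr)) (fun r hr => hB r (List.mem_of_getElem? hr))
  set a2 := Function.update a D
    (List.replicate (g.labels[2]?.elim 0 fun r => (a r).length) true ++ false :: a D) with ha2
  have e2 : ∀ r ∈ g.labels, a2 r = a r := fun r hr => Function.update_of_ne (hD r hr) _ _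
  have h1 := runs_pushNum a2 D g.labels[1]? B
    (fun r hr => hD r (List.mem_of_getElem? hr))
    (fun r hr => by rw [e2 r (List.mem_of_getElem? hr)]; exact hB r (List.mem_of_getElem? hr))
  set a1 := Function.update a2 D
    (List.replicate (g.labels[1]?.elim 0 fun r => (a2 r).length) true ++ false :: a2 D) with ha1
  have e1 : ∀ r ∈ g.labels, a1 r = a r := fun r hr => by
    rw [ha1, Function.update_of_ne (hD r hr), e2 r hr]
  have h0 := runs_pushNum a1 D g.labels[0]? B
    (fun r hr => hD r (List.mem_of_getElem? hr))
    (fun r hr => by rw [e1 r (List.mem_of_getElem? hr)]; exact hB r (List.mem_of_getElem? hr))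
  refine (h2.seq (h1.seq (h0.seq ((runs_push _ D false).seq (runs_pushConst _ D g.kind))))).congr
    ?_ rfl (by omega)
  rcases g with (t | ⟨c, t⟩ | ⟨u, v, t⟩) | t | t <;>
  · simp only [Gate.labels, List.mem_cons, forall_eq_or_imp, List.not_mem_nil, false_imp_iff,
      implies_true, and_true] at hD
    simp [Gate.labels, Gate.kind, Gate.map, CGate.map, Gate.enc, encNums, ha1, ha2, hD,
      List.replicate_succ]

/-- Run a program with renamed registers, and push the codes of the gates on the register `D`
instead of emitting the gates. -/
def record (ρ : ℕ → ℕ) (D : ℕ) : Prog → Prog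
  | .skip => .skip
  | .push r b => .push (ρ r) b
  | .pop r => .pop (ρ r)
  | .seq P Q => .seq (P.record ρ D) (Q.record ρ D)
  | .cases r E F T => .cases (ρ r) (E.record ρ D) (F.record ρ D) (T.record ρ D)
  | .loop r P => .loop (ρ r) (P.record ρ D)
  | .emit g => pushGate D (g.map ρ)

/-- The configuration `s'` simulates `s` and records its gates. -/
structure RecSim (ρ : ℕ → ℕ) (D B : ℕ) (base : ℕ → List Bool) (s s' : Config) : Prop where
  reg : ∀ r, s'.reg (ρ r) = s.reg r
  off : ∀ r, (∀ q, ρ q ≠ r) → r ≠ D → s'.reg r = base r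
  stack : s'.reg D = s.out.reverse.flatMap Gate.enc ++ base D
  out : s'.out = []
  len : ∀ r, (s.reg r).length ≤ B + s.time
  time : s'.time ≤ 15 * (B + s.time + 1) * s.time

theorem RecSim.tick {ρ : ℕ → ℕ} {D B : ℕ} {base : ℕ → List Bool} {s s' : Config}
    (h : RecSim ρ D B base s s') : RecSim ρ D B base s.tick s'.tick :=
  ⟨h.reg, h.off, h.stack, h.out, fun r => by have := h.len r; simp only [Config.tick]; omega, by
    have := h.time
    simp only [Config.tick]
    nlinarith⟩

theorem RecSim.update {ρ : ℕ → ℕ} (hρ : Function.Injective ρ) {D B : ℕ} (hD : ∀ r, ρ r ≠ D)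
    {base : ℕ → List Bool} {s s' : Config} (h : RecSim ρ D B base s s') (r : ℕ)
    (l : List Bool) (hl : l.length ≤ B + s.time) :
    RecSim ρ D B base { s with reg := Function.update s.reg r l }
      { s' with reg := Function.update s'.reg (ρ r) l } where
  reg q := by
    by_cases hq : q = r
    · subst hq; simp
    · simp [Function.update_of_ne hq, Function.update_of_ne (hρ.ne hq), h.reg]
  off q hq hq' := by simp [Function.update_of_ne (hq r).symm, h.off q hq hq']
  stack := by simp [Function.update_of_ne (hD r).symm, h.stack]
  out := h.out
  len q := by
    simp only [Function.update_apply]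
    split_ifs
    · exact hl
    · exact h.len q
  time := h.time

theorem Gate.labels_map {ι κ : Type} (f : ι → κ) (g : Gate ι) :
    (g.map f).labels = g.labels.map f := by
  rcases g with (_ | _ | _) | _ | _ <;> rfl

/-- Instead of one step for emitting a gate, the recording program takes at most `3 (B + time) + 12`
steps, since the labels are register lengths. The factor 15 in the quadratic time bound absorbs
this. -/
theorem RecSim.exec {ρ : ℕ → ℕ} (hρ : Function.Injective ρ) {D B : ℕ} (hD : ∀ r, ρ r ≠ D)
    {base : ℕ → List Bool} (P : Prog) : ∀ {s s' : Config}, RecSim ρ D B base s s' →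
      RecSim ρ D B base (P.exec s) ((P.record ρ D).exec s') := by
  induction P with
  | skip => intro s s' h; exact h.tick
  | push r b =>
    intro s s' h
    have := h.tick.update hρ hD r (b :: s.reg r) (by
      have := h.len r; simp only [Config.tick, List.length_cons]; omega)
    simp only [Prog.exec, Prog.record, Config.tick, h.reg] at this ⊢
    exact this
  | pop r =>
    intro s s' h
    have := h.tick.update hρ hD r (s.reg r).tail (by
      have := h.len r; simp only [Config.tick, List.length_tail]; omega)
    simp only [Prog.exec, Prog.record, Config.tick, h.reg] at this ⊢
    exact this
  | seq P Q hP hQ => intro s s' h; exact hQ (hP h)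
  | cases r E F T hE hF hT =>
    intro s s' h
    simp only [Prog.exec, Prog.record, h.reg]
    rcases s.reg r with _ | ⟨_ | _, _⟩
    · exact hE h.tick
    · exact hF h.tick
    · exact hT h.tick
  | loop r P hP =>
    intro s s' h
    simp only [Prog.exec, Prog.record, h.reg]
    generalize (s.reg r).length = m
    induction m with
    | zero => exact h.tick
    | succ m ih => rw [Function.iterate_succ_apply', Function.iterate_succ_apply']; exact hP ih
  | emit g =>
    intro s s' h
    obtain ⟨t, ht, e⟩ := (runs_pushGate s'.reg D (g.map ρ) (B + s.time)
      (fun r hr => by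
        rw [Gate.labels_map] at hr
        obtain ⟨q, _, rfl⟩ := List.mem_map.1 hr
        exact hD q)
      (fun r hr => by
        rw [Gate.labels_map] at hr
        obtain ⟨q, _, rfl⟩ := List.mem_map.1 hr
        rw [h.reg]; exact h.len q)).exec s'.out s'.time
    have e' : (record ρ D (.emit g)).exec s' = _ := e
    rw [e']
    refine ⟨fun r => ?_, fun r hr hr' => ?_, ?_, ?_, fun r => ?_, ?_⟩
    · exact (Function.update_of_ne (hD r) _ _).trans (h.reg r)
    · exact (Function.update_of_ne hr' _ _).trans (h.off r hr hr')
    · simp [Prog.exec, Config.tick, Gate.map_map, h.reg, h.stack]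
    · simp [h.out]
    · have := h.len r; simp only [Prog.exec, Config.tick]; omega
    · have := h.time
      simp only [Prog.exec, Config.tick]
      nlinarith

theorem Runs.record {P : Prog} {a b : ℕ → List Bool} {L : List (Gate ℕ)} {T B : ℕ}
    (h : Runs P a b L T) (hB : ∀ r, (a r).length ≤ B)
    {ρ : ℕ → ℕ} (hρ : Function.Injective ρ) {D : ℕ} (hD : ∀ r, ρ r ≠ D)
    {a' b' : ℕ → List Bool} (ha : ∀ r, a' (ρ r) = a r)
    (hb : ∀ r, b' (ρ r) = b r) (hab : ∀ r, (∀ q, ρ q ≠ r) → r ≠ D → b' r = a' r)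
    (hbD : b' D = L.reverse.flatMap Gate.enc ++ a' D) :
    Runs (P.record ρ D) a' b' [] (15 * (B + T + 1) * T) := by
  obtain ⟨t, ht, e⟩ := h
  have hs : RecSim ρ D B a' ⟨a, [], 0⟩ ⟨a', [], 0⟩ :=
    ⟨ha, fun _ _ _ => rfl, rfl, rfl, by simpa using hB, by simp⟩
  have h' := hs.exec hρ hD P
  rw [e] at h'
  have h1 : ((P.record ρ D).exec ⟨a', [], 0⟩).reg = b' := by
    funext r
    by_cases hr : ∃ q, ρ q = r
    · obtain ⟨q, rfl⟩ := hr
      rw [h'.reg, hb]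
    · push Not at hr
      by_cases hrD : r = D
      · subst hrD; rw [h'.stack, hbD]
      · rw [h'.off r hr hrD, hab r hr hrD]
  have h2 := h'.time
  have h3 := h'.out
  refine ⟨((P.record ρ D).exec ⟨a', [], 0⟩).time, h2.trans ?_, ?_⟩
  · simp only
    gcongr
  · generalize (P.record ρ D).exec ⟨a', [], 0⟩ = u at h1 h3
    subst h1
    cases u
    cases h3
    rfl

/-! #### Decoding -/

/-- Move a number from the stack `D` to the register `R`. -/
def readNum (D R : ℕ) : Prog :=
  .seq (.loop D (.cases D .skip .skip (.seq (.pop D) (.push R true)))) (.pop D)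

/-- The loop runs once for each bit of the whole stack, hence usually too often; as soon as the
separator `false` is on top, the body idles. This accounts for the truncations `x - i` and `min i x`
in the invariant. -/
theorem runs_readNum (a : ℕ → List Bool) {D R : ℕ} (hDR : D ≠ R) {x : ℕ} {l : List Bool}
    (ha : a D = List.replicate x true ++ false :: l) {B : ℕ} (hB : (a D).length ≤ B) :
    Runs (readNum D R) a
      (Function.update (Function.update a D l) R (List.replicate x true ++ a R)) []
      (3 * B + 2) := by
  have hx : x ≤ (a D).length := by rw [ha]; simp
  have h := Runs.loop (P := .cases D .skip .skip (.seq (.pop D) (.push R true))) (r := D)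
    (fun i => Function.update (Function.update a D (List.replicate (x - i) true ++ false :: l)) R
      (List.replicate (min i x) true ++ a R)) (fun _ => []) (T := 3) (m := (a D).length)
    (by simp [Function.update_of_ne hDR, ha]) (fun i _ => by
      rcases lt_or_ge i x with hi | hi
      · refine (Runs.cases_true (t := 2) (l := List.replicate (x - (i + 1)) true ++ false :: l) ?_
          (((runs_pop _ D).seq (runs_push _ R true)).congr rfl rfl le_rfl)).congr ?_ (by simp)
          le_rfl
        · rw [Function.update_of_ne hDR, Function.update_self,
            show x - i = (x - (i + 1)) + 1 by omega]
          rfl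
        · funext r
          simp only [Function.update_apply, hDR, if_false, if_true, hDR.symm,
            show x - i = (x - (i + 1)) + 1 by omega, List.replicate_succ, List.cons_append,
            List.tail_cons, show min i x = i by omega, show min (i + 1) x = i + 1 by omega]
          split_ifs <;> first | rfl | omega
      · refine (Runs.cases_false (l := l) ?_ (runs_skip _)).congr ?_ rfl (by omega)
        · rw [Function.update_of_ne hDR, Function.update_self, show x - i = 0 by omega]; rfl
        · rw [show x - i = 0 by omega, show x - (i + 1) = 0 by omega, show min i x = x by omega,
            show min (i + 1) x = x by omega])
  have h0 : Function.update (Function.update a D (List.replicate (x - 0) true ++ false :: l)) R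
      (List.replicate (min 0 x) true ++ a R) = a := by
    simp [← ha]
  simp only [h0] at h
  refine (h.seq (runs_pop _ D)).congr ?_ (by simp) (by omega)
  funext r
  simp only [Function.update_apply, hDR, if_false, if_true, show x - (a D).length = 0 by omega,
    show min (a D).length x = x by omega]
  split_ifs <;> first | rfl | omega | simp

/-- Emit the gate that is described by the registers `R`, …, `R + 3`. -/
def emitGate (R : ℕ) : Prog :=
  .cases R (.emit (.classical (.not (R + 1)))) .skip (.seq (.pop R)
    (.cases R (.emit (.classical (.cnot (R + 1) (R + 2)))) .skip (.seq (.pop R)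
      (.cases R (.emit (.classical (.ccnot (R + 1) (R + 2) (R + 3)))) .skip (.seq (.pop R)
        (.cases R (.emit (.had (R + 1))) .skip (.emit (.tgate (R + 1)))))))))

/-- The type is identified by popping at most three marks one after the other, so `t - 3` marks are
left over, to be cleared by the caller. -/
theorem runs_emitGate (a : ℕ → List Bool) {R t : ℕ} (h : a R = List.replicate t true) :
    Runs (emitGate R) a (Function.update a R (List.replicate (t - 3) true))
      [mkGate t (a (R + 1)).length (a (R + 2)).length (a (R + 3)).length] 8 := by
  have step : ∀ {a : ℕ → List Bool} {t : ℕ} {E T : Prog} {b : ℕ → List Bool} {L} {T' : ℕ},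
      a R = List.replicate (t + 1) true → Runs T (Function.update a R (List.replicate t true)) b L T' →
      Runs (.cases R E .skip (.seq (.pop R) T)) a b L (1 + (1 + T')) := by
    intro a t E T b L T' ha hT
    refine Runs.cases_true (l := List.replicate t true) (by rw [ha]; rfl) ?_
    exact (((runs_pop a R).congr (by rw [ha]; rfl) rfl le_rfl).seq hT).congr rfl (by simp) le_rfl
  have ne1 : R + 1 ≠ R := by omega
  have ne2 : R + 2 ≠ R := by omega
  have ne3 : R + 3 ≠ R := by omega
  rcases t with _ | _ | _ | _ | t
  · exact (Runs.cases_nil (by rw [h]; rfl) (runs_emit _ _)).congr (by simp [← h])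
      (by simp [Gate.map, CGate.map, mkGate]) (by omega)
  · exact (step (t := 0) h (Runs.cases_nil (by simp) (runs_emit _ _))).congr (by simp)
      (by simp [Gate.map, CGate.map, mkGate]) (by omega)
  · exact (step (t := 1) h (step (t := 0) (by simp) (Runs.cases_nil (by simp)
      (runs_emit _ _)))).congr (by simp) (by simp [Gate.map, CGate.map, mkGate]) (by omega)
  · exact (step (t := 2) h (step (t := 1) (by simp) (step (t := 0) (by simp) (Runs.cases_nil
      (by simp) (runs_emit _ _))))).congr (by simp) (by simp [Gate.map, mkGate]) (by omega)
  · exact (step (t := t + 3) h (step (t := t + 2) (by simp) (step (t := t + 1) (by simp)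
      (Runs.cases_true (l := List.replicate t true) (by simp; rfl)
      (runs_emit _ _))))).congr (by simp) (by simp [Gate.map, mkGate]) (by omega)

/-- Pop the code of a gate from the stack `D` and emit it, shifted by the length of register
`D - 1`. -/
def decodeOne (O : ℕ) : Prog :=
  .seq (readNum (O + 1) (O + 2)) (.seq (readNum (O + 1) (O + 3)) (.seq (readNum (O + 1) (O + 4))
    (.seq (readNum (O + 1) (O + 5)) (.seq (add O (O + 3)) (.seq (add O (O + 4))
      (.seq (add O (O + 5)) (.seq (emitGate (O + 2)) (clearFrom (O + 2) 4))))))))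

/-- The registers below `k` hold the numbers `e`, register `k` holds the number `o`, register
`k + 1` holds the stack `l`, and the next registers hold `t`, `x`, `y` and `z`. -/
def stackRegs (k : ℕ) (e : ℕ → ℕ) (o : ℕ) (l : List Bool) (t x y z : ℕ) : ℕ → List Bool := fun r =>
  if r < k then List.replicate (e r) true else if r = k then List.replicate o true
  else if r = k + 1 then l else if r = k + 2 then List.replicate t true
  else if r = k + 3 then List.replicate x true else if r = k + 4 then List.replicate y true
  else if r = k + 5 then List.replicate z true else []

theorem length_stackRegs_le (k : ℕ) (e : ℕ → ℕ) (o : ℕ) (l : List Bool) (t x y z B : ℕ)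
    (h : envSize k e + o ≤ B) (hl : l.length ≤ B) (ht : t ≤ B) (hx : x ≤ B) (hy : y ≤ B)
    (hz : z ≤ B) (r : ℕ) : (stackRegs k e o l t x y z r).length ≤ B := by
  unfold stackRegs
  split_ifs with h1
  · have := le_envSize e h1
    simp; omega
  all_goals first | exact hl | (simp only [List.length_replicate, List.length_nil]; omega)


section stackRegs

variable (k : ℕ) (e : ℕ → ℕ) (o : ℕ) (l : List Bool) (t x y z : ℕ)

theorem stackRegs_o : stackRegs k e o l t x y z k = List.replicate o true := by simp [stackRegs]

theorem stackRegs_l : stackRegs k e o l t x y z (k + 1) = l := by simp [stackRegs]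

theorem stackRegs_t : stackRegs k e o l t x y z (k + 2) = List.replicate t true := by simp [stackRegs]

theorem stackRegs_x : stackRegs k e o l t x y z (k + 3) = List.replicate x true := by simp [stackRegs]

theorem stackRegs_y : stackRegs k e o l t x y z (k + 4) = List.replicate y true := by simp [stackRegs]

theorem stackRegs_z : stackRegs k e o l t x y z (k + 5) = List.replicate z true := by simp [stackRegs]

theorem update_stackRegs_l (l' : List Bool) : Function.update (stackRegs k e o l t x y z) (k + 1) l' =
    stackRegs k e o l' t x y z := by
  funext r
  by_cases h : r = k + 1
  · subst h; simp [stackRegs]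
  · simp [Function.update_of_ne h, stackRegs, h]

theorem update_stackRegs_t (m : ℕ) : Function.update (stackRegs k e o l t x y z) (k + 2) (List.replicate m true) =
    stackRegs k e o l m x y z := by
  funext r
  by_cases h : r = k + 2
  · subst h; simp [stackRegs]
  · simp [Function.update_of_ne h, stackRegs, h]

theorem update_stackRegs_x (m : ℕ) : Function.update (stackRegs k e o l t x y z) (k + 3) (List.replicate m true) =
    stackRegs k e o l t m y z := by
  funext r
  by_cases h : r = k + 3
  · subst h; simp [stackRegs]
  · simp [Function.update_of_ne h, stackRegs, h]

theorem update_stackRegs_y (m : ℕ) : Function.update (stackRegs k e o l t x y z) (k + 4) (List.replicate m true) =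
    stackRegs k e o l t x m z := by
  funext r
  by_cases h : r = k + 4
  · subst h; simp [stackRegs]
  · simp [Function.update_of_ne h, stackRegs, h]

theorem update_stackRegs_z (m : ℕ) : Function.update (stackRegs k e o l t x y z) (k + 5) (List.replicate m true) =
    stackRegs k e o l t x y m := by
  funext r
  by_cases h : r = k + 5
  · subst h; simp [stackRegs]
  · simp [Function.update_of_ne h, stackRegs, h]

end stackRegs

-- The offset is added to all three wire registers, also to those that the gate does not have;
-- `mkGate` ignores these.
set_option maxHeartbeats 1000000 in
theorem runs_decodeOne (k : ℕ) (e : ℕ → ℕ) (o : ℕ) (g : Gate ℕ) (l : List Bool) {B : ℕ}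
    (h1 : envSize k e + o ≤ B) (h2 : (g.enc ++ l).length ≤ B) :
    Runs (decodeOne k) (stackRegs k e o (g.enc ++ l) 0 0 0 0) (stackRegs k e o l 0 0 0 0)
      [g.map (· + o)] (30 * B + 30) := by
  have hg := map_mkGate g.kind (g.labels.getD 0 0) (g.labels.getD 1 0) (g.labels.getD 2 0) o
  rw [g.mkGate_kind] at hg
  rw [hg]
  unfold Gate.enc encNums at h2 ⊢
  generalize g.kind = t at *
  generalize g.labels.getD 0 0 = x at *
  generalize g.labels.getD 1 0 = y at *
  generalize g.labels.getD 2 0 = z at *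
  simp only [List.append_assoc, List.cons_append, List.nil_append] at h2 ⊢
  simp only [List.length_append, List.length_cons, List.length_replicate] at h2
  have e3 : ∀ {P Q : Prog} {a b c : ℕ → List Bool} {L : List (Gate ℕ)} {T T' : ℕ},
      Runs P a b [] T → Runs Q b c L T' → Runs (.seq P Q) a c L (T + T') :=
    fun h h' => (h.seq h').congr rfl (by simp) le_rfl
  have r1 : Runs (readNum (k + 1) (k + 2)) _ (stackRegs k e o (List.replicate x true ++ false ::
      (List.replicate y true ++ false :: (List.replicate z true ++ false :: l))) t 0 0 0) [] _ :=
    (runs_readNum (stackRegs k e o (List.replicate t true ++ false :: (List.replicate x true ++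
      false :: (List.replicate y true ++ false :: (List.replicate z true ++ false :: l)))) 0 0 0 0)
      (x := t) (l := List.replicate x true ++ false ::
      (List.replicate y true ++ false :: (List.replicate z true ++ false :: l)))
      (by omega) (stackRegs_l _ _ _ _ _ _ _ _) (B := B) (by
        simp only [stackRegs_l, List.length_append, List.length_cons, List.length_replicate]
        omega)).congr (by
        simp only [update_stackRegs_l, update_stackRegs_t, update_stackRegs_x, update_stackRegs_y,
          update_stackRegs_z, stackRegs_t, stackRegs_x, stackRegs_y, stackRegs_z,
          List.replicate_zero, List.append_nil]) rfl le_rfl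
  have r2 : Runs (readNum (k + 1) (k + 3)) _ (stackRegs k e o
      (List.replicate y true ++ false :: (List.replicate z true ++ false :: l)) t x 0 0) [] _ :=
    (runs_readNum (stackRegs k e o (List.replicate x true ++
      false :: (List.replicate y true ++ false :: (List.replicate z true ++ false :: l))) t 0 0 0)
      (x := x) (l := List.replicate y true ++ false :: (List.replicate z true ++ false :: l))
      (by omega) (stackRegs_l _ _ _ _ _ _ _ _) (B := B) (by
        simp only [stackRegs_l, List.length_append, List.length_cons, List.length_replicate]
        omega)).congr (by
        simp only [update_stackRegs_l, update_stackRegs_t, update_stackRegs_x, update_stackRegs_y,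
          update_stackRegs_z, stackRegs_t, stackRegs_x, stackRegs_y, stackRegs_z,
          List.replicate_zero, List.append_nil]) rfl le_rfl
  have r3 : Runs (readNum (k + 1) (k + 4)) _ (stackRegs k e o
      (List.replicate z true ++ false :: l) t x y 0) [] _ :=
    (runs_readNum (stackRegs k e o (List.replicate y true ++ false ::
      (List.replicate z true ++ false :: l)) t x 0 0)
      (x := y) (l := List.replicate z true ++ false :: l)
      (by omega) (stackRegs_l _ _ _ _ _ _ _ _) (B := B) (by
        simp only [stackRegs_l, List.length_append, List.length_cons, List.length_replicate]
        omega)).congr (by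
        simp only [update_stackRegs_l, update_stackRegs_t, update_stackRegs_x, update_stackRegs_y,
          update_stackRegs_z, stackRegs_t, stackRegs_x, stackRegs_y, stackRegs_z,
          List.replicate_zero, List.append_nil]) rfl le_rfl
  have r4 : Runs (readNum (k + 1) (k + 5)) _ (stackRegs k e o l t x y z) [] _ :=
    (runs_readNum (stackRegs k e o (List.replicate z true ++ false :: l) t x y 0)
      (x := z) (l := l)
      (by omega) (stackRegs_l _ _ _ _ _ _ _ _) (B := B) (by
        simp only [stackRegs_l, List.length_append, List.length_cons, List.length_replicate]
        omega)).congr (by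
        simp only [update_stackRegs_l, update_stackRegs_t, update_stackRegs_x, update_stackRegs_y,
          update_stackRegs_z, stackRegs_t, stackRegs_x, stackRegs_y, stackRegs_z,
          List.replicate_zero, List.append_nil]) rfl le_rfl
  have r5 : Runs (add k (k + 3)) _ (stackRegs k e o l t (x + o) y z) [] (1 + B) :=
    (runs_add (stackRegs k e o l t x y z) _ _).congr (by
        simp only [stackRegs_o, stackRegs_x, stackRegs_y, stackRegs_z, List.length_replicate,
          List.replicate_append_replicate, update_stackRegs_x, update_stackRegs_y,
          update_stackRegs_z, Nat.add_comm o]) rfl (by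
        simp only [stackRegs_o, List.length_replicate]; omega)
  have r6 : Runs (add k (k + 4)) _ (stackRegs k e o l t (x + o) (y + o) z) [] (1 + B) :=
    (runs_add (stackRegs k e o l t (x + o) y z) _ _).congr (by
        simp only [stackRegs_o, stackRegs_x, stackRegs_y, stackRegs_z, List.length_replicate,
          List.replicate_append_replicate, update_stackRegs_x, update_stackRegs_y,
          update_stackRegs_z, Nat.add_comm o]) rfl (by
        simp only [stackRegs_o, List.length_replicate]; omega)
  have r7 : Runs (add k (k + 5)) _ (stackRegs k e o l t (x + o) (y + o) (z + o)) [] (1 + B) :=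
    (runs_add (stackRegs k e o l t (x + o) (y + o) z) _ _).congr (by
        simp only [stackRegs_o, stackRegs_x, stackRegs_y, stackRegs_z, List.length_replicate,
          List.replicate_append_replicate, update_stackRegs_x, update_stackRegs_y,
          update_stackRegs_z, Nat.add_comm o]) rfl (by
        simp only [stackRegs_o, List.length_replicate]; omega)
  have r8 : Runs (emitGate (k + 2)) _ (stackRegs k e o l (t - 3) (x + o) (y + o) (z + o))
      [mkGate t (x + o) (y + o) (z + o)] 8 :=
    (runs_emitGate (stackRegs k e o l t (x + o) (y + o) (z + o)) (t := t)
      (stackRegs_t _ _ _ _ _ _ _ _)).congr (update_stackRegs_t _ _ _ _ _ _ _ _ _) (by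
        rw [show k + 2 + 1 = k + 3 from rfl, show k + 2 + 2 = k + 4 from rfl,
          show k + 2 + 3 = k + 5 from rfl]
        simp only [stackRegs_x, stackRegs_y, stackRegs_z, List.length_replicate]) le_rfl
  have r9 := runs_clearFrom (stackRegs k e o l (t - 3) (x + o) (y + o) (z + o)) (k + 2) 4 (2 * B)
    (length_stackRegs_le _ _ _ _ _ _ _ _ _ (by omega) (by omega) (by omega) (by omega)
      (by omega) (by omega))
  refine (e3 r1 (e3 r2 (e3 r3 (e3 r4 (e3 r5 (e3 r6 (e3 r7 (r8.seq r9)))))))).congr ?_ (by simp)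
    (by omega)
  funext r
  simp only [stackRegs]
  split_ifs <;> first | rfl | omega

/-- Pop the codes of all gates from the stack in register `O + 1` and emit them, shifted by the
length of register `O`. -/
def decode (O : ℕ) : Prog :=
  .loop (O + 1) (.cases (O + 1) .skip (decodeOne O) (decodeOne O))

theorem flatMap_range_getElem? {α : Type} (l : List α) (m : ℕ) :
    ((List.range m).flatMap fun i => l[i]?.toList) = l.take m := by
  induction m with
  | zero => simp
  | succ m ih => rw [List.range_succ, List.flatMap_append, ih, List.take_add_one]; simp

/-- Gate codes are non-empty, so the length of the stack bounds the number of gates on it; the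
surplus iterations find an empty stack and do nothing. -/
theorem runs_decode (k : ℕ) (e : ℕ → ℕ) (o : ℕ) (L : List (Gate ℕ)) {B : ℕ}
    (h1 : envSize k e + o ≤ B) (h2 : (L.flatMap Gate.enc).length ≤ B) :
    Runs (decode k) (stackRegs k e o (L.flatMap Gate.enc) 0 0 0 0) (stackRegs k e o [] 0 0 0 0)
      (L.map (Gate.map (· + o))) (1 + B * (31 + 30 * B)) := by
  have hm : L.length ≤ (L.flatMap Gate.enc).length := by
    clear h2
    induction L with
    | nil => simp
    | cons g L ih =>
      have := g.length_enc_pos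
      rw [List.flatMap_cons, List.length_append, List.length_cons]; omega
  have h := Runs.loop (P := .cases (k + 1) .skip (decodeOne k) (decodeOne k)) (r := k + 1)
    (fun i => stackRegs k e o ((L.drop i).flatMap Gate.enc) 0 0 0 0)
    (fun i => (L[i]?.toList).map (Gate.map (· + o))) (T := 31 + 30 * B)
    (m := (L.flatMap Gate.enc).length) (by simp [stackRegs]) (fun i _ => by
      rcases lt_or_ge i L.length with hi | hi
      · have hd : (L.drop i).flatMap Gate.enc = L[i].enc ++ (L.drop (i + 1)).flatMap Gate.enc := by
          rw [List.drop_eq_getElem_cons hi, List.flatMap_cons]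
        have hlen : ((L.drop i).flatMap Gate.enc).length ≤ (L.flatMap Gate.enc).length := by
          conv_rhs => rw [← List.take_append_drop i L, List.flatMap_append, List.length_append]
          omega
        have := runs_decodeOne k e o L[i] ((L.drop (i + 1)).flatMap Gate.enc) (B := B) h1
          (by rw [← hd]; omega)
        rw [← hd] at this
        have hpos := L[i].length_enc_pos
        rcases hs : (L.drop i).flatMap Gate.enc with _ | ⟨b, s⟩
        · rw [hd] at hs
          simp only [List.append_eq_nil_iff] at hs
          rw [hs.1] at hpos
          simp at hpos
        · rw [hs] at this
          have hb : stackRegs k e o (b :: s) 0 0 0 0 (k + 1) = b :: s := by simp [stackRegs]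
          rcases b
          · exact (Runs.cases_false hb this).congr rfl (by simp [hi]) (by omega)
          · exact (Runs.cases_true hb this).congr rfl (by simp [hi]) (by omega)
      · refine (Runs.cases_nil ?_ (runs_skip _)).congr ?_ ?_ (by omega)
        · simp [stackRegs, List.drop_eq_nil_of_le hi]
        · rw [List.drop_eq_nil_of_le hi, List.drop_eq_nil_of_le (by omega)]
        · simp [List.getElem?_eq_none hi])
  refine h.congr ?_ ?_ ?_
  · rw [List.drop_eq_nil_of_le hm]; rfl
  · rw [← List.map_flatMap, flatMap_range_getElem?, List.take_of_length_le hm]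
  · gcongr

/-- The program without its output. -/
def mute : Prog → Prog
  | .skip => .skip
  | .push r b => .push r b
  | .pop r => .pop r
  | .seq P Q => .seq P.mute Q.mute
  | .cases r E F T => .cases r E.mute F.mute T.mute
  | .loop r P => .loop r P.mute
  | .emit _ => .skip

/-- `emit` and `skip` take one step each, so muting changes nothing but the output. It serves to
reuse the registers computed by a generator without its gates. -/
theorem exec_mute (P : Prog) : ∀ s : Config, P.mute.exec { s with out := [] } =
    { P.exec s with out := [] } := by
  induction P with
  | skip => intro s; rfl
  | push r b => intro s; rfl
  | pop r => intro s; rfl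
  | seq P Q hP hQ => intro s; rw [mute, Prog.exec, hP, hQ]; rfl
  | cases r E F T hE hF hT =>
    intro s
    simp only [mute, Prog.exec]
    rcases s.reg r with _ | ⟨_ | _, _⟩
    · exact hE s.tick
    · exact hF s.tick
    · exact hT s.tick
  | loop r P hP =>
    intro s
    simp only [mute, Prog.exec]
    generalize (s.reg r).length = m
    induction m with
    | zero => rfl
    | succ m ih => rw [Function.iterate_succ_apply', Function.iterate_succ_apply', ih, hP]
  | emit g => intro s; rfl

theorem Runs.mute {P : Prog} {a b : ℕ → List Bool} {L : List (Gate ℕ)} {T : ℕ}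
    (h : Runs P a b L T) : Runs P.mute a b [] T := by
  obtain ⟨t, ht, e⟩ := h
  have := exec_mute P ⟨a, [], 0⟩
  rw [e] at this
  exact ⟨t, ht, this⟩

end Prog

/-- Uncomputation needs reversed gate lists, and embedding a circuit needs shifted wires. Pushing
the codes of the gates on a stack and popping them reverses their order, and the offset is added
when they are emitted. -/
theorem GenGates.revShift {k : ℕ} {L : (ℕ → ℕ) → List (Gate ℕ)} {o : (ℕ → ℕ) → ℕ}
    (hL : GenGates k L) (ho : GenNum k o) :
    GenGates k fun e => ((L e).map (Gate.map (· + o e))).reverse := by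
  obtain ⟨b, hb⟩ := ho.exists_bound
  obtain ⟨P, p, hP⟩ := hL
  obtain ⟨Q, q, hQ⟩ := ho
  -- A bound for the length of the stack: initial contents of the registers plus the time taken by
  -- the recording.
  set c : Polynomial ℕ := (.X + b) + 15 * (.X + p + 1) * p with hc
  refine ⟨.seq Q (.seq (P.record (fun r => if r < k then r else r + 6) (k + 1))
    (.seq (decode k) (clear k))),
    q + (15 * (.X + p + 1) * p + ((1 + c * (31 + 30 * c)) + (1 + b))), fun e => ?_⟩
  have h0 : regs (k + 1) (Function.update e k (o e)) = stackRegs k e (o e) [] 0 0 0 0 := by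
    funext r
    simp only [regs, stackRegs, Function.update_apply]
    split_ifs <;> first | rfl | omega
  have h1 := hQ e
  rw [h0] at h1
  -- Six registers are kept free of the work space of `P`: the offset, the stack, and the four
  -- fields of a decoded gate.
  have hinj := skip_injective k 6
  have h2 : Runs (P.record (fun r => if r < k then r else r + 6) (k + 1))
      (stackRegs k e (o e) [] 0 0 0 0)
      (stackRegs k e (o e) ((L e).reverse.flatMap Gate.enc) 0 0 0 0) []
      (15 * (envSize k e + p.eval (envSize k e) + 1) * p.eval (envSize k e)) := by
    refine (hP e).record (length_regs_le k e) hinj (fun r => ?_) (fun r => ?_) (fun r => ?_)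
      (fun r hr hr' => ?_) ?_
    · split_ifs <;> omega
    · simp only [regs, stackRegs]
      split_ifs <;> first | rfl | omega
    · simp only [regs, stackRegs]
      split_ifs <;> first | rfl | omega
    · simp only [stackRegs]
      split_ifs <;> first | rfl | omega
    · simp [stackRegs]
  have hlen := h2.length_le (B := envSize k e + o e) (length_stackRegs_le _ _ _ _ _ _ _ _ _ le_rfl
    (by simp) (by simp) (by simp) (by simp) (by simp)) (k + 1)
  simp only [stackRegs, if_true, if_false, show ¬ k + 1 < k by omega,
    show ¬ k + 1 = k by omega] at hlen
  have hce : envSize k e + o e + 15 * (envSize k e + p.eval (envSize k e) + 1) *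
      p.eval (envSize k e) ≤ c.eval (envSize k e) := by
    have := hb e
    simp only [hc, Polynomial.eval_add, Polynomial.eval_mul, Polynomial.eval_X,
      Polynomial.eval_one, Polynomial.eval_ofNat]
    omega
  have h3 := runs_decode k e (o e) (L e).reverse (B := c.eval (envSize k e)) (by omega)
    (hlen.trans hce)
  refine (h1.seq (h2.seq (h3.seq (runs_clear _ k)))).congr ?_ ?_ ?_
  · funext r
    simp only [regs, stackRegs, Function.update_apply]
    split_ifs <;> first | rfl | omega
  · simp
  · have := hb e
    simp [stackRegs]
    omega

theorem GenGates.reverse {k : ℕ} {L : (ℕ → ℕ) → List (Gate ℕ)} (hL : GenGates k L) :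
    GenGates k fun e => (L e).reverse :=
  (hL.revShift (GenNum.const k 0)).congr fun e => by
    have : (Gate.map fun i : ℕ => i + 0) = id := funext fun g => Gate.map_id' g
    rw [this, List.map_id]

theorem GenGates.shift {k : ℕ} {L : (ℕ → ℕ) → List (Gate ℕ)} {o : (ℕ → ℕ) → ℕ}
    (hL : GenGates k L) (ho : GenNum k o) :
    GenGates k fun e => (L e).map (Gate.map (· + o e)) :=
  (hL.revShift ho).reverse.congr fun e => by simp

/-! #### Uniform families -/

theorem start_regs (n : ℕ) (e : ℕ → ℕ) (h : e 0 = n) :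
    (fun r => if r = 0 then List.replicate n true else []) = regs 1 e := by
  funext r
  simp only [regs, Nat.lt_one_iff]
  split_ifs with hr
  · rw [hr, h]
  · rfl

/-- Descriptions are read off registers `1` to `5`, which is exactly where five numbers end up if
they are computed one after the other as new variables next to `n` in register `0`. The gates are
then generated in the presence of these five. -/
theorem uniform_of_gen {kin qin kout qout : ℕ → ℕ} {C : ∀ n, Circ (kin n) (qin n) (kout n) (qout n)}
    (L : ℕ → List (Gate ℕ)) (w : ℕ → ℕ)
    (h1 : GenNum 1 fun e => kin (e 0)) (h2 : GenNum 1 fun e => qin (e 0))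
    (h3 : GenNum 1 fun e => kout (e 0)) (h4 : GenNum 1 fun e => qout (e 0))
    (h5 : GenNum 1 fun e => w (e 0)) (hL : GenGates 1 fun e => L (e 0))
    (hw : ∀ n, (C n).width = w n) (hC : ∀ n, (C n).gates.map (Gate.map Fin.val) = L n) :
    Uniform C := by
  obtain ⟨b1, hb1⟩ := h1.exists_bound
  obtain ⟨b2, hb2⟩ := h2.exists_bound
  obtain ⟨b3, hb3⟩ := h3.exists_bound
  obtain ⟨b4, hb4⟩ := h4.exists_bound
  obtain ⟨b5, hb5⟩ := h5.exists_bound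
  obtain ⟨P1, p1, r1⟩ := h1
  obtain ⟨P2, p2, r2⟩ := h2.weaken 1
  obtain ⟨P3, p3, r3⟩ := h3.weaken 2
  obtain ⟨P4, p4, r4⟩ := h4.weaken 3
  obtain ⟨P5, p5, r5⟩ := h5.weaken 4
  obtain ⟨P6, p6, r6⟩ := hL.weaken 5
  set b : Polynomial ℕ := .X + (b1 + (b2 + (b3 + (b4 + b5)))) with hb
  have key : ∀ n, Runs (.seq P1 (.seq P2 (.seq P3 (.seq P4 (.seq P5 P6)))))
      (fun r => if r = 0 then List.replicate n true else [])
      (regs 6 (Function.update (Function.update (Function.update (Function.update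
        (Function.update (fun _ => n) 1 (kin n)) 2 (qin n)) 3 (kout n)) 4 (qout n)) 5 (w n)))
      (L n) ((p1.comp b + (p2.comp b + (p3.comp b + (p4.comp b + (p5.comp b + p6.comp b))))).eval
        n) := by
    intro n
    set e1 : ℕ → ℕ := fun _ => n with he1
    set e2 := Function.update e1 1 (kin n) with he2
    set e3 := Function.update e2 2 (qin n) with he3
    set e4 := Function.update e3 3 (kout n) with he4
    set e5 := Function.update e4 4 (qout n) with he5
    set e6 := Function.update e5 5 (w n) with he6
    have z1 : envSize 1 e1 = n := by simp [envSize, he1]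
    have z2 : envSize 2 e2 = n + kin n := by rw [he2, envSize_succ_update, z1]
    have z3 : envSize 3 e3 = n + kin n + qin n := by rw [he3, envSize_succ_update, z2]
    have z4 : envSize 4 e4 = n + kin n + qin n + kout n := by rw [he4, envSize_succ_update, z3]
    have z5 : envSize 5 e5 = n + kin n + qin n + kout n + qout n := by
      rw [he5, envSize_succ_update, z4]
    have z6 : envSize 6 e6 = n + kin n + qin n + kout n + qout n + w n := by
      rw [he6, envSize_succ_update, z5]
    have c1 := hb1 e1
    have c2 := hb2 e1
    have c3 := hb3 e1
    have c4 := hb4 e1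
    have c5 := hb5 e1
    rw [z1] at c1 c2 c3 c4 c5
    simp only [he1] at c1 c2 c3 c4 c5
    have hbn : b.eval n = n + (b1.eval n + (b2.eval n + (b3.eval n + (b4.eval n + b5.eval n)))) := by
      simp [hb]
    have s1 := (r1 e1).mono (peval_mono p1 (show envSize 1 e1 ≤ b.eval n by omega))
    have s2 := (r2 e2).mono (peval_mono p2 (show envSize (1 + 1) e2 ≤ b.eval n by
      rw [show 1 + 1 = 2 from rfl]; omega))
    have s3 := (r3 e3).mono (peval_mono p3 (show envSize (1 + 2) e3 ≤ b.eval n by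
      rw [show 1 + 2 = 3 from rfl]; omega))
    have s4 := (r4 e4).mono (peval_mono p4 (show envSize (1 + 3) e4 ≤ b.eval n by
      rw [show 1 + 3 = 4 from rfl]; omega))
    have s5 := (r5 e5).mono (peval_mono p5 (show envSize (1 + 4) e5 ≤ b.eval n by
      rw [show 1 + 4 = 5 from rfl]; omega))
    have s6 := (r6 e6).mono (peval_mono p6 (show envSize (1 + 5) e6 ≤ b.eval n by
      rw [show 1 + 5 = 6 from rfl]; omega))
    rw [start_regs n e1 rfl]
    exact (s1.seq (s2.seq (s3.seq (s4.seq (s5.seq s6))))).congr rfl (by simp; rfl) (by simp)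
  refine ⟨.seq P1 (.seq P2 (.seq P3 (.seq P4 (.seq P5 P6)))),
    ⟨p1.comp b + (p2.comp b + (p3.comp b + (p4.comp b + (p5.comp b + p6.comp b)))), fun n => ?_⟩,
    fun n => ?_⟩
  · obtain ⟨t, ht, h⟩ := key n
    have hs : Prog.start _ n = _ := h
    simp only [hs]
    exact ht
  · obtain ⟨t, ht, h⟩ := key n
    have hs : Prog.start _ n = _ := h
    simp only [hs]
    simp [Config.desc, Circ.desc, regs, hw, hC]

/-- What a uniform family provides: its parameters and its gates can be generated. -/
theorem Uniform.gen {kin qin kout qout : ℕ → ℕ} {C : ∀ n, Circ (kin n) (qin n) (kout n) (qout n)}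
    (h : Uniform C) : GenGates 1 (fun e => (C (e 0)).gates.map (Gate.map Fin.val)) ∧
      GenNum 1 (fun e => kin (e 0)) ∧ GenNum 1 (fun e => qin (e 0)) ∧
      GenNum 1 (fun e => kout (e 0)) ∧ GenNum 1 (fun e => qout (e 0)) ∧
      GenNum 1 (fun e => (C (e 0)).width) := by
  obtain ⟨P, ⟨p, hp⟩, hP⟩ := h
  -- From register `B` on nothing is left behind by `P`. The minimum 6 covers the input register and
  -- the five numbers that are read off.
  set B := max P.bound 6 with hB
  have hbd : ∀ n r, B ≤ r → (P.start n).reg r = [] := by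
    intro n r hr
    refine (exec_reg_of_bound_le P _ r (by omega)).trans ?_
    exact if_neg (by omega)
  -- `P` destroys its input, so it is run with all registers moved up by one on a copy of `n`, and
  -- register `0` keeps the original.
  set S : ℕ → ℕ → List Bool := fun n r => if r = 0 then List.replicate n true else
    (P.start n).reg (r - 1) with hS
  have hrun : ∀ e : ℕ → ℕ, Runs (.seq (add 0 1) (P.map (· + 1))) (regs 1 e) (S (e 0))
      (P.start (e 0)).out ((1 + .X + p : Polynomial ℕ).eval (e 0)) := by
    intro e
    have h1 : Runs P (regs 1 e) (P.start (e 0)).reg (P.start (e 0)).out (p.eval (e 0)) :=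
      ⟨(P.start (e 0)).time, hp (e 0), by rw [← start_regs (e 0) e rfl]; rfl⟩
    have h2 : Runs (P.map (· + 1)) (Function.update (regs 1 e) 1 (List.replicate (e 0) true))
        (S (e 0)) (P.start (e 0)).out (p.eval (e 0)) := by
      refine h1.map (fun a b h => by simpa using h) (fun r => ?_) (fun r => ?_) (fun r hr => ?_)
      · simp only [regs, Function.update_apply]
        split_ifs with h1 h2 h3 h4 h5 <;> first | rfl | omega | skip
        rw [show r = 0 by omega]
      · simp [hS]
      · rcases r with _ | r
        · simp [hS, regs]
        · exact absurd rfl (hr r)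
    refine ((((runs_add _ 0 1).congr ?_ rfl le_rfl).seq h2)).congr rfl (by simp)
      (by simp [regs])
    simp [regs]
  have hmute : ∀ e : ℕ → ℕ, Runs (mute (.seq (add 0 1) (P.map (· + 1)))) (regs 1 e) (S (e 0))
      [] ((1 + .X + p : Polynomial ℕ).eval (e 0)) := fun e => (hrun e).mute
  have hlen : ∀ (e : ℕ → ℕ) (r : ℕ), (S (e 0) r).length ≤ (1 + .X + .X + p : Polynomial ℕ).eval
      (e 0) := by
    intro e r
    have := (hrun e).length_le (length_regs_le 1 e) r
    simp only [envSize, Finset.sum_range_one] at this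
    simp at this ⊢
    omega
  have hS0 : ∀ (e : ℕ → ℕ) (r : ℕ), B + 1 ≤ r → S (e 0) r = [] := by
    intro e r hr
    simp only [hS]
    rw [if_neg (by omega), hbd _ _ (by omega)]
  set c : Polynomial ℕ := 1 + .X + .X + p with hc
  have hnum : ∀ i, i < 6 → GenNum 1 fun e => ((P.start (e 0)).reg i).length := by
    intro i hi
    -- The wanted number is saved in the unused register `B + 1`, everything in between is cleared,
    -- and the number is moved to register `1`.
    refine ⟨.seq (mute (.seq (add 0 1) (P.map (· + 1)))) (.seq (add (i + 1) (B + 1))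
      (.seq (clearFrom 1 B) (.seq (add (B + 1) 1) (clear (B + 1))))),
      (1 + .X + p) + ((1 + c) + ((1 + B * (1 + c)) + ((1 + c) + (1 + c)))), fun e => ?_⟩
    have hsz : envSize 1 e = e 0 := by simp [envSize]
    rw [hsz]
    have hSi : S (e 0) (i + 1) = (P.start (e 0)).reg i := by simp [hS]
    have hle := hlen e (i + 1)
    rw [hSi] at hle
    have r2 := runs_add (S (e 0)) (i + 1) (B + 1)
    have r3 := runs_clearFrom (Function.update (S (e 0)) (B + 1) (List.replicate
      (S (e 0) (i + 1)).length true ++ S (e 0) (B + 1))) 1 B (c.eval (e 0)) (fun r => by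
        rw [Function.update_apply]
        split_ifs
        · rw [hS0 e _ le_rfl, hSi]; simpa using hle
        · exact hlen e r)
    have r4 := runs_add (fun r => if 1 ≤ r ∧ r < 1 + B then [] else Function.update (S (e 0))
      (B + 1) (List.replicate (S (e 0) (i + 1)).length true ++ S (e 0) (B + 1)) r) (B + 1) 1
    refine ((hmute e).seq (r2.seq (r3.seq (r4.seq (runs_clear _ (B + 1)))))).congr ?_ (by simp) ?_
    · funext r
      simp only [regs, Function.update_apply, hSi]
      rcases r with _ | _ | r
      · simp [hS]
      · simp [hS0 e (B + 1) le_rfl, show B ≠ 0 by omega, show 0 < B by omega,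
          show ¬ (B + 1 < 1 + B) by omega]
      · have := hS0 e (r + 1 + 1)
        split_ifs <;> first | rfl | omega | skip
        exact this (by omega)
    · have h1 : (S (e 0) (B + 1)).length = 0 := by rw [hS0 e _ le_rfl]; rfl
      simp [hSi, h1, show ¬ (B + 1 < 1 + B) by omega, show B ≠ 0 by omega] at hle ⊢
      omega
  refine ⟨?_, (hnum 1 (by omega)).congr fun e => congrArg Desc.kin (hP _),
    (hnum 2 (by omega)).congr fun e => congrArg Desc.qin (hP _),
    (hnum 3 (by omega)).congr fun e => congrArg Desc.kout (hP _),
    (hnum 4 (by omega)).congr fun e => congrArg Desc.qout (hP _),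
    (hnum 5 (by omega)).congr fun e => congrArg Desc.width (hP _)⟩
  refine ⟨.seq (.seq (add 0 1) (P.map (· + 1))) (clearFrom 1 B),
    (1 + .X + p) + (1 + B * (1 + c)), fun e => ?_⟩
  have hsz : envSize 1 e = e 0 := by simp [envSize]
  rw [hsz]
  refine ((hrun e).seq (runs_clearFrom _ 1 B _ (hlen e))).congr ?_ ?_ (by simp)
  · funext r
    rcases r with _ | r
    · simp [regs, hS]
    · have := hS0 e (r + 1)
      simp only [regs]
      split_ifs <;> first | rfl | omega | skip
      exact this (by omega)
  · rw [List.append_nil]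
    exact congrArg Desc.gates (hP (e 0))

theorem PolyBounded.of_gen {f : ℕ → ℕ} (h : GenNum 1 fun e => f (e 0)) : PolyBounded f := by
  obtain ⟨p, hp⟩ := h.exists_bound
  exact ⟨p, fun n => by simpa [envSize] using hp fun _ => n⟩

end QL

namespace QL

/-! ### Classical reversible computation on wires labelled by numbers -/

/-- The wires of a classical gate. -/
def CGate.labels {ι : Type} : CGate ι → List ι
  | .not t => [t]
  | .cnot c t => [c, t]
  | .ccnot a b t => [a, b, t]

theorem Gate.labels_classical {ι : Type} (g : CGate ι) :
    (Gate.classical g).labels = g.labels := by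
  rcases g with _ | _ | _ <;> rfl

theorem CGate.labels_map {ι κ : Type} (f : ι → κ) (g : CGate ι) :
    (g.map f).labels = g.labels.map f := by
  rcases g with _ | _ | _ <;> rfl

section apply

variable {ι : Type} [DecidableEq ι]

/-- Every gate is an involution, the degenerate ones because they act as the identity. Therefore the
reversed list computes the inverse. -/
theorem CGate.apply_apply (g : CGate ι) (z : ι → Bool) : g.apply (g.apply z) = z := by
  rcases g with t | ⟨c, t⟩ | ⟨a, b, t⟩
  · simp [CGate.apply]
  · by_cases h : c = t <;> simp [CGate.apply, h]
  · by_cases h : a = t ∨ b = t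
    · simp [CGate.apply, h]
    · push Not at h
      simp [CGate.apply, h]

theorem CGate.apply_of_notMem (g : CGate ι) (z : ι → Bool) {i : ι} (h : i ∉ g.labels) :
    g.apply z i = z i := by
  rcases g with t | ⟨c, t⟩ | ⟨a, b, t⟩ <;> simp only [CGate.labels, List.mem_cons,
    List.not_mem_nil, or_false, not_or] at h <;> simp only [CGate.apply]
  · rw [Function.update_of_ne h]
  · split_ifs
    · rfl
    · rw [Function.update_of_ne h.2]
  · split_ifs
    · rfl
    · rw [Function.update_of_ne h.2.2]

theorem CGate.apply_congr (g : CGate ι) {z z' : ι → Bool} {p : ι → Prop}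
    (hg : ∀ i ∈ g.labels, p i) (h : ∀ i, p i → z i = z' i) {i : ι} (hi : p i) :
    g.apply z i = g.apply z' i := by
  rcases g with t | ⟨c, t⟩ | ⟨a, b, t⟩ <;> simp only [CGate.labels, List.mem_cons,
    List.not_mem_nil, or_false, forall_eq_or_imp, forall_eq] at hg <;> simp only [CGate.apply]
  · simp only [Function.update_apply, h _ hg, h _ hi]
  · split_ifs
    · exact h _ hi
    · simp only [Function.update_apply, h _ hg.1, h _ hg.2, h _ hi]
  · split_ifs
    · exact h _ hi
    · simp only [Function.update_apply, h _ hg.1, h _ hg.2.1, h _ hg.2.2, h _ hi]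

/-- Apply a list of classical gates, the head first. -/
def cexec (L : List (CGate ι)) (z : ι → Bool) : ι → Bool := L.foldl (fun z g => g.apply z) z

@[simp] theorem cexec_nil (z : ι → Bool) : cexec [] z = z := rfl

@[simp] theorem cexec_cons (g : CGate ι) (L : List (CGate ι)) (z : ι → Bool) :
    cexec (g :: L) z = cexec L (g.apply z) := rfl

theorem cexec_append (L M : List (CGate ι)) (z : ι → Bool) :
    cexec (L ++ M) z = cexec M (cexec L z) := List.foldl_append

theorem cexec_reverse (L : List (CGate ι)) (z : ι → Bool) : cexec L.reverse (cexec L z) = z := by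
  induction L generalizing z with
  | nil => rfl
  | cons g L ih =>
    rw [List.reverse_cons, cexec_append, cexec_cons g L z, ih, cexec_cons, cexec_nil,
      g.apply_apply]

theorem cexec_reverse' (L : List (CGate ι)) (z : ι → Bool) : cexec L (cexec L.reverse z) = z := by
  simpa using cexec_reverse L.reverse z

theorem cexec_injective (L : List (CGate ι)) : Function.Injective (cexec L) :=
  Function.LeftInverse.injective (cexec_reverse L)

end apply

/-- All gates of the list act on wires that satisfy `p`. -/
def OnWires {ι : Type} (p : ι → Prop) (L : List (CGate ι)) : Prop := ∀ g ∈ L, ∀ i ∈ g.labels, p i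

section OnWires

variable {ι : Type} {p q : ι → Prop} {L M : List (CGate ι)}

theorem OnWires.mono (h : OnWires p L) (hpq : ∀ i, p i → q i) : OnWires q L :=
  fun g hg i hi => hpq i (h g hg i hi)

theorem OnWires.append (hL : OnWires p L) (hM : OnWires p M) : OnWires p (L ++ M) :=
  fun g hg => (List.mem_append.1 hg).elim (hL g) (hM g)

theorem OnWires.reverse (hL : OnWires p L) : OnWires p L.reverse :=
  fun g hg => hL g (List.mem_reverse.1 hg)

theorem OnWires.flatMap {m : ℕ} {L : ℕ → List (CGate ι)} (h : ∀ j < m, OnWires p (L j)) :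
    OnWires p ((List.range m).flatMap L) := by
  intro g hg
  obtain ⟨j, hj, hg⟩ := List.mem_flatMap.1 hg
  exact h j (List.mem_range.1 hj) g hg

theorem OnWires.not {t : ι} (h : p t) : OnWires p [.not t] := by
  simpa [OnWires, CGate.labels]

theorem OnWires.cnot {c t : ι} (hc : p c) (h : p t) : OnWires p [.cnot c t] := by
  simp [OnWires, CGate.labels, *]

theorem OnWires.ccnot {a b t : ι} (ha : p a) (hb : p b) (h : p t) : OnWires p [.ccnot a b t] := by
  simp [OnWires, CGate.labels, *]

theorem OnWires.map {κ : Type} {f : ι → κ} {r : κ → Prop} (h : OnWires p L)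
    (hf : ∀ i, p i → r (f i)) : OnWires r (L.map (CGate.map f)) := by
  intro g hg
  obtain ⟨g, hg', rfl⟩ := List.mem_map.1 hg
  intro i hi
  rw [CGate.labels_map] at hi
  obtain ⟨i', hi', rfl⟩ := List.mem_map.1 hi
  exact hf i' (h g hg' i' hi')

variable [DecidableEq ι]

theorem cexec_apply_of_onWires (hL : OnWires p L) (z : ι → Bool) {i : ι} (hi : ¬ p i) :
    cexec L z i = z i := by
  induction L generalizing z with
  | nil => rfl
  | cons g L ih =>
    rw [cexec_cons, ih (fun g' hg' => hL g' (List.mem_cons_of_mem _ hg')),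
      g.apply_of_notMem _ fun h => hi (hL g List.mem_cons_self i h)]

theorem cexec_congr (hL : OnWires p L) {z z' : ι → Bool} (h : ∀ i, p i → z i = z' i) {i : ι}
    (hi : p i) : cexec L z i = cexec L z' i := by
  induction L generalizing z z' with
  | nil => exact h i hi
  | cons g L ih =>
    exact ih (fun g' hg' => hL g' (List.mem_cons_of_mem _ hg'))
      fun i hi => g.apply_congr (hL g List.mem_cons_self) h hi

end OnWires

/-! #### Regions of wires -/

/-- Add `v` to the region of length `l` that starts at `o`. -/
def xorAt (z : ℕ → Bool) (o l : ℕ) (v : ℕ → Bool) : ℕ → Bool :=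
  fun i => if o ≤ i ∧ i < o + l then xor (z i) (v (i - o)) else z i

/-- Overwrite the region of length `l` that starts at `o` by `v`. -/
def setAt (z : ℕ → Bool) (o l : ℕ) (v : ℕ → Bool) : ℕ → Bool :=
  fun i => if o ≤ i ∧ i < o + l then v (i - o) else z i

theorem xorAt_of_not {z : ℕ → Bool} {o l : ℕ} {v : ℕ → Bool} {i : ℕ} (h : ¬ (o ≤ i ∧ i < o + l)) :
    xorAt z o l v i = z i := if_neg h

theorem setAt_of_not {z : ℕ → Bool} {o l : ℕ} {v : ℕ → Bool} {i : ℕ} (h : ¬ (o ≤ i ∧ i < o + l)) :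
    setAt z o l v i = z i := if_neg h

theorem xorAt_add {z : ℕ → Bool} {o l : ℕ} {v : ℕ → Bool} {i : ℕ} (h : i < l) :
    xorAt z o l v (o + i) = xor (z (o + i)) (v i) := by
  unfold xorAt; rw [if_pos (by omega), Nat.add_sub_cancel_left]

theorem setAt_add {z : ℕ → Bool} {o l : ℕ} {v : ℕ → Bool} {i : ℕ} (h : i < l) :
    setAt z o l v (o + i) = v i := by
  unfold setAt; rw [if_pos (by omega), Nat.add_sub_cancel_left]

theorem xorAt_congr {z : ℕ → Bool} {o l : ℕ} {v v' : ℕ → Bool} (h : ∀ i < l, v i = v' i) :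
    xorAt z o l v = xorAt z o l v' := by
  funext i
  unfold xorAt
  split_ifs with hi
  · rw [h _ (by omega)]
  · rfl

theorem xorAt_append (z : ℕ → Bool) (o a b : ℕ) (u v : ℕ → Bool) :
    xorAt (xorAt z o a u) (o + a) b v =
      xorAt z o (a + b) fun i => if i < a then u i else v (i - a) := by
  funext i
  unfold xorAt
  have e : i - (o + a) = i - o - a := (Nat.sub_sub i o a).symm
  simp only [e]
  split_ifs <;> first | rfl | omega

theorem xorAt_xorAt (z : ℕ → Bool) (o l : ℕ) (u v : ℕ → Bool) :
    xorAt (xorAt z o l u) o l v = xorAt z o l fun i => xor (u i) (v i) := by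
  funext i
  unfold xorAt
  split_ifs
  · exact Bool.xor_assoc _ _ _
  · rfl

theorem cexec_xorAt {L : List (CGate ℕ)} {o l : ℕ} (hL : OnWires (fun i => ¬ (o ≤ i ∧ i < o + l)) L)
    (z v : ℕ → Bool) : cexec L (xorAt z o l v) = xorAt (cexec L z) o l v := by
  funext i
  by_cases hi : o ≤ i ∧ i < o + l
  · rw [cexec_apply_of_onWires hL _ (not_not.2 hi)]
    unfold xorAt
    rw [if_pos hi, if_pos hi, cexec_apply_of_onWires hL _ (not_not.2 hi)]
  · rw [xorAt_of_not hi]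
    exact cexec_congr hL (fun i hi => xorAt_of_not hi) hi

/-- Compute, use the result, uncompute. -/
def conjG (L M : List (CGate ℕ)) : List (CGate ℕ) := L ++ (M ++ L.reverse)

/-- `L` does not touch the output region, so undoing `L` commutes with having added `v` there, and
all intermediate values vanish. Without this the work space would record which branch was taken and
destroy interference. -/
theorem cexec_conjG {L M : List (CGate ℕ)} {o l : ℕ} {z v : ℕ → Bool}
    (hL : OnWires (fun i => ¬ (o ≤ i ∧ i < o + l)) L)
    (hM : cexec M (cexec L z) = xorAt (cexec L z) o l v) :
    cexec (conjG L M) z = xorAt z o l v := by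
  rw [conjG, cexec_append, cexec_append, hM, cexec_xorAt hL.reverse, cexec_reverse]

theorem OnWires.conjG {p : ℕ → Prop} {L M : List (CGate ℕ)} (hL : OnWires p L) (hM : OnWires p M) :
    OnWires p (conjG L M) := hL.append (hM.append hL.reverse)

/-- The values added to the blocks do not depend on the output region (`hv`), and adding to that
region keeps the work space clean (`hP`). So each pass can be evaluated on the initial assignment,
and the blocks are filled independently. -/
theorem cexec_flatMap_xorAt (P : (ℕ → Bool) → Prop) (o l n : ℕ) (L : ℕ → List (CGate ℕ))
    (v : ℕ → (ℕ → Bool) → ℕ → Bool)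
    (hstep : ∀ j < n, ∀ z, P z → cexec (L j) z = xorAt z (o + j * l) l (v j z))
    (hP : ∀ z u, P z → P (xorAt z o (n * l) u))
    (hv : ∀ j < n, ∀ z u, P z → ∀ i < l, v j (xorAt z o (n * l) u) i = v j z i)
    {z : ℕ → Bool} (hz : P z) :
    cexec ((List.range n).flatMap L) z = xorAt z o (n * l) fun i => v (i / l) z (i % l) := by
  have key : ∀ m ≤ n, cexec ((List.range m).flatMap L) z =
      xorAt z o (m * l) fun i => v (i / l) z (i % l) := by
    intro m
    induction m with
    | zero =>
      intro _
      funext i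
      rw [xorAt_of_not (by omega)]; rfl
    | succ m ih =>
      intro hm
      have hml : m * l + l ≤ n * l := by
        rw [← Nat.succ_mul]; exact Nat.mul_le_mul_right l hm
      -- What has been written so far is seen as an addition to the whole output region, of a value
      -- that is zero beyond the first `m` blocks; this is the form that `hP` and `hv` handle.
      have hmask : xorAt z o (m * l) (fun i => v (i / l) z (i % l)) =
          xorAt z o (n * l) fun i => if i < m * l then v (i / l) z (i % l) else false := by
        funext i
        unfold xorAt
        by_cases h1 : o ≤ i ∧ i < o + m * l
        · rw [if_pos h1, if_pos (by omega)]
          simp only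
          rw [if_pos (by omega)]
        · rw [if_neg h1]
          split_ifs with h2
          · simp only
            rw [if_neg (by omega), Bool.xor_false]
          · rfl
      have e := hstep m (by omega) _ (hP z (fun i => if i < m * l then v (i / l) z (i % l) else
        false) hz)
      rw [← hmask, ← ih (by omega)] at e
      rw [List.range_succ, List.flatMap_append, cexec_append, List.flatMap_singleton, e,
        ih (by omega), xorAt_append, Nat.succ_mul]
      refine xorAt_congr fun i hi => ?_
      split_ifs with h
      · rfl
      · have hi' : i - m * l < l := by omega
        have hmod : i % l = i - m * l := by
          conv_lhs => rw [show i = (i - m * l) + m * l by omega]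
          rw [Nat.add_mul_mod_self_right, Nat.mod_eq_of_lt hi']
        have hdiv : i / l = m := by
          conv_lhs => rw [show i = (i - m * l) + m * l by omega]
          rw [Nat.add_mul_div_right _ _ (by omega), Nat.div_eq_of_lt hi', Nat.zero_add]
        rw [hmask, hv m (by omega) _ _ hz _ hi', hmod, hdiv]
  exact key n le_rfl

/-! #### Copies -/

/-- Add the region at `a` to the region at `b`. -/
def copyG (a b m : ℕ) : List (CGate ℕ) := (List.range m).flatMap fun i => [.cnot (a + i) (b + i)]

/-- Add the region at `a` to the region at `b` if the wire `c` is set. -/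
def ccopyG (c a b m : ℕ) : List (CGate ℕ) :=
  (List.range m).flatMap fun i => [.ccnot c (a + i) (b + i)]

/-- Negate the region at `b`. -/
def notG (b m : ℕ) : List (CGate ℕ) := (List.range m).flatMap fun i => [.not (b + i)]

/-- Add to the region at `d` the one at `q` if the wire `b` is set, and the one at `p` otherwise. -/
def selG (b p q d m : ℕ) : List (CGate ℕ) :=
  ccopyG b q d m ++ ([.not b] ++ (ccopyG b p d m ++ [.not b]))

/-- The regions do not meet. -/
def Disj (a l b m : ℕ) : Prop := a + l ≤ b ∨ b + m ≤ a ∨ l = 0 ∨ m = 0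

theorem cexec_flatMap_xorAt_one (b m : ℕ) (L : ℕ → List (CGate ℕ)) (v : ℕ → (ℕ → Bool) → Bool)
    (hstep : ∀ j < m, ∀ z, cexec (L j) z = xorAt z (b + j) 1 fun _ => v j z)
    (hv : ∀ j < m, ∀ z u, v j (xorAt z b m u) = v j z) (z : ℕ → Bool) :
    cexec ((List.range m).flatMap L) z = xorAt z b m fun i => v i z := by
  have := cexec_flatMap_xorAt (fun _ => True) b 1 m L (fun j z _ => v j z)
    (fun j hj z _ => by rw [Nat.mul_one]; exact hstep j hj z) (fun _ _ _ => trivial)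
    (fun j hj z u _ i _ => by rw [Nat.mul_one]; exact hv j hj z u) (z := z) trivial
  rw [Nat.mul_one] at this
  simpa using this

theorem cexec_copyG {a b m : ℕ} (h : Disj a m b m) (z : ℕ → Bool) :
    cexec (copyG a b m) z = xorAt z b m fun i => z (a + i) := by
  refine cexec_flatMap_xorAt_one b m _ (fun i z => z (a + i)) (fun j hj z => ?_)
    (fun j hj z u => xorAt_of_not (by unfold Disj at h; omega)) z
  have : a + j ≠ b + j := by unfold Disj at h; omega
  funext i
  simp only [cexec_cons, cexec_nil, CGate.apply, if_neg this, Function.update_apply, xorAt]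
  split_ifs with h1 h2 h2 <;> first | rfl | omega | rw [h1]

theorem cexec_ccopyG {c a b m : ℕ} (h : Disj a m b m) (hc : Disj c 1 b m) (z : ℕ → Bool) :
    cexec (ccopyG c a b m) z = xorAt z b m fun i => z c && z (a + i) := by
  refine cexec_flatMap_xorAt_one b m _ (fun i z => z c && z (a + i)) (fun j hj z => ?_)
    (fun j hj z u => ?_) z
  · have h1 : ¬ (c = b + j ∨ a + j = b + j) := by unfold Disj at h hc; omega
    funext i
    simp only [cexec_cons, cexec_nil, CGate.apply, if_neg h1, Function.update_apply, xorAt]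
    split_ifs with h1 h2 h2 <;> first | rfl | omega | rw [h1]
  · rw [xorAt_of_not (by unfold Disj at hc; omega), xorAt_of_not (by unfold Disj at h; omega)]

theorem cexec_notG (b m : ℕ) (z : ℕ → Bool) :
    cexec (notG b m) z = xorAt z b m fun _ => true := by
  refine cexec_flatMap_xorAt_one b m _ (fun i z => true) (fun j hj z => ?_) (fun _ _ _ _ => rfl) z
  funext i
  simp only [cexec_cons, cexec_nil, CGate.apply, Function.update_apply, xorAt]
  split_ifs with h1 h2 h2 <;> first | rfl | omega | (rw [h1]; simp)

theorem cexec_selG {b p q d m : ℕ} (hp : Disj p m d m) (hq : Disj q m d m) (hb : Disj b 1 d m)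
    (hbp : Disj b 1 p m) (z : ℕ → Bool) :
    cexec (selG b p q d m) z = xorAt z d m fun i => if z b then z (q + i) else z (p + i) := by
  rw [selG, cexec_append, cexec_append, cexec_append, cexec_ccopyG hq hb, cexec_ccopyG hp hb]
  funext i
  simp only [cexec_cons, cexec_nil, CGate.apply]
  by_cases hi : d ≤ i ∧ i < d + m
  · have hib : i ≠ b := by unfold Disj at hb; omega
    have hbd : ¬ (d ≤ b ∧ b < d + m) := by unfold Disj at hb; omega
    have hpb : p + (i - d) ≠ b := by unfold Disj at hbp; omega
    have hpd : ¬ (d ≤ p + (i - d) ∧ p + (i - d) < d + m) := by unfold Disj at hp; omega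
    simp only [Function.update_of_ne hib]
    simp only [xorAt, if_pos hi, if_neg hbd, Function.update_of_ne hib, Function.update_self,
      Function.update_of_ne hpb, if_neg hpd]
    cases z b <;> simp
  · rw [xorAt_of_not hi]
    by_cases hib : i = b
    · subst hib
      rw [Function.update_self, xorAt_of_not hi, Function.update_self, xorAt_of_not hi,
        Bool.not_not]
    · rw [Function.update_of_ne hib, xorAt_of_not hi, Function.update_of_ne hib, xorAt_of_not hi]

theorem OnWires.copyG {p : ℕ → Prop} {a b m : ℕ} (ha : ∀ i < m, p (a + i))
    (hb : ∀ i < m, p (b + i)) : OnWires p (copyG a b m) :=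
  OnWires.flatMap fun j hj => .cnot (ha j hj) (hb j hj)

theorem OnWires.ccopyG {p : ℕ → Prop} {c a b m : ℕ} (hc : p c) (ha : ∀ i < m, p (a + i))
    (hb : ∀ i < m, p (b + i)) : OnWires p (ccopyG c a b m) :=
  OnWires.flatMap fun j hj => .ccnot hc (ha j hj) (hb j hj)

theorem OnWires.notG {p : ℕ → Prop} {b m : ℕ} (hb : ∀ i < m, p (b + i)) : OnWires p (notG b m) :=
  OnWires.flatMap fun j hj => .not (hb j hj)

theorem OnWires.selG {p : ℕ → Prop} {b a q d m : ℕ} (hb : p b) (ha : ∀ i < m, p (a + i))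
    (hq : ∀ i < m, p (q + i)) (hd : ∀ i < m, p (d + i)) : OnWires p (selG b a q d m) :=
  (OnWires.ccopyG hb hq hd).append ((OnWires.not hb).append
    ((OnWires.ccopyG hb ha hd).append (.not hb)))

/-! #### Embedded circuits -/

/-- Extension of a bit string by zeros. -/
def ext {k : ℕ} (x : Bits k) : ℕ → Bool := fun i => if h : i < k then x ⟨i, h⟩ else false

/-- The bit string at position `o`. -/
def rd (z : ℕ → Bool) (o l : ℕ) : Bits l := fun i => z (o + i)

theorem ext_of_lt {k : ℕ} (x : Bits k) {i : ℕ} (h : i < k) : ext x i = x ⟨i, h⟩ := dif_pos h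

theorem ext_of_le {k : ℕ} (x : Bits k) {i : ℕ} (h : k ≤ i) : ext x i = false :=
  dif_neg (by omega)

theorem ext_val {k : ℕ} (x : Bits k) (i : Fin k) : ext x i = x i := ext_of_lt x i.2

theorem ext_rd_of_lt (z : ℕ → Bool) (o : ℕ) {l i : ℕ} (h : i < l) :
    ext (rd z o l) i = z (o + i) := ext_of_lt _ h

theorem rd_ext {k : ℕ} (x : Bits k) : rd (ext x) 0 k = x := by
  funext i
  simp [rd, ext_val]

theorem ext_injective {k : ℕ} : Function.Injective (ext (k := k)) := fun x y h => by
  rw [← rd_ext x, h, rd_ext]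

theorem ext_append {k l : ℕ} (x : Bits k) (y : Bits l) (i : ℕ) :
    ext (Fin.append x y) i = if i < k then ext x i else ext y (i - k) := by
  by_cases h : i < k + l
  · rw [ext_of_lt _ h]
    split_ifs with hk
    · rw [ext_of_lt _ hk]
      exact Fin.append_left x y ⟨i, hk⟩
    · rw [ext_of_lt _ (by omega : i - k < l)]
      have : (⟨i, h⟩ : Fin (k + l)) = Fin.natAdd k ⟨i - k, by omega⟩ := by
        ext; simp; omega
      rw [this, Fin.append_right]
  · rw [ext_of_le _ (by omega), if_neg (by omega), ext_of_le _ (by omega)]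

theorem ext_update {k : ℕ} (x : Bits k) (t : Fin k) (b : Bool) :
    ext (Function.update x t b) = Function.update (ext x) t b := by
  funext i
  by_cases h : i < k
  · rw [ext_of_lt _ h, Function.update_apply, Function.update_apply, ext_of_lt _ h]
    simp only [Fin.ext_iff]
  · rw [ext_of_le _ (by omega), Function.update_of_ne (by omega), ext_of_le _ (by omega)]

theorem ext_apply {k : ℕ} (g : CGate (Fin k)) (x : Bits k) :
    ext (g.apply x) = (g.map Fin.val).apply (ext x) := by
  rcases g with t | ⟨c, t⟩ | ⟨a, b, t⟩
  · simp [CGate.apply, CGate.map, ext_update, ext_val]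
  · simp only [CGate.apply, CGate.map, Fin.ext_iff]
    split_ifs
    · rfl
    · rw [ext_update, ext_val, ext_val]
  · simp only [CGate.apply, CGate.map, Fin.ext_iff]
    split_ifs
    · rfl
    · rw [ext_update, ext_val, ext_val, ext_val]

theorem ext_cexec {k : ℕ} (L : List (CGate (Fin k))) (x : Bits k) :
    ext (cexec L x) = cexec (L.map (CGate.map Fin.val)) (ext x) := by
  induction L generalizing x with
  | nil => rfl
  | cons g L ih => rw [cexec_cons, ih, ext_apply]; rfl

/-- Shift all wires. -/
def shiftG (o : ℕ) (L : List (CGate ℕ)) : List (CGate ℕ) := L.map (CGate.map (· + o))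

theorem apply_shift (o : ℕ) (g : CGate ℕ) (z : ℕ → Bool) (i : ℕ) :
    (g.map (· + o)).apply z (i + o) = g.apply (fun i => z (i + o)) i := by
  rcases g with t | ⟨c, t⟩ | ⟨a, b, t⟩
  · simp [CGate.apply, CGate.map, Function.update_apply]
  · simp only [CGate.apply, CGate.map, Nat.add_right_cancel_iff]
    split_ifs <;> simp [Function.update_apply]
  · simp only [CGate.apply, CGate.map, Nat.add_right_cancel_iff]
    split_ifs <;> simp [Function.update_apply]

theorem cexec_shiftG_add (o : ℕ) (L : List (CGate ℕ)) (z : ℕ → Bool) (i : ℕ) :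
    cexec (shiftG o L) z (i + o) = cexec L (fun i => z (i + o)) i := by
  induction L generalizing z with
  | nil => rfl
  | cons g L ih =>
    have : (fun i => (g.map (· + o)).apply z (i + o)) = g.apply fun i => z (i + o) :=
      funext fun i => apply_shift o g z i
    rw [cexec_cons, ← this, ← ih]; rfl

theorem OnWires.shiftG {p : ℕ → Prop} {o w : ℕ} {L : List (CGate ℕ)} (h : OnWires (· < w) L)
    (hp : ∀ i < w, p (o + i)) : OnWires p (shiftG o L) :=
  h.map fun i hi => by rw [Nat.add_comm]; exact hp i hi

namespace DetCirc

variable {k k' : ℕ} (C : DetCirc k k')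

/-- The gates of a classical circuit, on wires labelled by numbers. -/
def gatesN : List (CGate ℕ) := C.gates.map (CGate.map Fin.val)

theorem onWires_gatesN : OnWires (· < C.width) C.gatesN := by
  intro g hg
  obtain ⟨g, _, rfl⟩ := List.mem_map.1 hg
  intro i hi
  rw [CGate.labels_map] at hi
  obtain ⟨i, _, rfl⟩ := List.mem_map.1 hi
  exact i.2

/-- The values of all wires at the end of a computation. -/
def wires (x : Bits k) : ℕ → Bool := cexec C.gatesN (ext x)

theorem ext_eval (x : Bits k) {i : ℕ} (hi : i < k') : ext (C.eval x) i = C.wires x i := by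
  have hw := C.le_out
  have h : (ext fun i : Fin C.width => if hi : (i : ℕ) < k then x ⟨i, hi⟩ else false) = ext x := by
    funext i
    have hk := C.le_in
    by_cases h : i < C.width
    · rw [ext_of_lt _ h]; rfl
    · rw [ext_of_le _ (by omega), ext_of_le _ (by omega)]
  rw [ext_of_lt _ hi, wires, gatesN, ← h, ← ext_cexec, ext_of_lt _ (by omega : i < C.width)]
  simp [eval, slice, cexec]

theorem cexec_shiftG {o : ℕ} {z : ℕ → Bool} {x : Bits k}
    (hz : ∀ i < C.width, z (o + i) = ext x i) :
    cexec (shiftG o C.gatesN) z = setAt z o C.width (C.wires x) := by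
  funext i
  by_cases hi : o ≤ i ∧ i < o + C.width
  · unfold setAt
    rw [if_pos hi]
    obtain ⟨j, rfl⟩ := Nat.exists_eq_add_of_le' hi.1
    rw [cexec_shiftG_add, Nat.add_sub_cancel]
    exact cexec_congr C.onWires_gatesN (fun i hi => by rw [Nat.add_comm]; exact hz i hi) (by omega)
  · rw [setAt_of_not hi]
    exact cexec_apply_of_onWires (OnWires.shiftG C.onWires_gatesN (p := fun i =>
      o ≤ i ∧ i < o + C.width) fun i hi => by omega) _ hi

/-- Load an input and run the circuit. -/
theorem cexec_load {o : ℕ} {z : ℕ → Bool} {x : Bits k} {L : List (CGate ℕ)}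
    (hL : cexec L z = xorAt z o k (ext x)) (hz : ∀ i < C.width, z (o + i) = false) :
    cexec (L ++ shiftG o C.gatesN) z = setAt z o C.width (C.wires x) := by
  have hk := C.le_in
  rw [cexec_append, hL, C.cexec_shiftG (x := x)]
  · funext i
    unfold setAt xorAt
    split_ifs <;> first | rfl | omega
  · intro i hi
    by_cases hik : i < k
    · rw [xorAt_add hik, hz i hi, Bool.false_xor]
    · rw [xorAt_of_not (by omega), hz i hi, ext_of_le _ (by omega)]

end DetCirc

/-- Compute the conjunction of the region at `f` in the wire `c + m`. -/
def chainG (f c m : ℕ) : List (CGate ℕ) :=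
  [.not c] ++ (List.range m).flatMap fun i => [.ccnot (c + i) (f + i) (c + i + 1)]

theorem OnWires.chainG {p : ℕ → Prop} {f c m : ℕ} (hf : ∀ i < m, p (f + i))
    (hc : ∀ i ≤ m, p (c + i)) : OnWires p (chainG f c m) :=
  (OnWires.not (by simpa using hc 0 (by omega))).append
    (.flatMap fun j hj => .ccnot (hc j (by omega)) (hf j hj) (hc (j + 1) (by omega)))

-- Wire `c + i` receives the conjunction of the first `i` flags. The intermediate wires are not
-- cleaned up; the chain is used only where a measurement in the computational basis follows.
open Classical in
theorem cexec_chainG {f c m : ℕ} (h : Disj f m c (m + 1)) {z : ℕ → Bool}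
    (hz : ∀ i ≤ m, z (c + i) = false) :
    cexec (chainG f c m) z (c + m) = true ↔ ∀ i < m, z (f + i) = true := by
  have key : ∀ k ≤ m, cexec ((List.range k).flatMap fun i => [.ccnot (c + i) (f + i) (c + i + 1)])
      (Function.update z c true) = fun i => if c ≤ i ∧ i ≤ c + k then
        decide (∀ j < i - c, z (f + j) = true) else z i := by
    intro k
    induction k with
    | zero =>
      intro _
      funext i
      simp only [List.range_zero, List.flatMap_nil, cexec_nil, Function.update_apply]
      split_ifs with h1 h2 h2 <;> first | rfl | omega | skip
      subst h1; simp
    | succ k ih =>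
      intro hk
      rw [List.range_succ, List.flatMap_append, cexec_append, ih (by omega),
        List.flatMap_singleton, cexec_cons, cexec_nil]
      have h1 : ¬ (c + k = c + k + 1 ∨ f + k = c + k + 1) := by unfold Disj at h; omega
      have h2 : ¬ (c ≤ f + k ∧ f + k ≤ c + k) := by unfold Disj at h; omega
      simp only [CGate.apply, if_neg h1]
      funext i
      simp only [Function.update_apply, if_neg h2]
      by_cases hi : i = c + k + 1
      · subst hi
        rw [if_pos rfl, if_neg (by omega), if_pos (by omega), if_pos (by omega),
          show c + k + 1 = c + (k + 1) by omega, hz (k + 1) hk, Bool.false_xor,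
          Nat.add_sub_cancel_left, Nat.add_sub_cancel_left, Bool.eq_iff_iff]
        simp only [Bool.and_eq_true, decide_eq_true_eq, Nat.lt_succ_iff_lt_or_eq]
        constructor
        · rintro ⟨h3, h4⟩ j (hj | rfl)
          exacts [h3 j hj, h4]
        · intro h3
          exact ⟨fun j hj => h3 j (.inl hj), h3 k (.inr rfl)⟩
      · rw [if_neg hi]
        split_ifs <;> first | rfl | omega
  have h0 : cexec [.not c] z = Function.update z c true := by
    have := hz 0 (by omega)
    simp only [Nat.add_zero] at this
    simp [CGate.apply, this]
  rw [chainG, cexec_append, h0, key m le_rfl]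
  simp

/-- Exchange the regions at `a` and `b`. -/
def swapG (a b m : ℕ) : List (CGate ℕ) := copyG a b m ++ (copyG b a m ++ copyG a b m)

theorem OnWires.swapG {p : ℕ → Prop} {a b m : ℕ} (ha : ∀ i < m, p (a + i))
    (hb : ∀ i < m, p (b + i)) : OnWires p (swapG a b m) :=
  (OnWires.copyG ha hb).append ((OnWires.copyG hb ha).append (.copyG ha hb))

theorem cexec_swapG {a b m : ℕ} (h : Disj a m b m) (z : ℕ → Bool) {i : ℕ} (hi : i < m) :
    cexec (swapG a b m) z (a + i) = z (b + i) := by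
  have h' : Disj b m a m := by unfold Disj at *; omega
  rw [swapG, cexec_append, cexec_append, cexec_copyG h, cexec_copyG h', cexec_copyG h,
    xorAt_of_not (by unfold Disj at h; omega), xorAt_add hi, xorAt_add hi,
    xorAt_of_not (by unfold Disj at h; omega)]
  cases z (a + i) <;> cases z (b + i) <;> rfl

/-! #### Generation of classical gates -/

/-- A list of classical gates that is generated in polynomial time. -/
def GenC (k : ℕ) (L : (ℕ → ℕ) → List (CGate ℕ)) : Prop :=
  GenGates k fun e => (L e).map Gate.classical

namespace GenC

variable {k : ℕ} {L M : (ℕ → ℕ) → List (CGate ℕ)}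

theorem append (hL : GenC k L) (hM : GenC k M) : GenC k fun e => L e ++ M e :=
  (GenGates.append hL hM).congr fun e => by simp

theorem reverse (hL : GenC k L) : GenC k fun e => (L e).reverse :=
  (GenGates.reverse hL).congr fun e => by simp

theorem conjG (hL : GenC k L) (hM : GenC k M) : GenC k fun e => conjG (L e) (M e) :=
  hL.append (hM.append hL.reverse)

theorem shiftG (hL : GenC k L) {o : (ℕ → ℕ) → ℕ} (ho : GenNum k o) :
    GenC k fun e => shiftG (o e) (L e) :=
  (GenGates.shift hL ho).congr fun e => by simp [QL.shiftG, Gate.map]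

theorem flatMap {m : (ℕ → ℕ) → ℕ} (hm : GenNum k m) {L : (ℕ → ℕ) → ℕ → List (CGate ℕ)}
    (hL : GenC (k + 1) fun e => L e (e k))
    (hL' : ∀ e x j, L (Function.update e k x) j = L e j) :
    GenC k fun e => (List.range (m e)).flatMap (L e) :=
  (GenGates.flatMap hm hL).congr fun e => by
    simp [List.map_flatMap, hL']

theorem not {f : (ℕ → ℕ) → ℕ} (hf : GenNum k f) : GenC k fun e => [.not (f e)] :=
  GenGates.not hf

theorem cnot {f g : (ℕ → ℕ) → ℕ} (hf : GenNum k f) (hg : GenNum k g) :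
    GenC k fun e => [.cnot (f e) (g e)] := GenGates.cnot hf hg

theorem ccnot {f g h : (ℕ → ℕ) → ℕ} (hf : GenNum k f) (hg : GenNum k g) (hh : GenNum k h) :
    GenC k fun e => [.ccnot (f e) (g e) (h e)] := GenGates.ccnot hf hg hh

theorem weaken (h : GenC k L) (m : ℕ) : GenC (k + m) L := GenGates.weaken h m

variable {a b c d m : (ℕ → ℕ) → ℕ}

theorem copyG (ha : GenNum k a) (hb : GenNum k b) (hm : GenNum k m) :
    GenC k fun e => copyG (a e) (b e) (m e) :=
  flatMap hm (.cnot ((ha.weaken 1).add (.var (by omega))) ((hb.weaken 1).add (.var (by omega))))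
    fun e x j => by rw [ha.apply_update le_rfl, hb.apply_update le_rfl]

theorem ccopyG (hc : GenNum k c) (ha : GenNum k a) (hb : GenNum k b) (hm : GenNum k m) :
    GenC k fun e => ccopyG (c e) (a e) (b e) (m e) :=
  flatMap hm (.ccnot (hc.weaken 1) ((ha.weaken 1).add (.var (by omega)))
    ((hb.weaken 1).add (.var (by omega))))
    fun e x j => by rw [hc.apply_update le_rfl, ha.apply_update le_rfl, hb.apply_update le_rfl]

theorem notG (hb : GenNum k b) (hm : GenNum k m) : GenC k fun e => notG (b e) (m e) :=
  flatMap hm (.not ((hb.weaken 1).add (.var (by omega))))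
    fun e x j => by rw [hb.apply_update le_rfl]

theorem selG (hc : GenNum k c) (ha : GenNum k a) (hb : GenNum k b) (hd : GenNum k d)
    (hm : GenNum k m) : GenC k fun e => selG (c e) (a e) (b e) (d e) (m e) :=
  (ccopyG hc hb hd hm).append ((not hc).append ((ccopyG hc ha hd hm).append (not hc)))

theorem chainG (ha : GenNum k a) (hb : GenNum k b) (hm : GenNum k m) :
    GenC k fun e => chainG (a e) (b e) (m e) :=
  (not hb).append (flatMap hm (.ccnot ((hb.weaken 1).add (.var (by omega)))
    ((ha.weaken 1).add (.var (by omega))) (((hb.weaken 1).add (.var (by omega))).add (.const _ 1)))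
    fun e x j => by rw [ha.apply_update le_rfl, hb.apply_update le_rfl])

theorem swapG (ha : GenNum k a) (hb : GenNum k b) (hm : GenNum k m) :
    GenC k fun e => swapG (a e) (b e) (m e) :=
  (copyG ha hb hm).append ((copyG hb ha hm).append (copyG ha hb hm))

end GenC

end QL

namespace QL

open Matrix

/-! ### Pure states -/

section gates

variable {ι : Type} [DecidableEq ι]

/-- The action of a gate on amplitudes. -/
noncomputable def Gate.act (g : Gate ι) (v : (ι → Bool) → ℂ) : (ι → Bool) → ℂ :=
  match g with
  | .classical g => fun y => v (g.apply y)
  | .had t => fun y => (v (Function.update y t false) +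
      (if y t then -1 else 1) * v (Function.update y t true)) / (Real.sqrt 2 : ℂ)
  | .tgate t => fun y => (if y t then Complex.exp (Complex.I * (Real.pi : ℂ) / 4) else 1) * v y

theorem Gate.matrix_mulVec [Fintype ι] (g : Gate ι) (v : (ι → Bool) → ℂ) :
    g.matrix *ᵥ v = g.act v := by
  funext y
  rcases g with g | t | t
  · simp only [Gate.matrix, Gate.act, mulVec, dotProduct, Matrix.of_apply]
    rw [Finset.sum_eq_single (g.apply y)]
    · rw [g.apply_apply, if_pos rfl, one_mul]
    · intro z _ hz
      rw [if_neg, zero_mul]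
      rintro rfl
      exact hz (g.apply_apply z).symm
    · simp
  · simp only [Gate.matrix, Gate.act, mulVec, dotProduct, Matrix.of_apply]
    have hne : Function.update y t false ≠ Function.update y t true := fun h => by
      simpa using congrFun h t
    rw [← Finset.sum_subset (Finset.subset_univ {Function.update y t false, Function.update y t true}),
      Finset.sum_pair hne]
    · have h0 : ∀ b, ∀ i, i ≠ t → y i = Function.update y t b i := fun b i hi => by
        rw [Function.update_of_ne hi]
      rw [if_pos (h0 false), if_pos (h0 true)]
      simp only [Function.update_self, Bool.and_false, Bool.and_true, Bool.false_eq_true, if_false]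
      ring
    · intro z _ hz
      rw [if_neg, zero_mul]
      intro h
      apply hz
      rw [Finset.mem_insert, Finset.mem_singleton]
      have : z = Function.update y t (z t) := by
        funext i
        by_cases hi : i = t
        · subst hi; simp
        · rw [Function.update_of_ne hi, h i hi]
      cases hb : z t <;> rw [hb] at this
      · exact .inl this
      · exact .inr this
  · simp [Gate.matrix, Gate.act, mulVec_diagonal]

/-- Unitarity, gate by gate: permutations reindex the sum, phases have modulus one, and for the
Hadamard gate the basis states are paired by flipping the bit, where the parallelogram law applies.
-/
theorem Gate.norm_act [Fintype ι] (g : Gate ι) (v : (ι → Bool) → ℂ) :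
    ∑ y, ‖g.act v y‖ ^ 2 = ∑ y, ‖v y‖ ^ 2 := by
  rcases g with g | t | t
  · exact Equiv.sum_comp (⟨g.apply, g.apply, g.apply_apply, g.apply_apply⟩ : (ι → Bool) ≃ (ι → Bool))
      fun y => ‖v y‖ ^ 2
  · have hinv : Function.Involutive fun y : ι → Bool => Function.update y t (!(y t)) := fun y => by
      simp
    have h1 : ∀ F : (ι → Bool) → ℝ, ∑ y, F y = ∑ y, (F y + F (Function.update y t (!(y t)))) / 2 := by
      intro F
      have := Equiv.sum_comp hinv.toPerm F
      simp only [Function.Involutive.coe_toPerm] at this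
      rw [← Finset.sum_div, Finset.sum_add_distrib, this]; ring
    rw [h1, h1 fun y => ‖v y‖ ^ 2]
    refine Finset.sum_congr rfl fun y _ => ?_
    have key : ∀ a b : ℂ, ‖(a + b) / (Real.sqrt 2 : ℂ)‖ ^ 2 + ‖(a - b) / (Real.sqrt 2 : ℂ)‖ ^ 2 =
        ‖a‖ ^ 2 + ‖b‖ ^ 2 := by
      intro a b
      have h2 : ‖(Real.sqrt 2 : ℂ)‖ ^ 2 = 2 := by
        rw [Complex.norm_real, Real.norm_eq_abs, sq_abs, Real.sq_sqrt (by norm_num)]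
      have hp := parallelogram_law_with_norm ℝ a b
      rw [norm_div, norm_div, div_pow, div_pow, h2]
      nlinarith
    cases hy : y t
    · have e : Function.update y t false = y := by rw [← hy, Function.update_eq_self]
      have := key (v y) (v (Function.update y t true))
      simp only [Gate.act, hy, Bool.not_false, Function.update_idem, Function.update_self, e,
        Bool.false_eq_true, if_false, if_true, one_mul, neg_one_mul, ← sub_eq_add_neg]
      rw [this]
    · have e : Function.update y t true = y := by rw [← hy, Function.update_eq_self]
      have := key (v (Function.update y t false)) (v y)
      simp only [Gate.act, hy, Bool.not_true, Function.update_idem, Function.update_self, e,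
        Bool.false_eq_true, if_false, if_true, one_mul, neg_one_mul, ← sub_eq_add_neg]
      rw [add_comm, this, add_comm]
  · refine Finset.sum_congr rfl fun y _ => ?_
    simp only [Gate.act]
    rw [norm_mul]
    split_ifs
    · rw [Complex.norm_exp]
      simp
    · simp

theorem CGate.apply_map_comp {κ : Type} [DecidableEq κ] {f : ι → κ} (hf : Function.Injective f)
    (g : CGate ι) (z : κ → Bool) : (g.map f).apply z ∘ f = g.apply (z ∘ f) := by
  rcases g with t | ⟨c, t⟩ | ⟨a, b, t⟩
  · simp [CGate.apply, CGate.map, Function.update_comp_eq_of_injective _ hf]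
  · simp only [CGate.apply, CGate.map, hf.eq_iff]
    split_ifs
    · rfl
    · simp [Function.update_comp_eq_of_injective _ hf]
  · simp only [CGate.apply, CGate.map, hf.eq_iff]
    split_ifs
    · rfl
    · simp [Function.update_comp_eq_of_injective _ hf]

/-- The hypothesis `hc` says that `c` depends only on the wires outside the range of `f`. The gate
then acts on the first factor of a product, with `c` as a spectator. -/
theorem Gate.act_map {κ : Type} [DecidableEq κ] {f : ι → κ} (hf : Function.Injective f)
    (g : Gate ι) (u : (ι → Bool) → ℂ) {c : (κ → Bool) → ℂ}
    (hc : ∀ z z' : κ → Bool, (∀ i, (∀ j, f j ≠ i) → z i = z' i) → c z = c z') :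
    (g.map f).act (fun z => u (z ∘ f) * c z) = fun z => g.act u (z ∘ f) * c z := by
  have hup : ∀ (z : κ → Bool) (t : ι) (b : Bool), c (Function.update z (f t) b) = c z :=
    fun z t b => hc _ _ fun i hi => Function.update_of_ne (hi t).symm _ _
  funext z
  rcases g with g | t | t
  · simp only [Gate.act, Gate.map]
    rw [CGate.apply_map_comp hf]
    congr 1
    refine hc _ _ fun i hi => CGate.apply_of_notMem _ _ fun h => ?_
    rw [CGate.labels_map] at h
    obtain ⟨j, _, hj⟩ := List.mem_map.1 h
    exact hi j hj
  · simp only [Gate.act, Gate.map, hup, Function.update_comp_eq_of_injective _ hf,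
      Function.comp_apply]
    ring
  · simp only [Gate.act, Gate.map, Function.comp_apply]
    ring

end gates

/-- The action of a list of gates on amplitudes. -/
noncomputable def evolve {w : ℕ} (L : List (Gate (Fin w))) (v : Bits w → ℂ) : Bits w → ℂ :=
  gatesMatrix L *ᵥ v

theorem foldl_matrix {w : ℕ} (L : List (Gate (Fin w))) (U : Matrix (Bits w) (Bits w) ℂ) :
    L.foldl (fun U g => g.matrix * U) U = gatesMatrix L * U := by
  unfold gatesMatrix
  induction L generalizing U with
  | nil => simp
  | cons g L ih => rw [List.foldl_cons, List.foldl_cons, ih, ih (g.matrix * 1)]; simp [mul_assoc]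

@[simp] theorem evolve_nil {w : ℕ} (v : Bits w → ℂ) : evolve [] v = v := by
  simp [evolve, gatesMatrix]

theorem evolve_cons {w : ℕ} (g : Gate (Fin w)) (L : List (Gate (Fin w))) (v : Bits w → ℂ) :
    evolve (g :: L) v = evolve L (g.act v) := by
  have : gatesMatrix (g :: L) = gatesMatrix L * g.matrix := by
    rw [gatesMatrix, List.foldl_cons, foldl_matrix, mul_one]
  rw [evolve, this, ← mulVec_mulVec, g.matrix_mulVec]; rfl

theorem evolve_append {w : ℕ} (L M : List (Gate (Fin w))) (v : Bits w → ℂ) :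
    evolve (L ++ M) v = evolve M (evolve L v) := by
  induction L generalizing v with
  | nil => simp
  | cons g L ih => rw [List.cons_append, evolve_cons, ih, evolve_cons]

theorem norm_evolve {w : ℕ} (L : List (Gate (Fin w))) (v : Bits w → ℂ) :
    ∑ y, ‖evolve L v y‖ ^ 2 = ∑ y, ‖v y‖ ^ 2 := by
  induction L generalizing v with
  | nil => simp
  | cons g L ih => rw [evolve_cons, ih, g.norm_act]

theorem evolve_map {w w' : ℕ} {f : Fin w → Fin w'} (hf : Function.Injective f)
    (L : List (Gate (Fin w))) (u : Bits w → ℂ) {c : Bits w' → ℂ}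
    (hc : ∀ z z' : Bits w', (∀ i, (∀ j, f j ≠ i) → z i = z' i) → c z = c z') :
    evolve (L.map (Gate.map f)) (fun z => u (z ∘ f) * c z) =
      fun z => evolve L u (z ∘ f) * c z := by
  induction L generalizing u with
  | nil => simp
  | cons g L ih => rw [List.map_cons, evolve_cons, g.act_map hf u hc, ih, evolve_cons]

theorem evolve_classical {w : ℕ} (L : List (CGate (Fin w))) (v : Bits w → ℂ) (y : Bits w) :
    evolve (L.map Gate.classical) v y = v (cexec L.reverse y) := by
  induction L generalizing v with
  | nil => simp
  | cons g L ih => rw [List.map_cons, evolve_cons, ih, List.reverse_cons, cexec_append]; rfl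

/-! #### Gates on wires labelled by numbers -/

/-- Restriction of a bit assignment to `w` wires. -/
def res (w : ℕ) (u : ℕ → Bool) : Bits w := fun i => u i

theorem res_ext {w : ℕ} (y : Bits w) : res w (ext y) = y := funext fun i => ext_val y i

theorem ext_res_of_lt {w : ℕ} (u : ℕ → Bool) {i : ℕ} (h : i < w) : ext (res w u) i = u i :=
  ext_of_lt _ h

theorem ext_res {w : ℕ} {u : ℕ → Bool} (h : ∀ i, w ≤ i → u i = false) : ext (res w u) = u := by
  funext i
  by_cases hi : i < w
  · exact ext_res_of_lt u hi
  · rw [ext_of_le _ (by omega), h i (by omega)]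

variable {w : ℕ} [NeZero w]

/-- The gates as gates of a circuit on `w` wires. -/
def toFin (w : ℕ) [NeZero w] (L : List (Gate ℕ)) : List (Gate (Fin w)) :=
  L.map (Gate.map (Fin.ofNat w))

theorem toFin_append (L M : List (Gate ℕ)) : toFin w (L ++ M) = toFin w L ++ toFin w M :=
  List.map_append

theorem Gate.map_congr {ι κ : Type} {f h : ι → κ} (g : Gate ι) (H : ∀ i ∈ g.labels, f i = h i) :
    g.map f = g.map h := by
  rcases g with (_ | _ | _) | _ | _ <;> simp_all [Gate.labels, Gate.map, CGate.map]

theorem map_val_toFin {L : List (Gate ℕ)} (h : ∀ g ∈ L, ∀ i ∈ g.labels, i < w) :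
    (toFin w L).map (Gate.map Fin.val) = L := by
  rw [toFin, List.map_map]
  conv_rhs => rw [← List.map_id L]
  refine List.map_congr_left fun g hg => ?_
  rw [Function.comp_apply, Gate.map_map, id]
  conv_rhs => rw [← g.map_id']
  exact Gate.map_congr g fun i hi => Nat.mod_eq_of_lt (h g hg i hi)

theorem cexec_map_ofNat {L : List (CGate ℕ)} (h : OnWires (· < w) L) (y : Bits w) :
    cexec (L.map (CGate.map (Fin.ofNat w))) y = res w (cexec L (ext y)) := by
  have e : (L.map (CGate.map (Fin.ofNat w))).map (CGate.map Fin.val) = L := by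
    rw [List.map_map]
    conv_rhs => rw [← List.map_id L]
    refine List.map_congr_left fun g hg => ?_
    have := h g hg
    rcases g with t | ⟨c, t⟩ | ⟨a, b, t⟩ <;> simp only [CGate.labels, List.mem_cons,
      List.not_mem_nil, or_false, forall_eq_or_imp, forall_eq] at this <;>
      simp [CGate.map, Nat.mod_eq_of_lt, this]
  rw [← res_ext (cexec _ y), ext_cexec, e]

/-- The permutation of the basis states by classical gates. -/
def cperm (w : ℕ) (L : List (CGate ℕ)) (y : Bits w) : Bits w := res w (cexec L (ext y))

theorem ext_cperm {L : List (CGate ℕ)} (h : OnWires (· < w) L) (y : Bits w) :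
    ext (cperm w L y) = cexec L (ext y) :=
  ext_res fun i hi => by
    rw [cexec_apply_of_onWires h _ (by omega), ext_of_le _ hi]

theorem evolve_toFin_classical {L : List (CGate ℕ)} (h : OnWires (· < w) L) (v : Bits w → ℂ)
    (y : Bits w) : evolve (toFin w (L.map Gate.classical)) v y = v (cperm w L.reverse y) := by
  have e : toFin w (L.map Gate.classical) =
      (L.map (CGate.map (Fin.ofNat w))).map Gate.classical := by
    rw [toFin, List.map_map, List.map_map]; rfl
  rw [e, evolve_classical, ← List.map_reverse, cexec_map_ofNat h.reverse]; rfl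

theorem cperm_reverse {L : List (CGate ℕ)} (h : OnWires (· < w) L) (y : Bits w) :
    cperm w L.reverse (cperm w L y) = y := by
  rw [cperm, ext_cperm h, cexec_reverse, res_ext]

theorem cperm_reverse' {L : List (CGate ℕ)} (h : OnWires (· < w) L) (y : Bits w) :
    cperm w L (cperm w L.reverse y) = y := by
  rw [cperm, ext_cperm h.reverse, cexec_reverse', res_ext]

/-- The permutation as an equivalence. -/
def cpermEquiv {L : List (CGate ℕ)} (h : OnWires (· < w) L) : Bits w ≃ Bits w :=
  ⟨cperm w L, cperm w L.reverse, cperm_reverse h, cperm_reverse' h⟩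

theorem evolve_toFin_classical_cperm {L : List (CGate ℕ)} (h : OnWires (· < w) L)
    (v : Bits w → ℂ) (y : Bits w) :
    evolve (toFin w (L.map Gate.classical)) v (cperm w L y) = v y := by
  rw [evolve_toFin_classical h, cperm_reverse h]

theorem sum_evolve_classical {L : List (CGate ℕ)} (h : OnWires (· < w) L) (v : Bits w → ℂ)
    (p : Bits w → Prop) [DecidablePred p] :
    (∑ y, if p y then ‖evolve (toFin w (L.map Gate.classical)) v y‖ ^ 2 else 0) =
      ∑ y, if p (cperm w L y) then ‖v y‖ ^ 2 else 0 := by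
  rw [← Equiv.sum_comp (cpermEquiv h)]
  refine Finset.sum_congr rfl fun y _ => ?_
  simp only [cpermEquiv, Equiv.coe_fn_mk]
  rw [evolve_toFin_classical_cperm h]
  exact if_congr Iff.rfl rfl rfl

/-! #### Hadamard gates on a region -/

/-- Hadamard gates on the region of length `m` that starts at `o`. -/
def hadG (o m : ℕ) : List (Gate ℕ) := (List.range m).flatMap fun i => [.had (o + i)]

theorem hadG_succ (o m : ℕ) : hadG o (m + 1) = hadG o m ++ [.had (o + m)] := by
  rw [hadG, List.range_succ, List.flatMap_append]; rfl

/-- On a region in the state `|0…0⟩` all signs of the Hadamard transform are positive, so every bit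
string appears with the same amplitude. Together with `evolve_hadG_sum`, this avoids the general
formula with signs. -/
theorem evolve_hadG_zero {o m : ℕ} (h : o + m ≤ w) (v : Bits w → ℂ)
    (hv : ∀ y, (∃ i < m, ext y (o + i) = true) → v y = 0) (y : Bits w) :
    evolve (toFin w (hadG o m)) v y =
      (1 / (Real.sqrt 2 : ℂ)) ^ m * v (res w (setAt (ext y) o m fun _ => false)) := by
  induction m generalizing y with
  | zero =>
    have : setAt (ext y) o 0 (fun _ => false) = ext y := by
      funext i; exact setAt_of_not (by omega)
    simp [hadG, toFin, this, res_ext]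
  | succ m ih =>
    have hlt : o + m < w := by omega
    have hval : ((Fin.ofNat w (o + m) : Fin w) : ℕ) = o + m := Nat.mod_eq_of_lt hlt
    have ih' := ih (by omega) fun y ⟨i, hi, h⟩ => hv y ⟨i, by omega, h⟩
    rw [hadG_succ, toFin_append, evolve_append]
    simp only [toFin, List.map_cons, List.map_nil, evolve_cons, evolve_nil, Gate.map, Gate.act]
    simp only [toFin] at ih'
    rw [ih', ih', hv (res w (setAt (ext (Function.update y (Fin.ofNat w (o + m)) true)) o m
      fun _ => false)) ⟨m, by omega, ?_⟩]
    · have e : setAt (ext (Function.update y (Fin.ofNat w (o + m)) false)) o m (fun _ => false) =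
          setAt (ext y) o (m + 1) fun _ => false := by
        funext i
        unfold setAt
        rw [ext_update, hval, Function.update_apply]
        split_ifs <;> first | rfl | omega
      rw [e, mul_zero, mul_zero, add_zero, pow_succ]
      ring
    · rw [ext_res_of_lt _ hlt, setAt_of_not (by omega), ext_update, hval, Function.update_self]

theorem sum_bits_succ {m : ℕ} {M : Type*} [AddCommMonoid M] (F : (ℕ → Bool) → M) :
    ∑ β : Bits (m + 1), F (ext β) =
      ∑ β : Bits m, (F (ext β) + F (Function.update (ext β) m true)) := by
  rw [← Equiv.sum_comp (Fin.snocEquiv fun _ : Fin (m + 1) => Bool), Fintype.sum_prod_type,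
    Fintype.sum_bool, ← Finset.sum_add_distrib]
  refine Finset.sum_congr rfl fun β _ => ?_
  have e : ∀ b, ext ((Fin.snocEquiv fun _ : Fin (m + 1) => Bool) (b, β)) =
      Function.update (ext β) m b := by
    intro b
    funext i
    rw [Function.update_apply]
    split_ifs with hi
    · subst hi
      rw [ext_of_lt _ (Nat.lt_succ_self _)]
      exact Fin.snoc_last (α := fun _ => Bool) b β
    · by_cases hi' : i < m
      · rw [ext_of_lt _ (by omega : i < m + 1), ext_of_lt _ hi']
        exact Fin.snoc_castSucc (α := fun _ => Bool) b β ⟨i, hi'⟩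
      · rw [ext_of_le _ (by omega), ext_of_le _ (by omega)]
  rw [e, e, add_comm]
  congr 2
  funext i
  rw [Function.update_apply]
  split_ifs with hi
  · rw [hi, ext_of_le _ le_rfl]
  · rfl

/-- The dual case: the amplitude at the outcome `0…0` is an unsigned sum, because the row of the
Hadamard matrix that belongs to it is constant. -/
theorem evolve_hadG_sum {o m : ℕ} (h : o + m ≤ w) (v : Bits w → ℂ) (y : Bits w)
    (hy : ∀ i < m, ext y (o + i) = false) :
    evolve (toFin w (hadG o m)) v y =
      (1 / (Real.sqrt 2 : ℂ)) ^ m * ∑ β : Bits m, v (res w (setAt (ext y) o m (ext β))) := by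
  induction m generalizing y with
  | zero =>
    have : ∀ β : Bits 0, setAt (ext y) o 0 (ext β) = ext y := fun β => by
      funext i; exact setAt_of_not (by omega)
    simp [hadG, toFin, this, res_ext]
  | succ m ih =>
    have hlt : o + m < w := by omega
    have hval : ((Fin.ofNat w (o + m) : Fin w) : ℕ) = o + m := Nat.mod_eq_of_lt hlt
    rw [hadG_succ, toFin_append, evolve_append]
    simp only [toFin, List.map_cons, List.map_nil, evolve_cons, evolve_nil, Gate.map, Gate.act]
    simp only [toFin] at ih
    have hz : ∀ b, ∀ i < m, ext (Function.update y (Fin.ofNat w (o + m)) b) (o + i) = false :=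
      fun b i hi => by
        rw [ext_update, hval, Function.update_of_ne (by omega), hy i (by omega)]
    have hyt : y (Fin.ofNat w (o + m)) = false := by
      rw [← ext_val y, hval, hy m (by omega)]
    rw [ih (by omega) _ (hz _), ih (by omega) _ (hz _), hyt,
      sum_bits_succ fun u => v (res w (setAt (ext y) o (m + 1) u)), Finset.sum_add_distrib]
    have e0 : ∀ β : Bits m, setAt (ext (Function.update y (Fin.ofNat w (o + m)) false)) o m (ext β) =
        setAt (ext y) o (m + 1) (ext β) := by
      intro β
      funext i
      unfold setAt
      rw [ext_update, hval, Function.update_apply]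
      split_ifs <;> first | rfl | omega | skip
      rw [ext_of_le _ (by omega)]
    have e1 : ∀ β : Bits m, setAt (ext (Function.update y (Fin.ofNat w (o + m)) true)) o m (ext β) =
        setAt (ext y) o (m + 1) (Function.update (ext β) m true) := by
      intro β
      funext i
      unfold setAt
      rw [ext_update, hval, Function.update_apply, Function.update_apply]
      split_ifs <;> first | rfl | omega
    simp only [e0, e1]
    rw [pow_succ]
    simp only [Bool.false_eq_true, if_false]
    ring

/-! #### Blocks -/

/-- Disjoint blocks evolve independently. The induction is on the number of blocks already
processed; at each step all other blocks are part of the spectator factor. -/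
theorem evolve_blocks {W n o : ℕ} (h : o + n * W ≤ w) (K : List (Gate (Fin W))) (u : Bits W → ℂ)
    {c : Bits w → ℂ} (hc : ∀ z z' : Bits w,
      (∀ i : Fin w, ¬ (o ≤ (i : ℕ) ∧ (i : ℕ) < o + n * W) → z i = z' i) → c z = c z') :
    evolve (toFin w ((List.range n).flatMap fun j =>
        (K.map (Gate.map Fin.val)).map (Gate.map (· + (o + j * W)))))
      (fun z => (∏ j ∈ Finset.range n, u (rd (ext z) (o + j * W) W)) * c z) =
      fun z => (∏ j ∈ Finset.range n, evolve K u (rd (ext z) (o + j * W) W)) * c z := by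
  have key : ∀ m ≤ n, evolve (toFin w ((List.range m).flatMap fun j =>
        (K.map (Gate.map Fin.val)).map (Gate.map (· + (o + j * W)))))
      (fun z => (∏ j ∈ Finset.range n, u (rd (ext z) (o + j * W) W)) * c z) =
      fun z => (∏ j ∈ Finset.range n, if j < m then evolve K u (rd (ext z) (o + j * W) W) else
        u (rd (ext z) (o + j * W) W)) * c z := by
    intro m
    induction m with
    | zero => intro _; simp [toFin]
    | succ m ih =>
      intro hm
      rw [List.range_succ, List.flatMap_append, toFin_append, evolve_append, ih (by omega)]
      have hmW : m * W + W ≤ n * W := by rw [← Nat.succ_mul]; exact Nat.mul_le_mul_right W hm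
      set f : Fin W → Fin w := fun i => ⟨o + m * W + i, by omega⟩ with hf
      have hinj : Function.Injective f := fun a b hab => by
        simp only [hf, Fin.mk.injEq] at hab
        exact Fin.ext (by omega)
      have hg : toFin w ([m].flatMap fun j =>
          (K.map (Gate.map Fin.val)).map (Gate.map (· + (o + j * W)))) = K.map (Gate.map f) := by
        rw [List.flatMap_singleton, toFin, List.map_map, List.map_map]
        refine List.map_congr_left fun g _ => ?_
        rw [Function.comp_apply, Function.comp_apply, Gate.map_map, Gate.map_map]
        refine Gate.map_congr g fun i _ => Fin.ext ?_
        simp only [hf, Fin.ofNat]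
        rw [Nat.mod_eq_of_lt (by omega)]
        omega
      have hrd : ∀ z : Bits w, rd (ext z) (o + m * W) W = z ∘ f := by
        intro z
        funext i
        simp only [rd, Function.comp_apply, hf]
        rw [ext_of_lt _ (by omega)]
      have hmem : m ∈ Finset.range n := Finset.mem_range.2 (by omega)
      have hrest : ∀ j, j ≠ m → ∀ z z' : Bits w, (∀ i, (∀ k, f k ≠ i) → z i = z' i) → j < n →
          rd (ext z) (o + j * W) W = rd (ext z') (o + j * W) W := by
        intro j hj z z' hzz hjn
        funext i
        have hjW : j * W + W ≤ n * W := by rw [← Nat.succ_mul]; exact Nat.mul_le_mul_right W hjn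
        simp only [rd]
        rw [ext_of_lt _ (by omega), ext_of_lt _ (by omega)]
        refine hzz _ fun k hk => ?_
        have h1 := congrArg Fin.val hk
        simp only [hf] at h1
        rcases lt_or_gt_of_ne hj with h2 | h2
        · have : j * W + W ≤ m * W := by rw [← Nat.succ_mul]; exact Nat.mul_le_mul_right W h2
          omega
        · have : m * W + W ≤ j * W := by rw [← Nat.succ_mul]; exact Nat.mul_le_mul_right W h2
          omega
      -- All factors except that of block `m`. They do not depend on the wires of this block.
      set c' : Bits w → ℂ := fun z => (∏ j ∈ (Finset.range n).erase m, if j < m then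
        evolve K u (rd (ext z) (o + j * W) W) else u (rd (ext z) (o + j * W) W)) * c z with hc'
      have hc'i : ∀ z z' : Bits w, (∀ i, (∀ j, f j ≠ i) → z i = z' i) → c' z = c' z' := by
        intro z z' hzz
        simp only [hc']
        congr 1
        · refine Finset.prod_congr rfl fun j hj => ?_
          rw [hrest j (Finset.ne_of_mem_erase hj) z z' hzz
            (Finset.mem_range.1 (Finset.mem_of_mem_erase hj))]
        · refine hc _ _ fun i hi => hzz i fun k hk => hi ?_
          rw [← hk]
          simp only [hf]
          omega
      have e1 : (fun z => (∏ j ∈ Finset.range n, if j < m then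
          evolve K u (rd (ext z) (o + j * W) W) else u (rd (ext z) (o + j * W) W)) * c z) =
          fun z => u (z ∘ f) * c' z := by
        funext z
        rw [← Finset.mul_prod_erase _ _ hmem, if_neg (lt_irrefl m), hrd, mul_assoc]
      rw [hg, e1, evolve_map hinj K u hc'i]
      funext z
      rw [← Finset.mul_prod_erase _ _ hmem, if_pos (Nat.lt_succ_self m), hrd, mul_assoc]
      congr 1
      simp only [hc']
      congr 1
      refine Finset.prod_congr rfl fun j hj => ?_
      have := Finset.ne_of_mem_erase hj
      by_cases h1 : j < m
      · rw [if_pos h1, if_pos (by omega)]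
      · rw [if_neg h1, if_neg (by omega)]
  rw [key n le_rfl]
  funext z
  congr 1
  exact Finset.prod_congr rfl fun j hj => if_pos (Finset.mem_range.1 hj)

end QL

namespace QL

open Matrix

/-! ### Runs of circuits on pure states -/

/-- The density matrix of a (subnormalised) pure state. -/
def pureState {α : Type} (φ : α → ℂ) : Matrix α α ℂ := vecMulVec φ (star φ)

theorem pureState_apply {α : Type} (φ : α → ℂ) (a b : α) :
    pureState φ a b = φ a * star (φ b) := rfl

theorem noQubits_eq : noQubits = pureState fun _ => 1 := by
  ext a b
  rw [pureState_apply, Subsingleton.elim a b]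
  simp [noQubits]

/-- Decomposition of the wires in three consecutive regions. -/
def splitBits {k q w : ℕ} (h : k + q ≤ w) : Bits w ≃ Bits k × Bits q × Bits (w - (k + q)) where
  toFun z := (slice z 0 k (by omega), slice z k q h, slice z (k + q) (w - (k + q)) (by omega))
  invFun p i := if h1 : (i : ℕ) < k then p.1 ⟨i, h1⟩ else
    if h2 : (i : ℕ) < k + q then p.2.1 ⟨i - k, by omega⟩ else p.2.2 ⟨i - (k + q), by omega⟩
  left_inv z := by
    funext i
    simp only [slice]
    split_ifs with h1 h2 <;> congr 1 <;> apply Fin.ext <;> simp only <;> omega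
  right_inv p := by
    refine Prod.ext (funext fun i => ?_) (Prod.ext (funext fun i => ?_) (funext fun i => ?_)) <;>
      simp only [slice]
    · have := i.2
      rw [dif_pos (by omega)]
      refine congrArg _ (Fin.ext ?_)
      simp only
      omega
    · have := i.2
      rw [dif_neg (by omega), dif_pos (by omega)]
      refine congrArg _ (Fin.ext ?_)
      simp only
      omega
    · have := i.2
      rw [dif_neg (by omega), dif_neg (by omega)]
      refine congrArg _ (Fin.ext ?_)
      simp only
      omega

theorem rest_eq_iff {k q w : ℕ} (h : k + q ≤ w) (z z' : Bits w) :
    (∀ i : Fin w, k + q ≤ i → z i = z' i) ↔ (splitBits h z).2.2 = (splitBits h z').2.2 := by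
  constructor
  · exact fun H => funext fun i => H _ (by simp)
  · intro H i hi
    have := congrFun H ⟨i - (k + q), by omega⟩
    simp only [splitBits, slice, Equiv.coe_fn_mk] at this
    have e : (⟨k + q + (i - (k + q)), by omega⟩ : Fin w) = i := Fin.ext (by simp only; omega)
    rwa [e] at this

namespace Circ

variable {kin qin kout qout : ℕ} (C : Circ kin qin kout qout)

/-- The initial amplitudes for a pure quantum input. -/
def initVec (x : Bits kin) (φ : Bits qin → ℂ) (z : Bits C.width) : ℂ :=
  have h := C.le_in
  if slice z 0 kin (by omega) = x ∧ ∀ i : Fin C.width, kin + qin ≤ i → z i = false then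
    φ (slice z kin qin h) else 0

/-- The final amplitudes for a pure quantum input. -/
noncomputable def amp (x : Bits kin) (φ : Bits qin → ℂ) : Bits C.width → ℂ := evolve C.gates (C.initVec x φ)

theorem initial_pureState (x : Bits kin) (φ : Bits qin → ℂ) :
    C.initial x (pureState φ) = pureState (C.initVec x φ) := by
  ext z z'
  simp only [initial, of_apply, pureState_apply, initVec]
  by_cases h1 : slice z 0 kin (by have := C.le_in; omega) = x ∧
      ∀ i : Fin C.width, kin + qin ≤ i → z i = false
  · by_cases h2 : slice z' 0 kin (by have := C.le_in; omega) = x ∧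
        ∀ i : Fin C.width, kin + qin ≤ i → z' i = false
    · rw [if_pos h1, if_pos h2, if_pos ⟨h1.1, h2.1, fun i hi => ⟨h1.2 i hi, h2.2 i hi⟩⟩]
    · rw [if_neg h2, if_neg fun h => h2 ⟨h.2.1, fun i hi => (h.2.2 i hi).2⟩]
      simp
  · rw [if_neg h1, if_neg fun h => h1 ⟨h.1, fun i hi => (h.2.2 i hi).1⟩]
    simp

theorem final_pureState (x : Bits kin) (φ : Bits qin → ℂ) :
    C.final x (pureState φ) = pureState (C.amp x φ) := by
  rw [final, initial_pureState, pureState, mul_vecMulVec, vecMulVec_mul, ← star_mulVec]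
  rfl

/-- Tracing out the discarded wires leaves one pure state for each value `r` of these wires. This
reduces everything that follows to amplitudes, `Circ.prob_sum` adding up the components. -/
theorem run_pureState (x : Bits kin) (φ : Bits qin → ℂ) (y : Bits kout) :
    C.run x (pureState φ) y = ∑ r, pureState fun a =>
      C.amp x φ ((splitBits C.le_out).symm (y, a, r)) := by
  ext a b
  rw [Matrix.sum_apply]
  simp only [run, of_apply, final_pureState, pureState_apply]
  rw [← Equiv.sum_comp (splitBits C.le_out).symm, Fintype.sum_prod_type]
  have key : ∀ z z' : Bits C.width, (slice z 0 kout (by have := C.le_out; omega) = y ∧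
      slice z' 0 kout (by have := C.le_out; omega) = y ∧
         slice z kout qout C.le_out = a ∧ slice z' kout qout C.le_out = b ∧
         ∀ i : Fin C.width, kout + qout ≤ i → z i = z' i) ↔
      ((splitBits C.le_out z).1 = y ∧ (splitBits C.le_out z').1 = y ∧
        (splitBits C.le_out z).2.1 = a ∧ (splitBits C.le_out z').2.1 = b ∧
        (splitBits C.le_out z).2.2 = (splitBits C.le_out z').2.2) := fun z z' => by
    rw [rest_eq_iff C.le_out]; rfl
  simp only [key]
  conv_lhs =>
    enter [2, x1, 2, x2]
    rw [← Equiv.sum_comp (splitBits C.le_out).symm, Fintype.sum_prod_type]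
  simp only [Equiv.apply_symm_apply, Fintype.sum_prod_type, ite_and]
  simp [Finset.sum_ite_irrel, Finset.sum_ite_eq]

theorem prob_pureState (x : Bits kin) (φ : Bits qin → ℂ) (y : Bits kout) :
    C.prob x (pureState φ) y = ∑ z : Bits C.width,
      if slice z 0 kout (by have := C.le_out; omega) = y then ‖C.amp x φ z‖ ^ 2 else 0 := by
  rw [prob, run_pureState, trace_sum, ← Equiv.sum_comp (splitBits C.le_out).symm]
  have key : ∀ z : Bits C.width, slice z 0 kout (by have := C.le_out; omega) = y ↔
      (splitBits C.le_out z).1 = y := fun z => Iff.rfl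
  simp only [key, Equiv.apply_symm_apply, Fintype.sum_prod_type]
  rw [Finset.sum_eq_single y]
  · rw [Finset.sum_comm, Complex.re_sum]
    refine Finset.sum_congr rfl fun r _ => ?_
    simp only [if_true, trace, diag, pureState_apply, Complex.re_sum]
    refine Finset.sum_congr rfl fun a _ => ?_
    rw [Complex.star_def, Complex.mul_conj, Complex.ofReal_re, Complex.normSq_eq_norm_sq]
  · intro y' _ hy'
    simp [hy']
  · simp

theorem prob_pureState_nonneg (x : Bits kin) (φ : Bits qin → ℂ) (y : Bits kout) :
    0 ≤ C.prob x (pureState φ) y := by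
  rw [prob_pureState]
  refine Finset.sum_nonneg fun z _ => ?_
  split_ifs <;> positivity

theorem norm_initVec (x : Bits kin) (φ : Bits qin → ℂ) :
    ∑ z, ‖C.initVec x φ z‖ ^ 2 = ∑ a, ‖φ a‖ ^ 2 := by
  have h0 : ∀ z : Bits C.width, C.initVec x φ z = if (splitBits C.le_in z).1 = x ∧
      (splitBits C.le_in z).2.2 = fun _ => false then φ (splitBits C.le_in z).2.1 else 0 := by
    intro z
    have := rest_eq_iff C.le_in z fun _ => false
    simp only [initVec]
    refine if_congr (and_congr Iff.rfl this) rfl rfl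
  simp only [h0]
  rw [← Equiv.sum_comp (splitBits C.le_in).symm]
  simp only [Equiv.apply_symm_apply, Fintype.sum_prod_type]
  rw [Finset.sum_eq_single x]
  · refine Finset.sum_congr rfl fun a _ => ?_
    rw [Finset.sum_eq_single fun _ => false]
    · simp
    · intro r _ hr
      simp [hr]
    · simp
  · intro y _ hy
    simp [hy]
  · simp

theorem sum_prob_pureState (x : Bits kin) (φ : Bits qin → ℂ) :
    ∑ y, C.prob x (pureState φ) y = ∑ a, ‖φ a‖ ^ 2 := by
  simp only [prob_pureState]
  rw [Finset.sum_comm]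
  simp only [Finset.sum_ite_eq, Finset.mem_univ, if_true]
  rw [amp, norm_evolve, norm_initVec]

theorem initial_sum {ι : Type} (s : Finset ι) (x : Bits kin)
    (ρ : ι → Matrix (Bits qin) (Bits qin) ℂ) :
    C.initial x (∑ r ∈ s, ρ r) = ∑ r ∈ s, C.initial x (ρ r) := by
  ext z z'
  simp only [initial, of_apply, Matrix.sum_apply]
  split_ifs <;> simp

theorem prob_sum {ι : Type} (s : Finset ι) (x : Bits kin)
    (ρ : ι → Matrix (Bits qin) (Bits qin) ℂ) (y : Bits kout) :
    C.prob x (∑ r ∈ s, ρ r) y = ∑ r ∈ s, C.prob x (ρ r) y := by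
  have h1 : C.final x (∑ r ∈ s, ρ r) = ∑ r ∈ s, C.final x (ρ r) := by
    simp only [final, initial_sum, Matrix.mul_sum, Matrix.sum_mul]
  have h2 : C.run x (∑ r ∈ s, ρ r) y = ∑ r ∈ s, C.run x (ρ r) y := by
    ext a b
    simp only [run, of_apply, Matrix.sum_apply, h1]
    rw [Finset.sum_comm]
    conv_rhs => rw [Finset.sum_comm]
    rw [Finset.sum_comm]
    refine Finset.sum_congr rfl fun z _ => ?_
    conv_rhs => rw [Finset.sum_comm]
    refine Finset.sum_congr rfl fun z' _ => ?_
    split_ifs <;> simp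
  simp only [prob, h2, trace_sum, Complex.re_sum]

end Circ

end QL

namespace QL

open Matrix

/-! ### Negligible functions -/

theorem Negligible.add {f g : ℕ → ℝ} (hf : Negligible f) (hg : Negligible g) :
    Negligible fun n => f n + g n :=
  Asymptotics.SuperpolynomialDecay.add hf hg

theorem Negligible.const_mul {f : ℕ → ℝ} (hf : Negligible f) (c : ℝ) :
    Negligible fun n => c * f n :=
  Asymptotics.SuperpolynomialDecay.const_mul hf c

theorem Negligible.natCast_mul {f : ℕ → ℝ} (hf : Negligible f) :
    Negligible fun n => (n : ℝ) * f n :=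
  Asymptotics.SuperpolynomialDecay.param_mul hf

theorem negligible_half_pow : Negligible fun n => (1 / 2 : ℝ) ^ n := fun k => by
  have := tendsto_pow_const_mul_const_pow_of_abs_lt_one k (r := (1 / 2 : ℝ))
    (by rw [abs_of_pos] <;> norm_num)
  exact this

/-! ### Statistical distance -/

/-- A hybrid argument: `p` is replaced by `p'` while `q` is kept, then `q` by `q'` under the
distribution `p'`. The factors 2 undo the one half in `statDist`. -/
theorem abs_sum_sub_sum_le {α β : Type} [Fintype α] [Fintype β] {p p' : α → ℝ} {q q' : β → ℝ}
    (hp' : ∀ a, 0 ≤ p' a) (hp1 : ∑ a, p' a = 1) (hq : ∀ b, 0 ≤ q b) (hq1 : ∑ b, q b = 1)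
    {F : α → β → ℝ} (hF0 : ∀ a b, 0 ≤ F a b) (hF1 : ∀ a b, F a b ≤ 1) :
    |(∑ a, ∑ b, p a * q b * F a b) - ∑ a, ∑ b, p' a * q' b * F a b| ≤
      2 * statDist p p' + 2 * statDist q q' := by
  have e : (∑ a, ∑ b, p a * q b * F a b) - ∑ a, ∑ b, p' a * q' b * F a b =
      (∑ a, (p a - p' a) * ∑ b, q b * F a b) + ∑ a, p' a * ∑ b, (q b - q' b) * F a b := by
    rw [← Finset.sum_sub_distrib, ← Finset.sum_add_distrib]
    refine Finset.sum_congr rfl fun a _ => ?_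
    rw [← Finset.sum_sub_distrib, Finset.mul_sum, Finset.mul_sum, ← Finset.sum_add_distrib]
    exact Finset.sum_congr rfl fun b _ => by ring
  have h1 : |∑ a, (p a - p' a) * ∑ b, q b * F a b| ≤ 2 * statDist p p' := by
    refine (Finset.abs_sum_le_sum_abs _ _).trans ?_
    rw [statDist, ← mul_assoc, mul_one_div_cancel two_ne_zero, one_mul]
    refine Finset.sum_le_sum fun a _ => ?_
    rw [abs_mul]
    refine mul_le_of_le_one_right (abs_nonneg _) ?_
    rw [abs_of_nonneg (Finset.sum_nonneg fun b _ => mul_nonneg (hq b) (hF0 a b)), ← hq1]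
    exact Finset.sum_le_sum fun b _ => mul_le_of_le_one_right (hq b) (hF1 a b)
  have h2 : |∑ a, p' a * ∑ b, (q b - q' b) * F a b| ≤ 2 * statDist q q' := by
    refine (Finset.abs_sum_le_sum_abs _ _).trans ?_
    have : ∀ a, |p' a * ∑ b, (q b - q' b) * F a b| ≤ p' a * (2 * statDist q q') := fun a => by
      rw [abs_mul, abs_of_nonneg (hp' a)]
      refine mul_le_mul_of_nonneg_left ?_ (hp' a)
      refine (Finset.abs_sum_le_sum_abs _ _).trans ?_
      rw [statDist, ← mul_assoc, mul_one_div_cancel two_ne_zero, one_mul]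
      refine Finset.sum_le_sum fun b _ => ?_
      rw [abs_mul, abs_of_nonneg (hF0 a b)]
      exact mul_le_of_le_one_right (abs_nonneg _) (hF1 a b)
    refine (Finset.sum_le_sum fun a _ => this a).trans ?_
    rw [← Finset.sum_mul, hp1, one_mul]
  rw [e]
  exact (abs_add_le _ _).trans (add_le_add h1 h2)

theorem sum_coinDist_mul {k k' : ℕ} (C : DetCirc k k') (F : Bits k' → ℝ) :
    ∑ y, C.coinDist y * F y = ∑ r : Bits k, (1 / 2) ^ k * F (C.eval r) := by
  have : ∀ y, C.coinDist y * F y = ∑ r : Bits k, if C.eval r = y then (1 / 2) ^ k * F y else 0 := by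
    intro y
    rw [DetCirc.coinDist, ← Finset.sum_filter, Finset.sum_const, nsmul_eq_mul, one_div, inv_pow]
    ring
  simp only [this]
  rw [Finset.sum_comm]
  exact Finset.sum_congr rfl fun r _ => by simp

theorem coinDist_nonneg {k k' : ℕ} (C : DetCirc k k') (y : Bits k') : 0 ≤ C.coinDist y := by
  unfold DetCirc.coinDist
  positivity

theorem sum_coinDist {k k' : ℕ} (C : DetCirc k k') : ∑ y, C.coinDist y = 1 := by
  have := sum_coinDist_mul C fun _ => 1
  simp only [mul_one] at this
  rw [this, Finset.sum_const, Finset.card_univ, Fintype.card_fun]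
  simp

namespace GroupActionFamily

variable (A : GroupActionFamily) (n : ℕ)

theorem sum_ite_range {α β M : Type} [Fintype α] [Fintype β] [AddCommMonoid M] {f : α → β}
    (hf : Function.Injective f) [DecidablePred (· ∈ Set.range f)] (F : β → M) :
    (∑ y, if y ∈ Set.range f then F y else 0) = ∑ a, F (f a) := by
  classical
  rw [← Finset.sum_filter, ← Finset.sum_image fun a _ b _ h => hf h]
  refine Finset.sum_congr ?_ fun _ _ => rfl
  ext y
  simp

theorem sum_unifG_mul (F : Bits (A.lenG n) → ℝ) :
    ∑ y, A.unifG n y * F y = ∑ g : A.G n, 1 / (Fintype.card (A.G n) : ℝ) * F (A.repG n g) := by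
  classical
  rw [← sum_ite_range (A.repG_injective n) fun y => 1 / (Fintype.card (A.G n) : ℝ) * F y]
  refine Finset.sum_congr rfl fun y _ => ?_
  unfold unifG
  split_ifs <;> simp

theorem sum_unifS_mul (F : Bits (A.lenS n) → ℝ) :
    ∑ y, A.unifS n y * F y = ∑ s : A.S n, 1 / (Fintype.card (A.S n) : ℝ) * F (A.repS n s) := by
  classical
  rw [← sum_ite_range (A.repS_injective n) fun y => 1 / (Fintype.card (A.S n) : ℝ) * F y]
  refine Finset.sum_congr rfl fun y _ => ?_
  unfold unifS
  split_ifs <;> simp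

theorem card_G_pos : 0 < (Fintype.card (A.G n) : ℝ) := by
  have : Nonempty (A.G n) := ⟨1⟩
  exact_mod_cast Fintype.card_pos

theorem card_S_pos : 0 < (Fintype.card (A.S n) : ℝ) := by
  exact_mod_cast Fintype.card_pos

theorem sum_unifG : ∑ y, A.unifG n y = 1 := by
  have := A.sum_unifG_mul n fun _ => 1
  simp only [mul_one] at this
  rw [this, Finset.sum_const, Finset.card_univ, nsmul_eq_mul]
  exact mul_one_div_cancel (A.card_G_pos n).ne'

theorem unifG_nonneg (y : Bits (A.lenG n)) : 0 ≤ A.unifG n y := by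
  unfold unifG
  split_ifs <;> positivity

end GroupActionFamily

/-! ### Trace distance -/

theorem trace_conj_pureState {α κ : Type} [Fintype α] [Fintype κ] (K : Matrix κ α ℂ)
    (v : α → ℂ) : (K * pureState v * Kᴴ).trace.re = ∑ k, ‖(K *ᵥ v) k‖ ^ 2 := by
  rw [pureState, mul_vecMulVec, vecMulVec_mul, ← star_mulVec, trace, Complex.re_sum]
  refine Finset.sum_congr rfl fun k _ => ?_
  rw [diag_apply, vecMulVec_apply, Pi.star_apply, Complex.star_def, Complex.mul_conj,
    Complex.ofReal_re, Complex.normSq_eq_norm_sq]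

theorem isHermitian_pureState {α : Type} (v : α → ℂ) : (pureState v).IsHermitian := by
  ext a b
  simp [pureState_apply, mul_comm]

/-- In an orthonormal eigenbasis of the Hermitian matrix `ρ - σ` the difference is the sum of the
eigenvalues with weights `‖K e_i‖²`, which are at most 1. The roots of the characteristic polynomial
are these eigenvalues, so the sum of their absolute values is twice the trace distance. -/
theorem abs_trace_conj_sub_le {α κ : Type} [Fintype α] [DecidableEq α] [Fintype κ]
    {ρ σ : Matrix α α ℂ} (h : (ρ - σ).IsHermitian) (K : Matrix κ α ℂ)
    (hK : ∀ v : α → ℂ, ∑ k, ‖(K *ᵥ v) k‖ ^ 2 ≤ ∑ a, ‖v a‖ ^ 2) :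
    |(K * ρ * Kᴴ).trace.re - (K * σ * Kᴴ).trace.re| ≤ 2 * traceDist ρ σ := by
  have e1 : (K * ρ * Kᴴ).trace.re - (K * σ * Kᴴ).trace.re = (K * (ρ - σ) * Kᴴ).trace.re := by
    rw [Matrix.mul_sub, Matrix.sub_mul, trace_sub, Complex.sub_re]
  set e : α → α → ℂ := fun i a => h.eigenvectorBasis i a with he
  have e2 : ρ - σ = ∑ i, (h.eigenvalues i : ℂ) • pureState (e i) := by
    conv_lhs => rw [h.spectral_theorem, Unitary.conjStarAlgAut_apply]
    ext a b
    rw [Matrix.sum_apply, mul_apply]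
    refine Finset.sum_congr rfl fun i _ => ?_
    rw [mul_diagonal, Matrix.smul_apply, pureState_apply, smul_eq_mul]
    simp only [he, star_apply, IsHermitian.eigenvectorUnitary_apply, Function.comp_apply]
    simp
    ring
  have e3 : (K * (ρ - σ) * Kᴴ).trace.re = ∑ i, h.eigenvalues i * ∑ k, ‖(K *ᵥ e i) k‖ ^ 2 := by
    conv_lhs => rw [e2, Matrix.mul_sum, Matrix.sum_mul, trace_sum, Complex.re_sum]
    refine Finset.sum_congr rfl fun i _ => ?_
    rw [Matrix.mul_smul, Matrix.smul_mul, trace_smul, smul_eq_mul, Complex.re_ofReal_mul,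
      trace_conj_pureState]
  have hn : ∀ i, ∑ a, ‖e i a‖ ^ 2 = 1 := fun i => by
    have := h.eigenvectorBasis.orthonormal.1 i
    rw [EuclideanSpace.norm_eq, Real.sqrt_eq_one] at this
    exact this
  have e4 : 2 * traceDist ρ σ = ∑ i, |h.eigenvalues i| := by
    rw [traceDist, h.roots_charpoly_eq_eigenvalues, Multiset.map_map, ← mul_assoc,
      mul_one_div_cancel two_ne_zero, one_mul]
    refine Finset.sum_congr rfl fun i _ => ?_
    simp
  rw [e1, e3, e4]
  refine (Finset.abs_sum_le_sum_abs _ _).trans (Finset.sum_le_sum fun i _ => ?_)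
  rw [abs_mul]
  refine mul_le_of_le_one_right (abs_nonneg _) ?_
  rw [abs_of_nonneg (Finset.sum_nonneg fun k _ => by positivity), ← hn i]
  exact hK _

/-- The symmetrisation of amplitudes under a permutation, restricted to a subset, can only
increase distances by the trace distance. -/
theorem abs_symm_sum_sub_le {α ι : Type} [Fintype α] [DecidableEq α] [Fintype ι] (π : Equiv.Perm α)
    (p : α → Prop) [DecidablePred p] (v : ι → α → ℂ) (u : α → ℂ) :
    |(∑ i, ∑ a, if p a then ‖(v i a + v i (π a)) / 2‖ ^ 2 else 0) -
      ∑ a, (if p a then ‖(u a + u (π a)) / 2‖ ^ 2 else 0)| ≤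
      2 * traceDist (∑ i, pureState (v i)) (pureState u) := by
  -- The average of the identity and a permutation, followed by the projection on the basis states
  -- that satisfy `p`: a contraction, as both factors are.
  set K : Matrix α α ℂ := Matrix.of fun a b =>
    if p a then ((if a = b then 1 else 0) + if π a = b then 1 else 0) / 2 else 0 with hK
  have hKv : ∀ (v : α → ℂ) a, (K *ᵥ v) a = if p a then (v a + v (π a)) / 2 else 0 := by
    intro v a
    simp only [hK, mulVec, dotProduct, of_apply]
    split_ifs
    · have : ∀ b, (((if a = b then 1 else 0) + if π a = b then 1 else 0) / 2 : ℂ) * v b =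
          (if a = b then v b / 2 else 0) + if π a = b then v b / 2 else 0 := fun b => by
        split_ifs <;> ring
      simp only [this, Finset.sum_add_distrib, Finset.sum_ite_eq, Finset.mem_univ, if_true]
      ring
    · simp
  have hn : ∀ v : α → ℂ, ∑ a, ‖(K *ᵥ v) a‖ ^ 2 =
      ∑ a, if p a then ‖(v a + v (π a)) / 2‖ ^ 2 else 0 := fun v =>
    Finset.sum_congr rfl fun a _ => by rw [hKv]; split_ifs <;> simp
  have hc : ∀ v : α → ℂ, ∑ a, ‖(K *ᵥ v) a‖ ^ 2 ≤ ∑ a, ‖v a‖ ^ 2 := by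
    intro v
    rw [hn]
    have h1 : ∑ a, ‖v a‖ ^ 2 = ∑ a, (‖v a‖ ^ 2 + ‖v (π a)‖ ^ 2) / 2 := by
      rw [← Finset.sum_div, Finset.sum_add_distrib, Equiv.sum_comp π fun a => ‖v a‖ ^ 2]
      ring
    rw [h1]
    refine Finset.sum_le_sum fun a _ => ?_
    split_ifs
    · rw [norm_div, div_pow]
      have h2 : ‖(2 : ℂ)‖ ^ 2 = 4 := by norm_num
      have h3 := norm_add_le (v a) (v (π a))
      rw [h2]
      nlinarith [sq_nonneg (‖v a‖ - ‖v (π a)‖), norm_nonneg (v a + v (π a)), norm_nonneg (v a),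
        norm_nonneg (v (π a))]
    · positivity
  have hH : ((∑ i, pureState (v i)) - pureState u).IsHermitian := by
    refine IsHermitian.sub ?_ (isHermitian_pureState u)
    rw [IsHermitian, conjTranspose_sum]
    exact Finset.sum_congr rfl fun i _ => isHermitian_pureState _
  have := abs_trace_conj_sub_le hH K hc
  rwa [Matrix.mul_sum, Matrix.sum_mul, trace_sum, Complex.re_sum,
    Finset.sum_congr rfl fun i _ => trace_conj_pureState K (v i), trace_conj_pureState, hn,
    Finset.sum_congr rfl fun i _ => hn (v i)] at this

end QL

namespace QL

/-! ### Circuits for a group action at a fixed security parameter -/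

/-- Circuits for the algorithms of a group action. -/
structure Kit (A : GroupActionFamily) (n : ℕ) : Type where
  kG : ℕ
  kS : ℕ
  mul : DetCirc (A.lenG n + A.lenG n) (A.lenG n)
  inv : DetCirc (A.lenG n) (A.lenG n)
  act : DetCirc (A.lenG n + A.lenS n) (A.lenS n)
  recog : DetCirc (A.lenG n) 1
  sampleG : DetCirc kG (A.lenG n)
  sampleS : DetCirc kS (A.lenS n)
  sup : Circ 0 0 0 (A.lenG n)
  mul_eval : ∀ g h, mul.eval (Fin.append (A.repG n g) (A.repG n h)) = A.repG n (g * h)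
  inv_eval : ∀ g, inv.eval (A.repG n g) = A.repG n g⁻¹
  act_eval : ∀ g s, act.eval (Fin.append (A.repG n g) (A.repS n s)) = A.repS n (g • s)
  recog_eval : ∀ y, recog.eval y 0 = true ↔ y ∈ Set.range (A.repG n)

/-- The block of length `l` with index `j < n` lies within the `n` blocks. -/
theorem mul_add_le {j n : ℕ} (h : j < n) (l : ℕ) : j * l + l ≤ n * l := by
  rw [← Nat.succ_mul]; exact Nat.mul_le_mul_right l h

theorem xorAt_extend (z : ℕ → Bool) (o : ℕ) {a b : ℕ} (h : a ≤ b) (v : ℕ → Bool) :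
    xorAt z o a v = xorAt z o b fun i => if i < a then v i else false := by
  funext i
  unfold xorAt
  by_cases h1 : o ≤ i ∧ i < o + a
  · rw [if_pos h1, if_pos (by omega)]
    simp only
    rw [if_pos (by omega)]
  · rw [if_neg h1]
    by_cases h2 : o ≤ i ∧ i < o + b
    · rw [if_pos h2]
      simp only
      rw [if_neg (by omega), Bool.xor_false]
    · rw [if_neg h2]

theorem rd_congr {z z' : ℕ → Bool} {o l : ℕ} (h : ∀ i < l, z (o + i) = z' (o + i)) :
    rd z o l = rd z' o l := funext fun i => h i i.2

theorem rd_xorAt_of_disj {z u : ℕ → Bool} {o l p m : ℕ} (h : Disj p m o l) :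
    rd (xorAt z o l u) p m = rd z p m :=
  rd_congr fun i hi => xorAt_of_not (by unfold Disj at h; omega)

namespace DetCirc

variable {k l m : ℕ} (C : DetCirc (k + l) m)

/-- Copy two inputs from `a` and `b` to `w` and run the circuit there. -/
def load₂ (a b w : ℕ) : List (CGate ℕ) :=
  (QL.copyG a w k ++ QL.copyG b (w + k) l) ++ QL.shiftG w C.gatesN

theorem onWires_load₂ {p : ℕ → Prop} {a b w : ℕ} (ha : ∀ i < k, p (a + i))
    (hb : ∀ i < l, p (b + i)) (hw : ∀ i < C.width, p (w + i)) : OnWires p (C.load₂ a b w) := by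
  have := C.le_in
  exact ((OnWires.copyG ha fun i hi => hw i (by omega)).append (.copyG hb fun i hi => by
    rw [Nat.add_assoc]; exact hw _ (by omega))).append (.shiftG C.onWires_gatesN hw)

theorem cexec_load₂ {a b w : ℕ} {z : ℕ → Bool} (ha : Disj a k w (k + l)) (hb : Disj b l w (k + l))
    (hz : ∀ i < C.width, z (w + i) = false) :
    cexec (C.load₂ a b w) z =
      setAt z w C.width (C.wires (Fin.append (rd z a k) (rd z b l))) := by
  refine C.cexec_load ?_ hz
  rw [cexec_append, cexec_copyG (by unfold Disj at *; omega),
    cexec_copyG (by unfold Disj at *; omega), xorAt_append]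
  refine xorAt_congr fun i hi => ?_
  rw [ext_append]
  split_ifs with h
  · rw [ext_rd_of_lt _ _ h]
  · rw [ext_rd_of_lt _ _ (by omega), xorAt_of_not (by unfold Disj at *; omega)]

variable {k l m : ℕ} (C : DetCirc k m)

/-- Copy the input from `a` to `w` and run the circuit there. -/
def load (a w : ℕ) : List (CGate ℕ) := QL.copyG a w k ++ QL.shiftG w C.gatesN

theorem onWires_load {p : ℕ → Prop} {a w : ℕ} (ha : ∀ i < k, p (a + i))
    (hw : ∀ i < C.width, p (w + i)) : OnWires p (C.load a w) := by
  have := C.le_in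
  exact (OnWires.copyG ha fun i hi => hw i (by omega)).append (.shiftG C.onWires_gatesN hw)

theorem cexec_load' {a w : ℕ} {z : ℕ → Bool} (ha : Disj a k w k)
    (hz : ∀ i < C.width, z (w + i) = false) :
    cexec (C.load a w) z = setAt z w C.width (C.wires (rd z a k)) := by
  refine C.cexec_load ?_ hz
  rw [cexec_copyG ha]
  exact xorAt_congr fun i hi => by rw [ext_rd_of_lt _ _ hi]

end DetCirc

namespace Kit

variable {A : GroupActionFamily} {n : ℕ} (K : Kit A n)

/-- Number of wires of the superposition circuit. -/
abbrev W : ℕ := K.sup.width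

theorem lenG_le : A.lenG n ≤ K.W := by
  have := K.sup.le_out
  unfold W
  omega

/-- Compute, at `w`, the action of the group element of block `j` on the set element selected by
bit `j`. The set elements are at `P` and `P + lenS`, the bits at `B`, the blocks at `D`. -/
def actL (P B D w j : ℕ) : List (CGate ℕ) :=
  (copyG (D + j * K.W) w (A.lenG n) ++
    selG (B + j) P (P + A.lenS n) (w + A.lenG n) (A.lenS n)) ++ shiftG w K.act.gatesN

/-- The element of the set selected by bit `j`. -/
def selS (A : GroupActionFamily) (n P B : ℕ) (z : ℕ → Bool) (j : ℕ) : Bits (A.lenS n) :=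
  rd z (if z (B + j) then P + A.lenS n else P) (A.lenS n)

/-- The contents of the work space after the computation of the action. -/
def actV (P B D : ℕ) (z : ℕ → Bool) (j : ℕ) : ℕ → Bool :=
  K.act.wires (Fin.append (rd z (D + j * K.W) (A.lenG n)) (selS A n P B z j))

theorem onWires_actL {p : ℕ → Prop} {P B D w j : ℕ} (hj : j < n)
    (hP : ∀ i, P ≤ i → i < P + (A.lenS n + A.lenS n) → p i)
    (hB : ∀ i, B ≤ i → i < B + n → p i) (hD : ∀ i, D ≤ i → i < D + n * K.W → p i)
    (hw : ∀ i, w ≤ i → i < w + K.act.width → p i) : OnWires p (K.actL P B D w j) := by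
  have h1 := K.act.le_in
  have h2 := K.lenG_le
  have h3 := mul_add_le hj K.W
  refine ((OnWires.copyG (fun i hi => hD _ (by omega) (by omega)) fun i hi =>
    hw _ (by omega) (by omega)).append (.selG (hB _ (by omega) (by omega))
      (fun i hi => hP _ (by omega) (by omega)) (fun i hi => hP _ (by omega) (by omega))
      fun i hi => hw _ (by omega) (by omega))).append
    (.shiftG K.act.onWires_gatesN fun i hi => hw _ (by omega) (by omega))

theorem cexec_actL {P B D w j : ℕ} (hj : j < n) (h1 : P + (A.lenS n + A.lenS n) ≤ B)
    (h2 : B + n ≤ D) (h3 : D + n * K.W ≤ w) {z : ℕ → Bool}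
    (hz : ∀ i < K.act.width, z (w + i) = false) :
    cexec (K.actL P B D w j) z = setAt z w K.act.width (K.actV P B D z j) := by
  have h4 := K.lenG_le
  have h5 := mul_add_le hj K.W
  refine K.act.cexec_load ?_ hz
  rw [cexec_append, cexec_copyG (by unfold Disj; omega), cexec_selG (by unfold Disj; omega)
    (by unfold Disj; omega) (by unfold Disj; omega) (by unfold Disj; omega), xorAt_append]
  refine xorAt_congr fun i hi => ?_
  rw [ext_append]
  by_cases h : i < A.lenG n
  · rw [if_pos h, if_pos h, ext_rd_of_lt _ _ h]
  · rw [if_neg h, if_neg h, selS, ext_rd_of_lt _ _ (by omega), xorAt_of_not (i := B + j) (by omega),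
      xorAt_of_not (by omega), xorAt_of_not (by omega)]
    split_ifs <;> rfl

/-- Add to the region at `Y` the results of the action. -/
def ysL (P Y B D w : ℕ) : List (CGate ℕ) :=
  (List.range n).flatMap fun j =>
    conjG (K.actL P B D w j) (copyG w (Y + j * A.lenS n) (A.lenS n))

theorem actV_xorAt {P B D j o l : ℕ} (hj : j < n) (z u : ℕ → Bool)
    (h1 : Disj P (A.lenS n + A.lenS n) o l) (h2 : Disj B n o l) (h3 : Disj D (n * K.W) o l) :
    K.actV P B D (xorAt z o l u) j = K.actV P B D z j := by
  have h4 := K.lenG_le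
  have h5 := mul_add_le hj K.W
  unfold Disj at *
  unfold actV selS
  rw [rd_xorAt_of_disj (by unfold Disj; omega), xorAt_of_not (i := B + j) (by omega)]
  split_ifs
  · rw [rd_xorAt_of_disj (by unfold Disj; omega)]
  · rw [rd_xorAt_of_disj (by unfold Disj; omega)]

theorem onWires_ysL {p : ℕ → Prop} {P Y B D w : ℕ}
    (hP : ∀ i, P ≤ i → i < P + (A.lenS n + A.lenS n) → p i)
    (hY : ∀ i, Y ≤ i → i < Y + n * A.lenS n → p i)
    (hB : ∀ i, B ≤ i → i < B + n → p i) (hD : ∀ i, D ≤ i → i < D + n * K.W → p i)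
    (hw : ∀ i, w ≤ i → i < w + K.act.width → p i) : OnWires p (K.ysL P Y B D w) := by
  have h1 := K.act.le_out
  refine .flatMap fun j hj => ?_
  have h2 := mul_add_le hj (A.lenS n)
  exact (K.onWires_actL hj hP hB hD hw).conjG (.copyG (fun i hi => hw _ (by omega) (by omega))
    fun i hi => hY _ (by omega) (by omega))

theorem cexec_ysL {P Y B D w : ℕ} (h1 : P + (A.lenS n + A.lenS n) ≤ Y)
    (h2 : Y + n * A.lenS n ≤ B) (h3 : B + n ≤ D) (h4 : D + n * K.W ≤ w) {z : ℕ → Bool}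
    (hz : ∀ i < K.act.width, z (w + i) = false) :
    cexec (K.ysL P Y B D w) z = xorAt z Y (n * A.lenS n) fun i =>
      K.actV P B D z (i / A.lenS n) (i % A.lenS n) := by
  have ho := K.act.le_out
  refine cexec_flatMap_xorAt (fun z => ∀ i < K.act.width, z (w + i) = false) Y (A.lenS n) n _
    (fun j z => K.actV P B D z j) (fun j hj z hz => ?_)
    (fun z u hz i hi => by rw [xorAt_of_not (by omega), hz i hi])
    (fun j hj z u _ i _ => by
      rw [K.actV_xorAt hj _ _ (by unfold Disj; omega) (by unfold Disj; omega)
        (by unfold Disj; omega)]) hz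
  have h5 := mul_add_le hj (A.lenS n)
  refine cexec_conjG (K.onWires_actL hj (fun i _ _ => by omega) (fun i _ _ => by omega)
    (fun i _ _ => by omega) fun i _ _ => by omega) ?_
  rw [K.cexec_actL hj (by omega) h3 h4 hz, cexec_copyG (by unfold Disj; omega)]
  exact xorAt_congr fun i hi => by rw [setAt_add (by omega)]

/-- Add to the region at `F` the flags of the copies: the first flag of a copy tells whether the
block holds a group element, the others compare the result of the action with the region `Y`. -/
def flagsL (P Y B D F w w' : ℕ) : List (CGate ℕ) :=
  (List.range n).flatMap fun j =>
    conjG (K.actL P B D w j ++ K.recog.load (D + j * K.W) w')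
      (copyG w' (F + j * (1 + A.lenS n)) 1 ++ (copyG w (F + j * (1 + A.lenS n) + 1) (A.lenS n) ++
        (copyG (Y + j * A.lenS n) (F + j * (1 + A.lenS n) + 1) (A.lenS n) ++
          notG (F + j * (1 + A.lenS n) + 1) (A.lenS n))))

/-- The flags of a copy. -/
def flagV (P Y B D : ℕ) (z : ℕ → Bool) (j i : ℕ) : Bool :=
  if i = 0 then K.recog.wires (rd z (D + j * K.W) (A.lenG n)) 0 else
    !(xor (K.actV P B D z j (i - 1)) (z (Y + j * A.lenS n + (i - 1))))

theorem onWires_flagsL {p : ℕ → Prop} {P Y B D F w w' : ℕ}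
    (hP : ∀ i, P ≤ i → i < P + (A.lenS n + A.lenS n) → p i)
    (hY : ∀ i, Y ≤ i → i < Y + n * A.lenS n → p i)
    (hB : ∀ i, B ≤ i → i < B + n → p i) (hD : ∀ i, D ≤ i → i < D + n * K.W → p i)
    (hF : ∀ i, F ≤ i → i < F + n * (1 + A.lenS n) → p i)
    (hw : ∀ i, w ≤ i → i < w + K.act.width → p i)
    (hw' : ∀ i, w' ≤ i → i < w' + K.recog.width → p i) :
    OnWires p (K.flagsL P Y B D F w w') := by
  have h1 := K.act.le_out
  have h0 := K.recog.le_out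
  have h4 := K.lenG_le
  refine .flatMap fun j hj => ?_
  have h2 := mul_add_le hj (A.lenS n)
  have h3 := mul_add_le hj (1 + A.lenS n)
  have h5 := mul_add_le hj K.W
  exact ((K.onWires_actL hj hP hB hD hw).append (K.recog.onWires_load
    (fun i hi => hD _ (by omega) (by omega)) fun i hi => hw' _ (by omega) (by omega))).conjG
    ((OnWires.copyG (fun i hi => hw' _ (by omega) (by omega)) fun i hi =>
      hF _ (by omega) (by omega)).append ((OnWires.copyG (fun i hi => hw _ (by omega) (by omega))
      fun i hi => hF _ (by omega) (by omega)).append ((OnWires.copyG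
      (fun i hi => hY _ (by omega) (by omega)) fun i hi => hF _ (by omega) (by omega)).append
      (.notG fun i hi => hF _ (by omega) (by omega)))))

theorem cexec_flagsL {P Y B D F w w' : ℕ} (h1 : P + (A.lenS n + A.lenS n) ≤ Y)
    (h2 : Y + n * A.lenS n ≤ B) (h3 : B + n ≤ D) (h4 : D + n * K.W ≤ F)
    (h5 : F + n * (1 + A.lenS n) ≤ w) (h6 : w + K.act.width ≤ w') {z : ℕ → Bool}
    (hz : ∀ i, w ≤ i → i < w' + K.recog.width → z i = false) :
    cexec (K.flagsL P Y B D F w w') z = xorAt z F (n * (1 + A.lenS n)) fun i =>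
      K.flagV P Y B D z (i / (1 + A.lenS n)) (i % (1 + A.lenS n)) := by
  have ho := K.act.le_out
  have ho' := K.recog.le_out
  have hG := K.lenG_le
  refine cexec_flatMap_xorAt (fun z => ∀ i, w ≤ i → i < w' + K.recog.width → z i = false) F
    (1 + A.lenS n) n _ (fun j z => K.flagV P Y B D z j) (fun j hj z hz => ?_)
    (fun z u hz i hi hi' => by rw [xorAt_of_not (by omega), hz i hi hi'])
    (fun j hj z u _ i hi => ?_) hz
  · have h7 := mul_add_le hj (1 + A.lenS n)
    have h8 := mul_add_le hj K.W
    have h9 := mul_add_le hj (A.lenS n)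
    refine cexec_conjG ((K.onWires_actL hj (fun i _ _ => by omega) (fun i _ _ => by omega)
      (fun i _ _ => by omega) fun i _ _ => by omega).append (K.recog.onWires_load
      (fun i _ => by omega) fun i _ => by omega)) ?_
    have hL : cexec (K.actL P B D w j ++ K.recog.load (D + j * K.W) w') z =
        setAt (setAt z w K.act.width (K.actV P B D z j)) w' K.recog.width (K.recog.wires
          (rd (setAt z w K.act.width (K.actV P B D z j)) (D + j * K.W) (A.lenG n))) := by
      rw [cexec_append, K.cexec_actL hj (by omega) h3 (by omega) fun i hi => hz _ (by omega)
        (by omega), K.recog.cexec_load' (by unfold Disj; omega)]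
      intro i hi
      rw [setAt_of_not (by omega), hz _ (by omega) (by omega)]
    rw [hL]
    · set z' := setAt (setAt z w K.act.width (K.actV P B D z j)) w' K.recog.width
        (K.recog.wires (rd (setAt z w K.act.width (K.actV P B D z j)) (D + j * K.W) (A.lenG n)))
        with hz'
      rw [cexec_append, cexec_append, cexec_append, cexec_copyG (by unfold Disj; omega),
        cexec_copyG (by unfold Disj; omega), cexec_copyG (by unfold Disj; omega), cexec_notG,
        xorAt_xorAt, xorAt_xorAt, xorAt_append]
      refine xorAt_congr fun i hi => ?_
      unfold flagV
      by_cases hi0 : i = 0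
      · subst hi0
        rw [if_pos Nat.one_pos, if_pos rfl, hz', setAt_add (by omega)]
        rw [rd_congr (z' := z) fun i hi => setAt_of_not (by omega)]
      · rw [if_neg (by omega), if_neg hi0]
        have e1 : xorAt z' (F + j * (1 + A.lenS n)) 1 (fun i => z' (w' + i)) (w + (i - 1)) =
            K.actV P B D z j (i - 1) := by
          rw [xorAt_of_not (by omega), hz', setAt_of_not (by omega), setAt_add (by omega)]
        have e2 : ∀ v : ℕ → Bool, xorAt (xorAt z' (F + j * (1 + A.lenS n)) 1
            (fun i => z' (w' + i))) (F + j * (1 + A.lenS n) + 1) (A.lenS n) v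
              (Y + j * A.lenS n + (i - 1)) = z (Y + j * A.lenS n + (i - 1)) := by
          intro v
          rw [xorAt_of_not (by omega), xorAt_of_not (by omega), hz', setAt_of_not (by omega),
            setAt_of_not (by omega)]
        rw [e1, e2]
        simp
  · have h8 := mul_add_le hj K.W
    have h9 := mul_add_le hj (A.lenS n)
    unfold flagV
    rw [K.actV_xorAt hj _ _ (by unfold Disj; omega) (by unfold Disj; omega)
      (by unfold Disj; omega), rd_xorAt_of_disj (by unfold Disj; omega)]
    split_ifs with hi0
    · rfl
    · rw [xorAt_of_not (by omega)]

/-- A copy is valid: its block holds a group element, whose action yields the region `Y`. -/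
def Valid (P Y B D : ℕ) (z : ℕ → Bool) (j : ℕ) : Prop :=
  K.recog.eval (rd z (D + j * K.W) (A.lenG n)) 0 = true ∧
    K.act.eval (Fin.append (rd z (D + j * K.W) (A.lenG n)) (selS A n P B z j)) =
      rd z (Y + j * A.lenS n) (A.lenS n)

/-- The flags of a copy are the answer of the recognition circuit and the bits of the equality test.
The first is needed because the action circuit is unspecified on strings that represent no group
element. -/
theorem flagV_iff (P Y B D : ℕ) (z : ℕ → Bool) :
    (∀ i < n * (1 + A.lenS n), K.flagV P Y B D z (i / (1 + A.lenS n)) (i % (1 + A.lenS n)) = true) ↔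
      ∀ j < n, K.Valid P Y B D z j := by
  have hr : ∀ x, K.recog.wires x 0 = K.recog.eval x 0 := fun x => by
    rw [← K.recog.ext_eval x Nat.one_pos, ext_of_lt _ Nat.one_pos]; rfl
  have key : ∀ j, K.Valid P Y B D z j ↔ ∀ i < 1 + A.lenS n, K.flagV P Y B D z j i = true := by
    intro j
    constructor
    · rintro ⟨h1, h2⟩ i hi
      unfold flagV
      split_ifs with h0
      · rw [hr, h1]
      · rw [actV, ← K.act.ext_eval _ (by omega : i - 1 < A.lenS n), h2,
          ext_rd_of_lt _ _ (by omega)]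
        simp
    · intro H
      refine ⟨?_, funext fun i => ?_⟩
      · have := H 0 (by omega)
        rwa [flagV, if_pos rfl, hr] at this
      · have := H (1 + i) (by omega)
        rw [flagV, if_neg (by omega), Nat.add_sub_cancel_left, actV, ← K.act.ext_eval _ i.2,
          ext_val] at this
        rw [rd]
        simpa using this
  constructor
  · intro H j hj
    refine (key j).2 fun i hi => ?_
    have h1 := mul_add_le hj (1 + A.lenS n)
    have := H (j * (1 + A.lenS n) + i) (by omega)
    have e1 : (j * (1 + A.lenS n) + i) / (1 + A.lenS n) = j := by
      rw [Nat.mul_comm, Nat.mul_add_div (by omega), Nat.div_eq_of_lt hi, Nat.add_zero]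
    have e2 : (j * (1 + A.lenS n) + i) % (1 + A.lenS n) = i := by
      rw [Nat.mul_comm, Nat.mul_add_mod, Nat.mod_eq_of_lt hi]
    rwa [e1, e2] at this
  · intro H i hi
    exact (key _).1 (H _ ((Nat.div_lt_iff_lt_mul (by omega)).2 hi)) _ (Nat.mod_lt _ (by omega))

end Kit

end QL

/-! ### Untwisting: removing the dependence of the group elements on the bits. -/

namespace QL

theorem setAt_apply {z : ℕ → Bool} {o l : ℕ} {v : ℕ → Bool} {i : ℕ} (h : o ≤ i) (h' : i < o + l) :
    setAt z o l v i = v (i - o) := if_pos ⟨h, h'⟩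

theorem xorAt_apply {z : ℕ → Bool} {o l : ℕ} {v : ℕ → Bool} {i : ℕ} (h : o ≤ i) (h' : i < o + l) :
    xorAt z o l v i = xor (z i) (v (i - o)) := if_pos ⟨h, h'⟩

theorem add_mul_div_eq {j l i : ℕ} (hi : i < l) : (j * l + i) / l = j := by
  rw [Nat.mul_comm, Nat.mul_add_div (by omega), Nat.div_eq_of_lt hi, Nat.add_zero]

theorem add_mul_mod_eq {j l i : ℕ} (hi : i < l) : (j * l + i) % l = i := by
  rw [Nat.mul_comm, Nat.mul_add_mod, Nat.mod_eq_of_lt hi]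

/-- Decomposition of a position in a region of `n` blocks of length `l`. -/
theorem exists_block {n l k : ℕ} (h : k < n * l) : ∃ j < n, ∃ i < l, k = j * l + i := by
  have hl : 0 < l := Nat.pos_of_ne_zero fun h0 => by simp [h0] at h
  exact ⟨k / l, (Nat.div_lt_iff_lt_mul hl).2 h, k % l, Nat.mod_lt _ hl, by
    rw [Nat.mul_comm]; exact (Nat.div_add_mod k l).symm⟩

theorem DetCirc.wires_of_eval {k k' : ℕ} (C : DetCirc k k') {x : Bits k} {y : Bits k'}
    (h : C.eval x = y) {i : ℕ} (hi : i < k') : C.wires x i = ext y i := by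
  rw [← C.ext_eval x hi, h]

namespace Kit

variable {A : GroupActionFamily} {n : ℕ} (K : Kit A n)

/-- Add to the blocks at `d` the blocks at `a`, multiplied from the right by the group element at
`b` if the bit at `B` is set. -/
def mulL (B a sa b d sd w : ℕ) : List (CGate ℕ) :=
  (List.range n).flatMap fun j => conjG (K.mul.load₂ (a + j * sa) b w)
    (selG (B + j) (a + j * sa) w (d + j * sd) (A.lenG n))

/-- The contribution to a block. -/
def mulV (B a sa b : ℕ) (z : ℕ → Bool) (j i : ℕ) : Bool :=
  if i < A.lenG n then if z (B + j) then
    K.mul.wires (Fin.append (rd z (a + j * sa) (A.lenG n)) (rd z b (A.lenG n))) i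
    else z (a + j * sa + i) else false

theorem onWires_mulL {p : ℕ → Prop} {B a sa b d sd w : ℕ} (hsa : A.lenG n ≤ sa)
    (hsd : A.lenG n ≤ sd) (hB : ∀ i, B ≤ i → i < B + n → p i)
    (ha : ∀ i, a ≤ i → i < a + n * sa → p i) (hb : ∀ i, b ≤ i → i < b + A.lenG n → p i)
    (hd : ∀ i, d ≤ i → i < d + n * sd → p i) (hw : ∀ i, w ≤ i → i < w + K.mul.width → p i) :
    OnWires p (K.mulL B a sa b d sd w) := by
  have h1 := K.mul.le_out
  refine .flatMap fun j hj => ?_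
  have h2 := mul_add_le hj sa
  have h3 := mul_add_le hj sd
  exact (K.mul.onWires_load₂ (fun i hi => ha _ (by omega) (by omega))
    (fun i hi => hb _ (by omega) (by omega)) fun i hi => hw _ (by omega) (by omega)).conjG
    (.selG (hB _ (by omega) (by omega)) (fun i hi => ha _ (by omega) (by omega))
      (fun i hi => hw _ (by omega) (by omega)) fun i hi => hd _ (by omega) (by omega))

theorem cexec_mulL {B a sa b d sd w : ℕ} (hsa : A.lenG n ≤ sa) (hsd : A.lenG n ≤ sd)
    (hBa : Disj B n a (n * sa)) (hBd : Disj B n d (n * sd)) (hbd : Disj b (A.lenG n) d (n * sd))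
    (had : Disj a (n * sa) d (n * sd)) (hBw : B + n ≤ w) (haw : a + n * sa ≤ w)
    (hbw : b + A.lenG n ≤ w) (hdw : d + n * sd ≤ w) {z : ℕ → Bool}
    (hz : ∀ i < K.mul.width, z (w + i) = false) :
    cexec (K.mulL B a sa b d sd w) z = xorAt z d (n * sd) fun i =>
      K.mulV B a sa b z (i / sd) (i % sd) := by
  have ho := K.mul.le_in
  have ho' := K.mul.le_out
  refine cexec_flatMap_xorAt (fun z => ∀ i < K.mul.width, z (w + i) = false) d sd n _
    (fun j z => K.mulV B a sa b z j) (fun j hj z hz => ?_)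
    (fun z u hz i hi => by rw [xorAt_of_not (by omega), hz i hi])
    (fun j hj z u _ i hi => ?_) hz
  · have h2 := mul_add_le hj sa
    have h3 := mul_add_le hj sd
    unfold Disj at *
    rw [cexec_conjG (o := d + j * sd) (l := A.lenG n)
      (v := fun i => K.mulV B a sa b z j i), xorAt_extend _ _ hsd]
    · refine xorAt_congr fun i hi => ?_
      unfold mulV
      split_ifs <;> rfl
    · exact K.mul.onWires_load₂ (fun i hi => by omega) (fun i hi => by omega) fun i hi => by omega
    · rw [K.mul.cexec_load₂ (by unfold Disj; omega) (by unfold Disj; omega) hz,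
        cexec_selG (by unfold Disj; omega) (by unfold Disj; omega) (by unfold Disj; omega)
          (by unfold Disj; omega)]
      refine xorAt_congr fun i hi => ?_
      unfold mulV
      rw [if_pos hi, setAt_of_not (by omega), setAt_add (by omega), setAt_of_not (by omega)]
  · have h2 := mul_add_le hj sa
    unfold Disj at *
    unfold mulV
    have e : xorAt z d (n * sd) u (B + j) = z (B + j) := xorAt_of_not (by omega)
    rw [e]
    split_ifs with h4 h5
    · rw [rd_xorAt_of_disj (by unfold Disj; omega), rd_xorAt_of_disj (by unfold Disj; omega)]
    · rw [xorAt_of_not (by omega)]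
    · rfl

/-- The positions of the regions of the full verification. -/
structure Layout (Γ P Y B D wi F c T w w' wm N : ℕ) : Prop where
  h1 : Γ + A.lenG n ≤ P
  h2 : P + (A.lenS n + A.lenS n) ≤ Y
  h3 : Y + n * A.lenS n ≤ B
  h4 : B + n ≤ D
  h5 : D + n * K.W ≤ wi
  h6 : wi + K.inv.width ≤ F
  h7 : F + (n * (1 + A.lenS n) + n) ≤ c
  h8 : c + (n * (1 + A.lenS n) + n + 1) ≤ T
  h9 : T + n * A.lenG n ≤ w
  h10 : w + K.act.width ≤ w'
  h11 : w' + K.recog.width ≤ wm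
  h12 : wm + K.mul.width ≤ N

/-- The classical computation of the full verification that precedes the Hadamard gates: compute
the flags of the copies and replace each group element by one that depends on the bit. -/
def untwistL (Γ P Y B D wi F T w w' wm : ℕ) : List (CGate ℕ) :=
  K.inv.load Γ wi ++ (K.flagsL P Y B D F w w' ++
    (K.mulL B D K.W Γ T (A.lenG n) wm ++ K.mulL B T (A.lenG n) wi D K.W wm))

variable {K} {Γ P Y B D wi F c T w w' wm N : ℕ}

/-- The predicate singles out the gap between the flags of the copies and `T`, which is reserved for
the flags of the bits and for the chain and has to stay zero during this stage. -/
theorem Layout.onWires (h : K.Layout Γ P Y B D wi F c T w w' wm N) :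
    OnWires (fun i => i < N ∧ ¬ (F + n * (1 + A.lenS n) ≤ i ∧ i < T) ∧ ¬ (B ≤ i ∧ i < B + n) ∨
      (B ≤ i ∧ i < B + n)) (K.untwistL Γ P Y B D wi F T w w' wm) := by
  obtain ⟨h1, h2, h3, h4, h5, h6, h7, h8, h9, h10, h11, h12⟩ := h
  have hG := K.lenG_le
  have hi := K.inv.le_out
  refine (K.inv.onWires_load (fun i _ => ?_) fun i _ => ?_).append
    ((K.onWires_flagsL ?_ ?_ ?_ ?_ ?_ ?_ ?_).append
      ((K.onWires_mulL hG le_rfl ?_ ?_ ?_ ?_ ?_).append (K.onWires_mulL le_rfl hG ?_ ?_ ?_ ?_ ?_)))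
  all_goals intros; omega

/-- The input of the full verification for elements `g` of the group and `s` of the set, when
the blocks hold the group elements `x`. -/
structure Input (K : Kit A n) (Γ P D wi N : ℕ) (g : A.G n) (s : A.S n) (x : ℕ → A.G n)
    (z : ℕ → Bool) : Prop where
  g_eq : rd z Γ (A.lenG n) = A.repG n g
  s_eq : rd z P (A.lenS n) = A.repS n s
  s'_eq : rd z (P + A.lenS n) (A.lenS n) = A.repS n (g • s)
  x_eq : ∀ j < n, rd z (D + j * K.W) (A.lenG n) = A.repG n (x j)
  zero : ∀ i, wi ≤ i → i < N → z i = false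

/-- The first multiplication writes `x_j`, times `g` if the bit is set, to `T`. The second one
multiplies by `g⁻¹` under the same condition, recovers `x_j` and adds it to the original block,
which thereby becomes zero. Right multiplication being invertible, the replacement leaves no trace
of the old element. -/
theorem Layout.cexec_untwistL (h : K.Layout Γ P Y B D wi F c T w w' wm N) {g : A.G n} {s : A.S n}
    {x : ℕ → A.G n} {z : ℕ → Bool} (hz : K.Input Γ P D wi N g s x z) {i : ℕ}
    (hi : ¬ (F ≤ i ∧ i < F + n * (1 + A.lenS n))) :
    cexec (K.untwistL Γ P Y B D wi F T w w' wm) z i =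
      if wi ≤ i ∧ i < wi + K.inv.width then K.inv.wires (A.repG n g) (i - wi) else
      if T ≤ i ∧ i < T + n * A.lenG n then
        ext (A.repG n (if z (B + (i - T) / A.lenG n) then x ((i - T) / A.lenG n) * g
          else x ((i - T) / A.lenG n))) ((i - T) % A.lenG n) else
      if D ≤ i ∧ i < D + n * K.W ∧ (i - D) % K.W < A.lenG n then false else z i := by
  obtain ⟨h1, h2, h3, h4, h5, h6, h7, h8, h9, h10, h11, h12⟩ := h
  have hG := K.lenG_le
  have hio := K.inv.le_out
  rw [untwistL, cexec_append, cexec_append, cexec_append,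
    K.inv.cexec_load' (by unfold Disj; omega) fun i hi => hz.zero _ (by omega) (by omega), hz.g_eq]
  set z1 := setAt z wi K.inv.width (K.inv.wires (A.repG n g)) with hz1
  rw [K.cexec_flagsL h2 h3 h4 (by omega) (by omega) h10 (fun i _ _ => by
    rw [hz1, setAt_of_not (by omega), hz.zero _ (by omega) (by omega)])]
  set z2 := xorAt z1 F (n * (1 + A.lenS n)) fun i =>
    K.flagV P Y B D z1 (i / (1 + A.lenS n)) (i % (1 + A.lenS n)) with hz2
  rw [K.cexec_mulL hG le_rfl (by unfold Disj; omega) (by unfold Disj; omega)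
    (by unfold Disj; omega) (by unfold Disj; omega) (by omega) (by omega) (by omega) (by omega)
    (fun i _ => by rw [hz2, xorAt_of_not (by omega), hz1, setAt_of_not (by omega),
      hz.zero _ (by omega) (by omega)])]
  set z3 := xorAt z2 T (n * A.lenG n) fun i =>
    K.mulV B D K.W Γ z2 (i / A.lenG n) (i % A.lenG n) with hz3
  rw [K.cexec_mulL le_rfl hG (by unfold Disj; omega) (by unfold Disj; omega)
    (by unfold Disj; omega) (by unfold Disj; omega) (by omega) (by omega) (by omega) (by omega)
    (fun i _ => by rw [hz3, xorAt_of_not (by omega), hz2, xorAt_of_not (by omega), hz1,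
      setAt_of_not (by omega), hz.zero _ (by omega) (by omega)])]
  have e1 : ∀ k, ¬ (F ≤ k ∧ k < F + n * (1 + A.lenS n)) → ¬ (wi ≤ k ∧ k < wi + K.inv.width) →
      z2 k = z k := fun k hk hk' => by
    rw [hz2, xorAt_of_not hk, hz1, setAt_of_not hk']
  have e2 : ∀ k, ¬ (F ≤ k ∧ k < F + n * (1 + A.lenS n)) → ¬ (wi ≤ k ∧ k < wi + K.inv.width) →
      ¬ (T ≤ k ∧ k < T + n * A.lenG n) → z3 k = z k := fun k hk hk' hk'' => by
    rw [hz3, xorAt_of_not hk'', e1 k hk hk']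
  have e3 : ∀ j < n, ∀ k < A.lenG n, z3 (T + j * A.lenG n + k) =
      ext (A.repG n (if z (B + j) then x j * g else x j)) k := by
    intro j hj k hk
    have := mul_add_le hj (A.lenG n)
    have := mul_add_le hj K.W
    rw [hz3, Nat.add_assoc, xorAt_add (by omega), add_mul_div_eq hk, add_mul_mod_eq hk,
      e1 _ (by omega) (by omega), hz.zero _ (by omega) (by omega), Bool.false_xor, mulV, if_pos hk,
      e1 (B + j) (by omega) (by omega),
      rd_congr (z := z2) (z' := z) fun i hi => e1 _ (by omega) (by omega), hz.x_eq j hj,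
      rd_congr (z := z2) (z' := z) fun i hi => e1 _ (by omega) (by omega), hz.g_eq]
    split_ifs
    · exact K.mul.wires_of_eval (K.mul_eval _ _) hk
    · rw [e1 _ (by omega) (by omega), ← hz.x_eq j hj, ext_rd_of_lt _ _ hk]
  have e4 : rd z3 wi (A.lenG n) = A.repG n g⁻¹ := by
    funext k
    rw [rd, hz3, xorAt_of_not (by omega), hz2, xorAt_of_not (by omega), hz1,
      setAt_add (by omega), K.inv.wires_of_eval (K.inv_eval g) k.2, ext_val]
  by_cases hD : D ≤ i ∧ i < D + n * K.W
  · obtain ⟨j, hj, k, hk, hjk⟩ := exists_block (show i - D < n * K.W by omega)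
    obtain rfl : i = D + (j * K.W + k) := by omega
    rw [if_neg (by omega), if_neg (by omega), xorAt_add (by omega), Nat.add_sub_cancel_left,
      add_mul_div_eq hk, add_mul_mod_eq hk, e2 _ (by omega) (by omega) (by omega)]
    -- The rest of a block holds the discarded wires of the superposition circuit. They stay as they
    -- are.
    by_cases hkG : k < A.lenG n
    · have hx : z (D + (j * K.W + k)) = ext (A.repG n (x j)) k := by
        rw [← hz.x_eq j hj, ext_rd_of_lt _ _ hkG, Nat.add_assoc]
      have ht : rd z3 (T + j * A.lenG n) (A.lenG n) =
          A.repG n (if z (B + j) then x j * g else x j) := by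
        funext k
        rw [rd, e3 j hj k k.2, ext_val]
      rw [if_pos ⟨hD.1, hD.2, hkG⟩, mulV, if_pos hkG, e2 (B + j) (by omega) (by omega) (by omega),
        e3 j hj k hkG, ht, e4, hx]
      split_ifs with hb
      · rw [K.mul.wires_of_eval (K.mul_eval _ _) hkG, mul_inv_cancel_right, Bool.xor_self]
      · rw [Bool.xor_self]
    · rw [if_neg (by omega), mulV, if_neg hkG, Bool.xor_false]
  · rw [xorAt_of_not hD]
    by_cases h13 : wi ≤ i ∧ i < wi + K.inv.width
    · rw [if_pos h13, hz3, xorAt_of_not (by omega), hz2, xorAt_of_not (by omega), hz1,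
        setAt_apply h13.1 h13.2]
    by_cases h14 : T ≤ i ∧ i < T + n * A.lenG n
    · obtain ⟨j, hj, k, hk, hjk⟩ := exists_block (show i - T < n * A.lenG n by omega)
      obtain rfl : i = T + (j * A.lenG n + k) := by omega
      rw [if_neg h13, if_pos h14, ← Nat.add_assoc, e3 j hj k hk, Nat.add_assoc,
        Nat.add_sub_cancel_left, add_mul_div_eq hk, add_mul_mod_eq hk]
    · rw [if_neg h13, if_neg h14, if_neg (by omega), e2 _ hi h13 h14]

/-- The flags do not depend on the work space. -/
theorem Layout.cexec_untwistL_flag (h : K.Layout Γ P Y B D wi F c T w w' wm N) {z : ℕ → Bool}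
    (hz : ∀ i, wi ≤ i → i < N → z i = false) {i : ℕ} (hi : i < n * (1 + A.lenS n)) :
    cexec (K.untwistL Γ P Y B D wi F T w w' wm) z (F + i) =
      K.flagV P Y B D z (i / (1 + A.lenS n)) (i % (1 + A.lenS n)) := by
  obtain ⟨h1, h2, h3, h4, h5, h6, h7, h8, h9, h10, h11, h12⟩ := h
  have hG := K.lenG_le
  have hio := K.inv.le_out
  rw [untwistL, cexec_append, cexec_append, cexec_append,
    cexec_apply_of_onWires (K.onWires_mulL (p := fun i => ¬ (F ≤ i ∧ i < F + n * (1 + A.lenS n)))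
      le_rfl hG ?_ ?_ ?_ ?_ ?_) _ (by omega),
    cexec_apply_of_onWires (K.onWires_mulL (p := fun i => ¬ (F ≤ i ∧ i < F + n * (1 + A.lenS n)))
      hG le_rfl ?_ ?_ ?_ ?_ ?_) _ (by omega),
    K.inv.cexec_load' (by unfold Disj; omega) fun i hi => hz _ (by omega) (by omega)]
  · set z1 := setAt z wi K.inv.width (K.inv.wires (rd z Γ (A.lenG n))) with hz1
    rw [K.cexec_flagsL h2 h3 h4 (by omega) (by omega) h10 (fun i _ _ => by
      rw [hz1, setAt_of_not (by omega), hz _ (by omega) (by omega)]), xorAt_add hi, hz1,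
      setAt_of_not (by omega), hz _ (by omega) (by omega), Bool.false_xor, ← hz1]
    have hj : i / (1 + A.lenS n) < n := (Nat.div_lt_iff_lt_mul (by omega)).2 hi
    have h8 := mul_add_le hj K.W
    have h9 := mul_add_le hj (A.lenS n)
    have hr : i % (1 + A.lenS n) < 1 + A.lenS n := Nat.mod_lt _ (by omega)
    have hrd : ∀ o l, o + l ≤ wi → rd z1 o l = rd z o l := fun o l hol =>
      rd_congr fun i hi => by rw [hz1, setAt_of_not (by omega)]
    unfold flagV actV selS
    rw [hrd _ _ (by omega), hz1, setAt_of_not (i := B + i / (1 + A.lenS n)) (by omega),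
      ← hz1]
    split_ifs with h13 h14
    · rfl
    · rw [hrd _ _ (by omega), hz1, setAt_of_not (by omega)]
    · rw [hrd _ _ (by omega), hz1, setAt_of_not (by omega)]
  all_goals intros; omega

end Kit

end QL

/-! ### The circuits of the scheme and the layout of their wires. -/

namespace QL

theorem labels_lt_of_onWires {w : ℕ} {L : List (CGate ℕ)} (h : OnWires (· < w) L) :
    ∀ g ∈ L.map Gate.classical, ∀ i ∈ g.labels, i < w := by
  intro g hg i hi
  obtain ⟨g', hg', rfl⟩ := List.mem_map.1 hg
  exact h g' hg' i (by rwa [Gate.labels_classical] at hi)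

theorem labels_lt_append {w : ℕ} {L M : List (Gate ℕ)} (hL : ∀ g ∈ L, ∀ i ∈ g.labels, i < w)
    (hM : ∀ g ∈ M, ∀ i ∈ g.labels, i < w) : ∀ g ∈ L ++ M, ∀ i ∈ g.labels, i < w := by
  intro g hg
  rcases List.mem_append.1 hg with h | h
  exacts [hL g h, hM g h]

theorem labels_lt_hadG {w o m : ℕ} (h : o + m ≤ w) : ∀ g ∈ hadG o m, ∀ i ∈ g.labels, i < w := by
  intro g hg i hi
  obtain ⟨j, hj, hg⟩ := List.mem_flatMap.1 hg
  rw [List.mem_range] at hj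
  rw [List.mem_singleton] at hg
  subst hg
  simp only [Gate.labels, List.mem_singleton] at hi
  omega

/-- Classical gates on wires labelled by numbers, as a classical circuit on `w + 1` wires. -/
def detCirc {k k' : ℕ} (w : ℕ) (L : List (CGate ℕ)) (h : k ≤ w) (h' : k' ≤ w) : DetCirc k k' where
  width := w + 1
  le_in := by omega
  le_out := by omega
  gates := L.map (CGate.map (Fin.ofNat (w + 1)))

/-- Gates on wires labelled by numbers, as a circuit on `w + 1` wires. -/
def circ {kin qin kout qout : ℕ} (w : ℕ) (L : List (Gate ℕ)) (h : kin + qin ≤ w)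
    (h' : kout + qout ≤ w) : Circ kin qin kout qout where
  width := w + 1
  le_in := by omega
  le_out := by omega
  gates := toFin (w + 1) L

theorem toFin_classical {w : ℕ} [NeZero w] (L : List (CGate ℕ)) :
    toFin w (L.map Gate.classical) = (L.map (CGate.map (Fin.ofNat w))).map Gate.classical := by
  rw [toFin, List.map_map, List.map_map]; rfl

theorem detCirc_gates {k k' w : ℕ} {L : List (CGate ℕ)} (h : k ≤ w) (h' : k' ≤ w)
    (hL : OnWires (· < w + 1) L) :
    (detCirc w L h h').toCirc.gates.map (Gate.map Fin.val) = L.map Gate.classical := by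
  rw [← map_val_toFin (w := w + 1) (labels_lt_of_onWires hL), toFin_classical]; rfl

theorem circ_gates {kin qin kout qout w : ℕ} {L : List (Gate ℕ)} (h : kin + qin ≤ w)
    (h' : kout + qout ≤ w) (hL : ∀ g ∈ L, ∀ i ∈ g.labels, i < w + 1) :
    (circ w L h h').gates.map (Gate.map Fin.val) = L :=
  map_val_toFin (w := w + 1) hL

theorem detCirc_eval {k k' w : ℕ} {L : List (CGate ℕ)} (h : k ≤ w) (h' : k' ≤ w)
    (hL : OnWires (· < w + 1) L) (x : Bits k) (i : Fin k') :
    (detCirc w L h h').eval x i = cexec L (ext x) i := by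
  have e : (detCirc w L h h').gatesN = L := by
    have := detCirc_gates h h' hL
    simp only [DetCirc.toCirc, List.map_map] at this
    have h2 : List.map Gate.classical (detCirc w L h h').gatesN = L.map Gate.classical := by
      rw [← this, DetCirc.gatesN, List.map_map]; rfl
    exact List.map_injective_iff.2 (fun a b hab => by injection hab) h2
  rw [← ext_val ((detCirc w L h h').eval x), DetCirc.ext_eval _ _ i.2, DetCirc.wires, e]

namespace Kit

variable {A : GroupActionFamily} {n : ℕ} (K : Kit A n)

/-! #### Setup -/

/-- Layout of the key generation: secret and public key come first, with total length `gC`; then the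
coins, and the work spaces of the two samplers and of the action. -/
def gC (A : GroupActionFamily) (n : ℕ) : ℕ :=
  (A.lenG n + (A.lenS n + A.lenS n)) + (A.lenS n + A.lenS n)
def gG : ℕ := gC A n + (K.kG + K.kS)
def gS : ℕ := K.gG + K.sampleG.width
def gA : ℕ := K.gS + K.sampleS.width
def gN : ℕ := K.gA + K.act.width

/-- The classical part of the key generation. -/
def setupL : List (CGate ℕ) :=
  K.sampleG.load (gC A n) K.gG ++ (K.sampleS.load (gC A n + K.kG) K.gS ++
    (K.act.load₂ K.gG K.gS K.gA ++ (copyG K.gG 0 (A.lenG n) ++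
      (copyG K.gS (A.lenG n) (A.lenS n) ++ (copyG K.gA (A.lenG n + A.lenS n) (A.lenS n) ++
        (copyG K.gS (A.lenG n + (A.lenS n + A.lenS n)) (A.lenS n) ++
          copyG K.gA (A.lenG n + (A.lenS n + A.lenS n) + A.lenS n) (A.lenS n)))))))

theorem onWires_setupL : OnWires (· < K.gN + 1) K.setupL := by
  have h1 := K.sampleG.le_out
  have h2 := K.sampleS.le_out
  have h3 := K.act.le_out
  have e : gC A n = (A.lenG n + (A.lenS n + A.lenS n)) + (A.lenS n + A.lenS n) := rfl
  have e1 : K.gG = gC A n + (K.kG + K.kS) := rfl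
  have e2 : K.gS = K.gG + K.sampleG.width := rfl
  have e3 : K.gA = K.gS + K.sampleS.width := rfl
  have e4 : K.gN = K.gA + K.act.width := rfl
  refine (K.sampleG.onWires_load ?_ ?_).append ((K.sampleS.onWires_load ?_ ?_).append
    ((K.act.onWires_load₂ ?_ ?_ ?_).append ((OnWires.copyG ?_ ?_).append ((OnWires.copyG ?_ ?_).append
      ((OnWires.copyG ?_ ?_).append ((OnWires.copyG ?_ ?_).append (.copyG ?_ ?_)))))))
  all_goals intros; omega

/-- The coins are prepared by Hadamard gates, serve only as controls, and end among the discarded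
wires, so that they behave like classical uniform bits. -/
def setupGates : List (Gate ℕ) := hadG (gC A n) (K.kG + K.kS) ++ K.setupL.map Gate.classical

def setup : Circ 0 0 ((A.lenG n + (A.lenS n + A.lenS n)) + (A.lenS n + A.lenS n)) 0 :=
  circ K.gN K.setupGates (by omega) (by unfold gN gA gS gG gC; omega)

theorem labels_setup : ∀ g ∈ K.setupGates, ∀ i ∈ g.labels, i < K.gN + 1 :=
  labels_lt_append (labels_lt_hadG (by unfold gN gA gS gG; omega))
    (labels_lt_of_onWires K.onWires_setupL)

/-! #### State generation -/

/-- The wires are laid out in the order of the output: public key and images form the serial number,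
bits and blocks the state. The public key stays in place, so the serial number repeats it. -/
def tY (A : GroupActionFamily) (n : ℕ) : ℕ := A.lenS n + A.lenS n
def tB (A : GroupActionFamily) (n : ℕ) : ℕ := tY A n + n * A.lenS n
def tD (A : GroupActionFamily) (n : ℕ) : ℕ := tB A n + n
def tw : ℕ := tD A n + n * K.W
def tN : ℕ := K.tw + K.act.width

/-- The superposition circuit on every block. -/
def supGates (D : ℕ) : List (Gate ℕ) := (List.range n).flatMap fun j =>
  (K.sup.gates.map (Gate.map Fin.val)).map (Gate.map (· + (D + j * K.W)))

def stateGates : List (Gate ℕ) := hadG (tB A n) n ++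
  (K.supGates (tD A n) ++ (K.ysL 0 (tY A n) (tB A n) (tD A n) K.tw).map Gate.classical)

def stateGen : Circ (A.lenS n + A.lenS n) 0 ((A.lenS n + A.lenS n) + n * A.lenS n) (n + n * K.W) :=
  circ K.tN K.stateGates (by unfold tN tw tD tB tY; omega) (by unfold tN tw tD tB tY; omega)

theorem onWires_stateL :
    OnWires (· < K.tN + 1) (K.ysL 0 (tY A n) (tB A n) (tD A n) K.tw) := by
  have e1 : tY A n = A.lenS n + A.lenS n := rfl
  have e2 : tB A n = tY A n + n * A.lenS n := rfl
  have e3 : tD A n = tB A n + n := rfl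
  have e4 : K.tw = tD A n + n * K.W := rfl
  have e5 : K.tN = K.tw + K.act.width := rfl
  refine K.onWires_ysL ?_ ?_ ?_ ?_ ?_
  all_goals intros; omega

theorem labels_state : ∀ g ∈ K.stateGates, ∀ i ∈ g.labels, i < K.tN + 1 := by
  refine labels_lt_append (labels_lt_hadG (by unfold tN tw tD; omega)) (labels_lt_append ?_
    (labels_lt_of_onWires K.onWires_stateL))
  intro g hg i hi
  obtain ⟨j, hj, hg⟩ := List.mem_flatMap.1 hg
  obtain ⟨g', hg', rfl⟩ := List.mem_map.1 hg
  obtain ⟨g'', hg'', rfl⟩ := List.mem_map.1 hg'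
  rw [Prog.Gate.labels_map, Prog.Gate.labels_map] at hi
  obtain ⟨i', hi', rfl⟩ := List.mem_map.1 hi
  obtain ⟨i'', hi'', rfl⟩ := List.mem_map.1 hi'
  have := mul_add_le (List.mem_range.1 hj) K.W
  have : (i'' : ℕ) < K.W := i''.2
  unfold tN tw
  omega

/-! #### Deletion -/

/-- No gates are needed: the measurement of the output wires in the computational basis is the
deletion. -/
def del : Circ 0 (n + n * K.W) (n + n * K.W) 0 where
  width := n + n * K.W
  le_in := by omega
  le_out := by omega
  gates := []

/-! #### Semi-verification -/

/-- Four set elements precede the images: the public key and its repetition in the serial number.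
Only the former is used, so nothing is taken on trust from the serial number except the images. -/
def sY (A : GroupActionFamily) (n : ℕ) : ℕ := (A.lenS n + A.lenS n) + (A.lenS n + A.lenS n)
def sB (A : GroupActionFamily) (n : ℕ) : ℕ := sY A n + n * A.lenS n
def sD (A : GroupActionFamily) (n : ℕ) : ℕ := sB A n + n
def sF : ℕ := sD A n + n * K.W
def sc : ℕ := K.sF + n * (1 + A.lenS n) + 1
def sw : ℕ := K.sc + (n * (1 + A.lenS n) + 1)
def sw' : ℕ := K.sw + K.act.width
def sN : ℕ := K.sw' + K.recog.width

def semiL : List (CGate ℕ) :=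
  K.flagsL 0 (sY A n) (sB A n) (sD A n) K.sF K.sw K.sw' ++
    (chainG K.sF K.sc (n * (1 + A.lenS n)) ++ swapG 0 (K.sc + n * (1 + A.lenS n)) 1)

theorem onWires_semiL : OnWires (· < K.sN + 1) K.semiL := by
  have e1 : sY A n = (A.lenS n + A.lenS n) + (A.lenS n + A.lenS n) := rfl
  have e2 : sB A n = sY A n + n * A.lenS n := rfl
  have e3 : sD A n = sB A n + n := rfl
  have e4 : K.sF = sD A n + n * K.W := rfl
  have e5 : K.sc = K.sF + n * (1 + A.lenS n) + 1 := rfl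
  have e6 : K.sw = K.sc + (n * (1 + A.lenS n) + 1) := rfl
  have e7 : K.sw' = K.sw + K.act.width := rfl
  have e8 : K.sN = K.sw' + K.recog.width := rfl
  refine (K.onWires_flagsL ?_ ?_ ?_ ?_ ?_ ?_ ?_).append ((OnWires.chainG ?_ ?_).append
    (.swapG ?_ ?_))
  all_goals intros; omega

def semiVer : DetCirc ((A.lenS n + A.lenS n) + ((A.lenS n + A.lenS n) + n * A.lenS n) +
    (n + n * K.W)) 1 :=
  detCirc K.sN K.semiL (by unfold sN sw' sw sc sF sD sB sY; omega) (by unfold sN sw' sw; omega)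

/-! #### Full verification -/

/-- As for the semi-verification, the two set elements are taken from the key, here the secret one
behind `g`, and not from the serial number. -/
def fY (A : GroupActionFamily) (n : ℕ) : ℕ :=
  A.lenG n + (A.lenS n + A.lenS n) + (A.lenS n + A.lenS n)
def fB (A : GroupActionFamily) (n : ℕ) : ℕ := fY A n + n * A.lenS n
def fD (A : GroupActionFamily) (n : ℕ) : ℕ := fB A n + n
def fI : ℕ := fD A n + n * K.W
def fF : ℕ := K.fI + K.inv.width
def fc : ℕ := K.fF + (n * (1 + A.lenS n) + n) + 1
def fT : ℕ := K.fc + (n * (1 + A.lenS n) + n + 1)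
def fw : ℕ := K.fT + n * A.lenG n
def fw' : ℕ := K.fw + K.act.width
def fm : ℕ := K.fw' + K.recog.width
def fN : ℕ := K.fm + K.mul.width

theorem layout : K.Layout 0 (A.lenG n) (fY A n) (fB A n) (fD A n) K.fI K.fF K.fc K.fT K.fw K.fw'
    K.fm (K.fN + 1) := by
  constructor
  · omega
  · unfold fY; omega
  · exact le_rfl
  · exact le_rfl
  · exact le_rfl
  · exact le_rfl
  · exact Nat.le_succ _
  · exact le_rfl
  · exact le_rfl
  · exact le_rfl
  · exact le_rfl
  · exact Nat.le_succ _

def fullL : List (CGate ℕ) :=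
  K.untwistL 0 (A.lenG n) (fY A n) (fB A n) (fD A n) K.fI K.fF K.fT K.fw K.fw' K.fm

/-- The stage after the Hadamard gates: the negated bits are appended to the flags of the copies,
the conjunction of all flags is formed, and the answer is brought to the output wire. -/
def fullL' : List (CGate ℕ) :=
  copyG (fB A n) (K.fF + n * (1 + A.lenS n)) n ++ (notG (K.fF + n * (1 + A.lenS n)) n ++
    (chainG K.fF K.fc (n * (1 + A.lenS n) + n) ++ swapG 0 (K.fc + (n * (1 + A.lenS n) + n)) 1))

theorem onWires_fullL : OnWires (· < K.fN + 1) K.fullL := by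
  have h := K.layout
  refine h.onWires.mono fun i hi => ?_
  have := h.h4
  have := h.h5
  have := h.h6
  have := h.h7
  have := h.h8
  have := h.h9
  have := h.h10
  have := h.h11
  have := h.h12
  omega

theorem onWires_fullL' : OnWires (· < K.fN + 1) K.fullL' := by
  obtain ⟨h1, h2, h3, h4, h5, h6, h7, h8, h9, h10, h11, h12⟩ := K.layout
  refine (OnWires.copyG ?_ ?_).append ((OnWires.notG ?_).append ((OnWires.chainG ?_ ?_).append
    (.swapG ?_ ?_)))
  all_goals intros; omega

def fullGates : List (Gate ℕ) :=
  K.fullL.map Gate.classical ++ (hadG (fB A n) n ++ K.fullL'.map Gate.classical)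

theorem labels_full : ∀ g ∈ K.fullGates, ∀ i ∈ g.labels, i < K.fN + 1 :=
  labels_lt_append (labels_lt_of_onWires K.onWires_fullL) (labels_lt_append
    (labels_lt_hadG (by unfold fN fm fw' fw fT fc fF fI fD; omega))
    (labels_lt_of_onWires K.onWires_fullL'))

def fullVer : Circ ((A.lenG n + (A.lenS n + A.lenS n)) + ((A.lenS n + A.lenS n) + n * A.lenS n))
    (n + n * K.W) 1 0 :=
  circ K.fN K.fullGates (by unfold fN fm fw' fw fT fc fF fI fD fB fY; omega)
    (by unfold fN fm fw' fw fT fc; omega)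

end Kit

/-! ### Uniformity -/

/-- Families of circuits for the algorithms of a group action that are generated in polynomial
time. -/
structure UniformKit {A : GroupActionFamily} (K : ∀ n, Kit A n) : Prop where
  lenG : GenNum 1 fun e => A.lenG (e 0)
  lenS : GenNum 1 fun e => A.lenS (e 0)
  kG : GenNum 1 fun e => (K (e 0)).kG
  kS : GenNum 1 fun e => (K (e 0)).kS
  wMul : GenNum 1 fun e => (K (e 0)).mul.width
  wInv : GenNum 1 fun e => (K (e 0)).inv.width
  wAct : GenNum 1 fun e => (K (e 0)).act.width
  wRecog : GenNum 1 fun e => (K (e 0)).recog.width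
  wSampleG : GenNum 1 fun e => (K (e 0)).sampleG.width
  wSampleS : GenNum 1 fun e => (K (e 0)).sampleS.width
  wSup : GenNum 1 fun e => (K (e 0)).sup.width
  mul : GenC 1 fun e => (K (e 0)).mul.gatesN
  inv : GenC 1 fun e => (K (e 0)).inv.gatesN
  act : GenC 1 fun e => (K (e 0)).act.gatesN
  recog : GenC 1 fun e => (K (e 0)).recog.gatesN
  sampleG : GenC 1 fun e => (K (e 0)).sampleG.gatesN
  sampleS : GenC 1 fun e => (K (e 0)).sampleS.gatesN
  sup : GenGates 1 fun e => (K (e 0)).sup.gates.map (Gate.map Fin.val)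

theorem DetUniform.gen {k k' : ℕ → ℕ} {C : ∀ n, DetCirc (k n) (k' n)} (h : DetUniform C) :
    GenC 1 (fun e => (C (e 0)).gatesN) ∧ GenNum 1 (fun e => k (e 0)) ∧
      GenNum 1 (fun e => k' (e 0)) ∧ GenNum 1 (fun e => (C (e 0)).width) := by
  obtain ⟨h1, h2, _, h4, _, h6⟩ := Uniform.gen h
  refine ⟨h1.congr fun e => ?_, h2, h4, h6⟩
  simp only [DetCirc.gatesN, List.map_map]
  rfl

open Classical in
theorem GroupActionFamily.HasEfficientAlgorithms.exists_kit {A : GroupActionFamily}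
    (h : A.HasEfficientAlgorithms) : ∃ K : ∀ n, Kit A n, UniformKit K ∧
      (Negligible fun n => statDist (K n).sampleG.coinDist (A.unifG n)) ∧
      (Negligible fun n => statDist (K n).sampleS.coinDist (A.unifS n)) ∧
      Negligible fun n => traceDist ((K n).sup.run noBits noQubits noBits) (A.densG n) := by
  obtain ⟨-, -, ⟨mul, mulU, hmul⟩, ⟨inv, invU, hinv⟩, ⟨act, actU, hact⟩, ⟨recog, recU, hrec⟩, -,
    ⟨kG, sG, sGU, hsG⟩, ⟨kS, sS, sSU, hsS⟩, ⟨sup, supU, hsup⟩⟩ := h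
  refine ⟨fun n => ⟨kG n, kS n, mul n, inv n, act n, recog n, sG n, sS n, sup n, hmul n, hinv n,
    hact n, hrec n⟩, ?_, hsG, hsS, hsup⟩
  obtain ⟨m1, -, m3, m4⟩ := mulU.gen
  obtain ⟨i1, -, -, i4⟩ := invU.gen
  obtain ⟨a1, -, a3, a4⟩ := actU.gen
  obtain ⟨r1, -, -, r4⟩ := recU.gen
  obtain ⟨g1, g2, -, g4⟩ := sGU.gen
  obtain ⟨s1, s2, -, s4⟩ := sSU.gen
  obtain ⟨p1, -, -, -, -, p6⟩ := supU.gen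
  exact ⟨m3, a3, g2, s2, m4, i4, a4, r4, g4, s4, p6, m1, i1, a1, r1, g1, s1, p1⟩

end QL

/-! ### Polynomial-time generation of the circuits of the scheme. -/

namespace QL

theorem genNum_id : GenNum 1 fun e => e 0 := GenNum.var (by omega)

theorem genNum_one : GenNum (1 + 1) fun e => e 1 := GenNum.var (by omega)

namespace UniformKit

variable {A : GroupActionFamily} {K : ∀ n, Kit A n}


theorem load {k k' : ℕ → ℕ} {C : ∀ n, DetCirc (k n) (k' n)} (hk : GenNum 1 fun e => k (e 0))
    (hC : GenC 1 fun e => (C (e 0)).gatesN) (m : ℕ) {a w : (ℕ → ℕ) → ℕ}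
    (ha : GenNum (1 + m) a) (hw : GenNum (1 + m) w) :
    GenC (1 + m) fun e => (C (e 0)).load (a e) (w e) :=
  (GenC.copyG ha hw (hk.weaken m)).append ((hC.weaken m).shiftG hw)

theorem load₂ {k l k' : ℕ → ℕ} {C : ∀ n, DetCirc (k n + l n) (k' n)}
    (hk : GenNum 1 fun e => k (e 0)) (hl : GenNum 1 fun e => l (e 0))
    (hC : GenC 1 fun e => (C (e 0)).gatesN) (m : ℕ) {a b w : (ℕ → ℕ) → ℕ}
    (ha : GenNum (1 + m) a) (hb : GenNum (1 + m) b) (hw : GenNum (1 + m) w) :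
    GenC (1 + m) fun e => (C (e 0)).load₂ (a e) (b e) (w e) :=
  ((GenC.copyG ha hw (hk.weaken m)).append (.copyG hb (hw.add (hk.weaken m)) (hl.weaken m))).append
    ((hC.weaken m).shiftG hw)

/-- Position of the block that is the last variable. -/
theorem block {d sd : (ℕ → ℕ) → ℕ} (hd : GenNum 1 d) (hsd : GenNum 1 sd) :
    GenNum (1 + 1) fun e => d e + e 1 * sd e :=
  (hd.weaken 1).add (genNum_one.mul (hsd.weaken 1))

/-- Variable `0` is the security parameter and variable `1` the index of the copy, over which the
lists `ysL` and `flagsL` then loop. -/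
theorem actL (h : UniformKit K) {P B D w : ℕ → ℕ} (hP : GenNum 1 fun e => P (e 0)) (hB : GenNum 1 fun e => B (e 0))
    (hD : GenNum 1 fun e => D (e 0)) (hw : GenNum 1 fun e => w (e 0)) :
    GenC (1 + 1) fun e => (K (e 0)).actL (P (e 0)) (B (e 0)) (D (e 0)) (w (e 0)) (e 1) :=
  ((GenC.copyG (block hD h.wSup) (hw.weaken 1) (h.lenG.weaken 1)).append
    (.selG ((hB.weaken 1).add genNum_one) (hP.weaken 1) ((hP.weaken 1).add (h.lenS.weaken 1))
      ((hw.weaken 1).add (h.lenG.weaken 1)) (h.lenS.weaken 1))).append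
    ((h.act.weaken 1).shiftG (hw.weaken 1))

theorem ysL (h : UniformKit K) {P Y B D w : ℕ → ℕ} (hP : GenNum 1 fun e => P (e 0)) (hY : GenNum 1 fun e => Y (e 0))
    (hB : GenNum 1 fun e => B (e 0)) (hD : GenNum 1 fun e => D (e 0))
    (hw : GenNum 1 fun e => w (e 0)) :
    GenC 1 fun e => (K (e 0)).ysL (P (e 0)) (Y (e 0)) (B (e 0)) (D (e 0)) (w (e 0)) :=
  GenC.flatMap (L := fun e j => conjG ((K (e 0)).actL (P (e 0)) (B (e 0)) (D (e 0)) (w (e 0)) j)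
    (copyG (w (e 0)) (Y (e 0) + j * A.lenS (e 0)) (A.lenS (e 0)))) genNum_id
    ((h.actL hP hB hD hw).conjG (.copyG (hw.weaken 1) (block hY h.lenS) (h.lenS.weaken 1)))
    fun _ _ _ => rfl

theorem flagsL (h : UniformKit K) {P Y B D F w w' : ℕ → ℕ} (hP : GenNum 1 fun e => P (e 0))
    (hY : GenNum 1 fun e => Y (e 0)) (hB : GenNum 1 fun e => B (e 0))
    (hD : GenNum 1 fun e => D (e 0)) (hF : GenNum 1 fun e => F (e 0))
    (hw : GenNum 1 fun e => w (e 0)) (hw' : GenNum 1 fun e => w' (e 0)) :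
    GenC 1 fun e => (K (e 0)).flagsL (P (e 0)) (Y (e 0)) (B (e 0)) (D (e 0)) (F (e 0)) (w (e 0))
      (w' (e 0)) := by
  have hf := block hF ((GenNum.const 1 1).add h.lenS)
  have hf1 := hf.add (GenNum.const (1 + 1) 1)
  have hS := h.lenS.weaken 1
  exact GenC.flatMap (L := fun e j =>
    conjG ((K (e 0)).actL (P (e 0)) (B (e 0)) (D (e 0)) (w (e 0)) j ++
        (K (e 0)).recog.load (D (e 0) + j * (K (e 0)).W) (w' (e 0)))
      (copyG (w' (e 0)) (F (e 0) + j * (1 + A.lenS (e 0))) 1 ++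
        (copyG (w (e 0)) (F (e 0) + j * (1 + A.lenS (e 0)) + 1) (A.lenS (e 0)) ++
        (copyG (Y (e 0) + j * A.lenS (e 0)) (F (e 0) + j * (1 + A.lenS (e 0)) + 1) (A.lenS (e 0)) ++
          notG (F (e 0) + j * (1 + A.lenS (e 0)) + 1) (A.lenS (e 0)))))) genNum_id
    (((h.actL hP hB hD hw).append (load (C := fun n => (K n).recog) h.lenG h.recog 1
      (block hD h.wSup) (hw'.weaken 1))).conjG ((GenC.copyG (hw'.weaken 1) hf (.const _ 1)).append
        ((GenC.copyG (hw.weaken 1) hf1 hS).append ((GenC.copyG (block hY h.lenS) hf1 hS).append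
          (.notG hf1 hS))))) fun _ _ _ => rfl

theorem mulL (h : UniformKit K) {B a sa b d sd w : ℕ → ℕ} (hB : GenNum 1 fun e => B (e 0))
    (ha : GenNum 1 fun e => a (e 0)) (hsa : GenNum 1 fun e => sa (e 0))
    (hb : GenNum 1 fun e => b (e 0)) (hd : GenNum 1 fun e => d (e 0))
    (hsd : GenNum 1 fun e => sd (e 0)) (hw : GenNum 1 fun e => w (e 0)) :
    GenC 1 fun e => (K (e 0)).mulL (B (e 0)) (a (e 0)) (sa (e 0)) (b (e 0)) (d (e 0)) (sd (e 0))
      (w (e 0)) :=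
  GenC.flatMap (L := fun e j => conjG
    ((K (e 0)).mul.load₂ (a (e 0) + j * sa (e 0)) (b (e 0)) (w (e 0)))
    (selG (B (e 0) + j) (a (e 0) + j * sa (e 0)) (w (e 0)) (d (e 0) + j * sd (e 0))
      (A.lenG (e 0)))) genNum_id
    ((load₂ (C := fun n => (K n).mul) h.lenG h.lenG h.mul 1 (block ha hsa) (hb.weaken 1)
      (hw.weaken 1)).conjG (.selG ((hB.weaken 1).add genNum_one) (block ha hsa) (hw.weaken 1)
        (block hd hsd) (h.lenG.weaken 1))) fun _ _ _ => rfl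

theorem hadG {o m : (ℕ → ℕ) → ℕ} (ho : GenNum 1 o) (hm : GenNum 1 m) :
    GenGates 1 fun e => hadG (o e) (m e) :=
  (GenGates.flatMap hm (GenGates.had ((ho.weaken 1).add genNum_one))).congr fun e => by
    simp only [QL.hadG]
    refine List.flatMap_congr fun j _ => ?_
    rw [ho.apply_update le_rfl, Function.update_self]


theorem gC (h : UniformKit K) : GenNum 1 fun e => Kit.gC A (e 0) :=
  (h.lenG.add (h.lenS.add h.lenS)).add (h.lenS.add h.lenS)

theorem gG (h : UniformKit K) : GenNum 1 fun e => (K (e 0)).gG := h.gC.add (h.kG.add h.kS)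
theorem gS (h : UniformKit K) : GenNum 1 fun e => (K (e 0)).gS := h.gG.add h.wSampleG
theorem gA (h : UniformKit K) : GenNum 1 fun e => (K (e 0)).gA := h.gS.add h.wSampleS
theorem gN (h : UniformKit K) : GenNum 1 fun e => (K (e 0)).gN + 1 := (h.gA.add h.wAct).add (.const 1 1)

theorem setupL (h : UniformKit K) : GenC 1 fun e => (K (e 0)).setupL :=
  (load (C := fun n => (K n).sampleG) h.kG h.sampleG 0 h.gC h.gG).append
    ((load (C := fun n => (K n).sampleS) h.kS h.sampleS 0 (h.gC.add h.kG) h.gS).append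
      ((load₂ (C := fun n => (K n).act) h.lenG h.lenS h.act 0 h.gG h.gS h.gA).append
        ((GenC.copyG h.gG (.const 1 0) h.lenG).append ((GenC.copyG h.gS h.lenG h.lenS).append
          ((GenC.copyG h.gA (h.lenG.add h.lenS) h.lenS).append
            ((GenC.copyG h.gS (h.lenG.add (h.lenS.add h.lenS)) h.lenS).append
              (.copyG h.gA ((h.lenG.add (h.lenS.add h.lenS)).add h.lenS) h.lenS)))))))

theorem setup (h : UniformKit K) : Uniform fun n => (K n).setup :=
  uniform_of_gen (fun n => (K n).setupGates) (fun n => (K n).gN + 1) (.const 1 0) (.const 1 0)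
    h.gC (.const 1 0) h.gN (GenGates.append (hadG h.gC (h.kG.add h.kS)) h.setupL)
    (fun _ => rfl) fun n => circ_gates _ _ (K n).labels_setup

theorem tY (h : UniformKit K) : GenNum 1 fun e => Kit.tY A (e 0) := h.lenS.add h.lenS
theorem tB (h : UniformKit K) : GenNum 1 fun e => Kit.tB A (e 0) := h.tY.add (genNum_id.mul h.lenS)
theorem tD (h : UniformKit K) : GenNum 1 fun e => Kit.tD A (e 0) := h.tB.add genNum_id
theorem tw (h : UniformKit K) : GenNum 1 fun e => (K (e 0)).tw := h.tD.add (genNum_id.mul h.wSup)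
theorem tN (h : UniformKit K) : GenNum 1 fun e => (K (e 0)).tN + 1 := (h.tw.add h.wAct).add (.const 1 1)

theorem blocks (h : UniformKit K) : GenNum 1 fun e => e 0 + e 0 * (K (e 0)).W :=
  genNum_id.add (genNum_id.mul h.wSup)

theorem snum (h : UniformKit K) : GenNum 1 fun e => (A.lenS (e 0) + A.lenS (e 0)) + e 0 * A.lenS (e 0) :=
  (h.lenS.add h.lenS).add (genNum_id.mul h.lenS)

theorem stateGen (h : UniformKit K) : Uniform fun n => (K n).stateGen := by
  refine uniform_of_gen (fun n => (K n).stateGates) (fun n => (K n).tN + 1) (h.lenS.add h.lenS)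
    (.const 1 0) h.snum h.blocks h.tN (GenGates.append (hadG h.tB genNum_id) (GenGates.append ?_
    (h.ysL (P := fun _ => 0) (Y := Kit.tY A) (B := Kit.tB A) (D := Kit.tD A)
      (w := fun n => (K n).tw) (.const 1 0) h.tY h.tB h.tD h.tw)))
    (fun _ => rfl) fun n => circ_gates _ _ (K n).labels_state
  exact (GenGates.flatMap genNum_id ((h.sup.weaken 1).shift (block h.tD h.wSup))).congr fun e => rfl

theorem del (h : UniformKit K) : Uniform fun n => (K n).del :=
  uniform_of_gen (fun _ => []) (fun n => n + n * (K n).W) (.const 1 0) h.blocks h.blocks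
    (.const 1 0) h.blocks (.nil 1) (fun _ => rfl) fun _ => rfl

theorem sY (h : UniformKit K) : GenNum 1 fun e => Kit.sY A (e 0) := (h.lenS.add h.lenS).add (h.lenS.add h.lenS)
theorem sB (h : UniformKit K) : GenNum 1 fun e => Kit.sB A (e 0) := h.sY.add (genNum_id.mul h.lenS)
theorem sD (h : UniformKit K) : GenNum 1 fun e => Kit.sD A (e 0) := h.sB.add genNum_id
theorem sF (h : UniformKit K) : GenNum 1 fun e => (K (e 0)).sF := h.sD.add (genNum_id.mul h.wSup)
theorem flags (h : UniformKit K) : GenNum 1 fun e => e 0 * (1 + A.lenS (e 0)) :=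
  genNum_id.mul ((GenNum.const 1 1).add h.lenS)
theorem sc (h : UniformKit K) : GenNum 1 fun e => (K (e 0)).sc := (h.sF.add h.flags).add (.const 1 1)
theorem sw (h : UniformKit K) : GenNum 1 fun e => (K (e 0)).sw := h.sc.add (h.flags.add (.const 1 1))
theorem sw' (h : UniformKit K) : GenNum 1 fun e => (K (e 0)).sw' := h.sw.add h.wAct
theorem sN (h : UniformKit K) : GenNum 1 fun e => (K (e 0)).sN + 1 := (h.sw'.add h.wRecog).add (.const 1 1)

theorem semiL (h : UniformKit K) : GenC 1 fun e => (K (e 0)).semiL :=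
  (h.flagsL (P := fun _ => 0) (Y := Kit.sY A) (B := Kit.sB A) (D := Kit.sD A)
    (F := fun n => (K n).sF) (w := fun n => (K n).sw) (w' := fun n => (K n).sw') (.const 1 0) h.sY h.sB h.sD h.sF h.sw h.sw').append
    ((GenC.chainG h.sF h.sc h.flags).append (.swapG (.const 1 0) (h.sc.add h.flags) (.const 1 1)))

theorem semiVer (h : UniformKit K) : DetUniform fun n => (K n).semiVer :=
  uniform_of_gen (fun n => (K n).semiL.map Gate.classical) (fun n => (K n).sN + 1)
    ((h.lenS.add h.lenS).add h.snum |>.add h.blocks) (.const 1 0) (.const 1 1) (.const 1 0) h.sN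
    h.semiL (fun _ => rfl) fun n => detCirc_gates _ _ (K n).onWires_semiL

theorem fY (h : UniformKit K) : GenNum 1 fun e => Kit.fY A (e 0) :=
  (h.lenG.add (h.lenS.add h.lenS)).add (h.lenS.add h.lenS)
theorem fB (h : UniformKit K) : GenNum 1 fun e => Kit.fB A (e 0) := h.fY.add (genNum_id.mul h.lenS)
theorem fD (h : UniformKit K) : GenNum 1 fun e => Kit.fD A (e 0) := h.fB.add genNum_id
theorem fI (h : UniformKit K) : GenNum 1 fun e => (K (e 0)).fI := h.fD.add (genNum_id.mul h.wSup)
theorem fF (h : UniformKit K) : GenNum 1 fun e => (K (e 0)).fF := h.fI.add h.wInv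
theorem fc (h : UniformKit K) : GenNum 1 fun e => (K (e 0)).fc :=
  (h.fF.add (h.flags.add genNum_id)).add (.const 1 1)
theorem fT (h : UniformKit K) : GenNum 1 fun e => (K (e 0)).fT := h.fc.add ((h.flags.add genNum_id).add (.const 1 1))
theorem fw (h : UniformKit K) : GenNum 1 fun e => (K (e 0)).fw := h.fT.add (genNum_id.mul h.lenG)
theorem fw' (h : UniformKit K) : GenNum 1 fun e => (K (e 0)).fw' := h.fw.add h.wAct
theorem fm (h : UniformKit K) : GenNum 1 fun e => (K (e 0)).fm := h.fw'.add h.wRecog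
theorem fN (h : UniformKit K) : GenNum 1 fun e => (K (e 0)).fN + 1 := (h.fm.add h.wMul).add (.const 1 1)

theorem fullL (h : UniformKit K) : GenC 1 fun e => (K (e 0)).fullL :=
  (load (C := fun n => (K n).inv) h.lenG h.inv 0 (.const 1 0) h.fI).append
    ((h.flagsL (P := A.lenG) (Y := Kit.fY A) (B := Kit.fB A) (D := Kit.fD A)
      (F := fun n => (K n).fF) (w := fun n => (K n).fw) (w' := fun n => (K n).fw') h.lenG h.fY h.fB h.fD h.fF h.fw h.fw').append
      ((h.mulL (B := Kit.fB A) (a := Kit.fD A) (sa := fun n => (K n).W) (b := fun _ => 0)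
        (d := fun n => (K n).fT) (sd := A.lenG) (w := fun n => (K n).fm) h.fB h.fD h.wSup (.const 1 0) h.fT h.lenG h.fm).append
        (h.mulL (B := Kit.fB A) (a := fun n => (K n).fT) (sa := A.lenG) (b := fun n => (K n).fI)
          (d := Kit.fD A) (sd := fun n => (K n).W) (w := fun n => (K n).fm) h.fB h.fT h.lenG h.fI h.fD h.wSup h.fm)))

theorem fullL' (h : UniformKit K) : GenC 1 fun e => (K (e 0)).fullL' := by
  have hf := h.fF.add h.flags
  have hm := h.flags.add genNum_id
  exact (GenC.copyG h.fB hf genNum_id).append ((GenC.notG hf genNum_id).append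
    ((GenC.chainG h.fF h.fc hm).append (.swapG (.const 1 0) (h.fc.add hm) (.const 1 1))))

theorem fullVer (h : UniformKit K) : Uniform fun n => (K n).fullVer :=
  uniform_of_gen (fun n => (K n).fullGates) (fun n => (K n).fN + 1)
    ((h.lenG.add (h.lenS.add h.lenS)).add h.snum) h.blocks (.const 1 1) (.const 1 0) h.fN
    (GenGates.append h.fullL (GenGates.append (hadG h.fB genNum_id) h.fullL'))
    (fun _ => rfl) fun n => circ_gates _ _ (K n).labels_full

end UniformKit

/-- The two-tier quantum lightning scheme of a group action. -/
def scheme {A : GroupActionFamily} {K : ∀ n, Kit A n} (h : UniformKit K) : LightningScheme where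
  skLen n := A.lenG n + (A.lenS n + A.lenS n)
  pkLen n := A.lenS n + A.lenS n
  snumLen n := (A.lenS n + A.lenS n) + n * A.lenS n
  certLen n := n + n * (K n).W
  qubits n := n + n * (K n).W
  setup n := (K n).setup
  stateGen n := (K n).stateGen
  del n := (K n).del
  semiVer n := (K n).semiVer
  fullVer n := (K n).fullVer
  setup_uniform := h.setup
  stateGen_uniform := h.stateGen
  del_uniform := h.del
  semiVer_uniform := h.semiVer
  fullVer_uniform := h.fullVer

end QL

/-! ### Effect of the untwisting stage on the basis states of the scheme. -/

namespace QL

open Matrix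

theorem rd_append_left {k l : ℕ} (x : Bits k) (y : Bits l) {o m : ℕ} (h : o + m ≤ k) :
    rd (ext (Fin.append x y)) o m = rd (ext x) o m :=
  rd_congr fun i hi => by rw [ext_append, if_pos (by omega)]

theorem rd_append_right {k l : ℕ} (x : Bits k) (y : Bits l) {p o m : ℕ} (h : p = k + o) :
    rd (ext (Fin.append x y)) p m = rd (ext y) o m :=
  funext fun i => by
    simp only [rd]
    rw [ext_append, if_neg (by omega)]
    congr 1
    omega

theorem rd_val {z : ℕ → Bool} {o l : ℕ} {x : Bits l} (h : rd z o l = x) {i : ℕ} (hi : i < l) :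
    z (o + i) = ext x i := by rw [← h, ext_rd_of_lt _ _ hi]

theorem Circ.initVec_append {kin qin kout qout : ℕ} (C : Circ kin qin kout qout) (x : Bits kin)
    (φ : Bits qin → ℂ) (q : Bits qin) :
    C.initVec x φ (res C.width (ext (Fin.append x q))) = φ q := by
  have h := C.le_in
  rw [initVec, if_pos]
  · congr 1
    funext i
    simp only [slice, res]
    rw [ext_append, if_neg (by omega), Nat.add_sub_cancel_left, ext_val]
  · refine ⟨funext fun i => ?_, fun i hi => ?_⟩
    · simp only [slice, res]
      rw [ext_append, if_pos (by omega), Nat.zero_add, ext_val]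
    · simp only [res]
      rw [ext_of_le _ hi]

theorem Circ.exists_of_initVec_ne_zero {kin qin kout qout : ℕ} (C : Circ kin qin kout qout)
    {x : Bits kin} {φ : Bits qin → ℂ} {z : Bits C.width} (hz : C.initVec x φ z ≠ 0) :
    ∃ q : Bits qin, z = res C.width (ext (Fin.append x q)) := by
  have h := C.le_in
  rw [initVec] at hz
  have hc := (ite_ne_right_iff.1 hz).1
  refine ⟨slice z kin qin h, funext fun i => ?_⟩
  simp only [res]
  rw [ext_append]
  split_ifs with hi
  · rw [ext_of_lt _ hi, ← hc.1]
    simp only [slice]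
    congr 1
    exact Fin.ext (by simp)
  · by_cases hi' : (i : ℕ) < kin + qin
    · rw [ext_of_lt _ (by omega)]
      simp only [slice]
      congr 1
      exact Fin.ext (by simp only; omega)
    · rw [ext_of_le _ (by omega), hc.2 i (by omega)]

/-- Hadamard gates alter only the bits of their region. Tracing a non-zero amplitude back through
them shows that no basis state outside the expected ones contributes to acceptance. -/
theorem exists_of_evolve_hadG_ne_zero {w : ℕ} [NeZero w] {o m : ℕ} (h : o + m ≤ w)
    {v : Bits w → ℂ} {y : Bits w} (hy : evolve (toFin w (hadG o m)) v y ≠ 0) :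
    ∃ y', v y' ≠ 0 ∧ ∀ i, ¬ (o ≤ i ∧ i < o + m) → ext y i = ext y' i := by
  induction m generalizing y with
  | zero => exact ⟨y, by simpa [hadG, toFin] using hy, fun _ _ => rfl⟩
  | succ m ih =>
    have hval : ((Fin.ofNat w (o + m) : Fin w) : ℕ) = o + m := Nat.mod_eq_of_lt (by omega)
    rw [hadG_succ, toFin_append, evolve_append] at hy
    simp only [toFin, List.map_cons, List.map_nil, evolve_cons, evolve_nil, Gate.map,
      Gate.act] at hy
    have : ∃ b, evolve (toFin w (hadG o m)) v (Function.update y (Fin.ofNat w (o + m)) b) ≠ 0 := by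
      by_contra! hb
      simp only [toFin] at hb
      rw [hb, hb] at hy
      simp at hy
    obtain ⟨b, hb⟩ := this
    obtain ⟨y', hy', H⟩ := ih (by omega) hb
    refine ⟨y', hy', fun i hi => ?_⟩
    rw [← H i (by omega), ext_update, hval, Function.update_of_ne (by omega)]

/-! ### Bits and blocks -/

/-- Quantum states of the scheme consist of `n` bits and `n` blocks. -/
def qEquiv (n W : ℕ) : Bits n × (Fin n → Bits W) ≃ Bits (n + n * W) where
  toFun p i := if h : (i : ℕ) < n then p.1 ⟨i, h⟩ else
    p.2 ⟨(i - n) / W, Nat.div_lt_of_lt_mul (by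
      have := i.2
      have := Nat.mul_comm n W
      omega)⟩
      ⟨(i - n) % W, Nat.mod_lt _ (Nat.pos_of_ne_zero fun hW => by
        have := i.2; subst hW; omega)⟩
  invFun q := (fun j => q ⟨j, by omega⟩, fun j i => q ⟨n + (j * W + i), by
    have := mul_add_le j.2 W; omega⟩)
  left_inv p := by
    refine Prod.ext (funext fun j => ?_) (funext fun j => funext fun i => ?_)
    · simp
    · simp only
      rw [dif_neg (by omega)]
      refine congr (congrArg p.2 (Fin.ext ?_)) (Fin.ext ?_)
      · show (n + (j * W + i) - n) / W = j
        rw [Nat.add_sub_cancel_left, add_mul_div_eq i.2]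
      · show (n + (j * W + i) - n) % W = i
        rw [Nat.add_sub_cancel_left, add_mul_mod_eq i.2]
  right_inv q := by
    funext i
    simp only
    split_ifs with h
    · rfl
    · congr 1
      refine Fin.ext ?_
      simp only
      rw [Nat.mul_comm, Nat.div_add_mod]
      omega

theorem ext_qEquiv {n W : ℕ} (β : Bits n) (u : Fin n → Bits W) (j : Fin n) :
    ext (qEquiv n W (β, u)) j = β j := by
  rw [ext_of_lt _ (by omega)]
  exact congrFun (congrArg Prod.fst ((qEquiv n W).symm_apply_apply (β, u))) j

theorem rd_qEquiv {n W : ℕ} (β : Bits n) (u : Fin n → Bits W) (j : Fin n) :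
    rd (ext (qEquiv n W (β, u))) (n + j * W) W = u j := by
  funext i
  have := mul_add_le j.2 W
  rw [rd, ext_of_lt _ (by omega)]
  refine Eq.trans ?_ (congrFun (congrFun (congrArg Prod.snd
    ((qEquiv n W).symm_apply_apply (β, u))) j) i)
  exact congrArg _ (Fin.ext (Nat.add_assoc _ _ _))

namespace Kit

variable {A : GroupActionFamily} {n : ℕ} (K : Kit A n)

/-- The group element of a block. -/
def head (u : Bits K.W) : Bits (A.lenG n) := (splitBits K.sup.le_out u).2.1

theorem head_apply (u : Bits K.W) (i : Fin (A.lenG n)) : K.head u i = ext u i := by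
  have := K.lenG_le
  rw [ext_of_lt _ (show (i : ℕ) < K.W by omega)]
  exact congrArg u (Fin.ext (Nat.zero_add _))

open Classical in
/-- Multiplication by `g⁻¹` from the right on representations of group elements. -/
noncomputable def mulRight (A : GroupActionFamily) (n : ℕ) (g : A.G n) (h : Bits (A.lenG n)) : Bits (A.lenG n) :=
  if H : ∃ x, A.repG n x = h then A.repG n (H.choose * g⁻¹) else h

theorem mulRight_rep (g x : A.G n) : mulRight A n g (A.repG n x) = A.repG n (x * g⁻¹) := by
  have H : ∃ x', A.repG n x' = A.repG n x := ⟨x, rfl⟩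
  rw [mulRight, dif_pos H, A.repG_injective n H.choose_spec]

/-- Strings that represent no group element are fixed, which makes the multiplication a permutation
of all bit strings. -/
theorem mulRight_of_not (g : A.G n) {h : Bits (A.lenG n)} (H : ¬ ∃ x, A.repG n x = h) :
    mulRight A n g h = h := dif_neg H

theorem mulRight_inv (g : A.G n) (h : Bits (A.lenG n)) :
    mulRight A n g⁻¹ (mulRight A n g h) = h := by
  by_cases H : ∃ x, A.repG n x = h
  · obtain ⟨x, rfl⟩ := H
    rw [mulRight_rep, mulRight_rep, inv_inv, inv_mul_cancel_right]
  · rw [mulRight_of_not g H, mulRight_of_not _ H]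

/-- Multiplication by `g⁻¹` from the right as a permutation. -/
noncomputable def mulRightPerm (A : GroupActionFamily) (n : ℕ) (g : A.G n) : Equiv.Perm (Bits (A.lenG n)) :=
  ⟨mulRight A n g, mulRight A n g⁻¹, mulRight_inv g, fun h => by
    have := mulRight_inv g⁻¹ h
    rwa [inv_inv] at this⟩

/-- Multiplication by `g⁻¹` from the right on blocks. -/
noncomputable def twist (g : A.G n) (u : Bits K.W) : Bits K.W :=
  (splitBits K.sup.le_out).symm ((splitBits K.sup.le_out u).1, mulRight A n g (K.head u),
    (splitBits K.sup.le_out u).2.2)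

theorem head_twist (g : A.G n) (u : Bits K.W) : K.head (K.twist g u) = mulRight A n g (K.head u) := by
  rw [head, twist, Equiv.apply_symm_apply]

theorem twist_inv (g : A.G n) (u : Bits K.W) : K.twist g⁻¹ (K.twist g u) = u := by
  rw [twist, head_twist, mulRight_inv, twist, Equiv.apply_symm_apply]
  exact Equiv.symm_apply_apply _ _

theorem twist_inv' (g : A.G n) (u : Bits K.W) : K.twist g (K.twist g⁻¹ u) = u := by
  have := K.twist_inv g⁻¹ u
  rwa [inv_inv] at this

theorem ext_twist_of_le (g : A.G n) (u : Bits K.W) {i : ℕ} (hi : A.lenG n ≤ i) :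
    ext (K.twist g u) i = ext u i := by
  by_cases hW : i < K.W
  · have h1 := (rest_eq_iff K.sup.le_out (K.twist g u) u).2 (by
      rw [twist, Equiv.apply_symm_apply]) ⟨i, hW⟩ (by simpa using hi)
    rw [ext_of_lt _ hW, ext_of_lt _ hW, h1]
  · rw [ext_of_le _ (by omega), ext_of_le _ (by omega)]

/-- Twist the blocks whose bit is set. -/
noncomputable def twists (g : A.G n) (β : Bits n) (u : Fin n → Bits K.W) : Fin n → Bits K.W :=
  fun j => if β j then K.twist g (u j) else u j

/-- The block holds a group element that maps `s` to `y`. -/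
def Maps (s : A.S n) (y : Bits (A.lenS n)) (u : Bits K.W) : Prop :=
  ∃ x, A.repG n x = K.head u ∧ A.repS n (x • s) = y

/-- Copy `j` of the image. -/
def img {n : ℕ} (snum : Bits ((A.lenS n + A.lenS n) + n * A.lenS n)) (j : ℕ) : Bits (A.lenS n) :=
  rd (ext snum) ((A.lenS n + A.lenS n) + j * A.lenS n) (A.lenS n)

/-- The secret key. -/
def skey (g : A.G n) (s : A.S n) : Bits (A.lenG n + (A.lenS n + A.lenS n)) :=
  Fin.append (A.repG n g) (Fin.append (A.repS n s) (A.repS n (g • s)))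

/-- If the bit is set, the element `h` of the block satisfies `h • (g • s) = y`, which says that `h
* g` maps `s` to `y`; twisting by `g⁻¹` is right multiplication by `g`. Validity thus becomes a
condition on the untwisted block that refers to `s` alone. -/
theorem valid_iff {g : A.G n} {s : A.S n} {P Y B D : ℕ} {z : ℕ → Bool} {y : Bits (A.lenS n)}
    {b : Bool} {u : Bits K.W} {j : ℕ} (h0 : rd z P (A.lenS n) = A.repS n s)
    (h1 : rd z (P + A.lenS n) (A.lenS n) = A.repS n (g • s)) (hb : z (B + j) = b)
    (hu : rd z (D + j * K.W) (A.lenG n) = K.head u)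
    (hy : rd z (Y + j * A.lenS n) (A.lenS n) = y) :
    K.Valid P Y B D z j ↔ K.Maps s y (if b then K.twist g⁻¹ u else u) := by
  unfold Valid selS Maps
  rw [hu, hb, hy, K.recog_eval]
  cases b
  · simp only [Bool.false_eq_true, if_false, h0]
    constructor
    · rintro ⟨⟨x, hx⟩, h⟩
      exact ⟨x, hx, by rw [← h, ← hx, K.act_eval]⟩
    · rintro ⟨x, hx, h⟩
      exact ⟨⟨x, hx⟩, by rw [← h, ← hx, K.act_eval]⟩
  · simp only [if_true, h1, head_twist]
    constructor
    · rintro ⟨⟨x, hx⟩, h⟩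
      exact ⟨x * g, by rw [← hx, mulRight_rep, inv_inv], by rw [← h, ← hx, K.act_eval, mul_smul]⟩
    · rintro ⟨x, hx, h⟩
      have hx' : A.repG n (x * g⁻¹) = K.head u := by
        have := mulRight_inv g⁻¹ (K.head u)
        rw [← this, ← hx, inv_inv, mulRight_rep]
      exact ⟨⟨_, hx'⟩, by rw [← h, ← hx', K.act_eval, ← mul_smul, inv_mul_cancel_right]⟩

section full

variable (g : A.G n) (s : A.S n) (snum : Bits ((A.lenS n + A.lenS n) + n * A.lenS n))

/-- The wires at the start of the full verification. -/
def fullZ (q : Bits (n + n * K.W)) : ℕ → Bool := ext (Fin.append (Fin.append (skey g s) snum) q)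

theorem fullZ_bit (β : Bits n) (u : Fin n → Bits K.W) (j : Fin n) :
    K.fullZ g s snum (qEquiv _ _ (β, u)) (fB A n + j) = β j := by
  have e : fB A n = (A.lenG n + (A.lenS n + A.lenS n)) + ((A.lenS n + A.lenS n) + n * A.lenS n) := by
    unfold fB fY; omega
  rw [fullZ, ext_append, if_neg (by omega), e, Nat.add_sub_cancel_left, ext_qEquiv]

theorem fullZ_block (β : Bits n) (u : Fin n → Bits K.W) (j : Fin n) :
    rd (K.fullZ g s snum (qEquiv _ _ (β, u))) (fD A n + j * K.W) K.W = u j := by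
  rw [fullZ, rd_append_right (o := n + j * K.W) _ _ (by unfold fD fB fY; omega), rd_qEquiv]

theorem fullZ_head (β : Bits n) (u : Fin n → Bits K.W) (j : Fin n) :
    rd (K.fullZ g s snum (qEquiv _ _ (β, u))) (fD A n + j * K.W) (A.lenG n) = K.head (u j) := by
  funext i
  have := K.lenG_le
  rw [head_apply]
  exact rd_val (K.fullZ_block g s snum β u j) (by omega)

theorem fullZ_img (q : Bits (n + n * K.W)) (j : ℕ) (hj : j < n) :
    rd (K.fullZ g s snum q) (fY A n + j * A.lenS n) (A.lenS n) = img snum j := by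
  have := mul_add_le hj (A.lenS n)
  rw [fullZ, rd_append_left _ _ (by unfold fY; omega),
    rd_append_right (o := (A.lenS n + A.lenS n) + j * A.lenS n) _ _ (by unfold fY; omega)]
  rfl

theorem fullZ_g (q : Bits (n + n * K.W)) : rd (K.fullZ g s snum q) 0 (A.lenG n) = A.repG n g := by
  rw [fullZ, rd_append_left _ _ (by omega), rd_append_left _ _ (by omega), skey,
    rd_append_left _ _ (by omega), rd_ext]

theorem fullZ_s (q : Bits (n + n * K.W)) :
    rd (K.fullZ g s snum q) (A.lenG n) (A.lenS n) = A.repS n s := by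
  rw [fullZ, rd_append_left _ _ (by omega), rd_append_left _ _ (by omega), skey,
    rd_append_right (o := 0) _ _ (by omega), rd_append_left _ _ (by omega), rd_ext]

theorem fullZ_s' (q : Bits (n + n * K.W)) :
    rd (K.fullZ g s snum q) (A.lenG n + A.lenS n) (A.lenS n) = A.repS n (g • s) := by
  rw [fullZ, rd_append_left _ _ (by omega), rd_append_left _ _ (by omega), skey,
    rd_append_right (o := A.lenS n) _ _ (by omega), rd_append_right (o := 0) _ _ (by omega), rd_ext]

theorem fullZ_zero (q : Bits (n + n * K.W)) {i : ℕ} (hi : K.fI ≤ i) :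
    K.fullZ g s snum q i = false := ext_of_le _ (by unfold fI fD fB fY at hi; omega)

theorem valid_full_iff (β : Bits n) (u : Fin n → Bits K.W) (j : Fin n) :
    K.Valid (A.lenG n) (fY A n) (fB A n) (fD A n) (K.fullZ g s snum (qEquiv _ _ (β, u))) j ↔
      K.Maps s (img snum j) (if β j then K.twist g⁻¹ (u j) else u j) :=
  K.valid_iff (K.fullZ_s g s snum _) (K.fullZ_s' g s snum _) (K.fullZ_bit g s snum β u j)
    (K.fullZ_head g s snum β u j) (K.fullZ_img g s snum _ j j.2)

theorem flags_full_iff (β : Bits n) (u : Fin n → Bits K.W) :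
    (∀ i < n * (1 + A.lenS n), cexec K.fullL (K.fullZ g s snum (qEquiv _ _ (β, u))) (K.fF + i) =
      true) ↔ ∀ j : Fin n, K.Maps s (img snum j) (if β j then K.twist g⁻¹ (u j) else u j) := by
  have h1 : ∀ i < n * (1 + A.lenS n), cexec K.fullL (K.fullZ g s snum (qEquiv _ _ (β, u)))
      (K.fF + i) = K.flagV (A.lenG n) (fY A n) (fB A n) (fD A n)
        (K.fullZ g s snum (qEquiv _ _ (β, u))) (i / (1 + A.lenS n)) (i % (1 + A.lenS n)) :=
    fun i hi => K.layout.cexec_untwistL_flag (fun i hi _ => K.fullZ_zero g s snum _ hi) hi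
  rw [forall₂_congr fun i hi => by rw [h1 i hi], flagV_iff]
  exact ⟨fun H j => (K.valid_full_iff g s snum β u j).1 (H j j.2),
    fun H j hj => (K.valid_full_iff g s snum β u ⟨j, hj⟩).2 (H ⟨j, hj⟩)⟩

theorem input_twists {u : Fin n → Bits K.W} {x : Fin n → A.G n}
    (hx : ∀ j, A.repG n (x j) = K.head (u j)) (β : Bits n) :
    K.Input 0 (A.lenG n) (fD A n) K.fI (K.fN + 1) g s
      (fun j => if hj : j < n then if β ⟨j, hj⟩ then x ⟨j, hj⟩ * g⁻¹ else x ⟨j, hj⟩ else 1)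
      (K.fullZ g s snum (qEquiv _ _ (β, K.twists g β u))) :=
  ⟨K.fullZ_g g s snum _, K.fullZ_s g s snum _, K.fullZ_s' g s snum _, fun j hj => by
    rw [dif_pos hj, K.fullZ_head g s snum _ _ ⟨j, hj⟩, twists]
    split_ifs
    · rw [head_twist, ← hx, mulRight_rep]
    · rw [← hx],
    fun i hi _ => K.fullZ_zero g s snum _ hi⟩

theorem twists_false (u : Fin n → Bits K.W) : K.twists g (fun _ => false) u = u := by
  funext j
  simp [twists]

theorem cexec_fullL_bit {u : Fin n → Bits K.W} (hu : ∀ j : Fin n, K.Maps s (img snum j) (u j))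
    (β : Bits n) (j : Fin n) :
    cexec K.fullL (K.fullZ g s snum (qEquiv _ _ (β, K.twists g β u))) (fB A n + j) = β j := by
  choose x hx hxs using hu
  have hl := K.layout
  obtain ⟨h1, h2, h3, h4, h5, h6, h7, h8, h9, h10, h11, h12⟩ := K.layout
  rw [fullL, hl.cexec_untwistL (K.input_twists g s snum hx β) (by omega), if_neg (by omega),
    if_neg (by omega), if_neg (by omega), fullZ_bit]

/-- This is the purpose of untwisting: the twists of one tuple by different `β` become basis states
that differ in the bits only, so that Hadamard gates on the bits make them interfere. -/
theorem cexec_fullL_twists {u : Fin n → Bits K.W} (hu : ∀ j : Fin n, K.Maps s (img snum j) (u j))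
    (β : Bits n) {i : ℕ} (hi : ¬ (fB A n ≤ i ∧ i < fB A n + n)) :
    cexec K.fullL (K.fullZ g s snum (qEquiv _ _ (β, K.twists g β u))) i =
      cexec K.fullL (K.fullZ g s snum (qEquiv _ _ (fun _ => false, u))) i := by
  have hl := K.layout
  -- In the region of the flags both sides are `true`, since twisting preserves validity.
  by_cases hF : K.fF ≤ i ∧ i < K.fF + n * (1 + A.lenS n)
  · obtain ⟨k, rfl⟩ := Nat.exists_eq_add_of_le hF.1
    rw [(K.flags_full_iff g s snum β (K.twists g β u)).2 _ k (by omega),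
      (K.flags_full_iff g s snum (fun _ => false) u).2 _ k (by omega)]
    · simpa using hu
    · intro j
      unfold twists
      split_ifs with hb
      · rw [twist_inv]; exact hu j
      · exact hu j
  choose x hx hxs using hu
  have hin := K.input_twists g s snum hx fun _ => false
  rw [twists_false] at hin
  have hin' := K.input_twists g s snum hx β
  rw [fullL, hl.cexec_untwistL hin hF, hl.cexec_untwistL hin' hF]
  by_cases h1 : K.fI ≤ i ∧ i < K.fI + K.inv.width
  · rw [if_pos h1, if_pos h1]
  rw [if_neg h1, if_neg h1]
  by_cases h2 : K.fT ≤ i ∧ i < K.fT + n * A.lenG n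
  · rw [if_pos h2, if_pos h2]
    obtain ⟨j, hj, k, hk, hjk⟩ := exists_block (show i - K.fT < n * A.lenG n by omega)
    rw [hjk, add_mul_div_eq hk, add_mul_mod_eq hk]
    have e1 := K.fullZ_bit g s snum (fun _ => false) u ⟨j, hj⟩
    have e2 := K.fullZ_bit g s snum β (K.twists g β u) ⟨j, hj⟩
    simp only at e1 e2
    rw [e1, e2, dif_pos hj, dif_pos hj]
    simp only [Bool.false_eq_true, if_false]
    split_ifs
    · rw [inv_mul_cancel_right]
    · rfl
  rw [if_neg h2, if_neg h2]
  by_cases h3 : fD A n ≤ i ∧ i < fD A n + n * K.W ∧ (i - fD A n) % K.W < A.lenG n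
  · rw [if_pos h3, if_pos h3]
  rw [if_neg h3, if_neg h3]
  by_cases h4 : fD A n ≤ i ∧ i < fD A n + n * K.W
  · obtain ⟨j, hj, k, hk, hjk⟩ := exists_block (show i - fD A n < n * K.W by omega)
    rw [hjk, add_mul_mod_eq hk] at h3
    obtain rfl : i = fD A n + j * K.W + k := by omega
    rw [rd_val (K.fullZ_block g s snum β _ ⟨j, hj⟩) hk,
      rd_val (K.fullZ_block g s snum _ u ⟨j, hj⟩) hk, twists]
    split_ifs
    · exact K.ext_twist_of_le g _ (by omega)
    · rfl
  · by_cases h5 : K.fI ≤ i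
    · rw [fullZ_zero _ _ _ _ _ h5, fullZ_zero _ _ _ _ _ h5]
    · have e : fB A n = (A.lenG n + (A.lenS n + A.lenS n)) +
          ((A.lenS n + A.lenS n) + n * A.lenS n) := by unfold fB fY; omega
      have e1 : K.fI = fD A n + n * K.W := rfl
      have e2 : fD A n = fB A n + n := rfl
      have e3 : ∀ q, K.fullZ g s snum q i = ext (Fin.append (skey g s) snum) i := fun q => by
        rw [fullZ, ext_append (Fin.append (skey g s) snum), if_pos (by omega)]
      rw [e3, e3]

end full

end Kit

end QL

/-! ### The acceptance probability of the full verification. -/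

namespace QL

open Matrix

namespace Kit

variable {A : GroupActionFamily} {n : ℕ} (K : Kit A n)

/-- The wires that hold the flags of the bits and the chain are not touched by the first part. -/
theorem fullL_zone {z : ℕ → Bool} {i : ℕ} (h : K.fF + n * (1 + A.lenS n) ≤ i) (h' : i < K.fT) :
    cexec K.fullL z i = z i := by
  have hl := K.layout
  have := hl.h4
  have := hl.h5
  have := hl.h6
  exact cexec_apply_of_onWires hl.onWires z (by omega)

/-- The second part accepts if all flags are set and all bits of the state vanish. -/
theorem fullL'_iff {z : ℕ → Bool}
    (hz : ∀ i, K.fF + n * (1 + A.lenS n) ≤ i → i < K.fT → z i = false) :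
    cexec K.fullL' z 0 = true ↔ (∀ i < n * (1 + A.lenS n), z (K.fF + i) = true) ∧
      ∀ i < n, z (fB A n + i) = false := by
  obtain ⟨h1, h2, h3, h4, h5, h6, h7, h8, h9, h10, h11, h12⟩ := K.layout
  have hc : K.fc = K.fF + (n * (1 + A.lenS n) + n) + 1 := rfl
  have hT : K.fT = K.fc + (n * (1 + A.lenS n) + n + 1) := rfl
  have h0 := cexec_swapG (a := 0) (b := K.fc + (n * (1 + A.lenS n) + n)) (m := 1)
    (by unfold Disj; omega) (cexec (chainG K.fF K.fc (n * (1 + A.lenS n) + n))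
      (cexec (notG (K.fF + n * (1 + A.lenS n)) n)
        (cexec (copyG (fB A n) (K.fF + n * (1 + A.lenS n)) n) z))) (i := 0) Nat.one_pos
  rw [fullL', cexec_append, cexec_append, cexec_append, ← Nat.add_zero 0, h0, Nat.add_zero]
  rw [cexec_copyG (by unfold Disj; omega), cexec_notG, xorAt_xorAt,
    cexec_chainG (by unfold Disj; omega) fun i hi => by
      rw [xorAt_of_not (by omega), hz _ (by omega) (by omega)]]
  constructor
  · refine fun H => ⟨fun i hi => ?_, fun i hi => ?_⟩
    · have := H i (by omega)
      rwa [xorAt_of_not (by omega)] at this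
    · have := H (n * (1 + A.lenS n) + i) (by omega)
      rw [← Nat.add_assoc, xorAt_add hi, hz _ (by omega) (by omega)] at this
      simpa using this
  · rintro ⟨H, H'⟩ i hi
    by_cases hi' : i < n * (1 + A.lenS n)
    · rw [xorAt_of_not (by omega), H i hi']
    · obtain ⟨k, rfl⟩ := Nat.exists_eq_add_of_le (not_lt.1 hi')
      rw [← Nat.add_assoc, xorAt_add (by omega), hz _ (by omega) (by omega), H' k (by omega)]
      rfl

variable (g : A.G n) (s : A.S n) (snum : Bits ((A.lenS n + A.lenS n) + n * A.lenS n))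

/-- The basis states of the circuit of the full verification at the start. -/
def fullI (q : Bits (n + n * K.W)) : Bits (K.fN + 1) := res _ (K.fullZ g s snum q)

theorem fI_le : K.fI ≤ K.fN + 1 := by
  unfold fN fm fw' fw fT fc fF
  omega

theorem ext_fullI (q : Bits (n + n * K.W)) : ext (K.fullI g s snum q) = K.fullZ g s snum q :=
  ext_res fun i hi => K.fullZ_zero g s snum q (by have := K.fI_le; omega)

theorem ext_cperm_fullI (q : Bits (n + n * K.W)) :
    ext (cperm _ K.fullL (K.fullI g s snum q)) = cexec K.fullL (K.fullZ g s snum q) := by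
  rw [ext_cperm K.onWires_fullL, ext_fullI]

theorem fullZ_injective : Function.Injective (K.fullZ g s snum) := fun q q' h => by
  have h1 := ext_injective h
  funext i
  have h2 := congrFun h1 (Fin.natAdd _ i)
  rwa [Fin.append_right, Fin.append_right] at h2

theorem qEquiv_eq_twists (β : Bits n) (u : Fin n → Bits K.W) :
    u = K.twists g β fun j => if β j then K.twist g⁻¹ (u j) else u j := by
  funext j
  unfold twists
  by_cases hb : β j
  · simp only [hb, if_true, twist_inv']
  · simp [hb]

open Classical in
/-- The probability that the full verification accepts a pure state. -/
theorem prob_fullVer (φ : Bits (n + n * K.W) → ℂ) :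
    K.fullVer.prob (Fin.append (skey g s) snum) (pureState φ) (fun _ => true) =
      (1 / 2) ^ n * ∑ u : Fin n → Bits K.W, if ∀ j : Fin n, K.Maps s (img snum j) (u j) then
        ‖∑ β : Bits n, φ (qEquiv n K.W (β, K.twists g β u))‖ ^ 2 else 0 := by
  have hB : fB A n + n ≤ K.fN + 1 := by
    have := K.fI_le
    have : K.fI = fB A n + n + n * K.W := rfl
    omega
  have hl := K.layout
  rw [Circ.prob_pureState]
  -- Amplitudes at the start (`v0`), after the untwisting (`v1`) and after the Hadamard gates
  -- (`v2`). The gates that follow only permute basis states.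
  set v0 : Bits (K.fN + 1) → ℂ := K.fullVer.initVec (Fin.append (skey g s) snum) φ with hv0
  set v1 : Bits (K.fN + 1) → ℂ := evolve (toFin _ (K.fullL.map Gate.classical)) v0 with hv1
  set v2 : Bits (K.fN + 1) → ℂ := evolve (toFin _ (hadG (fB A n) n)) v1 with hv2
  have hI : ∀ q, v1 (cperm _ K.fullL (K.fullI g s snum q)) = φ q := fun q => by
    rw [hv1, evolve_toFin_classical_cperm K.onWires_fullL, hv0]
    exact K.fullVer.initVec_append _ φ q
  have hI' : ∀ y, v1 y ≠ 0 → ∃ q, y = cperm _ K.fullL (K.fullI g s snum q) := fun y hy => by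
    rw [hv1, evolve_toFin_classical K.onWires_fullL] at hy
    obtain ⟨q, hq⟩ := K.fullVer.exists_of_initVec_ne_zero hy
    refine ⟨q, ?_⟩
    have h1 := cperm_reverse' K.onWires_fullL y
    rw [hq] at h1
    exact h1.symm
  have hamp : K.fullVer.amp (Fin.append (skey g s) snum) φ =
      evolve (toFin (K.fN + 1) (K.fullL'.map Gate.classical)) v2 := by
    show evolve (toFin (K.fN + 1) K.fullGates) v0 = _
    rw [fullGates, toFin_append, toFin_append, evolve_append, evolve_append]
  have hacc : ∀ z : Bits (K.fN + 1), slice z 0 1 (by omega) = (fun _ => true) ↔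
      ext z 0 = true := fun z => by
    rw [ext_of_lt _ (by omega)]
    exact ⟨fun h => congrFun h 0, fun h => funext fun i => by
      rw [Subsingleton.elim i 0]; exact h⟩
  have hzero : ∀ q, ∀ i, K.fF + n * (1 + A.lenS n) ≤ i → i < K.fT →
      ext (cperm _ K.fullL (K.fullI g s snum q)) i = false := fun q i hi hi' => by
    have := hl.h6
    rw [ext_cperm_fullI, K.fullL_zone hi hi', K.fullZ_zero _ _ _ _ (by omega)]
  have hbit : ∀ u : Fin n → Bits K.W, (∀ j : Fin n, K.Maps s (img snum j) (u j)) → ∀ (β : Bits n)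
      (i : ℕ), i < n → ext (cperm _ K.fullL (K.fullI g s snum (qEquiv _ _ (β, K.twists g β u))))
        (fB A n + i) = ext β i := fun u hu β i hi => by
    rw [ext_cperm_fullI, K.cexec_fullL_bit g s snum hu β ⟨i, hi⟩, ext_of_lt _ hi]
  have hag : ∀ u : Fin n → Bits K.W, (∀ j : Fin n, K.Maps s (img snum j) (u j)) → ∀ (β : Bits n)
      (i : ℕ), ¬ (fB A n ≤ i ∧ i < fB A n + n) →
      ext (cperm _ K.fullL (K.fullI g s snum (qEquiv _ _ (β, K.twists g β u)))) i =
        ext (cperm _ K.fullL (K.fullI g s snum (qEquiv _ _ (fun _ => false, u)))) i :=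
    fun u hu β i hi => by
      rw [ext_cperm_fullI, ext_cperm_fullI, K.cexec_fullL_twists g s snum hu β hi]
  have hbit0 : ∀ u : Fin n → Bits K.W, (∀ j : Fin n, K.Maps s (img snum j) (u j)) → ∀ i < n,
      ext (cperm _ K.fullL (K.fullI g s snum (qEquiv _ _ (fun _ => false, u))))
        (fB A n + i) = false := fun u hu i hi => by
    have := hbit u hu (fun _ => false) i hi
    rwa [twists_false, ext_of_lt _ hi] at this
  -- Filling the zero bits of the basis state with `β` gives the image of the tuple twisted by `β`,
  -- by `hbit` and `hag`. The unsigned sum of amplitudes after the Hadamard gates is therefore the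
  -- sum over the twists.
  have hM : ∀ u : Fin n → Bits K.W, (∀ j : Fin n, K.Maps s (img snum j) (u j)) →
      ‖v2 (cperm _ K.fullL (K.fullI g s snum (qEquiv _ _ (fun _ => false, u))))‖ ^ 2 =
        (1 / 2) ^ n * ‖∑ β : Bits n, φ (qEquiv n K.W (β, K.twists g β u))‖ ^ 2 := by
    intro u hu
    rw [hv2, evolve_hadG_sum hB _ _ (hbit0 u hu), norm_mul, mul_pow, norm_pow, ← pow_mul,
      Nat.mul_comm n 2, pow_mul]
    congr 2
    · rw [norm_div, div_pow, Complex.norm_real, Real.norm_eq_abs, sq_abs,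
        Real.sq_sqrt (by norm_num)]
      norm_num
    · congr 1
      refine Finset.sum_congr rfl fun β _ => ?_
      rw [← hI]
      congr 1
      apply ext_injective
      rw [ext_res fun i hi => by rw [setAt_of_not (by omega), ext_of_le _ hi]]
      funext i
      by_cases hi : fB A n ≤ i ∧ i < fB A n + n
      · obtain ⟨k, rfl⟩ := Nat.exists_eq_add_of_le hi.1
        rw [setAt_add (by omega), hbit u hu β k (by omega)]
      · rw [setAt_of_not hi, hag u hu β i hi]
  have hflag : ∀ u : Fin n → Bits K.W, (∀ j : Fin n, K.Maps s (img snum j) (u j)) →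
      ∀ i < n * (1 + A.lenS n),
      ext (cperm _ K.fullL (K.fullI g s snum (qEquiv _ _ (fun _ => false, u)))) (K.fF + i) =
        true := fun u hu => by
    rw [ext_cperm_fullI, K.flags_full_iff]
    simpa using hu
  have h1 : (∑ z : Bits K.fullVer.width, if slice z 0 1 (by have := K.fullVer.le_out; omega) =
      (fun _ => true) then ‖K.fullVer.amp (Fin.append (skey g s) snum) φ z‖ ^ 2 else 0) =
      ∑ z : Bits (K.fN + 1), if ext z 0 = true then
        ‖evolve (toFin (K.fN + 1) (K.fullL'.map Gate.classical)) v2 z‖ ^ 2 else 0 := by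
    rw [hamp]
    exact Finset.sum_congr rfl fun z _ => if_congr (hacc z) rfl rfl
  rw [h1, sum_evolve_classical K.onWires_fullL' v2 (fun z => ext z 0 = true), Finset.mul_sum]
  simp only [ext_cperm K.onWires_fullL']
  rw [← Finset.sum_filter]
  have h2 : ∀ u : Fin n → Bits K.W, ((1 / 2 : ℝ) ^ n *
      if ∀ j : Fin n, K.Maps s (img snum j) (u j) then
        ‖∑ β : Bits n, φ (qEquiv n K.W (β, K.twists g β u))‖ ^ 2 else 0) =
      if ∀ j : Fin n, K.Maps s (img snum j) (u j) then
        ‖v2 (cperm _ K.fullL (K.fullI g s snum (qEquiv _ _ (fun _ => false, u))))‖ ^ 2 else 0 := by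
    intro u
    split_ifs with hu
    · rw [hM u hu]
    · rw [mul_zero]
  rw [Finset.sum_congr rfl fun u _ => h2 u, ← Finset.sum_filter]
  symm
  -- Valid tuples correspond injectively to accepted basis states; it remains to see that every
  -- other accepted basis state has amplitude zero.
  refine Finset.sum_of_injOn
    (fun u => cperm _ K.fullL (K.fullI g s snum (qEquiv _ _ (fun _ => false, u)))) ?_ ?_ ?_
    fun _ _ => rfl
  · intro u _ u' _ h
    have h3 := congrArg ext h
    simp only [ext_cperm_fullI] at h3
    have h4 := K.fullZ_injective g s snum (cexec_injective _ h3)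
    exact (Prod.ext_iff.1 ((qEquiv n K.W).injective h4)).2
  · intro u hu
    have hu' := (Finset.mem_filter.1 hu).2
    refine Finset.mem_filter.2 ⟨Finset.mem_univ _, ?_⟩
    exact (K.fullL'_iff (hzero _)).2 ⟨hflag u hu', hbit0 u hu'⟩
  -- An accepted basis state of non-zero amplitude comes from some `(β, u)`. Its flags make the
  -- untwisted form of `u` valid, and its bits vanish, so it is the image of that untwisted form.
  · intro z hz hz'
    have hz1 := (Finset.mem_filter.1 hz).2
    by_contra hne
    obtain ⟨y, hy, hzy⟩ := exists_of_evolve_hadG_ne_zero hB (v := v1) (y := z) fun h0 => hne (by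
      rw [hv2, h0]; simp)
    obtain ⟨q, rfl⟩ := hI' y hy
    obtain ⟨⟨β, u⟩, rfl⟩ := (qEquiv n K.W).surjective q
    have hB1 := hl.h4
    have hB2 := hl.h5
    have hB3 := hl.h6
    obtain ⟨hf, hb⟩ := (K.fullL'_iff fun i hi hi' => by
      rw [hzy i (by omega), hzero _ i hi hi']).1 hz1
    have hval : ∀ j : Fin n, K.Maps s (img snum j) (if β j then K.twist g⁻¹ (u j) else u j) := by
      rw [← K.flags_full_iff g s snum β u]
      intro i hi
      rw [← ext_cperm_fullI, ← hzy _ (by omega), hf i hi]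
    refine hz' ⟨_, by simpa using hval, ?_⟩
    apply ext_injective
    funext i
    by_cases hi : fB A n ≤ i ∧ i < fB A n + n
    · obtain ⟨k, rfl⟩ := Nat.exists_eq_add_of_le hi.1
      rw [hb k (by omega)]
      exact hbit0 _ hval k (by omega)
    · rw [hzy i hi]
      refine (hag _ hval β i hi).symm.trans ?_
      rw [← K.qEquiv_eq_twists g β u]

end Kit

end QL

/-! ### The distribution of the keys. -/

namespace QL

open Matrix

/-- Amplitudes supported on a region. -/
theorem sum_region {w : ℕ} {o m : ℕ} (h : o + m ≤ w) {M : Type} [AddCommMonoid M]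
    (F : Bits w → M) [DecidablePred fun z : Bits w => ∀ i, ¬ (o ≤ i ∧ i < o + m) → ext z i = false] :
    (∑ z, if ∀ i, ¬ (o ≤ i ∧ i < o + m) → ext z i = false then F z else 0) =
      ∑ r : Bits m, F (res w (setAt (fun _ => false) o m (ext r))) := by
  have hext : ∀ r : Bits m, ext (res w (setAt (fun _ => false) o m (ext r))) =
      setAt (fun _ => false) o m (ext r) := fun r =>
    ext_res fun i hi => setAt_of_not (by omega)
  rw [← Finset.sum_filter]
  symm
  refine Finset.sum_of_injOn (fun r => res w (setAt (fun _ => false) o m (ext r))) ?_ ?_ ?_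
    fun _ _ => rfl
  · intro r _ r' _ h'
    have h1 := congrArg ext h'
    simp only [hext] at h1
    apply ext_injective
    funext i
    by_cases hi : i < m
    · have := congrFun h1 (o + i)
      rwa [setAt_add hi, setAt_add hi] at this
    · rw [ext_of_le _ (by omega), ext_of_le _ (by omega)]
  · intro r _
    refine Finset.mem_coe.2 (Finset.mem_filter.2 ⟨Finset.mem_univ _, fun i hi => ?_⟩)
    rw [hext, setAt_of_not hi]
  · intro z hz hz'
    refine absurd ⟨rd (ext z) o m, Finset.mem_coe.2 (Finset.mem_univ _), ?_⟩ hz'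
    apply ext_injective
    simp only [hext]
    funext i
    by_cases hi : o ≤ i ∧ i < o + m
    · rw [setAt_apply hi.1 hi.2, ext_rd_of_lt _ _ (by omega)]
      congr 1
      omega
    · rw [setAt_of_not hi, (Finset.mem_filter.1 hz).2 i hi]

theorem norm_half_sqrt_sq (m : ℕ) : ‖(1 / (Real.sqrt 2 : ℂ)) ^ m‖ ^ 2 = (1 / 2) ^ m := by
  rw [norm_pow, ← pow_mul, Nat.mul_comm m 2, pow_mul, norm_div, div_pow, Complex.norm_real,
    Real.norm_eq_abs, sq_abs, Real.sq_sqrt (by norm_num)]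
  norm_num

/-- The flattening of `n` bit strings of length `l`. -/
def flatten {n l : ℕ} (y : Fin n → Bits l) : Bits (n * l) := fun i =>
  y ⟨i / l, Nat.div_lt_of_lt_mul (by have := i.2; have := Nat.mul_comm n l; omega)⟩
    ⟨i % l, Nat.mod_lt _ (Nat.pos_of_ne_zero fun hl => by have := i.2; subst hl; omega)⟩

theorem rd_flatten {n l : ℕ} (y : Fin n → Bits l) (j : Fin n) :
    rd (ext (flatten y)) (j * l) l = y j := by
  funext i
  have := mul_add_le j.2 l
  rw [rd, ext_of_lt _ (by omega), flatten]
  refine congr (congrArg y (Fin.ext ?_)) (Fin.ext ?_)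
  · exact add_mul_div_eq i.2
  · exact add_mul_mod_eq i.2

namespace Circ

theorem initVec_noQubits {kin kout qout : ℕ} (C : Circ kin 0 kout qout) (x : Bits kin)
    (z : Bits C.width) [Decidable (∀ i, ext z i = ext x i)] :
    C.initVec x (fun _ => 1) z = if ∀ i, ext z i = ext x i then 1 else 0 := by
  have hk := C.le_in
  rw [initVec]
  refine if_congr ⟨fun h i => ?_, fun h => ⟨funext fun i => ?_, fun i hi => ?_⟩⟩ rfl rfl
  · by_cases hi : i < kin
    · rw [ext_of_lt x hi, ext_of_lt z (by omega), ← h.1]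
      simp only [slice]
      congr 1
      exact Fin.ext (by simp)
    · by_cases hi' : i < C.width
      · rw [ext_of_lt _ hi', ext_of_le x (by omega)]; exact h.2 ⟨i, hi'⟩ (by simpa using hi)
      · rw [ext_of_le _ (by omega), ext_of_le x (by omega)]
  · rw [← ext_val x, ← h, ext_of_lt _ (by omega)]
    simp only [slice]
    congr 1
    exact Fin.ext (by simp)
  · rw [← ext_val z, h, ext_of_le _ hi]

theorem initVec_noBits {kout qout : ℕ} (C : Circ 0 0 kout qout) (z : Bits C.width)
    [Decidable (∀ i, ext z i = false)] :
    C.initVec noBits (fun _ => 1) z = if ∀ i, ext z i = false then 1 else 0 := by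
  classical
  rw [initVec_noQubits]
  refine if_congr (forall_congr' fun i => ?_) rfl rfl
  rw [ext_of_le noBits (Nat.zero_le i)]

/-- The total probability of outcomes of a second circuit. -/
theorem sum_prob_run_mem {kin kout qout kin' kout' qout' : ℕ} (C : Circ kin 0 kout qout)
    (C' : Circ kin' qout kout' qout') (x : Bits kin) (x' : Bits kout → Bits kin')
    (p : Bits kout → Bits kout' → Prop) [∀ y b, Decidable (p y b)] :
    0 ≤ (∑ y, ∑ b, if p y b then C'.prob (x' y) (C.run x noQubits y) b else 0) ∧
      (∑ y, ∑ b, if p y b then C'.prob (x' y) (C.run x noQubits y) b else 0) ≤ 1 := by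
  have h0 : ∀ y b, 0 ≤ C'.prob (x' y) (C.run x noQubits y) b := fun y b => by
    rw [noQubits_eq, C.run_pureState, C'.prob_sum]
    exact Finset.sum_nonneg fun r _ => C'.prob_pureState_nonneg _ _ _
  refine ⟨Finset.sum_nonneg fun y _ => Finset.sum_nonneg fun b _ => ?_, ?_⟩
  · split_ifs
    exacts [h0 y b, le_rfl]
  · have h1 : ∀ y, (∑ b, C'.prob (x' y) (C.run x noQubits y) b) = C.prob x noQubits y := fun y => by
      rw [noQubits_eq, prob_pureState, C.run_pureState]
      simp only [C'.prob_sum]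
      rw [Finset.sum_comm]
      simp only [C'.sum_prob_pureState]
      rw [← Equiv.sum_comp (splitBits C.le_out).symm]
      have key : ∀ z : Bits C.width, slice z 0 kout (by have := C.le_out; omega) = y ↔
          (splitBits C.le_out z).1 = y := fun z => Iff.rfl
      simp only [key, Equiv.apply_symm_apply, Fintype.sum_prod_type]
      rw [Finset.sum_eq_single y]
      · rw [Finset.sum_comm]
        simp
      · intro y' _ hy'
        simp [hy']
      · simp
    have h2 : (∑ y, C.prob x noQubits y) = 1 := by
      rw [noQubits_eq, sum_prob_pureState]
      simp
    rw [← h2]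
    refine Finset.sum_le_sum fun y _ => ?_
    rw [← h1]
    refine Finset.sum_le_sum fun b _ => ?_
    split_ifs
    exacts [le_rfl, h0 y b]

end Circ

namespace Kit

variable {A : GroupActionFamily} {n : ℕ} (K : Kit A n)

/-! #### Setup -/

/-- The keys made of outputs of the samplers. -/
def keys (gb : Bits (A.lenG n)) (sb : Bits (A.lenS n)) : Bits (A.lenS n + A.lenS n) :=
  Fin.append sb (K.act.eval (Fin.append gb sb))

theorem cexec_setupL (r : Bits (K.kG + K.kS)) {gb : Bits (A.lenG n)} {sb : Bits (A.lenS n)}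
    (hg : K.sampleG.eval (rd (ext r) 0 K.kG) = gb) (hs : K.sampleS.eval (rd (ext r) K.kG K.kS) = sb)
    (i : Fin ((A.lenG n + (A.lenS n + A.lenS n)) + (A.lenS n + A.lenS n))) :
    cexec K.setupL (setAt (fun _ => false) (gC A n) (K.kG + K.kS) (ext r)) i =
      (Fin.append (Fin.append gb (K.keys gb sb)) (K.keys gb sb) : Bits _) i := by
  have hg1 := K.sampleG.le_out
  have hs1 := K.sampleS.le_out
  have ha1 := K.act.le_out
  have ha2 := K.act.le_in
  have e : gC A n = (A.lenG n + (A.lenS n + A.lenS n)) + (A.lenS n + A.lenS n) := rfl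
  have e1 : K.gG = gC A n + (K.kG + K.kS) := rfl
  have e2 : K.gS = K.gG + K.sampleG.width := rfl
  have e3 : K.gA = K.gS + K.sampleS.width := rfl
  set z0 : ℕ → Bool := setAt (fun _ => false) (gC A n) (K.kG + K.kS) (ext r) with hz0
  have hr0 : rd z0 (gC A n) K.kG = rd (ext r) 0 K.kG := funext fun i => by
    simp only [rd]
    rw [hz0, setAt_add (by omega), Nat.zero_add]
  have hr1 : rd z0 (gC A n + K.kG) K.kS = rd (ext r) K.kG K.kS := funext fun i => by
    simp only [rd]
    rw [hz0, Nat.add_assoc, setAt_add (by omega)]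
  have h00 : ∀ i, K.gG ≤ i ∨ i < gC A n → z0 i = false := fun i hi => setAt_of_not (by omega)
  rw [setupL, cexec_append, cexec_append, cexec_append, cexec_append, cexec_append, cexec_append,
    cexec_append, K.sampleG.cexec_load' (by unfold Disj; omega) fun i _ => h00 _ (by omega), hr0]
  set z1 := setAt z0 K.gG K.sampleG.width (K.sampleG.wires (rd (ext r) 0 K.kG)) with hz1
  have hr2 : rd z1 (gC A n + K.kG) K.kS = rd (ext r) K.kG K.kS := by
    rw [← hr1]
    exact rd_congr fun i hi => by rw [hz1, setAt_of_not (by omega)]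
  rw [K.sampleS.cexec_load' (by unfold Disj; omega) fun i _ => by
    rw [hz1, setAt_of_not (by omega), h00 _ (by omega)], hr2]
  set z2 := setAt z1 K.gS K.sampleS.width (K.sampleS.wires (rd (ext r) K.kG K.kS)) with hz2
  have hrg : rd z2 K.gG (A.lenG n) = gb := funext fun i => by
    simp only [rd]
    rw [hz2, setAt_of_not (by omega), hz1, setAt_add (by omega), K.sampleG.wires_of_eval hg i.2,
      ext_val]
  have hrs : rd z2 K.gS (A.lenS n) = sb := funext fun i => by
    simp only [rd]
    rw [hz2, setAt_add (by omega), K.sampleS.wires_of_eval hs i.2, ext_val]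
  rw [K.act.cexec_load₂ (by unfold Disj; omega) (by unfold Disj; omega) fun i _ => by
    rw [hz2, setAt_of_not (by omega), hz1, setAt_of_not (by omega), h00 _ (by omega)], hrg, hrs]
  set z3 := setAt z2 K.gA K.act.width (K.act.wires (Fin.append gb sb)) with hz3
  have hg3 : ∀ i < A.lenG n, z3 (K.gG + i) = ext gb i := fun i hi => by
    rw [hz3, setAt_of_not (by omega), rd_val hrg hi]
  have hs3 : ∀ i < A.lenS n, z3 (K.gS + i) = ext sb i := fun i hi => by
    rw [hz3, setAt_of_not (by omega), rd_val hrs hi]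
  have ha3 : ∀ i < A.lenS n, z3 (K.gA + i) = ext (K.act.eval (Fin.append gb sb)) i := fun i hi => by
    rw [hz3, setAt_add (by omega), K.act.wires_of_eval rfl hi]
  have h03 : ∀ i < gC A n, z3 i = false := fun i hi => by
    rw [hz3, setAt_of_not (by omega), hz2, setAt_of_not (by omega), hz1, setAt_of_not (by omega),
      h00 _ (by omega)]
  have hi := i.2
  rw [cexec_copyG (by unfold Disj; omega), cexec_copyG (by unfold Disj; omega),
    cexec_copyG (by unfold Disj; omega), cexec_copyG (by unfold Disj; omega),
    cexec_copyG (by unfold Disj; omega), ← ext_val (Fin.append _ _) i, ext_append, ext_append]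
  unfold keys
  rw [ext_append]
  -- The five fields of the output: group element and two set elements of the secret key, then the
  -- two set elements again as the public key.
  by_cases c1 : (i : ℕ) < A.lenG n
  · rw [if_pos (by omega), if_pos c1, xorAt_of_not (by omega), xorAt_of_not (by omega),
      xorAt_of_not (by omega), xorAt_of_not (by omega), xorAt_apply (by omega) (by omega),
      h03 _ (by omega), Bool.false_xor, hg3 _ (by omega), Nat.sub_zero]
  by_cases c2 : (i : ℕ) < A.lenG n + A.lenS n
  · rw [if_pos (by omega), if_neg c1, if_pos (by omega), xorAt_of_not (by omega),
      xorAt_of_not (by omega), xorAt_of_not (by omega), xorAt_apply (by omega) (by omega),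
      xorAt_of_not (by omega), xorAt_of_not (by omega), h03 _ (by omega), Bool.false_xor,
      hs3 _ (by omega)]
  by_cases c3 : (i : ℕ) < A.lenG n + (A.lenS n + A.lenS n)
  · rw [if_pos (by omega), if_neg c1, if_neg (by omega), xorAt_of_not (by omega),
      xorAt_of_not (by omega), xorAt_apply (by omega) (by omega), xorAt_of_not (by omega),
      xorAt_of_not (by omega), xorAt_of_not (by omega), xorAt_of_not (by omega), h03 _ (by omega),
      Bool.false_xor, ha3 _ (by omega)]
    congr 1
    omega
  rw [if_neg c3, ext_append]
  by_cases c4 : (i : ℕ) < A.lenG n + (A.lenS n + A.lenS n) + A.lenS n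
  · rw [if_pos (by omega), xorAt_of_not (by omega), xorAt_apply (by omega) (by omega),
      xorAt_of_not (by omega), xorAt_of_not (by omega), xorAt_of_not (by omega),
      xorAt_of_not (by omega), xorAt_of_not (by omega), xorAt_of_not (by omega), h03 _ (by omega),
      Bool.false_xor, hs3 _ (by omega)]
  · rw [if_neg (by omega), xorAt_apply (by omega) (by omega), xorAt_of_not (by omega),
      xorAt_of_not (by omega), xorAt_of_not (by omega), xorAt_of_not (by omega),
      xorAt_of_not (by omega), xorAt_of_not (by omega), xorAt_of_not (by omega),
      xorAt_of_not (by omega), h03 _ (by omega), Bool.false_xor, ha3 _ (by omega)]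
    congr 1
    omega

-- Each string of coins has squared amplitude `2⁻ᵏ`, with `k` the number of coins, and the classical
-- gates permute basis states, so the probability counts the coins that lead to `y`.
open Classical in
theorem prob_setup (y : Bits ((A.lenG n + (A.lenS n + A.lenS n)) + (A.lenS n + A.lenS n))) :
    K.setup.prob noBits noQubits y = ∑ r : Bits (K.kG + K.kS),
      if Fin.append (Fin.append (K.sampleG.eval (rd (ext r) 0 K.kG))
          (K.keys (K.sampleG.eval (rd (ext r) 0 K.kG)) (K.sampleS.eval (rd (ext r) K.kG K.kS))))
        (K.keys (K.sampleG.eval (rd (ext r) 0 K.kG)) (K.sampleS.eval (rd (ext r) K.kG K.kS))) = y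
      then (1 / 2) ^ (K.kG + K.kS) else 0 := by
  have hC : gC A n + (K.kG + K.kS) ≤ K.gN + 1 := by unfold gN gA gS gG; omega
  have hk : (A.lenG n + (A.lenS n + A.lenS n)) + (A.lenS n + A.lenS n) = gC A n := rfl
  rw [noQubits_eq, Circ.prob_pureState]
  set v0 : Bits (K.gN + 1) → ℂ := K.setup.initVec noBits fun _ => 1 with hv0
  have hv0' : ∀ z, v0 z = if ∀ i, ext z i = false then 1 else 0 := fun z =>
    K.setup.initVec_noBits z
  set v1 : Bits (K.gN + 1) → ℂ := evolve (toFin _ (hadG (gC A n) (K.kG + K.kS))) v0 with hv1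
  have hv1' : ∀ z, v1 z = if ∀ i, ¬ (gC A n ≤ i ∧ i < gC A n + (K.kG + K.kS)) → ext z i = false then
      (1 / (Real.sqrt 2 : ℂ)) ^ (K.kG + K.kS) else 0 := fun z => by
    rw [hv1, evolve_hadG_zero hC v0 fun y ⟨i, _, h⟩ => by
      rw [hv0', if_neg fun h' => by rw [h'] at h; exact absurd h (by simp)], hv0',
      ext_res fun i hi => by rw [setAt_of_not (by omega), ext_of_le _ hi]]
    by_cases h : ∀ i, ¬ (gC A n ≤ i ∧ i < gC A n + (K.kG + K.kS)) → ext z i = false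
    · rw [if_pos h, if_pos, mul_one]
      intro i
      by_cases hi : gC A n ≤ i ∧ i < gC A n + (K.kG + K.kS)
      · exact setAt_apply hi.1 hi.2
      · rw [setAt_of_not hi, h i hi]
    · rw [if_neg h, if_neg, mul_zero]
      exact fun h' => h fun i hi => by rw [← h' i, setAt_of_not hi]
  have hamp : K.setup.amp noBits (fun _ => 1) =
      evolve (toFin (K.gN + 1) (K.setupL.map Gate.classical)) v1 := by
    show evolve (toFin (K.gN + 1) K.setupGates) v0 = _
    rw [setupGates, toFin_append, evolve_append]
  have h1 : (∑ z : Bits K.setup.width, if slice z 0 _ (by have := K.setup.le_out; omega) = y then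
      ‖K.setup.amp noBits (fun _ => 1) z‖ ^ 2 else 0) =
      ∑ z : Bits (K.gN + 1), if slice z 0 _ (by omega) = y then
        ‖evolve (toFin (K.gN + 1) (K.setupL.map Gate.classical)) v1 z‖ ^ 2 else 0 := by
    rw [hamp]
    rfl
  rw [h1, sum_evolve_classical K.onWires_setupL v1 (fun z => slice z 0 _ (by omega) = y)]
  have h2 : ∀ z, (if slice (cperm (K.gN + 1) K.setupL z) 0
      ((A.lenG n + (A.lenS n + A.lenS n)) + (A.lenS n + A.lenS n)) (by omega) = y then
        ‖v1 z‖ ^ 2 else 0) =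
      if ∀ i, ¬ (gC A n ≤ i ∧ i < gC A n + (K.kG + K.kS)) → ext z i = false then
        (if slice (cperm (K.gN + 1) K.setupL z) 0
          ((A.lenG n + (A.lenS n + A.lenS n)) + (A.lenS n + A.lenS n)) (by omega) = y then
          (1 / 2 : ℝ) ^ (K.kG + K.kS) else 0) else 0 := fun z => by
    rw [hv1']
    split_ifs <;> simp only [norm_half_sqrt_sq, norm_zero, ne_eq, OfNat.ofNat_ne_zero,
      not_false_eq_true, zero_pow]
  rw [Finset.sum_congr rfl fun z _ => h2 z, sum_region hC]
  refine Finset.sum_congr rfl fun r _ => if_congr ?_ rfl rfl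
  have h3 : slice (cperm (K.gN + 1) K.setupL (res (K.gN + 1)
      (setAt (fun _ => false) (gC A n) (K.kG + K.kS) (ext r)))) 0
      ((A.lenG n + (A.lenS n + A.lenS n)) + (A.lenS n + A.lenS n)) (by omega) =
      Fin.append (Fin.append (K.sampleG.eval (rd (ext r) 0 K.kG))
          (K.keys (K.sampleG.eval (rd (ext r) 0 K.kG)) (K.sampleS.eval (rd (ext r) K.kG K.kS))))
        (K.keys (K.sampleG.eval (rd (ext r) 0 K.kG)) (K.sampleS.eval (rd (ext r) K.kG K.kS))) := by
    funext i
    have := K.cexec_setupL r rfl rfl i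
    rw [← this]
    simp only [slice, cperm, res]
    rw [Nat.zero_add]
    congr 1
    exact ext_res fun i hi => setAt_of_not (by omega)
  rw [h3]

/-- Averages over the keys are averages over the outputs of the samplers. -/
theorem sum_setup (F : Bits (A.lenG n + (A.lenS n + A.lenS n)) → Bits (A.lenS n + A.lenS n) → ℝ) :
    (∑ sk, ∑ pk, K.setup.prob noBits noQubits (Fin.append sk pk) * F sk pk) =
      ∑ gb, ∑ sb, K.sampleG.coinDist gb * K.sampleS.coinDist sb *
        F (Fin.append gb (K.keys gb sb)) (K.keys gb sb) := by
  classical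
  have h1 : ∀ gb, (∑ sb, K.sampleG.coinDist gb * K.sampleS.coinDist sb *
      F (Fin.append gb (K.keys gb sb)) (K.keys gb sb)) =
      K.sampleG.coinDist gb * ∑ r, (1 / 2) ^ K.kS * F (Fin.append gb (K.keys gb
        (K.sampleS.eval r))) (K.keys gb (K.sampleS.eval r)) := fun gb => by
    rw [← sum_coinDist_mul K.sampleS fun sb => F (Fin.append gb (K.keys gb sb)) (K.keys gb sb),
      Finset.mul_sum]
    exact Finset.sum_congr rfl fun _ _ => by ring
  rw [Finset.sum_congr rfl fun gb _ => h1 gb, sum_coinDist_mul]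
  simp only [prob_setup, Finset.sum_mul]
  have hinj : ∀ {a b : ℕ} (x x' : Bits a) (y y' : Bits b), Fin.append x y = Fin.append x' y' ↔
      x = x' ∧ y = y' := fun x x' y y' => by
    constructor
    · intro h
      have := (Fin.appendEquiv _ _).injective (a₁ := (x, y)) (a₂ := (x', y')) h
      exact Prod.ext_iff.1 this
    · rintro ⟨rfl, rfl⟩; rfl
  simp only [hinj, ite_and]
  have h2 : ∀ r : Bits (K.kG + K.kS), (∑ sk, ∑ pk, (if Fin.append (K.sampleG.eval
      (rd (ext r) 0 K.kG)) (K.keys (K.sampleG.eval (rd (ext r) 0 K.kG))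
        (K.sampleS.eval (rd (ext r) K.kG K.kS))) = sk then
      if K.keys (K.sampleG.eval (rd (ext r) 0 K.kG))
        (K.sampleS.eval (rd (ext r) K.kG K.kS)) = pk then (1 / 2 : ℝ) ^ (K.kG + K.kS) else 0
      else 0) * F sk pk) = (1 / 2 : ℝ) ^ (K.kG + K.kS) * F (Fin.append (K.sampleG.eval
      (rd (ext r) 0 K.kG)) (K.keys (K.sampleG.eval (rd (ext r) 0 K.kG))
        (K.sampleS.eval (rd (ext r) K.kG K.kS)))) (K.keys (K.sampleG.eval (rd (ext r) 0 K.kG))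
        (K.sampleS.eval (rd (ext r) K.kG K.kS))) := fun r => by
    simp only [ite_mul, zero_mul]
    rw [Finset.sum_comm]
    simp [Finset.sum_ite_eq]
  have h3 : ∀ sk, (∑ pk, ∑ r : Bits (K.kG + K.kS), (if Fin.append (K.sampleG.eval
      (rd (ext r) 0 K.kG)) (K.keys (K.sampleG.eval (rd (ext r) 0 K.kG))
        (K.sampleS.eval (rd (ext r) K.kG K.kS))) = sk then
      if K.keys (K.sampleG.eval (rd (ext r) 0 K.kG))
        (K.sampleS.eval (rd (ext r) K.kG K.kS)) = pk then (1 / 2 : ℝ) ^ (K.kG + K.kS) else 0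
      else 0) * F sk pk) = ∑ r : Bits (K.kG + K.kS), ∑ pk, (if Fin.append (K.sampleG.eval
      (rd (ext r) 0 K.kG)) (K.keys (K.sampleG.eval (rd (ext r) 0 K.kG))
        (K.sampleS.eval (rd (ext r) K.kG K.kS))) = sk then
      if K.keys (K.sampleG.eval (rd (ext r) 0 K.kG))
        (K.sampleS.eval (rd (ext r) K.kG K.kS)) = pk then (1 / 2 : ℝ) ^ (K.kG + K.kS) else 0
      else 0) * F sk pk := fun sk => Finset.sum_comm
  rw [Finset.sum_congr rfl fun sk _ => h3 sk, Finset.sum_comm, Finset.sum_congr rfl fun r _ => h2 r,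
    ← Equiv.sum_comp (Fin.appendEquiv K.kG K.kS), Fintype.sum_prod_type]
  refine Finset.sum_congr rfl fun r _ => ?_
  rw [Finset.mul_sum]
  refine Finset.sum_congr rfl fun r' _ => ?_
  have e1 : rd (ext (Fin.append r r')) 0 K.kG = r := by
    rw [rd_append_left _ _ (by omega), rd_ext]
  have e2 : rd (ext (Fin.append r r')) K.kG K.kS = r' := by
    rw [rd_append_right (o := 0) _ _ (by omega), rd_ext]
  show (1 / 2 : ℝ) ^ (K.kG + K.kS) * F (Fin.append (K.sampleG.eval
      (rd (ext (Fin.append r r')) 0 K.kG)) (K.keys (K.sampleG.eval (rd (ext (Fin.append r r')) 0 K.kG))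
        (K.sampleS.eval (rd (ext (Fin.append r r')) K.kG K.kS)))) (K.keys (K.sampleG.eval
          (rd (ext (Fin.append r r')) 0 K.kG))
        (K.sampleS.eval (rd (ext (Fin.append r r')) K.kG K.kS))) = _
  rw [e1, e2, pow_add, mul_assoc]

end Kit

end QL

/-! ### The honest state, and the semi-verification as a predicate. -/

namespace QL

open Matrix

namespace Kit

variable {A : GroupActionFamily} {n : ℕ} (K : Kit A n)

/-- The amplitudes of the superposition circuit. -/
noncomputable def supAmp : Bits K.W → ℂ := K.sup.amp noBits fun _ => 1

/-- The amplitudes of the honest state, without the condition on the serial number. -/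
noncomputable def honest (p : Bits n × (Fin n → Bits K.W)) : ℂ :=
  (1 / (Real.sqrt 2 : ℂ)) ^ n * ∏ j, K.supAmp (p.2 j)

variable (s0 s1 : Bits (A.lenS n))

/-- The serial number that belongs to a basis state. -/
def snumOf (p : Bits n × (Fin n → Bits K.W)) : Bits ((A.lenS n + A.lenS n) + n * A.lenS n) :=
  Fin.append (Fin.append s0 s1) (flatten fun j =>
    K.act.eval (Fin.append (K.head (p.2 j)) (if p.1 j then s1 else s0)))

theorem img_snumOf (p : Bits n × (Fin n → Bits K.W)) (j : Fin n) :
    img (K.snumOf s0 s1 p) j =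
      K.act.eval (Fin.append (K.head (p.2 j)) (if p.1 j then s1 else s0)) := by
  rw [img, snumOf, rd_append_right (o := j * A.lenS n) _ _ rfl, rd_flatten]

/-- The wires before the action is computed. -/
def stateI (a : Bits (n + n * K.W)) : Bits (K.tN + 1) :=
  res _ (ext (Fin.append (Fin.append (Fin.append s0 s1) fun _ : Fin (n * A.lenS n) => false) a))

/-- The wires after the action was computed. -/
def stateT (p : Bits n × (Fin n → Bits K.W)) : Bits (K.tN + 1) :=
  res _ (ext (Fin.append (K.snumOf s0 s1 p) (qEquiv n K.W p)))

theorem tN_ge : (A.lenS n + A.lenS n) + n * A.lenS n + (n + n * K.W) ≤ K.tN + 1 := by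
  unfold tN tw tD tB tY
  omega

theorem ext_stateI (a : Bits (n + n * K.W)) : ext (K.stateI s0 s1 a) =
    ext (Fin.append (Fin.append (Fin.append s0 s1) fun _ : Fin (n * A.lenS n) => false) a) :=
  ext_res fun i hi => ext_of_le _ (by have := K.tN_ge; omega)

theorem ext_stateT (p : Bits n × (Fin n → Bits K.W)) : ext (K.stateT s0 s1 p) =
    ext (Fin.append (K.snumOf s0 s1 p) (qEquiv n K.W p)) :=
  ext_res fun i hi => ext_of_le _ (by have := K.tN_ge; omega)

theorem rd_stateI_block (p : Bits n × (Fin n → Bits K.W)) (j : Fin n) :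
    rd (ext (K.stateI s0 s1 (qEquiv n K.W p))) (tD A n + j * K.W) K.W = p.2 j := by
  rw [ext_stateI, rd_append_right (o := n + j * K.W) _ _ (by unfold tD tB tY; omega), rd_qEquiv]

theorem cperm_stateI (p : Bits n × (Fin n → Bits K.W)) :
    cperm _ (K.ysL 0 (tY A n) (tB A n) (tD A n) K.tw) (K.stateI s0 s1 (qEquiv n K.W p)) =
      K.stateT s0 s1 p := by
  have hN := K.tN_ge
  have hG := K.lenG_le
  have e1 : tY A n = A.lenS n + A.lenS n := rfl
  have e2 : tB A n = tY A n + n * A.lenS n := rfl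
  have e3 : tD A n = tB A n + n := rfl
  have e4 : K.tw = tD A n + n * K.W := rfl
  apply ext_injective
  rw [ext_cperm K.onWires_stateL, ext_stateT, K.cexec_ysL (by omega) e2.ge e3.ge e4.ge
    fun i _ => by rw [ext_stateI, ext_of_le _ (by omega)]]
  funext i
  by_cases hi : tY A n ≤ i ∧ i < tY A n + n * A.lenS n
  · obtain ⟨k, rfl⟩ := Nat.exists_eq_add_of_le hi.1
    obtain ⟨j, hj, l, hl, rfl⟩ := exists_block (show k < n * A.lenS n by omega)
    rw [xorAt_add (by omega), add_mul_div_eq hl, add_mul_mod_eq hl]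
    have hz : ext (K.stateI s0 s1 (qEquiv n K.W p)) (tY A n + (j * A.lenS n + l)) = false := by
      rw [ext_stateI, ext_append, if_pos (by omega), ext_append, if_neg (by omega),
        ext_of_lt _ (by omega)]
    have hbit : ext (K.stateI s0 s1 (qEquiv n K.W p)) (tB A n + j) = p.1 ⟨j, hj⟩ := by
      rw [ext_stateI, ext_append, if_neg (by omega)]
      have := ext_qEquiv p.1 p.2 ⟨j, hj⟩
      rw [← this]
      congr 1
      simp only
      omega
    have h0 : rd (ext (K.stateI s0 s1 (qEquiv n K.W p))) 0 (A.lenS n) = s0 := by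
      rw [ext_stateI, rd_append_left _ _ (by omega), rd_append_left _ _ (by omega),
        rd_append_left _ _ (by omega), rd_ext]
    have h1 : rd (ext (K.stateI s0 s1 (qEquiv n K.W p))) (0 + A.lenS n) (A.lenS n) = s1 := by
      rw [ext_stateI, rd_append_left _ _ (by omega), rd_append_left _ _ (by omega),
        rd_append_right (o := 0) _ _ (by omega), rd_ext]
    have hh : rd (ext (K.stateI s0 s1 (qEquiv n K.W p))) (tD A n + j * K.W) (A.lenG n) =
        K.head (p.2 ⟨j, hj⟩) := funext fun i => by
      rw [head_apply]
      exact rd_val (K.rd_stateI_block s0 s1 p ⟨j, hj⟩) (by omega)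
    have hv : K.actV 0 (tB A n) (tD A n) (ext (K.stateI s0 s1 (qEquiv n K.W p))) j l =
        ext (img (K.snumOf s0 s1 p) j) l := by
      rw [K.img_snumOf s0 s1 p ⟨j, hj⟩, actV]
      refine K.act.wires_of_eval ?_ hl
      rw [hh, selS, hbit]
      split_ifs
      · rw [h1]
      · rw [h0]
    rw [hz, hv, Bool.false_xor, img, ext_rd_of_lt _ _ hl, ext_append, if_pos (by omega)]
    congr 1
    omega
  · rw [xorAt_of_not hi, ext_stateI, ext_append (Fin.append (Fin.append s0 s1) _),
      ext_append (K.snumOf s0 s1 p)]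
    split_ifs with h
    · rw [snumOf, ext_append (Fin.append s0 s1), ext_append (Fin.append s0 s1),
        if_pos (by omega), if_pos (by omega)]
    · rfl

-- As the action is computed and its work space restored, every basis state in the support is
-- determined by its bits and blocks and carries the serial number that belongs to them. The second
-- half excludes all other basis states.
open Classical in
theorem amp_stateGen :
    (∀ p, K.stateGen.amp (Fin.append s0 s1) (fun _ => 1) (K.stateT s0 s1 p) = K.honest p) ∧
    ∀ z, K.stateGen.amp (Fin.append s0 s1) (fun _ => 1) z ≠ 0 → ∃ p, z = K.stateT s0 s1 p := by
  have hN := K.tN_ge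
  have e1 : tY A n = A.lenS n + A.lenS n := rfl
  have e2 : tB A n = tY A n + n * A.lenS n := rfl
  have e3 : tD A n = tB A n + n := rfl
  have hb : tD A n + n * K.W ≤ K.tN + 1 := by omega
  set v0 : Bits (K.tN + 1) → ℂ := K.stateGen.initVec (Fin.append s0 s1) fun _ => 1 with hv0
  have hv0' : ∀ z, v0 z = if ∀ i, ext z i = ext (Fin.append s0 s1) i then 1 else 0 := fun z =>
    K.stateGen.initVec_noQubits (Fin.append s0 s1) z
  set u0 : Bits K.W → ℂ := K.sup.initVec noBits fun _ => 1 with hu0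
  have hu0' : ∀ z, u0 z = if ∀ i, ext z i = false then 1 else 0 := fun z =>
    K.sup.initVec_noBits z
  -- The amplitude of the bits, together with the condition that the wires outside bits and blocks
  -- hold the public key followed by zeros. It does not involve the blocks, so it is a spectator of
  -- the superposition circuits.
  set c : Bits (K.tN + 1) → ℂ := fun z => if ∀ i, ¬ (tB A n ≤ i ∧ i < tD A n + n * K.W) →
    ext z i = ext (Fin.append s0 s1) i then (1 / (Real.sqrt 2 : ℂ)) ^ n else 0 with hc
  have h1 : evolve (toFin _ (hadG (tB A n) n)) v0 =
      fun z => (∏ j ∈ Finset.range n, u0 (rd (ext z) (tD A n + j * K.W) K.W)) * c z := by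
    funext z
    rw [evolve_hadG_zero (by omega) v0 fun y ⟨i, hi, h⟩ => by
      rw [hv0', if_neg fun h' => by
        rw [h', ext_of_le _ (by omega)] at h
        exact absurd h (by simp)], hv0',
      ext_res fun i hi => by rw [setAt_of_not (by omega), ext_of_le _ hi]]
    simp only [hu0', hc]
    rw [Finset.prod_ite_zero, Finset.prod_const_one]
    by_cases h : ∀ i, setAt (ext z) (tB A n) n (fun _ => false) i = ext (Fin.append s0 s1) i
    · rw [if_pos h, if_pos, if_pos, mul_one, one_mul]
      · intro i hi
        rw [← h i, setAt_of_not (by omega)]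
      · intro j hj i
        have := mul_add_le (Finset.mem_range.1 hj) K.W
        by_cases hi : i < K.W
        · rw [ext_rd_of_lt _ _ hi]
          have := h (tD A n + j * K.W + i)
          rwa [setAt_of_not (by omega), ext_of_le (Fin.append s0 s1) (by omega)] at this
        · rw [ext_of_le _ (by omega)]
    · rw [if_neg h, mul_zero]
      symm
      by_contra hne
      have h2 := (ite_ne_right_iff.1 (left_ne_zero_of_mul hne)).1
      have h3 := (ite_ne_right_iff.1 (right_ne_zero_of_mul hne)).1
      refine h fun i => ?_
      by_cases hi : tB A n ≤ i ∧ i < tB A n + n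
      · rw [setAt_apply hi.1 hi.2, ext_of_le _ (by omega)]
      rw [setAt_of_not hi]
      by_cases hi' : tD A n ≤ i ∧ i < tD A n + n * K.W
      · obtain ⟨k, rfl⟩ := Nat.exists_eq_add_of_le hi'.1
        obtain ⟨j, hj, l, hl, rfl⟩ := exists_block (show k < n * K.W by omega)
        have := h2 j (Finset.mem_range.2 hj) l
        rw [ext_rd_of_lt _ _ hl] at this
        rw [← Nat.add_assoc, this, ext_of_le _ (by omega)]
      · exact h3 i (by omega)
  have h2 : evolve (toFin _ (K.supGates (tD A n))) (evolve (toFin _ (hadG (tB A n) n)) v0) =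
      fun z => (∏ j ∈ Finset.range n, K.supAmp (rd (ext z) (tD A n + j * K.W) K.W)) * c z := by
    rw [h1]
    exact evolve_blocks hb K.sup.gates u0 fun z z' hzz => by
      simp only [hc]
      refine if_congr (forall₂_congr fun i hi => ?_) rfl rfl
      by_cases hi' : i < K.tN + 1
      · rw [ext_of_lt z hi', ext_of_lt z' hi', hzz ⟨i, hi'⟩ (by simp only; omega)]
      · rw [ext_of_le z (by omega), ext_of_le z' (by omega)]
  set v2 : Bits (K.tN + 1) → ℂ := fun z =>
    (∏ j ∈ Finset.range n, K.supAmp (rd (ext z) (tD A n + j * K.W) K.W)) * c z with hv2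
  have hamp : K.stateGen.amp (Fin.append s0 s1) (fun _ => 1) = evolve (toFin (K.tN + 1)
      ((K.ysL 0 (tY A n) (tB A n) (tD A n) K.tw).map Gate.classical)) v2 := by
    show evolve (toFin (K.tN + 1) K.stateGates) v0 = _
    rw [stateGates, toFin_append, toFin_append, evolve_append, evolve_append, h2]
  rw [hamp]
  constructor
  · intro p
    rw [← cperm_stateI, evolve_toFin_classical_cperm K.onWires_stateL, hv2]
    simp only [hc]
    rw [if_pos, Finset.prod_range, honest, mul_comm]
    · congr 1
      exact Finset.prod_congr rfl fun j _ => by rw [rd_stateI_block]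
    · intro i hi
      rw [ext_stateI, ext_append]
      by_cases hi' : i < A.lenS n + A.lenS n + n * A.lenS n
      · rw [if_pos hi', ext_append]
        split_ifs with h
        · rfl
        · rw [ext_of_lt _ (by omega), ext_of_le _ (by omega)]
      · rw [if_neg hi', ext_of_le _ (by omega), ext_of_le _ (by omega)]
  · intro (z : Bits (K.tN + 1)) hz
    change evolve (toFin (K.tN + 1) ((K.ysL 0 (tY A n) (tB A n) (tD A n) K.tw).map
      Gate.classical)) v2 z ≠ 0 at hz
    rw [evolve_toFin_classical K.onWires_stateL] at hz
    have h3 := (ite_ne_right_iff.1 (right_ne_zero_of_mul hz)).1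
    set y := cperm (K.tN + 1) (K.ysL 0 (tY A n) (tB A n) (tD A n) K.tw).reverse z with hy
    have h4 : y = K.stateI s0 s1 (rd (ext y) (tB A n) (n + n * K.W)) := by
      apply ext_injective
      rw [ext_stateI]
      funext i
      rw [ext_append]
      by_cases hi : i < A.lenS n + A.lenS n + n * A.lenS n
      · rw [if_pos hi, h3 i (by omega), ext_append (Fin.append s0 s1)]
        split_ifs with h
        · rfl
        · rw [ext_of_le _ (by omega), ext_of_lt _ (by omega)]
      · rw [if_neg hi]
        by_cases hi' : i < tD A n + n * K.W
        · rw [ext_rd_of_lt _ _ (by omega)]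
          congr 1
          omega
        · rw [ext_of_le _ (by omega : n + n * K.W ≤ _), h3 i (by omega), ext_of_le _ (by omega)]
    obtain ⟨p, hp⟩ := (qEquiv n K.W).surjective (rd (ext y) (tB A n) (n + n * K.W))
    rw [← hp] at h4
    refine ⟨p, ?_⟩
    have h5 := cperm_reverse' (w := K.tN + 1) K.onWires_stateL z
    rw [← h5, ← hy, h4, cperm_stateI]

theorem splitBits_stateT (p : Bits n × (Fin n → Bits K.W)) :
    splitBits K.stateGen.le_out (K.stateT s0 s1 p) =
      (K.snumOf s0 s1 p, qEquiv n K.W p, fun _ => false) := by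
  have hN := K.tN_ge
  refine Prod.ext (funext fun i => ?_) (Prod.ext (funext fun i => ?_) (funext fun i => ?_)) <;>
    simp only [splitBits, Equiv.coe_fn_mk, slice, stateT, res]
  · rw [ext_append, if_pos (by omega), Nat.zero_add, ext_val]
  · rw [ext_append, if_neg (by omega), Nat.add_sub_cancel_left, ext_val]
  · rw [ext_of_le _ (by omega)]

open Classical in
/-- The honest state for a given serial number. -/
theorem run_stateGen (snum : Bits ((A.lenS n + A.lenS n) + n * A.lenS n)) :
    K.stateGen.run (Fin.append s0 s1) noQubits snum = pureState fun a =>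
      if snum = K.snumOf s0 s1 ((qEquiv n K.W).symm a) then K.honest ((qEquiv n K.W).symm a)
      else 0 := by
  obtain ⟨h1, h2⟩ := K.amp_stateGen s0 s1
  -- The discarded wires are zero throughout the support, so a single component remains and the
  -- state is pure. The garbage of the superposition circuit is kept in the blocks and not
  -- discarded.
  rw [noQubits_eq, Circ.run_pureState, Finset.sum_eq_single fun _ => false]
  · congr 1
    funext a
    split_ifs with h
    · rw [← h1]
      congr 1
      refine (splitBits K.stateGen.le_out).injective ?_
      rw [Equiv.apply_symm_apply, splitBits_stateT, ← h, Equiv.apply_symm_apply]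
    · by_contra hne
      obtain ⟨p, hp⟩ := h2 _ hne
      replace hp := congrArg (splitBits K.stateGen.le_out) hp
      rw [Equiv.apply_symm_apply, splitBits_stateT] at hp
      have h3 := (Prod.ext_iff.1 hp).1
      have h4 := (Prod.ext_iff.1 (Prod.ext_iff.1 hp).2).1
      simp only at h3 h4
      exact h (by rw [h3, h4, Equiv.symm_apply_apply])
  · intro r _ hr
    have : (fun a => K.stateGen.amp (Fin.append s0 s1) (fun _ => 1)
        ((splitBits K.stateGen.le_out).symm (snum, a, r))) = 0 := by
      funext a
      by_contra hne
      obtain ⟨p, hp⟩ := h2 _ hne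
      replace hp := congrArg (splitBits K.stateGen.le_out) hp
      rw [Equiv.apply_symm_apply, splitBits_stateT] at hp
      exact hr (Prod.ext_iff.1 (Prod.ext_iff.1 hp).2).2
    rw [this]
    ext a b
    simp [pureState_apply]
  · simp

/-! #### Semi-verification -/

/-- The semi-verification sets the same flags as the full verification, so the two verdicts can be
compared tuple by tuple. The circuit sees only `s` and `g • s`; the element `g` enters through the
untwisted formulation. -/
theorem semiVer_iff (g : A.G n) (s : A.S n) (snum : Bits ((A.lenS n + A.lenS n) + n * A.lenS n))
    (β : Bits n) (u : Fin n → Bits K.W) :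
    K.semiVer.eval (Fin.append (Fin.append (Fin.append (A.repS n s) (A.repS n (g • s))) snum)
      (qEquiv n K.W (β, u))) 0 = true ↔
      ∀ j : Fin n, K.Maps s (img snum j) (if β j then K.twist g⁻¹ (u j) else u j) := by
  have hG := K.lenG_le
  have e1 : sY A n = (A.lenS n + A.lenS n) + (A.lenS n + A.lenS n) := rfl
  have e2 : sB A n = sY A n + n * A.lenS n := rfl
  have e3 : sD A n = sB A n + n := rfl
  have e4 : K.sF = sD A n + n * K.W := rfl
  have e5 : K.sc = K.sF + n * (1 + A.lenS n) + 1 := rfl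
  have e6 : K.sw = K.sc + (n * (1 + A.lenS n) + 1) := rfl
  have e7 : K.sw' = K.sw + K.act.width := rfl
  set z := ext (Fin.append (Fin.append (Fin.append (A.repS n s) (A.repS n (g • s))) snum)
    (qEquiv n K.W (β, u))) with hz
  have hz0 : ∀ i, K.sF ≤ i → z i = false := fun i hi => ext_of_le _ (by omega)
  rw [semiVer, detCirc_eval _ _ K.onWires_semiL, ← hz, semiL, cexec_append, cexec_append]
  have h0 := cexec_swapG (a := 0) (b := K.sc + n * (1 + A.lenS n)) (m := 1)
    (by unfold Disj; omega) (cexec (chainG K.sF K.sc (n * (1 + A.lenS n)))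
      (cexec (K.flagsL 0 (sY A n) (sB A n) (sD A n) K.sF K.sw K.sw') z)) (i := 0) Nat.one_pos
  rw [show (((0 : Fin 1) : ℕ)) = 0 + 0 from rfl, h0, Nat.add_zero]
  rw [K.cexec_flagsL (by omega) e2.ge e3.ge e4.ge (by omega) e7.ge fun i hi _ =>
    hz0 i (by omega), cexec_chainG (by unfold Disj; omega) fun i hi => by
      rw [xorAt_of_not (by omega), hz0 _ (by omega)]]
  have h1 : ∀ i < n * (1 + A.lenS n), xorAt z K.sF (n * (1 + A.lenS n)) (fun i =>
      K.flagV 0 (sY A n) (sB A n) (sD A n) z (i / (1 + A.lenS n)) (i % (1 + A.lenS n)))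
        (K.sF + i) = K.flagV 0 (sY A n) (sB A n) (sD A n) z (i / (1 + A.lenS n))
          (i % (1 + A.lenS n)) := fun i hi => by
    rw [xorAt_add hi, hz0 _ (by omega), Bool.false_xor]
  rw [forall₂_congr fun i hi => by rw [h1 i hi], flagV_iff]
  have key : ∀ j : Fin n, K.Valid 0 (sY A n) (sB A n) (sD A n) z j ↔
      K.Maps s (img snum j) (if β j then K.twist g⁻¹ (u j) else u j) := fun j => by
    have hj := mul_add_le j.2 (A.lenS n)
    refine K.valid_iff ?_ ?_ ?_ ?_ ?_
    · rw [hz, rd_append_left _ _ (by omega), rd_append_left _ _ (by omega),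
        rd_append_left _ _ (by omega), rd_ext]
    · rw [hz, rd_append_left _ _ (by omega), rd_append_left _ _ (by omega),
        rd_append_right (o := 0) _ _ (by omega), rd_ext]
    · rw [hz, ext_append, if_neg (by omega), ← ext_qEquiv β u j]
      congr 1
      omega
    · funext i
      rw [head_apply]
      refine rd_val (x := u j) (o := sD A n + j * K.W) ?_ (by omega)
      rw [hz, rd_append_right (o := n + j * K.W) _ _ (by omega), rd_qEquiv]
    · rw [hz, rd_append_left _ _ (by omega),
        rd_append_right (o := (A.lenS n + A.lenS n) + j * A.lenS n) _ _ (by omega)]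
      rfl
  exact ⟨fun H j => (key j).1 (H j j.2), fun H j hj => (key ⟨j, hj⟩).2 (H ⟨j, hj⟩)⟩

end Kit

end QL

/-! ### Correctness, and the passage from sampled to uniform keys. -/

namespace QL

open Matrix

namespace Kit

variable {A : GroupActionFamily} {n : ℕ} (K : Kit A n)

/-! #### Correctness -/

/-- The block holds a group element. -/
def Good (u : Bits K.W) : Prop := ∃ x, A.repG n x = K.head u

open Classical in
/-- The squared norm of the symmetrisation of the superposition under right multiplication. -/
noncomputable def symmNorm (g : A.G n) : ℝ :=
  ∑ u : Bits K.W, if K.Good u then ‖(K.supAmp u + K.supAmp (K.twist g u)) / 2‖ ^ 2 else 0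

/-- The distance of the state of the superposition circuit to the uniform superposition. -/
noncomputable def supDist : ℝ := traceDist (K.sup.run noBits noQubits noBits) (A.densG n)

theorem symmNorm_nonneg (g : A.G n) : 0 ≤ K.symmNorm g := by
  classical
  exact Finset.sum_nonneg fun u _ => by split_ifs <;> positivity

theorem twist_one (u : Bits K.W) : K.twist 1 u = u := by
  have : mulRight A n 1 (K.head u) = K.head u := by
    by_cases H : ∃ x, A.repG n x = K.head u
    · obtain ⟨x, hx⟩ := H
      rw [← hx, mulRight_rep, inv_one, mul_one]
    · exact mulRight_of_not 1 H
  rw [twist, this]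
  exact Equiv.symm_apply_apply _ _

/-- Right multiplication permutes the group, so symmetrisation fixes `|G_n⟩` and the ideal value is
1. The twist leaves the discarded wires of the superposition circuit alone; summing over them turns
the amplitudes into the reduced state, to which the trace distance refers. -/
theorem le_symmNorm (g : A.G n) : 1 - 2 * K.supDist ≤ K.symmNorm g := by
  classical
  have h := abs_symm_sum_sub_le (mulRightPerm A n g) (fun a => ∃ x, A.repG n x = a)
    (fun r a => K.supAmp ((splitBits K.sup.le_out).symm (noBits, a, r))) (A.ketG n)
  have e1 : (∑ r, pureState fun a => K.supAmp ((splitBits K.sup.le_out).symm (noBits, a, r))) =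
      K.sup.run noBits noQubits noBits := by
    rw [noQubits_eq, Circ.run_pureState]
    rfl
  have e2 : (∑ a, if ∃ x, A.repG n x = a then
      ‖(A.ketG n a + A.ketG n (mulRightPerm A n g a)) / 2‖ ^ 2 else 0) = 1 := by
    rw [← A.sum_unifG n]
    refine Finset.sum_congr rfl fun a _ => ?_
    have hket : ∀ x, A.ketG n (A.repG n x) = 1 / (Real.sqrt (Fintype.card (A.G n)) : ℂ) :=
      fun x => if_pos ⟨x, rfl⟩
    by_cases ha : ∃ x, A.repG n x = a
    · obtain ⟨x, rfl⟩ := ha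
      have : mulRightPerm A n g (A.repG n x) = A.repG n (x * g⁻¹) := mulRight_rep g x
      rw [if_pos ⟨x, rfl⟩, this, hket, hket, add_self_div_two, GroupActionFamily.unifG,
        if_pos ⟨x, rfl⟩, norm_div, norm_one, Complex.norm_real, Real.norm_eq_abs, div_pow, one_pow,
        sq_abs, Real.sq_sqrt (Nat.cast_nonneg _)]
    · rw [if_neg ha, GroupActionFamily.unifG]
      exact (if_neg ha).symm
  have e3 : (∑ r, ∑ a, if ∃ x, A.repG n x = a then
      ‖(K.supAmp ((splitBits K.sup.le_out).symm (noBits, a, r)) + K.supAmp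
        ((splitBits K.sup.le_out).symm (noBits, mulRightPerm A n g a, r))) / 2‖ ^ 2 else 0) =
      K.symmNorm g := by
    rw [symmNorm, ← Equiv.sum_comp (splitBits K.sup.le_out).symm]
    symm
    rw [Fintype.sum_prod_type, Fintype.sum_subsingleton _ noBits, Fintype.sum_prod_type_right]
    refine Finset.sum_congr rfl fun r _ => Finset.sum_congr rfl fun a _ => ?_
    have h1 : K.head ((splitBits K.sup.le_out).symm (noBits, a, r)) = a := by
      rw [head, Equiv.apply_symm_apply]
    have h2 : K.twist g ((splitBits K.sup.le_out).symm (noBits, a, r)) =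
        (splitBits K.sup.le_out).symm (noBits, mulRightPerm A n g a, r) := by
      rw [twist, h1, Equiv.apply_symm_apply]
      rfl
    exact if_congr (by rw [Good, h1]) (by rw [h2]) rfl
  rw [e1, e2, e3] at h
  have := (abs_le.1 h).1
  have e4 : traceDist (K.sup.run noBits noQubits noBits) (pureState (A.ketG n)) = K.supDist := rfl
  linarith

/-- Bernoulli's inequality, available because the base is non-negative. -/
theorem le_symmNorm_pow (g : A.G n) : 1 - n * (2 * K.supDist) ≤ K.symmNorm g ^ n := by
  have h0 := K.symmNorm_nonneg g
  have h1 := K.le_symmNorm g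
  have h2 := one_add_mul_le_pow (a := K.symmNorm g - 1) (by linarith) n
  rw [add_sub_cancel] at h2
  have h3 : (n : ℝ) * (1 - 2 * K.supDist) ≤ n * K.symmNorm g :=
    mul_le_mul_of_nonneg_left h1 (Nat.cast_nonneg n)
  linarith

open Classical in
theorem symmNorm_pow (g : A.G n) : K.symmNorm g ^ n = ∑ u : Fin n → Bits K.W,
    if ∀ j, K.Good (u j) then ∏ j, ‖(K.supAmp (u j) + K.supAmp (K.twist g (u j))) / 2‖ ^ 2
    else 0 := by
  have : K.symmNorm g ^ n = ∏ _j : Fin n, K.symmNorm g := by simp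
  rw [this]
  simp only [symmNorm]
  rw [Finset.prod_univ_sum, Fintype.piFinset_univ]
  refine Finset.sum_congr rfl fun u _ => ?_
  rw [Finset.prod_ite_zero]
  simp

variable (g : A.G n) (s : A.S n)

/-- The terms on the left are the expansion of the product on the right: bit `j` chooses between the
two summands of factor `j`. -/
theorem sum_honest_twists (u : Fin n → Bits K.W) :
    ∑ β : Bits n, K.honest (β, K.twists g β u) =
      (1 / (Real.sqrt 2 : ℂ)) ^ n * ∏ j, (K.supAmp (u j) + K.supAmp (K.twist g (u j))) := by
  have h : ∏ j, (K.supAmp (u j) + K.supAmp (K.twist g (u j))) =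
      ∏ j, ∑ b : Bool, K.supAmp (if b then K.twist g (u j) else u j) :=
    Finset.prod_congr rfl fun j _ => by simp [add_comm]
  rw [h, Finset.prod_univ_sum, Fintype.piFinset_univ, Finset.mul_sum]
  rfl

/-- Since `(x * g⁻¹) • (g • s) = x • s`, twisting does not change the serial number that a basis
state carries. -/
theorem act_head_twists {u : Fin n → Bits K.W} {x : Fin n → A.G n}
    (hx : ∀ j, A.repG n (x j) = K.head (u j)) (β : Bits n) (j : Fin n) :
    K.act.eval (Fin.append (K.head (K.twists g β u j))
      (if β j then A.repS n (g • s) else A.repS n s)) = A.repS n (x j • s) := by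
  unfold twists
  split_ifs
  · rw [head_twist, ← hx, mulRight_rep, K.act_eval, smul_smul, inv_mul_cancel_right]
  · rw [← hx, K.act_eval]

theorem maps_snumOf {β : Bits n} {u : Fin n → Bits K.W} {j : Fin n} (hu : K.Good (u j)) :
    K.Maps s (img (K.snumOf (A.repS n s) (A.repS n (g • s)) (β, u)) j)
      (if β j then K.twist g⁻¹ (u j) else u j) := by
  obtain ⟨x, hx⟩ := hu
  rw [img_snumOf]
  by_cases hb : β j
  · simp only [hb, if_true]
    exact ⟨x * g, by rw [head_twist, ← hx, mulRight_rep, inv_inv],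
      by rw [← hx, K.act_eval, smul_smul]⟩
  · simp only [hb]
    exact ⟨x, hx, by simp only [Bool.false_eq_true, if_false]; rw [← hx, K.act_eval]⟩

/-- The probability that the full verification accepts the honest state. -/
theorem sum_prob_fullVer : ∑ snum, K.fullVer.prob (Fin.append (skey g s) snum)
    (K.stateGen.run (Fin.append (A.repS n s) (A.repS n (g • s))) noQubits snum)
      (fun _ => true) = K.symmNorm g ^ n := by
  classical
  set s0 := A.repS n s
  set s1 := A.repS n (g • s)
  simp only [run_stateGen, prob_fullVer, Equiv.symm_apply_apply]
  rw [← Finset.mul_sum, Finset.sum_comm, symmNorm_pow, Finset.mul_sum]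
  refine Finset.sum_congr rfl fun u _ => ?_
  by_cases hu : ∀ j, K.Good (u j)
  · choose x hx using hu
    -- All twists of `u` carry the same serial number, so exactly one serial number contributes, and
    -- for it the sum over `β` is complete.
    have hc : ∀ β, K.snumOf s0 s1 (β, K.twists g β u) = K.snumOf s0 s1 (fun _ => false, u) := by
      intro β
      unfold snumOf
      congr 2
      funext j
      rw [K.act_head_twists g s hx β j]
      have := K.act_head_twists g s hx (fun _ => false) j
      rw [twists_false] at this
      exact this.symm
    rw [if_pos fun j => ⟨x j, hx j⟩,
      Finset.sum_eq_single (K.snumOf s0 s1 (fun _ => false, u)) _ (by simp)]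
    · rw [if_pos fun j => by simpa using K.maps_snumOf g s (β := fun _ => false) ⟨x j, hx j⟩]
      simp only [hc, if_true]
      rw [sum_honest_twists, norm_mul, mul_pow, norm_half_sqrt_sq, norm_prod, ← Finset.prod_pow,
        ← mul_assoc, ← mul_pow]
      -- One factor `2⁻ⁿ` comes from the honest amplitudes and one from the Hadamard test; together
      -- they supply the squared halves of the `n` symmetrisations.
      have : (1 / 2 * (1 / 2) : ℝ) ^ n = ∏ _j : Fin n, (1 / 2) ^ 2 := by
        rw [Finset.prod_const, Finset.card_univ, Fintype.card_fin]
        norm_num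
      rw [this, ← Finset.prod_mul_distrib]
      refine Finset.prod_congr rfl fun j _ => ?_
      rw [norm_div, div_pow, Complex.norm_ofNat]
      ring
    · intro snum _ hne
      simp [hc, hne]
  · rw [if_neg hu, Finset.sum_eq_zero, mul_zero]
    intro snum _
    rw [if_neg fun h => hu fun j => ?_]
    obtain ⟨x, hx, _⟩ := h j
    exact ⟨x, hx⟩

theorem prob_del (φ : Bits (n + n * K.W) → ℂ) (cert : Bits (n + n * K.W)) :
    K.del.prob noBits (pureState φ) cert = ‖φ cert‖ ^ 2 := by
  have h1 : ∀ z : Bits (n + n * K.W), K.del.initVec noBits φ z = φ z := fun z =>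
    (if_pos ⟨Subsingleton.elim _ _, fun i hi => by
      have : (i : ℕ) < n + n * K.W := i.2
      omega⟩ : K.del.initVec noBits φ z = _).trans
      (congrArg φ (funext fun i => congrArg z (Fin.ext (Nat.zero_add _))))
  have h2 : ∀ z : Bits (n + n * K.W), slice z 0 (n + n * K.W) (by omega) = z := fun z =>
    funext fun i => congrArg z (Fin.ext (Nat.zero_add _))
  have h3 : ∀ z : Bits (n + n * K.W), K.del.amp noBits φ z = φ z := fun z => by
    rw [← h1 z]
    exact congrFun (evolve_nil _) z
  rw [Circ.prob_pureState]
  change (∑ z : Bits (n + n * K.W), if slice z 0 (n + n * K.W) (by omega) = cert then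
    ‖K.del.amp noBits φ z‖ ^ 2 else 0) = _
  simp only [h2, h3, Finset.sum_ite_eq', Finset.mem_univ, if_true]

open Classical in
/-- The semi-verification accepts honest certificates. -/
theorem le_sum_prob_del : K.symmNorm 1 ^ n ≤ ∑ snum, ∑ cert,
    if K.semiVer.eval (Fin.append (Fin.append (Fin.append (A.repS n s) (A.repS n (g • s))) snum)
      cert) 0 = true then K.del.prob noBits (K.stateGen.run
        (Fin.append (A.repS n s) (A.repS n (g • s))) noQubits snum) cert else 0 := by
  set s0 := A.repS n s with hs0
  set s1 := A.repS n (g • s) with hs1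
  rw [Finset.sum_comm, ← Equiv.sum_comp (qEquiv n K.W)]
  simp only [run_stateGen, prob_del, Equiv.symm_apply_apply]
  have h1 : ∀ p : Bits n × (Fin n → Bits K.W), (if ∀ j, K.Good (p.2 j) then ‖K.honest p‖ ^ 2
      else 0) ≤ ∑ snum, if K.semiVer.eval (Fin.append (Fin.append (Fin.append s0 s1) snum)
        (qEquiv n K.W p)) 0 = true then
          ‖if snum = K.snumOf s0 s1 p then K.honest p else 0‖ ^ 2 else 0 := by
    rintro ⟨β, u⟩
    rw [Finset.sum_eq_single (K.snumOf s0 s1 (β, u))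
      (fun _ _ hne => by rw [if_neg hne]; simp) (by simp), if_pos rfl]
    by_cases hu : ∀ j, K.Good (u j)
    · rw [if_pos hu, if_pos ((K.semiVer_iff g s _ β u).2 fun j => K.maps_snumOf g s (hu j))]
    · rw [if_neg hu]
      split_ifs <;> positivity
  refine le_trans (le_of_eq ?_) (Finset.sum_le_sum fun p _ => h1 p)
  -- For `g = 1` symmetrisation is the identity, and `symmNorm 1` is the probability that a block
  -- holds a group element. That suffices here, because an honest serial number makes any such block
  -- valid.
  rw [symmNorm_pow, Fintype.sum_prod_type_right]
  refine Finset.sum_congr rfl fun u _ => ?_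
  by_cases hu : ∀ j, K.Good (u j)
  · simp only [hu, implies_true, if_true, twist_one, add_self_div_two]
    simp only [honest, norm_mul, mul_pow, norm_half_sqrt_sq]
    rw [Finset.sum_const, Finset.card_univ, Fintype.card_fun, Fintype.card_fin, Fintype.card_bool,
      nsmul_eq_mul, ← mul_assoc, norm_prod, Finset.prod_pow]
    push_cast
    rw [← mul_pow]
    norm_num
  · simp only [if_neg hu, Finset.sum_const_zero]

/-! #### Ideal keys -/

/-- Both keys are functions of two independent samples, so the comparison of product distributions
applies, with `F` as a test function bounded by 1. -/
theorem abs_sum_setup_sub_le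
    {F : Bits (A.lenG n + (A.lenS n + A.lenS n)) → Bits (A.lenS n + A.lenS n) → ℝ}
    (hF : ∀ sk pk, 0 ≤ F sk pk ∧ F sk pk ≤ 1) :
    |(∑ sk, ∑ pk, K.setup.prob noBits noQubits (Fin.append sk pk) * F sk pk) -
      ∑ s : A.S n, ∑ g : A.G n, (1 / (Fintype.card (A.S n) : ℝ)) * (1 / (Fintype.card (A.G n) : ℝ)) *
        F (skey g s) (Fin.append (A.repS n s) (A.repS n (g • s)))| ≤
      2 * statDist K.sampleG.coinDist (A.unifG n) + 2 * statDist K.sampleS.coinDist (A.unifS n) := by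
  have e : (∑ s : A.S n, ∑ g : A.G n, (1 / (Fintype.card (A.S n) : ℝ)) *
      (1 / (Fintype.card (A.G n) : ℝ)) *
        F (skey g s) (Fin.append (A.repS n s) (A.repS n (g • s)))) =
      ∑ gb, ∑ sb, A.unifG n gb * A.unifS n sb *
        F (Fin.append gb (K.keys gb sb)) (K.keys gb sb) := by
    have e1 : ∀ gb, (∑ sb, A.unifG n gb * A.unifS n sb *
        F (Fin.append gb (K.keys gb sb)) (K.keys gb sb)) = A.unifG n gb * ∑ s : A.S n,
          1 / (Fintype.card (A.S n) : ℝ) * F (Fin.append gb (K.keys gb (A.repS n s)))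
            (K.keys gb (A.repS n s)) := fun gb => by
      rw [← A.sum_unifS_mul n fun sb => F (Fin.append gb (K.keys gb sb)) (K.keys gb sb),
        Finset.mul_sum]
      exact Finset.sum_congr rfl fun sb _ => mul_assoc _ _ _
    simp only [e1]
    rw [A.sum_unifG_mul, Finset.sum_comm]
    refine Finset.sum_congr rfl fun g _ => ?_
    rw [Finset.mul_sum]
    refine Finset.sum_congr rfl fun s _ => ?_
    simp only [skey, keys, K.act_eval]
    ring
  rw [e, K.sum_setup]
  exact abs_sum_sub_sum_le (A.unifG_nonneg n) (A.sum_unifG n) (coinDist_nonneg _) (sum_coinDist _)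
    (fun gb sb => (hF _ _).1) fun gb sb => (hF _ _).2

theorem le_sum_setup
    {F : Bits (A.lenG n + (A.lenS n + A.lenS n)) → Bits (A.lenS n + A.lenS n) → ℝ}
    (hF : ∀ sk pk, 0 ≤ F sk pk ∧ F sk pk ≤ 1) {c : ℝ}
    (hc : ∀ g s, c ≤ F (skey g s) (Fin.append (A.repS n s) (A.repS n (g • s)))) :
    c - (2 * statDist K.sampleG.coinDist (A.unifG n) +
      2 * statDist K.sampleS.coinDist (A.unifS n)) ≤
      ∑ sk, ∑ pk, K.setup.prob noBits noQubits (Fin.append sk pk) * F sk pk := by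
  have h1 := (abs_le.1 (K.abs_sum_setup_sub_le hF)).1
  have h2 : c ≤ ∑ s : A.S n, ∑ g : A.G n, (1 / (Fintype.card (A.S n) : ℝ)) *
      (1 / (Fintype.card (A.G n) : ℝ)) *
        F (skey g s) (Fin.append (A.repS n s) (A.repS n (g • s))) := by
    have hG := A.card_G_pos n
    have hS := A.card_S_pos n
    calc c = ∑ _s : A.S n, ∑ _g : A.G n, (1 / (Fintype.card (A.S n) : ℝ)) *
          (1 / (Fintype.card (A.G n) : ℝ)) * c := by
          simp only [Finset.sum_const, Finset.card_univ, nsmul_eq_mul]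
          field_simp
      _ ≤ _ := Finset.sum_le_sum fun s _ => Finset.sum_le_sum fun g _ =>
          mul_le_mul_of_nonneg_left (hc g s) (by positivity)
  linarith

end Kit

variable {A : GroupActionFamily} {K : ∀ n, Kit A n} (h : UniformKit K) (n : ℕ)

theorem scheme_semi_correct :
    1 - (n * (2 * (K n).supDist) + (2 * statDist (K n).sampleG.coinDist (A.unifG n) +
      2 * statDist (K n).sampleS.coinDist (A.unifS n))) ≤ (scheme h).semiCorrectProb n := by
  classical
  rw [← sub_sub]
  refine ((K n).le_sum_setup (F := fun _ pk => ∑ snum, ∑ cert,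
    if (K n).semiVer.eval (Fin.append (Fin.append pk snum) cert) 0 = true then
      (K n).del.prob noBits ((K n).stateGen.run pk noQubits snum) cert else 0)
    (fun sk pk => Circ.sum_prob_run_mem (K n).stateGen (K n).del pk (fun _ => noBits) _)
    fun g s => ((K n).le_symmNorm_pow 1).trans ((K n).le_sum_prob_del g s)).trans_eq ?_
  refine Finset.sum_congr rfl fun sk _ => Finset.sum_congr rfl fun pk _ => congrArg _ ?_
  exact Finset.sum_congr rfl fun snum _ => Finset.sum_congr rfl fun cert _ =>
    if_congr Iff.rfl rfl rfl

theorem scheme_full_correct :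
    1 - (n * (2 * (K n).supDist) + (2 * statDist (K n).sampleG.coinDist (A.unifG n) +
      2 * statDist (K n).sampleS.coinDist (A.unifS n))) ≤ (scheme h).fullCorrectProb n := by
  classical
  rw [← sub_sub]
  show _ ≤ ∑ sk, ∑ pk, (K n).setup.prob noBits noQubits (Fin.append sk pk) * ∑ snum,
    (K n).fullVer.prob (Fin.append sk snum) ((K n).stateGen.run pk noQubits snum) (fun _ => true)
  refine (K n).le_sum_setup (F := fun sk pk => ∑ snum, (K n).fullVer.prob (Fin.append sk snum)
    ((K n).stateGen.run pk noQubits snum) (fun _ => true)) (fun sk pk => ?_)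
    fun g s => ((K n).le_symmNorm_pow g).trans ((K n).sum_prob_fullVer g s).ge
  have := Circ.sum_prob_run_mem (K n).stateGen (K n).fullVer pk (fun snum => Fin.append sk snum)
    fun _ b => b = fun _ => true
  simpa only [Finset.sum_ite_eq', Finset.mem_univ, if_true] using this

end QL

/-! ### Turning a lightning adversary into an inverter of the group action. -/

namespace QL

open Matrix

/-! ### Classical processing of the outcome of a circuit -/

theorem evolve_front {w W : ℕ} [NeZero w] (h : W ≤ w) (G : List (Gate (Fin W))) (u : Bits W → ℂ)
    {c : Bits w → ℂ} (hc : ∀ z z' : Bits w, (∀ i : Fin w, W ≤ (i : ℕ) → z i = z' i) → c z = c z') :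
    evolve (toFin w (G.map (Gate.map Fin.val))) (fun z => u (rd (ext z) 0 W) * c z) =
      fun z => evolve G u (rd (ext z) 0 W) * c z := by
  have := evolve_blocks (n := 1) (o := 0) (by omega) G u (c := c)
    fun z z' H => hc z z' fun i hi => H i (by omega)
  simp only [List.range_one, List.flatMap_singleton, Nat.zero_mul, Nat.add_zero, Finset.range_one,
    Finset.prod_singleton] at this
  rwa [List.map_congr_left (g := id) fun g _ => g.map_id', List.map_id] at this

namespace Circ

variable {kin kout qout k' : ℕ} (B : Circ kin 0 kout qout)

/-- Run a circuit without measurement, followed by classical gates. -/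
def post (N : ℕ) (L : List (CGate ℕ)) (h : kin ≤ N) (h' : k' ≤ N) : Circ kin 0 k' 0 :=
  circ N (B.gates.map (Gate.map Fin.val) ++ L.map Gate.classical) h h'

/-- Deferred measurement: permuting basis states and then measuring amounts to measuring all wires
of `B` first and processing the outcome classically. The wires that were added start at zero. -/
theorem sum_prob_post {N : ℕ} {L : List (CGate ℕ)} (h : kin ≤ N) (h' : k' ≤ N) (hB : B.width ≤ N)
    (hL : OnWires (· < N + 1) L) (x : Bits kin) (p : Bits k' → Prop) [DecidablePred p] :
    (∑ y, if p y then (B.post N L h h').prob x noQubits y else 0) =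
      ∑ z : Bits B.width, if p (rd (cexec L (ext z)) 0 k') then
        ‖B.amp x (fun _ => 1) z‖ ^ 2 else 0 := by
  classical
  set v0 : Bits (N + 1) → ℂ := (B.post N L h h').initVec x fun _ => 1 with hv0
  have hv0' : ∀ z, v0 z = if ∀ i, ext z i = ext x i then 1 else 0 := fun z =>
    (B.post N L h h').initVec_noQubits x z
  set c : Bits (N + 1) → ℂ := fun z => if ∀ i, ¬ (0 ≤ i ∧ i < 0 + B.width) → ext z i = false
    then 1 else 0 with hc
  have hv0'' : v0 = fun z => B.initVec x (fun _ => 1) (rd (ext z) 0 B.width) * c z := by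
    funext z
    have hk := B.le_in
    rw [hv0', B.initVec_noQubits, hc, ite_zero_mul_ite_zero, mul_one]
    refine if_congr ⟨fun H => ⟨fun i => ?_, fun i hi => ?_⟩, fun H i => ?_⟩ rfl rfl
    · by_cases hi : i < B.width
      · rw [ext_rd_of_lt _ _ hi, Nat.zero_add, H]
      · rw [ext_of_le _ (by omega), ext_of_le x (by omega)]
    · rw [H, ext_of_le x (by omega)]
    · by_cases hi : i < B.width
      · rw [← H.1, ext_rd_of_lt _ _ hi, Nat.zero_add]
      · rw [H.2 i (by omega), ext_of_le x (by omega)]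
  have hv1 : evolve (toFin (N + 1) (B.gates.map (Gate.map Fin.val))) v0 =
      fun z => B.amp x (fun _ => 1) (rd (ext z) 0 B.width) * c z := by
    rw [hv0'']
    refine evolve_front (by omega) B.gates _ fun z z' hzz => ?_
    rw [hc]
    refine if_congr (forall₂_congr fun i hi => ?_) rfl rfl
    by_cases hi' : i < N + 1
    · rw [ext_of_lt z hi', ext_of_lt z' hi', hzz ⟨i, hi'⟩ (by simp only; omega)]
    · rw [ext_of_le z (by omega), ext_of_le z' (by omega)]
  have hamp : (B.post N L h h').amp x (fun _ => 1) =
      evolve (toFin (N + 1) (L.map Gate.classical))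
        (fun z => B.amp x (fun _ => 1) (rd (ext z) 0 B.width) * c z) := by
    rw [← hv1, ← evolve_append, ← toFin_append]
    rfl
  have h1 : ∀ y, (if p y then (B.post N L h h').prob x noQubits y else 0) =
      ∑ z : Bits (N + 1), if slice z 0 k' (by omega) = y then
        (if p (slice z 0 k' (by omega)) then ‖evolve (toFin (N + 1) (L.map Gate.classical))
          (fun z => B.amp x (fun _ => 1) (rd (ext z) 0 B.width) * c z) z‖ ^ 2 else 0) else 0 := by
    intro y
    rw [noQubits_eq, prob_pureState, hamp]
    by_cases hp : p y
    · rw [if_pos hp]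
      refine Finset.sum_congr rfl fun (z : Bits (N + 1)) _ => ?_
      by_cases hz : slice z 0 k' (by omega : 0 + k' ≤ N + 1) = y
      · exact (if_pos hz).trans (by rw [if_pos hz, if_pos (hz ▸ hp)])
      · exact (if_neg hz).trans (by rw [if_neg hz])
    · rw [if_neg hp, Finset.sum_eq_zero]
      intro z _
      by_cases hz : slice z 0 k' (by omega : 0 + k' ≤ N + 1) = y
      · rw [if_pos hz, if_neg (hz ▸ hp)]
      · rw [if_neg hz]
  rw [Finset.sum_congr rfl fun y _ => h1 y, Finset.sum_comm]
  simp only [Finset.sum_ite_eq, Finset.mem_univ, if_true]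
  rw [sum_evolve_classical hL _ fun z => p (slice z 0 k' (by omega))]
  have h2 : ∀ z : Bits (N + 1), (if p (slice (cperm (N + 1) L z) 0 k' (by omega)) then
      ‖B.amp x (fun _ => 1) (rd (ext z) 0 B.width) * c z‖ ^ 2 else 0) =
      if ∀ i, ¬ (0 ≤ i ∧ i < 0 + B.width) → ext z i = false then
        (if p (slice (cperm (N + 1) L z) 0 k' (by omega)) then
          ‖B.amp x (fun _ => 1) (rd (ext z) 0 B.width)‖ ^ 2 else 0) else 0 := fun z => by
    simp only [hc]
    split_ifs <;> simp
  rw [Finset.sum_congr rfl fun z _ => h2 z, sum_region (by omega)]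
  refine Finset.sum_congr rfl fun r _ => ?_
  have h3 : ext (res (N + 1) (setAt (fun _ => false) 0 B.width (ext r))) = ext r := by
    rw [ext_res fun i hi => setAt_of_not (by omega)]
    funext i
    by_cases hi : i < B.width
    · rw [setAt_apply (Nat.zero_le i) (by omega), Nat.sub_zero]
    · rw [setAt_of_not (by omega), ext_of_le _ (by omega)]
  have h4 : slice (cperm (N + 1) L (res (N + 1) (setAt (fun _ => false) 0 B.width (ext r)))) 0 k'
      (by omega) = rd (cexec L (ext r)) 0 k' := by
    funext i
    simp only [slice, rd]
    conv_rhs => rw [← h3, ← ext_cperm hL, ext_of_lt _ (by omega)]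
  rw [h3, rd_ext, h4]

end Circ

namespace Kit

variable {A : GroupActionFamily} {n : ℕ} (K : Kit A n)

/-! #### Reduction to the inversion of the group action -/

/-- The quotient of the group elements at `a` and `b`. -/
def quotL (a b w : ℕ) : List (CGate ℕ) :=
  K.inv.load a w ++ (K.mul.load₂ w b (w + K.inv.width) ++ swapG 0 (w + K.inv.width) (A.lenG n))

theorem onWires_quotL {a b w : ℕ} (ha : a + A.lenG n ≤ w) (hb : b + A.lenG n ≤ w) :
    OnWires (· < w + K.inv.width + K.mul.width + 1) (K.quotL a b w) := by
  have h1 := K.inv.le_out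
  have h2 := K.mul.le_out
  exact (K.inv.onWires_load (fun i hi => by omega) fun i hi => by omega).append
    ((K.mul.onWires_load₂ (fun i hi => by omega) (fun i hi => by omega) fun i hi => by omega).append
      (.swapG (fun i hi => by omega) fun i hi => by omega))

theorem rd_quotL {a b w : ℕ} (ha : a + A.lenG n ≤ w) (hb : b + A.lenG n ≤ w) {z : ℕ → Bool}
    (hz : ∀ i, w ≤ i → z i = false) {h h' : A.G n} (hh : A.repG n h = rd z a (A.lenG n))
    (hh' : A.repG n h' = rd z b (A.lenG n)) :
    rd (cexec (K.quotL a b w) z) 0 (A.lenG n) = A.repG n (h⁻¹ * h') := by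
  have h1 := K.inv.le_out
  have h2 := K.mul.le_out
  funext i
  have hi := i.2
  rw [rd, quotL, cexec_append, cexec_append, cexec_swapG (by unfold Disj; omega) _ hi,
    K.inv.cexec_load' (by unfold Disj; omega) fun i _ => hz _ (by omega), ← hh]
  set z1 := setAt z w K.inv.width (K.inv.wires (A.repG n h)) with hz1
  rw [K.mul.cexec_load₂ (by unfold Disj; omega) (by unfold Disj; omega) fun i _ => by
    rw [hz1, setAt_of_not (by omega), hz _ (by omega)], setAt_add (by omega)]
  have e1 : rd z1 w (A.lenG n) = A.repG n h⁻¹ := funext fun i => by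
    rw [rd, hz1, setAt_add (by omega), K.inv.wires_of_eval (K.inv_eval h) i.2, ext_val]
  have e2 : rd z1 b (A.lenG n) = A.repG n h' := by
    rw [hh']
    exact rd_congr fun i hi => setAt_of_not (by omega)
  rw [e1, e2, K.mul.wires_of_eval (K.mul_eval _ _) hi, ext_val]

/-- The quotient of two group elements solves the inversion problem. -/
def Breaks (g : A.G n) (s : A.S n) (b : Bool) (y y' : Bits (A.lenG n)) : Prop :=
  ∃ h h', A.repG n h = (if b then y else y') ∧ A.repG n h' = (if b then y' else y) ∧
    (h⁻¹ * h') • s = g • s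

/-- The position of a group element in the certificate. -/
def certPos (j : ℕ) : ℕ := n + j * K.W

/-- The position of a group element in the state. -/
def statePos (j : ℕ) : ℕ :=
  ((n + n * K.W) + ((A.lenS n + A.lenS n) + n * A.lenS n)) + (n + j * K.W)

variable (B : Circ (A.lenS n + A.lenS n) 0 ((n + n * K.W) + ((A.lenS n + A.lenS n) + n * A.lenS n))
  (n + n * K.W))

/-- The adversary against the group action. -/
def breaker (p : ℕ × Bool) : Circ (A.lenS n + A.lenS n) 0 (A.lenG n) 0 :=
  B.post (B.width + K.inv.width + K.mul.width)
    (if p.2 then K.quotL (K.certPos p.1) (K.statePos p.1) B.width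
      else K.quotL (K.statePos p.1) (K.certPos p.1) B.width)
    (by have := B.le_in; omega) (by have := K.mul.le_out; omega)

-- The inverter runs the adversary, takes the group elements of copy `p.1` from certificate and
-- state, and outputs their quotient. It does not have to check anything: an outcome that satisfies
-- `Breaks` already gives a solution.
open Classical in
theorem sum_breaks_le (g : A.G n) (s : A.S n) {p : ℕ × Bool} (hj : p.1 < n)
    (x : Bits (A.lenS n + A.lenS n)) :
    (∑ z : Bits B.width, if Breaks g s p.2 (rd (ext z) (K.certPos p.1) (A.lenG n))
      (rd (ext z) (K.statePos p.1) (A.lenG n)) then ‖B.amp x (fun _ => 1) z‖ ^ 2 else 0) ≤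
    ∑ y, if ∃ g', A.repG n g' = y ∧ g' • s = g • s then
      (K.breaker B p).prob x noQubits y else 0 := by
  obtain ⟨j, b⟩ := p
  have h1 := B.le_out
  have h2 := mul_add_le hj K.W
  have h3 := K.lenG_le
  have hc : K.certPos j + A.lenG n ≤ B.width := by unfold certPos; simp only at h2; omega
  have hs : K.statePos j + A.lenG n ≤ B.width := by unfold statePos; simp only at h2; omega
  have hL : OnWires (· < B.width + K.inv.width + K.mul.width + 1)
      (if b then K.quotL (K.certPos j) (K.statePos j) B.width
        else K.quotL (K.statePos j) (K.certPos j) B.width) := by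
    split_ifs
    exacts [K.onWires_quotL hc hs, K.onWires_quotL hs hc]
  rw [breaker, B.sum_prob_post _ _ (by omega) hL]
  refine Finset.sum_le_sum fun z _ => ?_
  by_cases hz : Breaks g s b (rd (ext z) (K.certPos j) (A.lenG n))
      (rd (ext z) (K.statePos j) (A.lenG n))
  · rw [if_pos hz, if_pos]
    obtain ⟨h, h', e1, e2, e3⟩ := hz
    refine ⟨h⁻¹ * h', ?_, e3⟩
    cases b
    · exact (K.rd_quotL hs hc (fun i hi => ext_of_le z hi) e1 e2).symm
    · exact (K.rd_quotL hc hs (fun i hi => ext_of_le z hi) e1 e2).symm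
  · rw [if_neg hz]
    split_ifs <;> positivity

end Kit

end QL

/-! ### Security for fixed keys. -/

namespace QL

open Matrix

namespace Kit

variable {A : GroupActionFamily} {n : ℕ} (K : Kit A n)

/-! #### Security -/

/-- The permutation of the blocks. -/
noncomputable def twistsEquiv (g : A.G n) (β : Bits n) : (Fin n → Bits K.W) ≃ (Fin n → Bits K.W) where
  toFun := K.twists g β
  invFun := K.twists g⁻¹ β
  left_inv u := funext fun j => by
    unfold twists
    split_ifs
    exacts [K.twist_inv g _, rfl]
  right_inv u := funext fun j => by
    unfold twists
    split_ifs
    exacts [K.twist_inv' g _, rfl]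

/-- When the bits differ, one of the two elements acts on `g • s`, say `h`, and the other, `h'`,
acts on `s`, with the same result `y`. From `h • (g • s) = h' • s` it follows that `h⁻¹ * h'` sends
`s` to `g • s`. The bit `γ` of the certificate tells which element is which. -/
theorem breaks_of_maps {g : A.G n} {s : A.S n} {y : Bits (A.lenS n)} {γ β : Bool} (hne : β ≠ γ)
    {c u : Bits K.W} (hc : K.Maps s y (if γ then K.twist g⁻¹ c else c)) (hu : K.Maps s y u) :
    Breaks g s γ (K.head c) (K.head (if β then K.twist g u else u)) := by
  have key : ∀ {x x' : A.G n}, A.repS n (x • s) = y → A.repS n (x' • s) = y →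
      ((x * g⁻¹)⁻¹ * x') • s = g • s := fun {x x'} h h' => by
    rw [_root_.mul_inv_rev, inv_inv, mul_assoc, mul_smul, mul_smul,
      A.repS_injective n (h'.trans h.symm), inv_smul_smul]
  have tw : ∀ {x : A.G n} {v : Bits K.W}, A.repG n x = K.head v →
      A.repG n (x * g⁻¹) = K.head (K.twist g v) := fun hx => by
    rw [head_twist, ← hx, mulRight_rep]
  obtain ⟨x', hx', hy'⟩ := hu
  obtain ⟨x, hx, hy⟩ := hc
  cases γ
  · obtain rfl : β = true := by simpa using hne
    exact ⟨x' * g⁻¹, x, tw hx', hx, key hy' hy⟩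
  · obtain rfl : β = false := by simpa using hne
    have := tw hx
    rw [if_pos rfl, twist_inv'] at this
    exact ⟨x * g⁻¹, x', this, hx', key hy hy'⟩

theorem rd_head (β : Bits n) (u : Fin n → Bits K.W) (j : Fin n) :
    rd (ext (qEquiv n K.W (β, u))) (K.certPos j) (A.lenG n) = K.head (u j) := funext fun i => by
  have hG := K.lenG_le
  rw [head_apply]
  exact rd_val (rd_qEquiv β u j) (by omega)

/-- The distinguished term is split off by `(a + b)² ≤ 2 a² + 2 b²`, and Cauchy–Schwarz bounds the
rest. In the application the cardinality is `2ⁿ`, which the normalisation of the Hadamard test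
cancels, whereas the distinguished term keeps the factor `2⁻ⁿ`. -/
theorem norm_sum_sq_le {ι : Type} [Fintype ι] [DecidableEq ι] (f : ι → ℂ) (i : ι) :
    ‖∑ j, f j‖ ^ 2 ≤ 2 * ‖f i‖ ^ 2 +
      2 * Fintype.card ι * ∑ j, if j ≠ i then ‖f j‖ ^ 2 else 0 := by
  have h1 : ‖∑ j, f j‖ ≤ ‖f i‖ + ∑ j ∈ Finset.univ.erase i, ‖f j‖ := by
    rw [← Finset.add_sum_erase _ _ (Finset.mem_univ i)]
    exact (norm_add_le _ _).trans (add_le_add_right (norm_sum_le _ _) _)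
  have h2 : (∑ j ∈ Finset.univ.erase i, ‖f j‖) ^ 2 ≤
      Fintype.card ι * ∑ j ∈ Finset.univ.erase i, ‖f j‖ ^ 2 := by
    refine (sq_sum_le_card_mul_sum_sq (s := Finset.univ.erase i)).trans ?_
    refine mul_le_mul_of_nonneg_right ?_ (Finset.sum_nonneg fun j _ => sq_nonneg _)
    exact_mod_cast Finset.card_le_univ _
  have h3 : (∑ j, if j ≠ i then ‖f j‖ ^ 2 else 0) = ∑ j ∈ Finset.univ.erase i, ‖f j‖ ^ 2 := by
    rw [← Finset.sum_filter]
    congr 1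
    ext j
    simp
  rw [h3, mul_assoc]
  have h4 := pow_le_pow_left₀ (norm_nonneg _) h1 2
  nlinarith [sq_nonneg (‖f i‖ - ∑ j ∈ Finset.univ.erase i, ‖f j‖)]

variable (g : A.G n) (s : A.S n) (snum : Bits ((A.lenS n + A.lenS n) + n * A.lenS n))

open Classical in
/-- A state that is accepted together with a certificate breaks the group action. -/
theorem prob_fullVer_le {cert : Bits (n + n * K.W)}
    (hc : K.semiVer.eval (Fin.append (Fin.append (Fin.append (A.repS n s) (A.repS n (g • s))) snum)
      cert) 0 = true) (φ : Bits (n + n * K.W) → ℂ) :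
    K.fullVer.prob (Fin.append (skey g s) snum) (pureState φ) (fun _ => true) ≤
      2 * (1 / 2) ^ n * ∑ a, ‖φ a‖ ^ 2 + 2 * ∑ p : Fin n × Bool, ∑ a,
        if Breaks g s p.2 (rd (ext cert) (K.certPos p.1) (A.lenG n))
          (rd (ext a) (K.certPos p.1) (A.lenG n)) then ‖φ a‖ ^ 2 else 0 := by
  obtain ⟨⟨γ, c⟩, rfl⟩ := (qEquiv n K.W).surjective cert
  rw [semiVer_iff] at hc
  -- The weight of a basis state, counted once for each copy and each bit for which it yields,
  -- together with the certificate, a solution of the inversion problem.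
  set D : Bits n → (Fin n → Bits K.W) → ℝ := fun β v => ∑ p : Fin n × Bool,
    if Breaks g s p.2 (K.head (c p.1)) (K.head (v p.1)) then ‖φ (qEquiv n K.W (β, v))‖ ^ 2 else 0
    with hD
  have hD0 : ∀ β v, 0 ≤ D β v := fun β v => Finset.sum_nonneg fun p _ => by
    split_ifs <;> positivity
  have h1 : ∀ u : Fin n → Bits K.W, (if ∀ j : Fin n, K.Maps s (img snum j) (u j) then
      ‖∑ β : Bits n, φ (qEquiv n K.W (β, K.twists g β u))‖ ^ 2 else 0) ≤
      2 * ‖φ (qEquiv n K.W (γ, K.twists g γ u))‖ ^ 2 +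
        2 * 2 ^ n * ∑ β, D β (K.twists g β u) := by
    intro u
    by_cases hu : ∀ j : Fin n, K.Maps s (img snum j) (u j)
    · rw [if_pos hu]
      refine (norm_sum_sq_le _ γ).trans ?_
      rw [Fintype.card_fun, Fintype.card_fin, Fintype.card_bool]
      push_cast
      refine add_le_add_right (mul_le_mul_of_nonneg_left (Finset.sum_le_sum fun β _ => ?_)
        (by positivity)) _
      by_cases hβ : β = γ
      · rw [if_neg (by simpa using hβ)]
        exact hD0 _ _
      · rw [if_pos hβ]
        -- At a copy `j` where `β` and `γ` differ, the pair `(j, γ j)` yields a solution, so the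
        -- weight is counted at least once.
        obtain ⟨j, hj⟩ := Function.ne_iff.1 hβ
        have hb : Breaks g s (γ j) (K.head (c j)) (K.head (K.twists g β u j)) :=
          K.breaks_of_maps hj (hc j) (hu j)
        refine le_trans (le_of_eq ?_) (Finset.single_le_sum (f := fun p : Fin n × Bool =>
          if Breaks g s p.2 (K.head (c p.1)) (K.head (K.twists g β u p.1)) then
            ‖φ (qEquiv n K.W (β, K.twists g β u))‖ ^ 2 else 0)
          (fun p _ => by split_ifs <;> positivity) (Finset.mem_univ (j, γ j)))
        exact (if_pos hb).symm
    · rw [if_neg hu]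
      have := Finset.sum_nonneg fun β (_ : β ∈ Finset.univ) => hD0 β (K.twists g β u)
      positivity
  have h2 : ∑ u, ‖φ (qEquiv n K.W (γ, K.twists g γ u))‖ ^ 2 ≤ ∑ a, ‖φ a‖ ^ 2 := by
    have e := Equiv.sum_comp (K.twistsEquiv g γ) fun v => ‖φ (qEquiv n K.W (γ, v))‖ ^ 2
    refine e.trans_le ?_
    rw [← Equiv.sum_comp (qEquiv n K.W), Fintype.sum_prod_type]
    exact Finset.single_le_sum (f := fun β => ∑ v, ‖φ (qEquiv n K.W (β, v))‖ ^ 2)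
      (fun β _ => Finset.sum_nonneg fun v _ => sq_nonneg _) (Finset.mem_univ γ)
  -- For each `β` twisting permutes the tuples, so summation over all tuples removes it and leaves
  -- the outcome distribution of a plain measurement.
  have h3 : ∑ u, ∑ β, D β (K.twists g β u) = ∑ p : Fin n × Bool, ∑ a,
      if Breaks g s p.2 (rd (ext (qEquiv n K.W (γ, c))) (K.certPos p.1) (A.lenG n))
        (rd (ext a) (K.certPos p.1) (A.lenG n)) then ‖φ a‖ ^ 2 else 0 := by
    rw [Finset.sum_comm]
    have : ∀ β, ∑ u, D β (K.twists g β u) = ∑ v, D β v := fun β =>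
      Equiv.sum_comp (K.twistsEquiv g β) (D β)
    rw [Finset.sum_congr rfl fun β _ => this β]
    simp only [hD]
    rw [← Fintype.sum_prod_type' (f := fun (β : Bits n) (v : Fin n → Bits K.W) =>
      ∑ p : Fin n × Bool, if Breaks g s p.2 (K.head (c p.1)) (K.head (v p.1)) then
        ‖φ (qEquiv n K.W (β, v))‖ ^ 2 else 0), Finset.sum_comm]
    refine Finset.sum_congr rfl fun p _ => ?_
    rw [← Equiv.sum_comp (qEquiv n K.W)]
    exact Finset.sum_congr rfl fun ⟨β, v⟩ _ => by rw [K.rd_head γ c, K.rd_head β v]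
  rw [prob_fullVer, ← h3]
  refine (mul_le_mul_of_nonneg_left (Finset.sum_le_sum fun u _ => h1 u) (by positivity)).trans ?_
  rw [Finset.sum_add_distrib, ← Finset.mul_sum, ← Finset.mul_sum, mul_add]
  -- Here the number of terms in the Cauchy–Schwarz estimate cancels against the normalisation.
  have h4 : ((1 / 2 : ℝ) ^ n) * (2 * 2 ^ n * ∑ u, ∑ β, D β (K.twists g β u)) =
      2 * ∑ u, ∑ β, D β (K.twists g β u) := by
    have : (1 / 2 : ℝ) ^ n * 2 ^ n = 1 := by
      rw [← mul_pow]
      norm_num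
    linear_combination (2 * ∑ u, ∑ β, D β (K.twists g β u)) * this
  rw [h4]
  refine add_le_add_left ?_ _
  rw [← mul_assoc, mul_comm ((1 / 2 : ℝ) ^ n)]
  exact mul_le_mul_of_nonneg_left h2 (by positivity)

variable (B : Circ (A.lenS n + A.lenS n) 0 ((n + n * K.W) + ((A.lenS n + A.lenS n) + n * A.lenS n))
  (n + n * K.W))

theorem sum_append {a b : ℕ} {M : Type} [AddCommMonoid M] (F : Bits (a + b) → M) :
    ∑ y, F y = ∑ x, ∑ y, F (Fin.append x y) := by
  rw [← Equiv.sum_comp (Fin.appendEquiv a b), Fintype.sum_prod_type]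
  rfl

open Classical in
/-- The winning probability for fixed keys. -/
theorem sum_prob_fullVer_le : (∑ cert, ∑ snum,
    if K.semiVer.eval (Fin.append (Fin.append (Fin.append (A.repS n s) (A.repS n (g • s))) snum)
      cert) 0 = true then K.fullVer.prob (Fin.append (skey g s) snum)
        (B.run (Fin.append (A.repS n s) (A.repS n (g • s))) noQubits (Fin.append cert snum))
        (fun _ => true) else 0) ≤
    2 * (1 / 2) ^ n + 2 * ∑ p : Fin n × Bool, ∑ z : Bits B.width,
      if Breaks g s p.2 (rd (ext z) (K.certPos p.1) (A.lenG n))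
        (rd (ext z) (K.statePos p.1) (A.lenG n)) then
        ‖B.amp (Fin.append (A.repS n s) (A.repS n (g • s))) (fun _ => 1) z‖ ^ 2 else 0 := by
  set x := Fin.append (A.repS n s) (A.repS n (g • s)) with hx
  set ψ := B.amp x (fun _ => 1) with hψ
  have hnorm : ∑ z, ‖ψ z‖ ^ 2 = 1 := by
    rw [hψ, Circ.amp, norm_evolve, Circ.norm_initVec]
    simp
  have hsum : ∀ F : Bits B.width → ℝ, ∑ z, F z = ∑ cert, ∑ snum, ∑ r, ∑ a,
      F ((splitBits B.le_out).symm (Fin.append cert snum, a, r)) := fun F => by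
    rw [← Equiv.sum_comp (splitBits B.le_out).symm, Fintype.sum_prod_type, sum_append]
    refine Finset.sum_congr rfl fun cert _ => Finset.sum_congr rfl fun snum _ => ?_
    rw [Fintype.sum_prod_type_right]
  have hext : ∀ (y : Bits _) (a : Bits (n + n * K.W)) r i, ext ((splitBits B.le_out).symm (y, a, r)) i =
      if i < (n + n * K.W) + ((A.lenS n + A.lenS n) + n * A.lenS n) then ext y i else
      if i < (n + n * K.W) + ((A.lenS n + A.lenS n) + n * A.lenS n) + (n + n * K.W) then
        ext a (i - ((n + n * K.W) + ((A.lenS n + A.lenS n) + n * A.lenS n))) else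
        ext r (i - ((n + n * K.W) + ((A.lenS n + A.lenS n) + n * A.lenS n) + (n + n * K.W))) := by
    intro y a r i
    have hB := B.le_out
    by_cases hi : i < B.width
    · rw [ext_of_lt _ hi]
      simp only [splitBits, Equiv.coe_fn_symm_mk]
      by_cases h1 : i < (n + n * K.W) + ((A.lenS n + A.lenS n) + n * A.lenS n)
      · rw [dif_pos h1, if_pos h1, ext_of_lt _ h1]
      by_cases h2 : i < (n + n * K.W) + ((A.lenS n + A.lenS n) + n * A.lenS n) + (n + n * K.W)
      · rw [dif_neg h1, dif_pos h2, if_neg h1, if_pos h2, ext_of_lt _ (by omega)]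
      · rw [dif_neg h1, dif_neg h2, if_neg h1, if_neg h2, ext_of_lt _ (by omega)]
    · rw [ext_of_le _ (by omega), if_neg (by omega), if_neg (by omega), ext_of_le _ (by omega)]
  have hG := K.lenG_le
  have hcert : ∀ cert snum (a : Bits (n + n * K.W)) r (j : Fin n),
      rd (ext ((splitBits B.le_out).symm (Fin.append cert snum, a, r))) (K.certPos j) (A.lenG n) =
        rd (ext cert) (K.certPos j) (A.lenG n) := fun cert snum a r j => rd_congr fun i hi => by
    have := mul_add_le j.2 K.W
    have e : K.certPos j = n + j * K.W := rfl
    rw [hext, if_pos (by omega), ext_append, if_pos (by omega)]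
  have hstate : ∀ y (a : Bits (n + n * K.W)) r (j : Fin n),
      rd (ext ((splitBits B.le_out).symm (y, a, r))) (K.statePos j) (A.lenG n) =
        rd (ext a) (K.certPos j) (A.lenG n) := fun y a r j => funext fun i => by
    have := mul_add_le j.2 K.W
    have e : K.certPos j = n + j * K.W := rfl
    have e' : K.statePos j = ((n + n * K.W) + ((A.lenS n + A.lenS n) + n * A.lenS n)) +
      (n + j * K.W) := rfl
    simp only [rd]
    rw [hext, if_neg (by omega), if_pos (by omega)]
    congr 1
    omega
  -- The bound is distributed over certificates, serial numbers and values of the discarded wires,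
  -- so that the estimate for pure states can be applied to each component. The first summand uses
  -- that the amplitudes have total weight 1.
  have hR : 2 * (1 / 2) ^ n + 2 * ∑ p : Fin n × Bool, ∑ z : Bits B.width,
      (if Breaks g s p.2 (rd (ext z) (K.certPos p.1) (A.lenG n))
        (rd (ext z) (K.statePos p.1) (A.lenG n)) then ‖ψ z‖ ^ 2 else 0) =
      ∑ cert, ∑ snum, ∑ r, (2 * (1 / 2) ^ n * ∑ a,
        ‖ψ ((splitBits B.le_out).symm (Fin.append cert snum, a, r))‖ ^ 2 +
        2 * ∑ p : Fin n × Bool, ∑ a, if Breaks g s p.2 (rd (ext cert) (K.certPos p.1) (A.lenG n))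
          (rd (ext a) (K.certPos p.1) (A.lenG n)) then
          ‖ψ ((splitBits B.le_out).symm (Fin.append cert snum, a, r))‖ ^ 2 else 0) := by
    have e : (∑ p : Fin n × Bool, ∑ z : Bits B.width,
        (if Breaks g s p.2 (rd (ext z) (K.certPos p.1) (A.lenG n))
          (rd (ext z) (K.statePos p.1) (A.lenG n)) then ‖ψ z‖ ^ 2 else 0)) =
        ∑ cert, ∑ snum, ∑ r, ∑ p : Fin n × Bool, ∑ a,
          if Breaks g s p.2 (rd (ext cert) (K.certPos p.1) (A.lenG n))
            (rd (ext a) (K.certPos p.1) (A.lenG n)) then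
            ‖ψ ((splitBits B.le_out).symm (Fin.append cert snum, a, r))‖ ^ 2 else 0 := by
      rw [Finset.sum_comm, hsum]
      refine Finset.sum_congr rfl fun cert _ => Finset.sum_congr rfl fun snum _ =>
        Finset.sum_congr rfl fun r _ => ?_
      rw [Finset.sum_comm]
      simp only [hcert, hstate]
    rw [e]
    simp only [Finset.sum_add_distrib, ← Finset.mul_sum]
    rw [← hsum fun z => ‖ψ z‖ ^ 2, hnorm, mul_one]
  rw [hR]
  refine Finset.sum_le_sum fun cert _ => Finset.sum_le_sum fun snum _ => ?_
  by_cases hc : K.semiVer.eval (Fin.append (Fin.append x snum) cert) 0 = true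
  · rw [if_pos hc, noQubits_eq, Circ.run_pureState, Circ.prob_sum]
    exact Finset.sum_le_sum fun r _ => K.prob_fullVer_le g s snum hc _
  · rw [if_neg hc]
    refine Finset.sum_nonneg fun r _ => ?_
    have h1 : 0 ≤ ∑ a, ‖ψ ((splitBits B.le_out).symm (Fin.append cert snum, a, r))‖ ^ 2 :=
      Finset.sum_nonneg fun a _ => sq_nonneg _
    have h2 : 0 ≤ ∑ p : Fin n × Bool, ∑ a, if Breaks g s p.2
        (rd (ext cert) (K.certPos p.1) (A.lenG n)) (rd (ext a) (K.certPos p.1) (A.lenG n)) then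
        ‖ψ ((splitBits B.le_out).symm (Fin.append cert snum, a, r))‖ ^ 2 else 0 :=
      Finset.sum_nonneg fun p _ => Finset.sum_nonneg fun a _ => by split_ifs <;> positivity
    positivity

end Kit

end QL

/-! ### Size of the inverters, and security of the scheme. -/

namespace QL

/-! ### Sizes -/

theorem PolyBounded.add {f g : ℕ → ℕ} (hf : PolyBounded f) (hg : PolyBounded g) :
    PolyBounded fun n => f n + g n := by
  obtain ⟨p, hp⟩ := hf
  obtain ⟨q, hq⟩ := hg
  exact ⟨p + q, fun n => by rw [Polynomial.eval_add]; exact Nat.add_le_add (hp n) (hq n)⟩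

theorem PolyBounded.mono {f g : ℕ → ℕ} (hg : PolyBounded g) (h : ∀ n, f n ≤ g n) :
    PolyBounded f := by
  obtain ⟨p, hp⟩ := hg
  exact ⟨p, fun n => (h n).trans (hp n)⟩

/-- A step emits at most one gate, so polynomial running time bounds the number of gates. -/
theorem Prog.length_out_exec (P : Prog) : ∀ s : Config,
    (P.exec s).out.length + s.time ≤ s.out.length + (P.exec s).time := by
  induction P with
  | skip => intro s; simp [Prog.exec, Config.tick]
  | push r b => intro s; simp [Prog.exec, Config.tick]
  | pop r => intro s; simp [Prog.exec, Config.tick]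
  | seq P Q hP hQ =>
    intro s
    have h1 := hP s
    have h2 := hQ (P.exec s)
    simp only [Prog.exec]
    omega
  | cases r E F T hE hF hT =>
    intro s
    simp only [Prog.exec]
    rcases s.reg r with _ | ⟨_ | _, _⟩
    · have := hE s.tick; simp only [Config.tick] at this ⊢; omega
    · have := hF s.tick; simp only [Config.tick] at this ⊢; omega
    · have := hT s.tick; simp only [Config.tick] at this ⊢; omega
  | loop r P hP =>
    intro s
    simp only [Prog.exec]
    generalize (s.reg r).length = m
    induction m with
    | zero => simp [Config.tick]
    | succ m ih =>
      rw [Function.iterate_succ_apply']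
      have := hP (P.exec^[m] s.tick)
      omega
  | emit g =>
    intro s
    simp only [Prog.exec, Config.tick, List.length_append, List.length_singleton]
    omega

theorem GenGates.polyBounded {L : ℕ → List (Gate ℕ)} (h : GenGates 1 fun e => L (e 0)) :
    PolyBounded fun n => (L n).length := by
  obtain ⟨P, p, hP⟩ := h
  refine ⟨p, fun n => ?_⟩
  obtain ⟨t, ht, e⟩ := hP fun _ => n
  have h1 := P.length_out_exec ⟨regs 1 fun _ => n, [], 0⟩
  rw [e] at h1
  have h2 : envSize 1 (fun _ => n) = n := by simp [envSize]
  rw [h2] at ht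
  simp only [List.length_nil] at h1 ⊢
  omega

theorem GenC.polyBounded {L : ℕ → List (CGate ℕ)} (h : GenC 1 fun e => L (e 0)) :
    PolyBounded fun n => (L n).length :=
  (GenGates.polyBounded (L := fun n => (L n).map Gate.classical) h).mono fun n => by simp

theorem length_copyG (a b m : ℕ) : (copyG a b m).length = m := by
  simp [copyG, List.length_flatMap]

theorem Kit.length_quotL {A : GroupActionFamily} {n : ℕ} (K : Kit A n) (a b w : ℕ) :
    (K.quotL a b w).length =
      K.inv.gatesN.length + K.mul.gatesN.length + (A.lenG n + A.lenG n + A.lenG n) +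
        (A.lenG n + A.lenG n + A.lenG n) := by
  simp only [Kit.quotL, DetCirc.load, DetCirc.load₂, swapG, shiftG, List.length_append,
    length_copyG, List.length_map]
  omega

variable {A : GroupActionFamily} {K : ∀ n, Kit A n}

/-- The positions from which the quotient is computed do not affect the size, so the choice `p` of
copy and bit may depend on `n` in an arbitrary way. -/
theorem UniformKit.polySize_breaker (h : UniformKit K)
    {B : ∀ n, Circ (A.lenS n + A.lenS n) 0
      ((n + n * (K n).W) + ((A.lenS n + A.lenS n) + n * A.lenS n)) (n + n * (K n).W)}
    (hB : PolySize B) (p : ℕ → ℕ × Bool) : PolySize fun n => (K n).breaker (B n) (p n) := by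
  have hG := PolyBounded.of_gen h.lenG
  refine ((((PolyBounded.add hB (.of_gen (f := fun n => (K n).inv.width) h.wInv)).add
    (.of_gen (f := fun n => (K n).mul.width) h.wMul)).add
    ((GenC.polyBounded (L := fun n => (K n).inv.gatesN) h.inv).add
      (GenC.polyBounded (L := fun n => (K n).mul.gatesN) h.mul))).add (((hG.add hG).add hG).add
      (((hG.add hG).add hG).add ⟨1, fun n => (Polynomial.eval_one (x := n)).ge⟩))).mono fun n => ?_
  have h1 : ((K n).breaker (B n) (p n)).size = (B n).width + (K n).inv.width + (K n).mul.width + 1 +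
      ((B n).gates.length + ((K n).inv.gatesN.length + (K n).mul.gatesN.length +
        (A.lenG n + A.lenG n + A.lenG n) + (A.lenG n + A.lenG n + A.lenG n))) := by
    simp only [Circ.size, Kit.breaker, Circ.post, circ, toFin, List.length_map, List.length_append]
    split_ifs <;> rw [Kit.length_quotL]
  have h2 : (B n).size = (B n).width + (B n).gates.length := rfl
  simp only
  omega

/-! ### Security -/

namespace Kit

variable {n : ℕ} (K : Kit A n)
  (B : Circ (A.lenS n + A.lenS n) 0 ((n + n * K.W) + ((A.lenS n + A.lenS n) + n * A.lenS n))
    (n + n * K.W))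

open Classical in
/-- The winning probability for given keys. -/
noncomputable def winFor (sk : Bits (A.lenG n + (A.lenS n + A.lenS n)))
    (pk : Bits (A.lenS n + A.lenS n)) : ℝ :=
  ∑ cert, ∑ snum, if K.semiVer.eval (Fin.append (Fin.append pk snum) cert) 0 = true then
    K.fullVer.prob (Fin.append sk snum) (B.run pk noQubits (Fin.append cert snum))
      (fun _ => true) else 0

theorem winFor_mem (sk : Bits (A.lenG n + (A.lenS n + A.lenS n)))
    (pk : Bits (A.lenS n + A.lenS n)) : 0 ≤ K.winFor B sk pk ∧ K.winFor B sk pk ≤ 1 := by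
  classical
  have := Circ.sum_prob_run_mem B K.fullVer pk
    (fun y => Fin.append sk ((Fin.appendEquiv _ _).symm y).2) fun y b =>
      K.semiVer.eval (Fin.append (Fin.append pk ((Fin.appendEquiv _ _).symm y).2)
        ((Fin.appendEquiv _ _).symm y).1) 0 = true ∧ b = fun _ => true
  rw [sum_append] at this
  have e : ∀ (x : Bits (n + n * K.W)) (y : Bits ((A.lenS n + A.lenS n) + n * A.lenS n)),
      (Fin.appendEquiv _ _).symm (Fin.append x y) = (x, y) := fun x y =>
    (Fin.appendEquiv _ _).symm_apply_apply (x, y)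
  simp only [e, ite_and] at this
  convert this using 2 <;>
  · rw [winFor]
    refine Finset.sum_congr rfl fun cert _ => Finset.sum_congr rfl fun snum _ => ?_
    by_cases hc : K.semiVer.eval (Fin.append (Fin.append pk snum) cert) 0 = true
    · simp [hc]
    · simp [hc]

/-- Averaging the estimate for fixed keys over uniform keys reproduces the experiment of the
inversion problem, in which `s` and `g • s` are the public key. -/
theorem sum_winFor_le :
    ∑ s : A.S n, ∑ g : A.G n, (1 / (Fintype.card (A.S n) : ℝ)) * (1 / (Fintype.card (A.G n) : ℝ)) *
      K.winFor B (skey g s) (Fin.append (A.repS n s) (A.repS n (g • s))) ≤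
    2 * (1 / 2) ^ n + 2 * ∑ p : Fin n × Bool, A.invertProb n (K.breaker B (p.1, p.2)) := by
  classical
  have hG := A.card_G_pos n
  have hS := A.card_S_pos n
  set T : A.S n → A.G n → Fin n × Bool → ℝ := fun s g p =>
    ∑ y, if ∃ g', A.repG n g' = y ∧ g' • s = g • s then
      (K.breaker B (p.1, p.2)).prob (Fin.append (A.repS n s) (A.repS n (g • s))) noQubits y else 0
    with hT
  have h1 : ∀ s g, K.winFor B (skey g s) (Fin.append (A.repS n s) (A.repS n (g • s))) ≤
      2 * (1 / 2) ^ n + 2 * ∑ p, T s g p := fun s g => by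
    refine (K.sum_prob_fullVer_le g s B).trans (add_le_add_right (mul_le_mul_of_nonneg_left
      (Finset.sum_le_sum fun p _ => ?_) (by norm_num)) _)
    exact K.sum_breaks_le B g s (p := (p.1, p.2)) p.1.2 _
  have h2 : ∀ p : Fin n × Bool, A.invertProb n (K.breaker B (p.1, p.2)) = ∑ s, ∑ g,
      (1 / (Fintype.card (A.S n) : ℝ)) * (1 / (Fintype.card (A.G n) : ℝ)) * T s g p := fun p => by
    simp only [GroupActionFamily.invertProb, hT]
  refine (Finset.sum_le_sum fun s _ => Finset.sum_le_sum fun g _ =>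
    mul_le_mul_of_nonneg_left (h1 s g) (by positivity)).trans_eq ?_
  simp only [h2, mul_add, Finset.sum_add_distrib]
  congr 1
  · simp only [Finset.sum_const, Finset.card_univ, nsmul_eq_mul]
    field_simp
  · simp only [Finset.mul_sum]
    rw [Finset.sum_congr rfl fun s _ => Finset.sum_comm, Finset.sum_comm]
    refine Finset.sum_congr rfl fun p _ => Finset.sum_congr rfl fun s _ =>
      Finset.sum_congr rfl fun g _ => ?_
    ring

end Kit

theorem scheme_winProb_le (h : UniformKit K) {n : ℕ} (B : Circ (A.lenS n + A.lenS n) 0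
      ((n + n * (K n).W) + ((A.lenS n + A.lenS n) + n * A.lenS n)) (n + n * (K n).W)) :
    (scheme h).winProb n B ≤ 2 * (1 / 2) ^ n +
      2 * ∑ p : Fin n × Bool, A.invertProb n ((K n).breaker B (p.1, p.2)) +
      (2 * statDist (K n).sampleG.coinDist (A.unifG n) +
        2 * statDist (K n).sampleS.coinDist (A.unifS n)) := by
  have h1 := (abs_le.1 ((K n).abs_sum_setup_sub_le fun sk pk => (K n).winFor_mem B sk pk)).2
  have h2 := (K n).sum_winFor_le B
  have h3 : (scheme h).winProb n B = ∑ sk, ∑ pk,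
      (K n).setup.prob noBits noQubits (Fin.append sk pk) * (K n).winFor B sk pk := by
    classical
    exact
    Finset.sum_congr rfl fun sk _ => Finset.sum_congr rfl fun pk _ => congrArg _
      (Finset.sum_congr rfl fun cert _ => Finset.sum_congr rfl fun snum _ =>
        if_congr Iff.rfl rfl rfl)
  rw [h3]
  linarith

/-- For every `n` the most successful of the inverters is fixed as non-uniform advice, so that
one-wayness has to be applied to one family only. There are `2n` summands with weight 2, whence the
factor `4n`, which keeps the bound negligible. -/
theorem scheme_secure (h : UniformKit K) (hA : A.OneWay)
    (hG : Negligible fun n => statDist (K n).sampleG.coinDist (A.unifG n))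
    (hS : Negligible fun n => statDist (K n).sampleS.coinDist (A.unifS n))
    (B : ∀ n, Circ (A.lenS n + A.lenS n) 0
      ((n + n * (K n).W) + ((A.lenS n + A.lenS n) + n * A.lenS n)) (n + n * (K n).W))
    (hB : PolySize B) :
    ∃ ν : ℕ → ℝ, Negligible ν ∧ ∀ n, (scheme h).winProb n (B n) ≤ ν n := by
  have hmax : ∀ n, ∃ q : ℕ × Bool, ∀ p : Fin n × Bool,
      A.invertProb n ((K n).breaker (B n) (p.1, p.2)) ≤
        A.invertProb n ((K n).breaker (B n) q) := fun n => by
    -- The range is taken up to `n + 1` to be non-empty also for `n = 0`; an additional candidate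
    -- for the maximum does no harm.
    obtain ⟨q, _, hq⟩ := Finset.exists_max_image (Finset.range (n + 1) ×ˢ Finset.univ)
      (fun q : ℕ × Bool => A.invertProb n ((K n).breaker (B n) q)) ⟨(0, true), by simp⟩
    exact ⟨q, fun p => hq _ (by simp)⟩
  choose q hq using hmax
  refine ⟨_, ((negligible_half_pow.const_mul 2).add
    (((hA _ (h.polySize_breaker hB q)).natCast_mul).const_mul 4)).add
      ((hG.const_mul 2).add (hS.const_mul 2)), fun n => (scheme_winProb_le h (B n)).trans ?_⟩
  refine add_le_add_left (add_le_add_right ?_ _) _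
  have := Finset.sum_le_card_nsmul Finset.univ _ _ fun p _ => hq n p
  rw [Finset.card_univ, Fintype.card_prod, Fintype.card_fin, Fintype.card_bool, nsmul_eq_mul] at this
  push_cast at this
  linarith

end QL

theorem mainTheorem11
    (h : ∃ A : QL.GroupActionFamily, A.HasEfficientAlgorithms ∧ A.OneWay) :
    ∃ Q : QL.LightningScheme, Q.IsTwoTierQuantumLightning := by
  obtain ⟨A, hE, hA⟩ := h
  obtain ⟨K, hK, hG, hS, hsup⟩ := hE.exists_kit
  have hν := ((QL.Negligible.const_mul hsup 2).natCast_mul).add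
    ((hG.const_mul 2).add (hS.const_mul 2))
  exact ⟨QL.scheme hK, ⟨_, hν, QL.scheme_semi_correct hK⟩, ⟨_, hν, QL.scheme_full_correct hK⟩,
    QL.scheme_secure hK hA hG hS⟩
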